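/- Let $\mathbb K=\mathbb R$ or $\mathbb C$, and write $\mathcal F_G$ for the sheaf of smooth (if $\mathbb K=\mathbb R$), respectively holomorphic (if $\mathbb K=\mathbb C$), functions on a Lie group $G$ over $\mathbb K$. **Superpairs.** A Harish-Chandra superpair $(G,\mathfrak g)$ consists of a Lie group $G$ over $\mathbb K$, a finite-dimensional Lie superalgebra $\mathfrak g=\mathfrak g_0\oplus\mathfrak g_1$ with $\mathfrak g_0=\mathrm{Lie}(G)$, and a smooth (holomorphic) action $\mathrm{Ad}$ of $G$ on $\mathfrak g$ by automorphisms of the Lie superalgebra which extends the adjoint action on $\mathfrak g_0$ and has the adjoint representation of $\mathfrak g_0$ on $\mathfrak g$ as differential. An isomorphism $(G,\mathfrak g)\to(G',\mathfrak g')$ is a pair $(L,\ell)$ of an isomorphism $L:G\to G'$ of Lie groups and an isomorphism $\ell:\mathfrak g\to\mathfrak g'$ of Lie superalgebras with $\ell|_{\mathfrak g_0}=dL$ and $\ell\circ\mathrm{Ad}(g)=\mathrm{Ad}'(L(g))\circ\ell$ for all $g\in G$. **RT Lie supergroups.** An LRT Lie supergroup $(G,\mathfrak g,\rho)$ is a representation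 $\rho$ of $\mathfrak g$ by superderivations of the sheaf $\mathcal F_G\otimes\Lambda\mathfrak g_1^*$ such that $X\in\mathfrak g_0$ acts on $\mathcal F_G\otimes 1$ by $(X.f)(g)=\frac{d}{dt}\big|_{0}f(g\exp(tX))$ and such that the superfunctions annihilated by all of $\mathfrak g$ are exactly the locally constant numerical functions. An RRT Lie supergroup is defined in the same way with $(X.f)(g)=\frac{d}{dt}\big|_{0}f(\exp(-tX)g)$. An RT Lie supergroup is an LRT structure $\rho_L$ and an RRT structure $\rho_R$ with $\rho_R(X)\rho_L(Y)=(-1)^{|X||Y|}\rho_L(Y)\rho_R(X)$ for homogeneous $X,Y$. It is planed if $\rho_L(X)\alpha=\alpha([\,\cdot\,,X])$ for all $X\in\mathfrak g_0$, $\alpha\in 1\otimes\mathfrak g_1^*$; the same condition defines planed LRT Lie supergroups. A morphism of LRT (resp. RT) Lie supergroups is a morphism of Lie groups $\psi:G\to G'$ with a morphism of Lie superalgebras $\psi^\diamond:\mathfrak g\to\mathfrak g'$ such that the pull-back $\psi^\#(f\otimes\omega)=(f\circ\psi)\otimes\Lambda(\psi^\diamond|_{\mathfrak g_1})^*\omega$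 satisfies $\rho(X)\circ\psi^\#=\psi^\#\circ\rho'(\psi^\diamond(X))$ for $\rho=\rho_L$ (resp. for $\rho=\rho_L$ and $\rho=\rho_R$) and all $X\in\mathfrak g$; it is an isomorphism if $(\psi,\psi^\#)$ is an isomorphism of supermanifolds. **Berezin's construction.** For a finitely generated Grassmann algebra $\Lambda=\Lambda_0\oplus\Lambda_1$ over $\mathbb K$ let $\widetilde G=\widetilde G(\Lambda)$ be the Lie group with Lie algebra $\tilde{\mathfrak g}=\Lambda_0\otimes\mathfrak g_0\oplus\Lambda_1\otimes\mathfrak g_1$ which contains $G$: its elements are $g\exp(n)$ with $g\in G$ and $n$ in the nilpotent ideal $\Lambda_0^+\otimes\mathfrak g_0\oplus\Lambda_1\otimes\mathfrak g_1$, where $\Lambda_0^+$ is the nilpotent part of $\Lambda_0$, and they are multiplied by $g\exp(n)\,h\exp(n')=gh\exp(\mathrm{Ad}(h^{-1})n)\exp(n')$ and the Baker–Campbell–Hausdorff formula. Let $(\Xi_j)$ be a basis of $\mathfrak g_1$ with dual basis $(\theta^j)$. A superfunction $f=\sum_I f_I\theta^I$ on an open set $U\subseteq G$ is continued to the $\Lambda$-valued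 function $$\tilde f\Big(g\exp(n_0)\exp\big(\textstyle\sum_j\sigma_j\Xi_j\big)\Big)=\sum_I\Big(\sum_{k\ge0}\tfrac1{k!}\,(n_0^k.f_I)(g)\Big)\sigma^I,\qquad g\in U,\ n_0\in\Lambda_0^+\otimes\mathfrak g_0,\ \sigma_j\in\Lambda_1,$$ on the part of $\widetilde G$ over $U$ (elements of $\mathfrak g_0$ act on functions as left-invariant derivations, extended $\Lambda_0$-linearly). An operator $\rho_L(X)$ on superfunctions is given by Berezin's construction if, for all $\Lambda$, all $U$, all superfunctions $f$ on $U$ and all $p\in\widetilde G$ over $U$, $$\tfrac{d}{dt}\big|_{0}\tilde f(p\exp(tX))=\widetilde{\rho_L(X)f}(p)\ \ (X\in\mathfrak g_0),\qquad \tfrac{d}{dt}\big|_{0}\tilde f(p\exp(t\alpha X))=\alpha\,\widetilde{\rho_L(X)f}(p)\ \ (X\in\mathfrak g_1,\ \alpha\in\Lambda_1),$$ and $\rho_R(X)$ is given by Berezin's construction if the same holds with $p\exp(tX)$, $p\exp(t\alpha X)$ replaced by $\exp(-tX)p$, $\exp(-t\alpha X)p$. **Proposition.** For every Harish-Chandra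 superpair $(G,\mathfrak g)$, Berezin's construction determines unique $\mathbb K$-linear maps $\rho_L$ and $\rho_R$ from $\mathfrak g$ to the endomorphisms of the sheaf $\mathcal F_G\otimes\Lambda\mathfrak g_1^*$, and $(G,\mathfrak g,\rho_L)$ is a planed LRT Lie supergroup and $(G,\mathfrak g,\rho_L,\rho_R)$ is a planed RT Lie supergroup. If $(L,\ell):(G,\mathfrak g)\to(G',\mathfrak g')$ is an isomorphism of Harish-Chandra superpairs, then the planed LRT Lie supergroups, and also the planed RT Lie supergroups, obtained from $(G,\mathfrak g)$ and $(G',\mathfrak g')$ by Berezin's construction are isomorphic, by an isomorphism with $\psi=L$ and $\psi^\diamond=\ell$. -/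

import Mathlib

open scoped Manifold ContDiff TensorProduct
open TopologicalSpace (Opens)

noncomputable section
namespace BerezinConstruction

/-! ### Calculus on open subsets of a Lie group -/

section Calculus

variable (𝕜 : Type*) [RCLike 𝕜] (E : Type*) [NormedAddCommGroup E] [NormedSpace 𝕜 E]
variable {G : Type*} [TopologicalSpace G] [ChartedSpace E G]

/-- The numerical functions on the open set `U`: smooth functions if `𝕜 = ℝ`, holomorphic
functions if `𝕜 = ℂ` (complex differentiable functions are holomorphic). -/
abbrev NumFun (U : Opens G) : Type _ := C^∞⟮𝓘(𝕜, E), U; 𝓘(𝕜, 𝕜), 𝕜⟯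

variable {𝕜 E}

/-- Restriction of numerical functions. -/
def NumFun.res {U W : Opens G} (h : U ≤ W) : NumFun 𝕜 E W →ₗ[𝕜] NumFun 𝕜 E U where
  toFun f := ⟨f ∘ Opens.inclusion h, f.contMDiff.comp (contMDiff_inclusion h)⟩
  map_add' _ _ := rfl
  map_smul' _ _ := rfl

/-- Evaluation of numerical functions at a point. -/
def NumFun.eval {U : Opens G} (x : U) : NumFun 𝕜 E U →ₗ[𝕜] 𝕜 where
  toFun f := f x
  map_add' _ _ := rfl
  map_smul' _ _ := rfl

/-- Pull-back of numerical functions on `W` along a smooth map `ψ`. -/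
def NumFun.pull {E' : Type*} [NormedAddCommGroup E'] [NormedSpace 𝕜 E'] {G' : Type*}
    [TopologicalSpace G'] [ChartedSpace E' G'] (ψ : C(G, G'))
    (hψ : ContMDiff 𝓘(𝕜, E) 𝓘(𝕜, E') ∞ ψ) (W : Opens G') (f : NumFun 𝕜 E' W) :
    NumFun 𝕜 E (Opens.comap ψ W) :=
  ⟨fun x => f ⟨ψ x, x.2⟩, f.contMDiff.comp (by
    rw [← ContMDiff.subtypeVal_comp_iff]
    exact hψ.comp contMDiff_subtype_val)⟩

open Classical in
/-- Extension by zero of a function on an open set. -/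
def extendZero {U : Opens G} (f : NumFun 𝕜 E U) (x : G) : 𝕜 := if h : x ∈ U then f ⟨x, h⟩ else 0

theorem contMDiffAt_extendZero {U : Opens G} (f : NumFun 𝕜 E U) {x : G} (hx : x ∈ U) :
    ContMDiffAt 𝓘(𝕜, E) 𝓘(𝕜, 𝕜) ∞ (extendZero f) x := by
  have h : ContMDiffAt 𝓘(𝕜, E) 𝓘(𝕜, 𝕜) ∞ (fun y : U => extendZero f y) ⟨x, hx⟩ := by
    have : (fun y : U => extendZero f y) = f := by
      funext y; simp [extendZero]
    rw [this]; exact f.contMDiff _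
  exact contMDiffAt_subtype_iff.mp h

theorem extendZero_add {U : Opens G} (f f' : NumFun 𝕜 E U) :
    extendZero (f + f') = extendZero f + extendZero f' := by
  funext x
  by_cases h : x ∈ U <;> simp [extendZero, h]

theorem extendZero_smul {U : Opens G} (c : 𝕜) (f : NumFun 𝕜 E U) :
    extendZero (c • f) = c • extendZero f := by
  funext x
  by_cases h : x ∈ U <;> simp [extendZero, h]

variable [Group G]

theorem contMDiffAt_comp_aux {U : Opens G} (f : NumFun 𝕜 E U)
    (μ : G → G → G) (hμ : ContMDiff (𝓘(𝕜, E).prod 𝓘(𝕜, E)) 𝓘(𝕜, E) ∞ (Function.uncurry μ))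
    (h1 : ∀ g, μ g 1 = g) {g : G} (hg : g ∈ U) :
    ContMDiffAt (𝓘(𝕜, E).prod 𝓘(𝕜, E)) 𝓘(𝕜, 𝕜) ∞
      (Function.uncurry fun a h => extendZero f (μ a h)) (g, 1) := by
  have : Function.uncurry (fun (a h : G) => extendZero f (μ a h)) =
    extendZero f ∘ Function.uncurry μ := rfl
  rw [this]
  refine ContMDiffAt.comp _ ?_ hμ.contMDiffAt
  exact contMDiffAt_extendZero f (by simpa [h1] using hg)

theorem mdifferentiableAt_aux {U : Opens G} (f : NumFun 𝕜 E U)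
    (μ : G → G → G) (hμ : ContMDiff (𝓘(𝕜, E).prod 𝓘(𝕜, E)) 𝓘(𝕜, E) ∞ (Function.uncurry μ))
    (h1 : ∀ g, μ g 1 = g) {g : G} (hg : g ∈ U) :
    MDifferentiableAt 𝓘(𝕜, E) 𝓘(𝕜, 𝕜) (fun h => extendZero f (μ g h)) 1 := by
  have h := contMDiffAt_comp_aux f μ hμ h1 hg
  have h2 : ContMDiffAt 𝓘(𝕜, E) (𝓘(𝕜, E).prod 𝓘(𝕜, E)) ∞ (fun h : G => (g, h)) 1 :=
    contMDiffAt_const.prodMk contMDiffAt_id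
  exact (ContMDiffAt.comp (1 : G) h h2).mdifferentiableAt (by simp)

variable [LieGroup 𝓘(𝕜, E) ∞ G]

theorem contMDiffAt_deriv {U : Opens G} (f : NumFun 𝕜 E U) (X : GroupLieAlgebra 𝓘(𝕜, E) G)
    (μ : G → G → G) (hμ : ContMDiff (𝓘(𝕜, E).prod 𝓘(𝕜, E)) 𝓘(𝕜, E) ∞ (Function.uncurry μ))
    (h1 : ∀ g, μ g 1 = g) {g : G} (hg : g ∈ U) :
    ContMDiffAt 𝓘(𝕜, E) 𝓘(𝕜, 𝕜) ∞
      (fun g => (mfderiv 𝓘(𝕜, E) 𝓘(𝕜, 𝕜) (fun h => extendZero f (μ g h)) 1 X : 𝕜)) g := by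
  have : IsManifold 𝓘(𝕜, E) 1 G := IsManifold.of_le (n := ∞) (by simp)
  have h := ContMDiffAt.mfderiv_apply (I := 𝓘(𝕜, E)) (I' := 𝓘(𝕜, 𝕜)) (J := 𝓘(𝕜, E))
    (n := ∞) (m := ∞) (x₀ := g)
    (fun (a h : G) => extendZero f (μ a h)) (fun _ => (1 : G)) id (fun _ => (X : E))
    (contMDiffAt_comp_aux f μ hμ h1 hg)
    contMDiffAt_const contMDiffAt_id contMDiffAt_const (by simp)
  have key : (trivializationAt E (TangentSpace 𝓘(𝕜, E)) (1 : G)).symmL 𝕜 (1 : G) X = X := by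
    rw [TangentBundle.symmL_trivializationAt_eq_core (mem_chart_source E (1 : G))]
    exact (tangentBundleCore 𝓘(𝕜, E) G).coordChange_self _ _ (mem_chart_source E (1 : G)) _
  refine h.congr_of_eventuallyEq (Filter.Eventually.of_forall fun a => ?_)
  simp only [inTangentCoordinates, ContinuousLinearMap.inCoordinates]
  erw [TangentBundle.continuousLinearMapAt_model_space]
  exact (congrArg (mfderiv 𝓘(𝕜, E) 𝓘(𝕜, 𝕜) (fun h => extendZero f (μ a h)) 1) key).symm

/-- The derivation `f ↦ (g ↦ d/dt f(μ(g, exp(tX))) at t = 0)` of numerical functions, for a smooth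
map `μ` with `μ(g, 1) = g`. -/
def pointDer (μ : G → G → G)
    (hμ : ContMDiff (𝓘(𝕜, E).prod 𝓘(𝕜, E)) 𝓘(𝕜, E) ∞ (Function.uncurry μ))
    (h1 : ∀ g, μ g 1 = g) (U : Opens G) :
    GroupLieAlgebra 𝓘(𝕜, E) G →ₗ[𝕜] Module.End 𝕜 (NumFun 𝕜 E U) :=
  LinearMap.mk₂ 𝕜
    (fun X f => ⟨fun g => (mfderiv 𝓘(𝕜, E) 𝓘(𝕜, 𝕜) (fun h => extendZero f (μ g h)) 1 X : 𝕜),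
      fun g => contMDiffAt_subtype_iff.mpr (contMDiffAt_deriv f X μ hμ h1 g.2)⟩)
    (fun X Y f => by
      ext g
      exact (mfderiv 𝓘(𝕜, E) 𝓘(𝕜, 𝕜) (fun h => extendZero f (μ g h)) 1).map_add X Y)
    (fun c X f => by
      ext g
      exact (mfderiv 𝓘(𝕜, E) 𝓘(𝕜, 𝕜) (fun h => extendZero f (μ g h)) 1).map_smul c X)
    (fun X f f' => by
      ext g
      have e : (fun h => extendZero (f + f') (μ g h)) =
          (fun h => extendZero f (μ g h)) + fun h => extendZero f' (μ g h) := by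
        funext h; simp [extendZero_add]
      change (mfderiv 𝓘(𝕜, E) 𝓘(𝕜, 𝕜) (fun h => extendZero (f + f') (μ g h)) 1 X : 𝕜) = _
      rw [e, mfderiv_add (mdifferentiableAt_aux f μ hμ h1 g.2)
        (mdifferentiableAt_aux f' μ hμ h1 g.2)]
      rfl)
    (fun c X f => by
      ext g
      have e : (fun h => extendZero (c • f) (μ g h)) = c • (fun h => extendZero f (μ g h)) := by
        funext h; simp [extendZero_smul]
      change (mfderiv 𝓘(𝕜, E) 𝓘(𝕜, 𝕜) (fun h => extendZero (c • f) (μ g h)) 1 X : 𝕜) = _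
      rw [e, const_smul_mfderiv (mdifferentiableAt_aux f μ hμ h1 g.2)]
      rfl)

/-- The classical left-invariant derivation `(X.f)(g) = d/dt f(g exp(tX))` at `t = 0`. -/
def leftDer (U : Opens G) : GroupLieAlgebra 𝓘(𝕜, E) G →ₗ[𝕜] Module.End 𝕜 (NumFun 𝕜 E U) :=
  pointDer (fun g h => g * h) (contMDiff_mul 𝓘(𝕜, E) ∞) mul_one U

/-- The classical right-invariant derivation `(X.f)(g) = d/dt f(exp(-tX) g)` at `t = 0`. -/
def rightDer (U : Opens G) : GroupLieAlgebra 𝓘(𝕜, E) G →ₗ[𝕜] Module.End 𝕜 (NumFun 𝕜 E U) :=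
  -pointDer (fun g h => h * g) ((contMDiff_mul 𝓘(𝕜, E) ∞).comp
    (contMDiff_snd.prodMk contMDiff_fst)) one_mul U

end Calculus

/-! ### Grassmann algebras -/

section Grassmann

variable (𝕜 : Type*) [RCLike 𝕜] (W : Type*) [AddCommGroup W] [Module 𝕜 W]

/-- The even part (`i = 0`) and the odd part (`i = 1`) of the exterior algebra. -/
abbrev extParity (i : ZMod 2) : Submodule 𝕜 (ExteriorAlgebra 𝕜 W) :=
  CliffordAlgebra.evenOdd (0 : QuadraticForm 𝕜 W) i

/-- The parity automorphism, `a ↦ (-1)^|a| a`. -/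
abbrev extInvol : ExteriorAlgebra 𝕜 W →ₐ[𝕜] ExteriorAlgebra 𝕜 W :=
  CliffordAlgebra.involute (Q := (0 : QuadraticForm 𝕜 W))

/-- The nilpotent even part: even elements without constant term. -/
def extNilEven : Submodule 𝕜 (ExteriorAlgebra 𝕜 W) :=
  extParity 𝕜 W 0 ⊓ LinearMap.ker (ExteriorAlgebra.algebraMapInv (R := 𝕜) (M := W)).toLinearMap

variable {𝕜 W}

theorem ext_ι_mul (v : W) (x : ExteriorAlgebra 𝕜 W) :
    ExteriorAlgebra.ι 𝕜 v * x = extInvol 𝕜 W x * ExteriorAlgebra.ι 𝕜 v := by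
  induction x using ExteriorAlgebra.induction with
  | algebraMap r => rw [AlgHom.commutes, Algebra.commutes]
  | ι w =>
    have h := ExteriorAlgebra.ι_add_mul_swap (R := 𝕜) v w
    have h2 : extInvol 𝕜 W (ExteriorAlgebra.ι 𝕜 w) = -ExteriorAlgebra.ι 𝕜 w :=
      CliffordAlgebra.involute_ι w
    rw [h2, neg_mul]
    exact eq_neg_of_add_eq_zero_left h
  | mul a b ha hb => rw [← mul_assoc, ha, mul_assoc, hb, ← mul_assoc, map_mul]
  | add a b ha hb => rw [mul_add, ha, hb, map_add, add_mul]

theorem ext_odd_mul {y : ExteriorAlgebra 𝕜 W} (hy : y ∈ extParity 𝕜 W 1)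
    (x : ExteriorAlgebra 𝕜 W) : y * x = extInvol 𝕜 W x * y := by
  induction x using ExteriorAlgebra.induction with
  | algebraMap r => rw [AlgHom.commutes, Algebra.commutes]
  | ι w =>
    have h := ext_ι_mul w y
    have h2 : extInvol 𝕜 W (ExteriorAlgebra.ι 𝕜 w) = -ExteriorAlgebra.ι 𝕜 w :=
      CliffordAlgebra.involute_ι w
    have h3 : extInvol 𝕜 W y = -y := CliffordAlgebra.involute_eq_of_mem_odd hy
    rw [h2, neg_mul, h, h3, neg_mul, neg_neg]
  | mul a b ha hb => rw [← mul_assoc, ha, mul_assoc, hb, ← mul_assoc, map_mul]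
  | add a b ha hb => rw [mul_add, ha, hb, map_add, add_mul]

theorem ext_odd_sq {y : ExteriorAlgebra 𝕜 W} (hy : y ∈ extParity 𝕜 W 1) : y * y = 0 := by
  have h := ext_odd_mul hy y
  have h3 : extInvol 𝕜 W y = -y := CliffordAlgebra.involute_eq_of_mem_odd hy
  rw [h3, neg_mul] at h
  have h2 : (2 : 𝕜) • (y * y) = 0 := by
    rw [two_smul]
    exact add_eq_zero_iff_eq_neg.mpr h
  exact (smul_eq_zero.mp h2).resolve_left two_ne_zero

theorem extParity_mul {i j : ZMod 2} {x y : ExteriorAlgebra 𝕜 W} (hx : x ∈ extParity 𝕜 W i)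
    (hy : y ∈ extParity 𝕜 W j) : x * y ∈ extParity 𝕜 W (i + j) :=
  CliffordAlgebra.evenOdd_mul_le _ i j (Submodule.mul_mem_mul hx hy)

theorem algebraMapInv_odd {x : ExteriorAlgebra 𝕜 W} (hx : x ∈ extParity 𝕜 W 1) :
    ExteriorAlgebra.algebraMapInv x = 0 := by
  have h : (ExteriorAlgebra.algebraMapInv (R := 𝕜) (M := W)).comp (extInvol 𝕜 W) =
      ExteriorAlgebra.algebraMapInv := by
    refine ExteriorAlgebra.hom_ext (LinearMap.ext fun v => ?_)
    have h2 : extInvol 𝕜 W (ExteriorAlgebra.ι 𝕜 v) = -ExteriorAlgebra.ι 𝕜 v :=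
      CliffordAlgebra.involute_ι v
    simp [h2, ExteriorAlgebra.algebraMapInv]
  have h3 : extInvol 𝕜 W x = -x := CliffordAlgebra.involute_eq_of_mem_odd hx
  have h4 := AlgHom.congr_fun h x
  rw [AlgHom.comp_apply, h3, map_neg] at h4
  exact self_eq_neg.mp h4.symm

theorem mem_extNilEven {x : ExteriorAlgebra 𝕜 W} : x ∈ extNilEven 𝕜 W ↔
    x ∈ extParity 𝕜 W 0 ∧ ExteriorAlgebra.algebraMapInv x = 0 := by
  rw [extNilEven, Submodule.mem_inf, LinearMap.mem_ker]
  rfl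

theorem extNilEven_mul {x y : ExteriorAlgebra 𝕜 W} (hx : x ∈ extNilEven 𝕜 W)
    (hy : y ∈ extNilEven 𝕜 W) : x * y ∈ extNilEven 𝕜 W := by
  rw [mem_extNilEven] at *
  refine ⟨?_, by rw [map_mul, hx.2, zero_mul]⟩
  have h := extParity_mul hx.1 hy.1
  rwa [add_zero] at h

theorem odd_mul_odd_mem_extNilEven {x y : ExteriorAlgebra 𝕜 W} (hx : x ∈ extParity 𝕜 W 1)
    (hy : y ∈ extParity 𝕜 W 1) : x * y ∈ extNilEven 𝕜 W := by
  rw [mem_extNilEven]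
  refine ⟨?_, by rw [map_mul, algebraMapInv_odd hx, zero_mul]⟩
  have h := extParity_mul hx hy
  rwa [show (1 : ZMod 2) + 1 = 0 from rfl] at h

end Grassmann

section Abbrevs

/-- The Grassmann algebra with `m` odd generators. -/
abbrev Gr (𝕜 : Type*) [RCLike 𝕜] (m : ℕ) : Type _ := ExteriorAlgebra 𝕜 (Fin m → 𝕜)

/-- The superfunctions on the open set `U`: the sections of `𝓕 ⊗ Λ V*`. -/
abbrev Superfun (𝕜 : Type*) [RCLike 𝕜] (E : Type*) [NormedAddCommGroup E] [NormedSpace 𝕜 E]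
    (V : Type*) [AddCommGroup V] [Module 𝕜 V]
    {G : Type*} [TopologicalSpace G] [ChartedSpace E G] (U : Opens G) : Type _ :=
  NumFun 𝕜 E U ⊗[𝕜] ExteriorAlgebra 𝕜 (Module.Dual 𝕜 V)

/-- The underlying vector space `𝔤 = 𝔤₀ ⊕ 𝔤₁` of the Lie superalgebra, with `𝔤₀ = Lie(G)` and
`𝔤₁ = V`. -/
abbrev SuperSpace (𝕜 : Type*) [RCLike 𝕜] (E : Type*) [NormedAddCommGroup E] [NormedSpace 𝕜 E]
    (V : Type*) (G : Type*) [TopologicalSpace G] [ChartedSpace E G] [Group G] : Type _ :=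
  GroupLieAlgebra 𝓘(𝕜, E) G × V

/-- The sign `(-1)^{ij}` of a pair of parities. -/
def ssign (𝕜 : Type*) [RCLike 𝕜] (i j : ZMod 2) : 𝕜 := if i = 1 ∧ j = 1 then -1 else 1

/-- The homogeneous elements of parity `i` of the superspace `M₀ ⊕ M₁`. -/
def homog (𝕜 : Type*) [RCLike 𝕜] (M₀ M₁ : Type*) [AddCommGroup M₀] [Module 𝕜 M₀]
    [AddCommGroup M₁] [Module 𝕜 M₁] (i : ZMod 2) : Submodule 𝕜 (M₀ × M₁) :=
  if i = 0 then LinearMap.range (LinearMap.inl 𝕜 M₀ M₁) else LinearMap.range (LinearMap.inr 𝕜 M₀ M₁)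

end Abbrevs

/-! ### Harish-Chandra superpairs -/

section Pairs

variable (𝕜 : Type*) [RCLike 𝕜] (E : Type*) [NormedAddCommGroup E] [NormedSpace 𝕜 E]
variable (V : Type*) [AddCommGroup V] [Module 𝕜 V]
variable (G : Type*) [TopologicalSpace G] [ChartedSpace E G] [Group G]

/-- A Harish-Chandra superpair `(G, 𝔤)`: a Lie superalgebra `𝔤 = 𝔤₀ ⊕ 𝔤₁` with
`𝔤₀ = Lie(G)`, `𝔤₁ = V`, together with an action `Ad` of `G` on `𝔤` by automorphisms of the Lie
superalgebra which extends the adjoint action of `G` on `𝔤₀` and has the adjoint representation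
of `𝔤₀` on `𝔤` as its differential. -/
structure HCSuperpair [LieGroup 𝓘(𝕜, E) ∞ G] where
  /-- the superbracket -/
  bracket : SuperSpace 𝕜 E V G →ₗ[𝕜] SuperSpace 𝕜 E V G →ₗ[𝕜] SuperSpace 𝕜 E V G
  bracket_mem : ∀ (i j : ZMod 2), ∀ X ∈ homog 𝕜 (GroupLieAlgebra 𝓘(𝕜, E) G) V i,
    ∀ Y ∈ homog 𝕜 (GroupLieAlgebra 𝓘(𝕜, E) G) V j,
      bracket X Y ∈ homog 𝕜 (GroupLieAlgebra 𝓘(𝕜, E) G) V (i + j)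
  bracket_skew : ∀ (i j : ZMod 2), ∀ X ∈ homog 𝕜 (GroupLieAlgebra 𝓘(𝕜, E) G) V i,
    ∀ Y ∈ homog 𝕜 (GroupLieAlgebra 𝓘(𝕜, E) G) V j,
      bracket X Y = -(ssign 𝕜 i j • bracket Y X)
  bracket_jacobi : ∀ (i j : ZMod 2), ∀ X ∈ homog 𝕜 (GroupLieAlgebra 𝓘(𝕜, E) G) V i,
    ∀ Y ∈ homog 𝕜 (GroupLieAlgebra 𝓘(𝕜, E) G) V j, ∀ Z,
      bracket X (bracket Y Z) = bracket (bracket X Y) Z + ssign 𝕜 i j • bracket Y (bracket X Z)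
  bracket_even : ∀ X Y : GroupLieAlgebra 𝓘(𝕜, E) G, bracket (X, 0) (Y, 0) = (⁅X, Y⁆, 0)
  /-- the adjoint action of `G` on `𝔤` -/
  Ad : G →* (SuperSpace 𝕜 E V G ≃ₗ[𝕜] SuperSpace 𝕜 E V G)
  Ad_mem : ∀ (g : G) (i : ZMod 2), ∀ X ∈ homog 𝕜 (GroupLieAlgebra 𝓘(𝕜, E) G) V i,
    Ad g X ∈ homog 𝕜 (GroupLieAlgebra 𝓘(𝕜, E) G) V i
  Ad_bracket : ∀ (g : G) X Y, Ad g (bracket X Y) = bracket (Ad g X) (Ad g Y)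
  Ad_even : ∀ (g : G) (X : GroupLieAlgebra 𝓘(𝕜, E) G),
    Ad g (X, 0) = ((mfderiv 𝓘(𝕜, E) 𝓘(𝕜, E) (fun h : G => g * h * g⁻¹) 1 X : E), 0)
  Ad_smooth : ∀ (X : SuperSpace 𝕜 E V G) (φ : Module.Dual 𝕜 (SuperSpace 𝕜 E V G)),
    ContMDiff 𝓘(𝕜, E) 𝓘(𝕜, 𝕜) ∞ (fun g => φ (Ad g X))
  Ad_deriv : ∀ (X : GroupLieAlgebra 𝓘(𝕜, E) G) (Y : SuperSpace 𝕜 E V G)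
    (φ : Module.Dual 𝕜 (SuperSpace 𝕜 E V G)),
    (mfderiv 𝓘(𝕜, E) 𝓘(𝕜, 𝕜) (fun g => φ (Ad g Y)) 1 X : 𝕜) = φ (bracket (X, 0) Y)

end Pairs

/-- The endomorphism `[·, X]` of `𝔤₁`, for `X ∈ 𝔤₀`. -/
def HCSuperpair.oddBracketRight {𝕜 : Type*} [RCLike 𝕜] {E : Type*} [NormedAddCommGroup E]
    [NormedSpace 𝕜 E] {V : Type*} [AddCommGroup V] [Module 𝕜 V] {G : Type*} [TopologicalSpace G]
    [ChartedSpace E G] [Group G] [LieGroup 𝓘(𝕜, E) ∞ G] (P : HCSuperpair 𝕜 E V G)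
    (X : GroupLieAlgebra 𝓘(𝕜, E) G) : V →ₗ[𝕜] V :=
  LinearMap.snd 𝕜 (GroupLieAlgebra 𝓘(𝕜, E) G) V ∘ₗ P.bracket.flip (X, 0) ∘ₗ
    LinearMap.inr 𝕜 (GroupLieAlgebra 𝓘(𝕜, E) G) V

/-! ### The Baker-Campbell-Hausdorff product -/

section BCH

variable {𝕜 : Type*} [RCLike 𝕜] {M : Type*} [AddCommGroup M] [Module 𝕜 M]

/-- The right-nested bracket `[x₁, [x₂, … [xₙ₋₁, xₙ]…]]` of a list. -/
def nestedBracket (br : M →ₗ[𝕜] M →ₗ[𝕜] M) : List M → M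
  | [] => 0
  | [x] => x
  | x :: y :: l => br x (nestedBracket br (y :: l))

/-- Dynkin's formula for the Baker-Campbell-Hausdorff product `x * y = log (exp x exp y)`:
`∑ (-1)^(k-1)/k · [x^{r₁} y^{s₁} ⋯ x^{r_k} y^{s_k}] / (∑ (rᵢ + sᵢ) · ∏ rᵢ! sᵢ!)`, the sum being over
`1 ≤ k ≤ N` and `rᵢ, sᵢ ≤ N` with `rᵢ + sᵢ > 0`. It contains every term of degree at most `N`, so that
it is the full product if all brackets of more than `N` elements vanish. -/
def bch (br : M →ₗ[𝕜] M →ₗ[𝕜] M) (N : ℕ) (x y : M) : M :=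
  ∑ k ∈ Finset.Icc 1 N,
    ∑ w ∈ Fintype.piFinset (fun _ : Fin k =>
        (Finset.range (N + 1) ×ˢ Finset.range (N + 1)).filter fun q => 0 < q.1 + q.2),
      ((-1 : 𝕜) ^ (k - 1) / ((k : 𝕜) * ((∑ i, ((w i).1 + (w i).2) : ℕ) : 𝕜) *
          ((∏ i, ((w i).1.factorial * (w i).2.factorial) : ℕ) : 𝕜))) •
        nestedBracket br
          ((List.ofFn fun i => List.replicate (w i).1 x ++ List.replicate (w i).2 y).flatten)

theorem nestedBracket_mem (br : M →ₗ[𝕜] M →ₗ[𝕜] M) (S : Submodule 𝕜 M)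
    (hS : ∀ x ∈ S, ∀ y ∈ S, br x y ∈ S) : ∀ l : List M, (∀ x ∈ l, x ∈ S) → nestedBracket br l ∈ S
  | [], _ => S.zero_mem
  | [x], h => h x (by simp)
  | x :: y :: l, h => hS _ (h x (by simp)) _
      (nestedBracket_mem br S hS (y :: l) fun z hz => h z (List.mem_cons_of_mem _ hz))

theorem bch_mem (br : M →ₗ[𝕜] M →ₗ[𝕜] M) (S : Submodule 𝕜 M)
    (hS : ∀ x ∈ S, ∀ y ∈ S, br x y ∈ S) (N : ℕ) {x y : M} (hx : x ∈ S) (hy : y ∈ S) :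
    bch br N x y ∈ S := by
  refine S.sum_mem fun k _ => S.sum_mem fun w _ => S.smul_mem _ (nestedBracket_mem br S hS _ ?_)
  intro z hz
  rw [List.mem_flatten] at hz
  obtain ⟨l, hl, hz⟩ := hz
  obtain ⟨i, rfl⟩ := (List.mem_ofFn' _ _).mp hl
  rcases List.mem_append.mp hz with h | h
  · rw [List.eq_of_mem_replicate h]; exact hx
  · rw [List.eq_of_mem_replicate h]; exact hy

end BCH

/-! ### The Grassmann envelope of a Harish-Chandra superpair -/

section Envelope

variable {𝕜 : Type*} [RCLike 𝕜] {E : Type*} [NormedAddCommGroup E] [NormedSpace 𝕜 E]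
variable {V : Type*} [AddCommGroup V] [Module 𝕜 V]
variable {G : Type*} [TopologicalSpace G] [ChartedSpace E G] [Group G]

variable (𝕜 E V G) in
/-- The projection of `𝔤` onto `𝔤₀`, as an endomorphism. -/
def evenProj : SuperSpace 𝕜 E V G →ₗ[𝕜] SuperSpace 𝕜 E V G :=
  LinearMap.inl 𝕜 _ _ ∘ₗ LinearMap.fst 𝕜 (GroupLieAlgebra 𝓘(𝕜, E) G) V

variable (𝕜 E V G) in
/-- The projection of `𝔤` onto `𝔤₁`, as an endomorphism. -/
def oddProj : SuperSpace 𝕜 E V G →ₗ[𝕜] SuperSpace 𝕜 E V G :=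
  LinearMap.inr 𝕜 _ _ ∘ₗ LinearMap.snd 𝕜 (GroupLieAlgebra 𝓘(𝕜, E) G) V

variable (𝕜 E V G) in
/-- The space `Λ₀⁺ ⊗ 𝔤₀`. -/
def evenSoul (m : ℕ) : Submodule 𝕜 (Gr 𝕜 m ⊗[𝕜] GroupLieAlgebra 𝓘(𝕜, E) G) :=
  Submodule.map₂ (TensorProduct.mk 𝕜 _ _) (extNilEven 𝕜 (Fin m → 𝕜)) ⊤

variable (𝕜 V) in
/-- The space `Λ₁ ⊗ 𝔤₁`. -/
def oddSoul (m : ℕ) : Submodule 𝕜 (Gr 𝕜 m ⊗[𝕜] V) :=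
  Submodule.map₂ (TensorProduct.mk 𝕜 _ _) (extParity 𝕜 (Fin m → 𝕜) 1) ⊤

variable (𝕜 E V G) in
/-- The nilpotent ideal `𝔫 = Λ₀⁺ ⊗ 𝔤₀ ⊕ Λ₁ ⊗ 𝔤₁` of the Lie algebra
`𝔤̃ = Λ₀ ⊗ 𝔤₀ ⊕ Λ₁ ⊗ 𝔤₁ = 𝔤₀ ⊕ 𝔫`. -/
def soul (m : ℕ) : Submodule 𝕜 (Gr 𝕜 m ⊗[𝕜] SuperSpace 𝕜 E V G) :=
  Submodule.map₂ (TensorProduct.mk 𝕜 _ _) (extNilEven 𝕜 (Fin m → 𝕜))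
      (homog 𝕜 (GroupLieAlgebra 𝓘(𝕜, E) G) V 0) ⊔
    Submodule.map₂ (TensorProduct.mk 𝕜 _ _) (extParity 𝕜 (Fin m → 𝕜) 1)
      (homog 𝕜 (GroupLieAlgebra 𝓘(𝕜, E) G) V 1)

theorem inl_mem_homog (X : GroupLieAlgebra 𝓘(𝕜, E) G) :
    ((X, 0) : SuperSpace 𝕜 E V G) ∈ homog 𝕜 (GroupLieAlgebra 𝓘(𝕜, E) G) V 0 :=
  ⟨X, rfl⟩

theorem inr_mem_homog (v : V) :
    ((0, v) : SuperSpace 𝕜 E V G) ∈ homog 𝕜 (GroupLieAlgebra 𝓘(𝕜, E) G) V 1 :=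
  ⟨v, rfl⟩

theorem evenProj_of_even {X : SuperSpace 𝕜 E V G}
    (hX : X ∈ homog 𝕜 (GroupLieAlgebra 𝓘(𝕜, E) G) V 0) : evenProj 𝕜 E V G X = X := by
  obtain ⟨x, rfl⟩ : X ∈ LinearMap.range (LinearMap.inl 𝕜 (GroupLieAlgebra 𝓘(𝕜, E) G) V) := hX
  rfl

theorem oddProj_of_even {X : SuperSpace 𝕜 E V G}
    (hX : X ∈ homog 𝕜 (GroupLieAlgebra 𝓘(𝕜, E) G) V 0) : oddProj 𝕜 E V G X = 0 := by
  obtain ⟨x, rfl⟩ : X ∈ LinearMap.range (LinearMap.inl 𝕜 (GroupLieAlgebra 𝓘(𝕜, E) G) V) := hX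
  rfl

theorem evenProj_of_odd {X : SuperSpace 𝕜 E V G}
    (hX : X ∈ homog 𝕜 (GroupLieAlgebra 𝓘(𝕜, E) G) V 1) : evenProj 𝕜 E V G X = 0 := by
  obtain ⟨x, rfl⟩ : X ∈ LinearMap.range (LinearMap.inr 𝕜 (GroupLieAlgebra 𝓘(𝕜, E) G) V) := hX
  rfl

theorem oddProj_of_odd {X : SuperSpace 𝕜 E V G}
    (hX : X ∈ homog 𝕜 (GroupLieAlgebra 𝓘(𝕜, E) G) V 1) : oddProj 𝕜 E V G X = X := by
  obtain ⟨x, rfl⟩ : X ∈ LinearMap.range (LinearMap.inr 𝕜 (GroupLieAlgebra 𝓘(𝕜, E) G) V) := hX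
  rfl

theorem evenSoul_map_mem {m : ℕ} {n : Gr 𝕜 m ⊗[𝕜] GroupLieAlgebra 𝓘(𝕜, E) G}
    (hn : n ∈ evenSoul 𝕜 E G m) :
    LinearMap.lTensor (Gr 𝕜 m) (LinearMap.inl 𝕜 _ V) n ∈ soul 𝕜 E V G m := by
  have h : evenSoul 𝕜 E G m ≤
      (soul 𝕜 E V G m).comap (LinearMap.lTensor (Gr 𝕜 m) (LinearMap.inl 𝕜 _ V)) :=
    Submodule.map₂_le.2 fun a ha X _ =>
      Submodule.mem_sup_left (Submodule.apply_mem_map₂ _ ha (inl_mem_homog X))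
  exact h hn

theorem oddSoul_map_mem {m : ℕ} {n : Gr 𝕜 m ⊗[𝕜] V} (hn : n ∈ oddSoul 𝕜 V m) :
    LinearMap.lTensor (Gr 𝕜 m) (LinearMap.inr 𝕜 (GroupLieAlgebra 𝓘(𝕜, E) G) V) n ∈
      soul 𝕜 E V G m := by
  have h : oddSoul 𝕜 V m ≤ (soul 𝕜 E V G m).comap
      (LinearMap.lTensor (Gr 𝕜 m) (LinearMap.inr 𝕜 (GroupLieAlgebra 𝓘(𝕜, E) G) V)) :=
    Submodule.map₂_le.2 fun a ha X _ =>
      Submodule.mem_sup_right (Submodule.apply_mem_map₂ _ ha (inr_mem_homog X))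
  exact h hn

theorem tmul_mem_soul {m : ℕ} {a : Gr 𝕜 m} {X : SuperSpace 𝕜 E V G}
    (h : a ∈ extNilEven 𝕜 (Fin m → 𝕜) ∧ X ∈ homog 𝕜 (GroupLieAlgebra 𝓘(𝕜, E) G) V 0 ∨
      a ∈ extParity 𝕜 (Fin m → 𝕜) 1 ∧ X ∈ homog 𝕜 (GroupLieAlgebra 𝓘(𝕜, E) G) V 1) :
    a ⊗ₜ X ∈ soul 𝕜 E V G m :=
  h.elim (fun h => Submodule.mem_sup_left (Submodule.apply_mem_map₂ _ h.1 h.2))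
    (fun h => Submodule.mem_sup_right (Submodule.apply_mem_map₂ _ h.1 h.2))

theorem soul_induction {m : ℕ} (S : Submodule 𝕜 (Gr 𝕜 m ⊗[𝕜] SuperSpace 𝕜 E V G))
    (h : ∀ (a : Gr 𝕜 m) (X : SuperSpace 𝕜 E V G),
      (a ∈ extNilEven 𝕜 (Fin m → 𝕜) ∧ X ∈ homog 𝕜 (GroupLieAlgebra 𝓘(𝕜, E) G) V 0 ∨
      a ∈ extParity 𝕜 (Fin m → 𝕜) 1 ∧ X ∈ homog 𝕜 (GroupLieAlgebra 𝓘(𝕜, E) G) V 1) →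
      a ⊗ₜ X ∈ S) : soul 𝕜 E V G m ≤ S :=
  sup_le (Submodule.map₂_le.2 fun a ha X hX => h a X (Or.inl ⟨ha, hX⟩))
    (Submodule.map₂_le.2 fun a ha X hX => h a X (Or.inr ⟨ha, hX⟩))

variable [LieGroup 𝓘(𝕜, E) ∞ G] (P : HCSuperpair 𝕜 E V G)

/-- The bracket `[a ⊗ X, b ⊗ Y] = (-1)^{|X||b|} ab ⊗ [X, Y]` of the Grassmann envelope. -/
def envBracket (m : ℕ) : Gr 𝕜 m ⊗[𝕜] SuperSpace 𝕜 E V G →ₗ[𝕜]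
    Gr 𝕜 m ⊗[𝕜] SuperSpace 𝕜 E V G →ₗ[𝕜] Gr 𝕜 m ⊗[𝕜] SuperSpace 𝕜 E V G :=
  TensorProduct.map₂ (LinearMap.mul 𝕜 (Gr 𝕜 m)) (P.bracket ∘ₗ evenProj 𝕜 E V G) +
    TensorProduct.map₂ ((LinearMap.mul 𝕜 (Gr 𝕜 m)).compl₂ (extInvol 𝕜 (Fin m → 𝕜)).toLinearMap)
      (P.bracket ∘ₗ oddProj 𝕜 E V G)

theorem envBracket_tmul (m : ℕ) (a b : Gr 𝕜 m) (X Y : SuperSpace 𝕜 E V G) :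
    envBracket P m (a ⊗ₜ X) (b ⊗ₜ Y) = (a * b) ⊗ₜ P.bracket (evenProj 𝕜 E V G X) Y +
      (a * extInvol 𝕜 (Fin m → 𝕜) b) ⊗ₜ P.bracket (oddProj 𝕜 E V G X) Y := rfl

theorem envBracket_mem (m : ℕ) : ∀ x ∈ soul 𝕜 E V G m, ∀ y ∈ soul 𝕜 E V G m,
    envBracket P m x y ∈ soul 𝕜 E V G m := by
  intro x hx y hy
  revert x
  refine soul_induction ((soul 𝕜 E V G m).comap ((envBracket P m).flip y)) fun a X haX => ?_
  change envBracket P m (a ⊗ₜ X) y ∈ soul 𝕜 E V G m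
  revert y
  refine soul_induction ((soul 𝕜 E V G m).comap (envBracket P m (a ⊗ₜ X))) fun b Y hbY => ?_
  change envBracket P m (a ⊗ₜ X) (b ⊗ₜ Y) ∈ soul 𝕜 E V G m
  rw [envBracket_tmul]
  rcases haX with ⟨ha, hX⟩ | ⟨ha, hX⟩
  · rw [evenProj_of_even hX, oddProj_of_even hX, map_zero, LinearMap.zero_apply,
      TensorProduct.tmul_zero, add_zero]
    rcases hbY with ⟨hb, hY⟩ | ⟨hb, hY⟩
    · exact tmul_mem_soul (Or.inl ⟨extNilEven_mul ha hb, P.bracket_mem 0 0 X hX Y hY⟩)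
    · exact tmul_mem_soul (Or.inr ⟨by simpa using extParity_mul (mem_extNilEven.mp ha).1 hb, P.bracket_mem 0 1 X hX Y hY⟩)
  · rw [evenProj_of_odd hX, oddProj_of_odd hX, map_zero, LinearMap.zero_apply,
      TensorProduct.tmul_zero, zero_add]
    rcases hbY with ⟨hb, hY⟩ | ⟨hb, hY⟩
    · have hb' : extInvol 𝕜 (Fin m → 𝕜) b = b := CliffordAlgebra.involute_eq_of_mem_even (mem_extNilEven.mp hb).1
      rw [hb']
      exact tmul_mem_soul (Or.inr ⟨by simpa using extParity_mul ha (mem_extNilEven.mp hb).1, P.bracket_mem 1 0 X hX Y hY⟩)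
    · have hb' : extInvol 𝕜 (Fin m → 𝕜) b = -b := CliffordAlgebra.involute_eq_of_mem_odd hb
      rw [hb', mul_neg, TensorProduct.neg_tmul]
      exact neg_mem (tmul_mem_soul
        (Or.inl ⟨odd_mul_odd_mem_extNilEven ha hb, P.bracket_mem 1 1 X hX Y hY⟩))

theorem Ad_mem_soul (m : ℕ) (g : G) : ∀ x ∈ soul 𝕜 E V G m,
    LinearMap.lTensor (Gr 𝕜 m) (P.Ad g).toLinearMap x ∈ soul 𝕜 E V G m :=
  soul_induction ((soul 𝕜 E V G m).comap (LinearMap.lTensor (Gr 𝕜 m) (P.Ad g).toLinearMap))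
    fun a X haX => by
      change a ⊗ₜ[𝕜] (P.Ad g X) ∈ soul 𝕜 E V G m
      exact tmul_mem_soul (haX.imp (fun h => ⟨h.1, P.Ad_mem g 0 X h.2⟩)
        (fun h => ⟨h.1, P.Ad_mem g 1 X h.2⟩))

variable (m : ℕ)

/-- The points `g · exp(n)`, `g ∈ G` and `n ∈ 𝔫`, of the Lie group `G̃ = G ⋉ exp(𝔫)` which contains
`G` and has the Lie algebra `𝔤̃`. -/
structure GrPoint (P : HCSuperpair 𝕜 E V G) (m : ℕ) where
  /-- the component in `G` -/
  body : G
  /-- the logarithm of the component in `exp(𝔫)` -/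
  log : soul 𝕜 E V G m

namespace GrPoint

variable {P m}

/-- The product `(g · exp(n)) (h · exp(n')) = gh · exp(Ad(h⁻¹) n) exp(n')` of `G̃`, where
`exp(x) exp(y)` is given by the Baker-Campbell-Hausdorff product of `𝔫`, in which all brackets of
more than `m` elements vanish. -/
instance : Mul (GrPoint P m) where
  mul p q := ⟨p.body * q.body,
    ⟨bch (envBracket P m) m (LinearMap.lTensor (Gr 𝕜 m) (P.Ad q.body⁻¹).toLinearMap p.log) q.log,
      bch_mem _ _ (envBracket_mem P m) m (Ad_mem_soul P m _ _ p.log.2) q.log.2⟩⟩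

variable (P m) in
/-- The inclusion of `G` into `G̃`. -/
def ofBody (g : G) : GrPoint P m := ⟨g, 0⟩

variable (P) in
/-- The exponential `exp(n₀)` of `n₀ ∈ Λ₀⁺ ⊗ 𝔤₀`. -/
def expEven (n : evenSoul 𝕜 E G m) : GrPoint P m :=
  ⟨1, ⟨LinearMap.lTensor (Gr 𝕜 m) (LinearMap.inl 𝕜 _ V) n, evenSoul_map_mem n.2⟩⟩

variable (P) in
/-- The exponential `exp(n₁)` of `n₁ ∈ Λ₁ ⊗ 𝔤₁`. -/
def expOdd (n : oddSoul 𝕜 V m) : GrPoint P m :=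
  ⟨1, ⟨LinearMap.lTensor (Gr 𝕜 m) (LinearMap.inr 𝕜 _ V) n, oddSoul_map_mem n.2⟩⟩

end GrPoint

end Envelope

/-! ### Grassmann-analytic continuation -/

section Continuation

variable {𝕜 : Type*} [RCLike 𝕜] {E : Type*} [NormedAddCommGroup E] [NormedSpace 𝕜 E]
variable {V : Type*} [AddCommGroup V] [Module 𝕜 V]
variable {G : Type*} [TopologicalSpace G] [ChartedSpace E G] [Group G]
variable {m : ℕ}

/-- For `n = ∑ σⱼ ⊗ Ξⱼ ∈ Λ₁ ⊗ 𝔤₁` the linear map `𝔤₁* → Λ`, `α ↦ ∑ σⱼ α(Ξⱼ)`. -/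
def oddPairing (n : Gr 𝕜 m ⊗[𝕜] V) : Module.Dual 𝕜 V →ₗ[𝕜] Gr 𝕜 m :=
  (TensorProduct.rid 𝕜 (Gr 𝕜 m)).toLinearMap ∘ₗ
    ((LinearMap.lTensorHom (R := 𝕜) (M := Gr 𝕜 m) (N := V) (P := 𝕜)).flip n)

theorem oddPairing_tmul (a : Gr 𝕜 m) (v : V) (α : Module.Dual 𝕜 V) :
    oddPairing (a ⊗ₜ v) α = α v • a := rfl

theorem oddPairing_odd {n : Gr 𝕜 m ⊗[𝕜] V} (hn : n ∈ oddSoul 𝕜 V m) (α : Module.Dual 𝕜 V) :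
    oddPairing n α ∈ extParity 𝕜 (Fin m → 𝕜) 1 := by
  have h : oddSoul 𝕜 V m ≤ (extParity 𝕜 (Fin m → 𝕜) 1).comap
      ((TensorProduct.rid 𝕜 (Gr 𝕜 m)).toLinearMap ∘ₗ LinearMap.lTensor (Gr 𝕜 m) α) :=
    Submodule.map₂_le.2 fun a ha v _ => Submodule.smul_mem _ (α v) ha
  exact h hn

/-- For `n = ∑ σⱼ ⊗ Ξⱼ ∈ Λ₁ ⊗ 𝔤₁` the algebra homomorphism `Λ𝔤₁* → Λ` which maps `α ∈ 𝔤₁*` to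
`∑ σⱼ α(Ξⱼ)`. -/
def oddSubst (n : oddSoul 𝕜 V m) : ExteriorAlgebra 𝕜 (Module.Dual 𝕜 V) →ₐ[𝕜] Gr 𝕜 m :=
  ExteriorAlgebra.lift 𝕜 ⟨oddPairing n.1, fun α => ext_odd_sq (oddPairing_odd n.2 α)⟩

/-- Evaluation at `x` of sections of `𝓕 ⊗ A`. -/
def evalAt {A : Type*} [AddCommGroup A] [Module 𝕜 A] {U : Opens G} (x : U) :
    NumFun 𝕜 E U ⊗[𝕜] A →ₗ[𝕜] A :=
  (TensorProduct.lid 𝕜 A).toLinearMap ∘ₗ LinearMap.rTensor A (NumFun.eval x)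

variable [LieGroup 𝓘(𝕜, E) ∞ G]

/-- For `n = ∑ aᵢ ⊗ ξᵢ ∈ Λ ⊗ 𝔤₀` the operator `f ↦ ∑ aᵢ ξᵢ.f` on `𝓕 ⊗ Λ`, where `ξᵢ` acts by the
left-invariant derivation. -/
def envDer (U : Opens G) : Gr 𝕜 m ⊗[𝕜] GroupLieAlgebra 𝓘(𝕜, E) G →ₗ[𝕜]
    Module.End 𝕜 (NumFun 𝕜 E U ⊗[𝕜] Gr 𝕜 m) :=
  TensorProduct.lift (LinearMap.mk₂ 𝕜
    (fun a X => TensorProduct.map (leftDer U X) (LinearMap.mulLeft 𝕜 a))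
    (fun a b X => by
      rw [← TensorProduct.map_add_right]
      exact congrArg _ (LinearMap.ext fun x => add_mul a b x))
    (fun c a X => by
      rw [← TensorProduct.map_smul_right]
      exact congrArg _ (LinearMap.ext fun x => smul_mul_assoc c a x))
    (fun a X Y => by rw [map_add, TensorProduct.map_add_left])
    (fun c a X => by rw [map_smul, TensorProduct.map_smul_left]))

/-- The value at `g · exp(n₀) · exp(n₁)` of the continuation of the superfunction `f = ∑ f_I θ^I`.
The odd coordinates `θ` are replaced by the coefficients of `n₁`, and the numerical functions `f_I`
are continued to `g · exp(n₀)` by their (finite) Taylor series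
`f̂_I(g exp(n₀)) = ∑ 1/k! (n₀ᵏ.f_I)(g)`. -/
def contValue {U : Opens G} (f : Superfun 𝕜 E V U) (g : U) (n₀ : evenSoul 𝕜 E G m)
    (n₁ : oddSoul 𝕜 V m) : Gr 𝕜 m :=
  evalAt g (∑ k ∈ Finset.range (m + 1), ((k.factorial : 𝕜)⁻¹) •
    ((envDer U n₀.1) ^ k) (LinearMap.lTensor _ (oddSubst n₁).toLinearMap f))

variable (P : HCSuperpair 𝕜 E V G)

open Classical in
/-- The Grassmann-analytic continuation `f̃ : G̃ → Λ` of a superfunction `f` on `U`; it is defined at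
the points over `U`, all of which are of the form `g · exp(n₀) · exp(n₁)` in a unique way. -/
def continuation {U : Opens G} (f : Superfun 𝕜 E V U) (p : GrPoint P m) : Gr 𝕜 m :=
  if h : ∃ q : U × evenSoul 𝕜 E G m × oddSoul 𝕜 V m,
      p = GrPoint.ofBody P m q.1 * GrPoint.expEven P q.2.1 * GrPoint.expOdd P q.2.2
  then contValue f h.choose.1 h.choose.2.1 h.choose.2.2 else 0

end Continuation

/-! ### Representation-theoretical Lie supergroups -/

section RT

variable {𝕜 : Type*} [RCLike 𝕜] {E : Type*} [NormedAddCommGroup E] [NormedSpace 𝕜 E]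
variable {V : Type*} [AddCommGroup V] [Module 𝕜 V]
variable {G : Type*} [TopologicalSpace G] [ChartedSpace E G] [Group G]

/-- Restriction of superfunctions. -/
def Superfun.res {U W : Opens G} (h : U ≤ W) : Superfun 𝕜 E V W →ₗ[𝕜] Superfun 𝕜 E V U :=
  LinearMap.rTensor _ (NumFun.res h)

variable (𝕜 E V) in
/-- The superfunctions of parity `i` on `U`. -/
def Superfun.parity (U : Opens G) (i : ZMod 2) : Submodule 𝕜 (Superfun 𝕜 E V U) :=
  LinearMap.range (LinearMap.lTensor (NumFun 𝕜 E U) (extParity 𝕜 (Module.Dual 𝕜 V) i).subtype)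

variable [LieGroup 𝓘(𝕜, E) ∞ G]

/-- A linear map `ρ` from `𝔤` to the endomorphisms of the sheaf `𝓕 ⊗ Λ𝔤₁*`: an operator
`ρ(X)` on the sections over every open set, compatible with restrictions. -/
structure SheafAction (P : HCSuperpair 𝕜 E V G) where
  /-- the operator `ρ(X)` on the sections over `U` -/
  op (U : Opens G) : SuperSpace 𝕜 E V G →ₗ[𝕜] Module.End 𝕜 (Superfun 𝕜 E V U)
  op_res : ∀ {U W : Opens G} (h : U ≤ W) (X : SuperSpace 𝕜 E V G) (f : Superfun 𝕜 E V W),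
    Superfun.res h (op W X f) = op U X (Superfun.res h f)

variable {P : HCSuperpair 𝕜 E V G}

/-- `ρ` is a representation of the Lie superalgebra `𝔤` by superderivations. -/
structure SheafAction.IsSuperRep (ρ : SheafAction P) : Prop where
  map_bracket : ∀ (U : Opens G) (i j : ZMod 2),
    ∀ X ∈ homog 𝕜 (GroupLieAlgebra 𝓘(𝕜, E) G) V i, ∀ Y ∈ homog 𝕜 (GroupLieAlgebra 𝓘(𝕜, E) G) V j,
      ρ.op U (P.bracket X Y) = ρ.op U X * ρ.op U Y - ssign 𝕜 i j • (ρ.op U Y * ρ.op U X)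
  parity : ∀ (U : Opens G) (i j : ZMod 2), ∀ X ∈ homog 𝕜 (GroupLieAlgebra 𝓘(𝕜, E) G) V i,
    ∀ f ∈ Superfun.parity 𝕜 E V U j, ρ.op U X f ∈ Superfun.parity 𝕜 E V U (i + j)
  leibniz : ∀ (U : Opens G) (i j : ZMod 2), ∀ X ∈ homog 𝕜 (GroupLieAlgebra 𝓘(𝕜, E) G) V i,
    ∀ f ∈ Superfun.parity 𝕜 E V U j, ∀ f' : Superfun 𝕜 E V U,
      ρ.op U X (f * f') = ρ.op U X f * f' + ssign 𝕜 i j • (f * ρ.op U X f')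

/-- Definiteness: the sheaf of invariant superfunctions is the sheaf of constants, i.e. a
superfunction is annihilated by `𝔤` if and only if it is a locally constant numerical function. -/
def SheafAction.IsDefinite (ρ : SheafAction P) : Prop :=
  ∀ (U : Opens G) (f : Superfun 𝕜 E V U), (∀ X, ρ.op U X f = 0) ↔
    ∃ c : NumFun 𝕜 E U, IsLocallyConstant c ∧ f = c ⊗ₜ 1

variable (P) in
/-- LRT Lie supergroups `(G, 𝔤, ρ)`. -/
structure LRTLieSupergroup extends SheafAction P where
  superRep : toSheafAction.IsSuperRep
  native : ∀ (U : Opens G) (X : GroupLieAlgebra 𝓘(𝕜, E) G) (f : NumFun 𝕜 E U),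
    op U (X, 0) (f ⊗ₜ 1) = (leftDer U X f) ⊗ₜ 1
  definite : toSheafAction.IsDefinite

variable (P) in
/-- RRT Lie supergroups `(G, 𝔤, ρ)`. -/
structure RRTLieSupergroup extends SheafAction P where
  superRep : toSheafAction.IsSuperRep
  native : ∀ (U : Opens G) (X : GroupLieAlgebra 𝓘(𝕜, E) G) (f : NumFun 𝕜 E U),
    op U (X, 0) (f ⊗ₜ 1) = (rightDer U X f) ⊗ₜ 1
  definite : toSheafAction.IsDefinite

variable (P) in
/-- RT Lie supergroups `(G, 𝔤, ρ_L, ρ_R)`. -/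
structure RTLieSupergroup where
  /-- the LRT Lie supergroup `(G, 𝔤, ρ_L)` -/
  left : LRTLieSupergroup P
  /-- the RRT Lie supergroup `(G, 𝔤, ρ_R)` -/
  right : RRTLieSupergroup P
  bilateral : ∀ (U : Opens G) (i j : ZMod 2),
    ∀ X ∈ homog 𝕜 (GroupLieAlgebra 𝓘(𝕜, E) G) V i, ∀ Y ∈ homog 𝕜 (GroupLieAlgebra 𝓘(𝕜, E) G) V j,
      right.op U X * left.op U Y = ssign 𝕜 i j • (left.op U Y * right.op U X)

/-- An LRT Lie supergroup is planed if `X₀.α = α([·, X₀])` for `X₀ ∈ 𝔤₀` and `α ∈ 1 ⊗ 𝔤₁*`. -/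
def LRTLieSupergroup.IsPlaned (S : LRTLieSupergroup P) : Prop :=
  ∀ (U : Opens G) (X : GroupLieAlgebra 𝓘(𝕜, E) G) (α : Module.Dual 𝕜 V),
    S.op U (X, 0) (1 ⊗ₜ ExteriorAlgebra.ι 𝕜 α) =
      1 ⊗ₜ ExteriorAlgebra.ι 𝕜 (α ∘ₗ P.oddBracketRight X)

/-- An RT Lie supergroup is planed if its LRT Lie supergroup is. -/
def RTLieSupergroup.IsPlaned (S : RTLieSupergroup P) : Prop := S.left.IsPlaned

/-! ### Berezin's construction -/

/-- For `α ∈ Λ₁` and `X ∈ 𝔤₁` the one-parameter subgroup `t ↦ exp(t α X)` of `G̃`. -/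
def oddCurve (P : HCSuperpair 𝕜 E V G) {m : ℕ} (α : extParity 𝕜 (Fin m → 𝕜) 1) (X : V) (t : 𝕜) :
    GrPoint P m :=
  GrPoint.expOdd P (t • ⟨α.1 ⊗ₜ X, Submodule.apply_mem_map₂ _ α.2 Submodule.mem_top⟩)

/-- The action `ρ` is Berezin's left-invariant action: the continuation of `ρ(X) f` is the derivative
of the continuation `f̃` along the left-invariant vector field on `G̃` given by `X`. That is, for
every Grassmann algebra `Λ` and every point `p` of `G̃` over `U`,
`d/dt f̃(p exp(tX)) = (ρ(X)f)~(p)` for `X ∈ 𝔤₀` and `d/dt f̃(p exp(tαX)) = α (ρ(X)f)~(p)` for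
`X ∈ 𝔤₁` and every odd parameter `α ∈ Λ₁`, at `t = 0`. (Identities in `Λ` are tested by linear
forms `l`. The derivative along `exp(tX)` is the derivative along `G` at `1` in the direction `X`.) -/
structure SheafAction.IsBerezinLeft (ρ : SheafAction P) : Prop where
  even : ∀ (m : ℕ) (U : Opens G) (f : Superfun 𝕜 E V U) (p : GrPoint P m), p.body ∈ U →
    ∀ (X : GroupLieAlgebra 𝓘(𝕜, E) G) (l : Module.Dual 𝕜 (Gr 𝕜 m)),
      MDifferentiableAt 𝓘(𝕜, E) 𝓘(𝕜, 𝕜)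
        (fun h : G => l (continuation P f (p * GrPoint.ofBody P m h))) 1 ∧
      (mfderiv 𝓘(𝕜, E) 𝓘(𝕜, 𝕜)
        (fun h : G => l (continuation P f (p * GrPoint.ofBody P m h))) 1 X : 𝕜) =
        l (continuation P (ρ.op U (X, 0) f) p)
  odd : ∀ (m : ℕ) (U : Opens G) (f : Superfun 𝕜 E V U) (p : GrPoint P m), p.body ∈ U →
    ∀ (X : V) (α : extParity 𝕜 (Fin m → 𝕜) 1) (l : Module.Dual 𝕜 (Gr 𝕜 m)),
      HasDerivAt (fun t : 𝕜 => l (continuation P f (p * oddCurve P α X t)))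
        (l (α * continuation P (ρ.op U (0, X) f) p)) 0

/-- The action `ρ` is Berezin's right-invariant action: the continuation of `ρ(X) f` is
the derivative of `f̃` along `p ↦ exp(-tX) p`, for `X ∈ 𝔤₀`, and along `p ↦ exp(-tαX) p`,
for `X ∈ 𝔤₁` and odd parameters `α`. -/
structure SheafAction.IsBerezinRight (ρ : SheafAction P) : Prop where
  even : ∀ (m : ℕ) (U : Opens G) (f : Superfun 𝕜 E V U) (p : GrPoint P m), p.body ∈ U →
    ∀ (X : GroupLieAlgebra 𝓘(𝕜, E) G) (l : Module.Dual 𝕜 (Gr 𝕜 m)),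
      MDifferentiableAt 𝓘(𝕜, E) 𝓘(𝕜, 𝕜)
        (fun h : G => l (continuation P f (GrPoint.ofBody P m h * p))) 1 ∧
      (mfderiv 𝓘(𝕜, E) 𝓘(𝕜, 𝕜)
        (fun h : G => l (continuation P f (GrPoint.ofBody P m h * p))) 1 (-X) : 𝕜) =
        l (continuation P (ρ.op U (X, 0) f) p)
  odd : ∀ (m : ℕ) (U : Opens G) (f : Superfun 𝕜 E V U) (p : GrPoint P m), p.body ∈ U →
    ∀ (X : V) (α : extParity 𝕜 (Fin m → 𝕜) 1) (l : Module.Dual 𝕜 (Gr 𝕜 m)),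
      HasDerivAt (fun t : 𝕜 => l (continuation P f (oddCurve P α X (-t) * p)))
        (l (α * continuation P (ρ.op U (0, X) f) p)) 0

end RT

/-- The RT Lie supergroup `(G, 𝔤, ρ_L, ρ_R)` is given by Berezin's construction. -/
def RTLieSupergroup.IsBerezin {𝕜 : Type*} [RCLike 𝕜] {E : Type*} [NormedAddCommGroup E]
    [NormedSpace 𝕜 E] {V : Type*} [AddCommGroup V] [Module 𝕜 V] {G : Type*} [TopologicalSpace G]
    [ChartedSpace E G] [Group G] [LieGroup 𝓘(𝕜, E) ∞ G] {P : HCSuperpair 𝕜 E V G}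
    (S : RTLieSupergroup P) : Prop :=
  S.left.toSheafAction.IsBerezinLeft ∧ S.right.toSheafAction.IsBerezinRight

/-! ### Morphisms -/

section Morphisms

variable {𝕜 : Type*} [RCLike 𝕜]
variable {E : Type*} [NormedAddCommGroup E] [NormedSpace 𝕜 E]
  {V : Type*} [AddCommGroup V] [Module 𝕜 V]
  {G : Type*} [TopologicalSpace G] [ChartedSpace E G] [Group G] [LieGroup 𝓘(𝕜, E) ∞ G]
variable {E' : Type*} [NormedAddCommGroup E'] [NormedSpace 𝕜 E']
  {V' : Type*} [AddCommGroup V'] [Module 𝕜 V']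
  {G' : Type*} [TopologicalSpace G'] [ChartedSpace E' G'] [Group G'] [LieGroup 𝓘(𝕜, E') ∞ G']

/-- An (even) morphism of the Lie superalgebras of two Harish-Chandra superpairs. -/
structure SuperHom (P : HCSuperpair 𝕜 E V G) (P' : HCSuperpair 𝕜 E' V' G') where
  /-- the even component -/
  even : GroupLieAlgebra 𝓘(𝕜, E) G →ₗ[𝕜] GroupLieAlgebra 𝓘(𝕜, E') G'
  /-- the odd component -/
  odd : V →ₗ[𝕜] V'
  map_bracket : ∀ X Y : SuperSpace 𝕜 E V G,
    even.prodMap odd (P.bracket X Y) = P'.bracket (even.prodMap odd X) (even.prodMap odd Y)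

/-- An isomorphism of Harish-Chandra superpairs: an isomorphism `L` of Lie groups together with an
isomorphism `ℓ` of Lie superalgebras which has the differential of `L` as its even component and is
equivariant with respect to the adjoint actions. -/
structure HCIso (P : HCSuperpair 𝕜 E V G) (P' : HCSuperpair 𝕜 E' V' G') where
  /-- the isomorphism of Lie groups -/
  L : G ≃* G'
  L_smooth : ContMDiff 𝓘(𝕜, E) 𝓘(𝕜, E') ∞ L
  L_symm_smooth : ContMDiff 𝓘(𝕜, E') 𝓘(𝕜, E) ∞ L.symm
  /-- the isomorphism of Lie superalgebras -/
  ell : SuperHom P P'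
  even_bijective : Function.Bijective ell.even
  odd_bijective : Function.Bijective ell.odd
  even_eq : ∀ X : GroupLieAlgebra 𝓘(𝕜, E) G,
    ell.even X = (mfderiv 𝓘(𝕜, E) 𝓘(𝕜, E') L 1 X : E')
  map_Ad : ∀ (g : G) (X : SuperSpace 𝕜 E V G),
    ell.even.prodMap ell.odd (P.Ad g X) = P'.Ad (L g) (ell.even.prodMap ell.odd X)

/-- The data common to the morphisms of LRT, RRT and RT Lie supergroups: a morphism `(ψ, ψ^#)` of
supermanifolds with fixed splitting together with a morphism `ψ^♢` of Lie superalgebras which satisfy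
the compatibility condition. -/
structure CompatibleMorphism (P : HCSuperpair 𝕜 E V G) (P' : HCSuperpair 𝕜 E' V' G') where
  /-- the underlying morphism `ψ` of Lie groups -/
  toHom : G →* G'
  smooth : ContMDiff 𝓘(𝕜, E) 𝓘(𝕜, E') ∞ toHom
  /-- the morphism `ψ^♢` of Lie superalgebras -/
  diamond : SuperHom P P'
  /-- the pull-back `ψ^#` of superfunctions -/
  pull (W : Opens G') : Superfun 𝕜 E' V' W →ₐ[𝕜]
    Superfun 𝕜 E V (Opens.comap ⟨toHom, smooth.continuous⟩ W)
  pull_res : ∀ {U W : Opens G'} (h : U ≤ W) (f : Superfun 𝕜 E' V' W),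
    Superfun.res (OrderHomClass.mono (Opens.comap ⟨toHom, smooth.continuous⟩) h) (pull W f) =
      pull U (Superfun.res h f)
  compatible : ∀ (W : Opens G') (f : NumFun 𝕜 E' W) (a : ExteriorAlgebra 𝕜 (Module.Dual 𝕜 V')),
    pull W (f ⊗ₜ a) = (NumFun.pull ⟨toHom, smooth.continuous⟩ smooth W f) ⊗ₜ
      ExteriorAlgebra.map diamond.odd.dualMap a

variable {P : HCSuperpair 𝕜 E V G} {P' : HCSuperpair 𝕜 E' V' G'}

/-- Equivariance, `ρ(X) ∘ ψ^# = ψ^# ∘ ρ'(ψ^♢(X))`. -/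
def CompatibleMorphism.IsEquivariant (Ψ : CompatibleMorphism P P') (ρ : SheafAction P)
    (ρ' : SheafAction P') : Prop :=
  ∀ (W : Opens G') (X : SuperSpace 𝕜 E V G) (f : Superfun 𝕜 E' V' W),
    ρ.op _ X (Ψ.pull W f) = Ψ.pull W (ρ'.op W (Ψ.diamond.even.prodMap Ψ.diamond.odd X) f)

/-- `(ψ, ψ^#)` is an isomorphism of supermanifolds. -/
structure CompatibleMorphism.IsIso (Ψ : CompatibleMorphism P P') : Prop where
  base : ∃ inv : G' → G, ContMDiff 𝓘(𝕜, E') 𝓘(𝕜, E) ∞ inv ∧ Function.LeftInverse inv Ψ.toHom ∧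
    Function.RightInverse inv Ψ.toHom
  pull_bijective : ∀ W : Opens G', Function.Bijective (Ψ.pull W)

/-- Morphisms of LRT Lie supergroups. -/
structure LRTHom (S : LRTLieSupergroup P) (S' : LRTLieSupergroup P') extends
    CompatibleMorphism P P' where
  equivariant : toCompatibleMorphism.IsEquivariant S.toSheafAction S'.toSheafAction

/-- Morphisms of RT Lie supergroups. -/
structure RTHom (S : RTLieSupergroup P) (S' : RTLieSupergroup P') extends
    CompatibleMorphism P P' where
  equivariant_left :
    toCompatibleMorphism.IsEquivariant S.left.toSheafAction S'.left.toSheafAction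
  equivariant_right :
    toCompatibleMorphism.IsEquivariant S.right.toSheafAction S'.right.toSheafAction

end Morphisms

end BerezinConstruction
end

/-!
Berezin's construction for a Harish-Chandra superpair `(G, 𝔤)`, `𝔤 = L ⊕ V`, `L = Lie(G)`.

*Left-invariant vector fields.* Let `u` be the action of the canonical odd element `∑ θʲ ⊗ Ξⱼ` of
`ΛV* ⊗ 𝔤` by the superbracket (`adGen`). It is nilpotent. A superfunction is regarded as a function
of a point `g exp(∑ θʲ Ξⱼ)`, and the translation of this point by `exp(X)` from the right is the
vector field with the coefficients `T⁻¹ eᵘ X`, where `T` (`logDiff`) is the identity on `L` and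
`(eᵘ - 1) / u` on `V` (`leftCoeff`, `leftOp`); the insertion of `exp(Z)` between `g` and
`exp(∑ θʲ Ξⱼ)` gives the coefficients `T⁻¹ Z` (`rightCoeff`). Both statements serve as definitions, so that
their bracket relations have to be proved: adjoining formal generators whose bracket with `u` is the
derivative of `u` along a vector field turns the compatibility of `eᵘ` with the bracket into the
flatness of the Maurer-Cartan form (`expNil_affineBracket`, `oddFieldBracket_leftCoeff`,
`leftOp_isSuperRepOn`).

*Continuation as a flow.* A representation of `𝔤` on superfunctions extends to the Grassmann
envelope `Λ ⊗ 𝔤` (`superAct`), even nilpotent elements `n` have the flow `exp(superAct n)`, and the flow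
of a Baker-Campbell-Hausdorff product is the product of the flows (`expNil_bch`, `flow_bch`). Contracted
with the odd coordinates, the odd left-invariant vector fields are the Euler field (`IsRadial`), which
forces their flow to be Taylor's formula in the odd directions (`bodySection_expNil_oddGen`). Together
with the ordinary Taylor expansion in the even nilpotent directions, and since every nilpotent element is
the product of an even and an odd one (`exists_bch_eq`), the continuation of `f` to `g exp(n)` is the value
at `g` of the flow for the time `n` applied to `f` (`continuation_eq`). For this flow, the derivatives in
Berezin's construction are immediate from the group law (`leftOp_berezin_even`, `leftOp_berezin_odd`).

*Right-invariant vector fields.* The functions `g ↦ Ad(g⁻¹) X` with values in `𝔤` are flat for the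
left-invariant derivations (`adFrame`, `isRightFrame`). The vector fields with these coefficients with
respect to the fields with coefficients `T⁻¹ Z` supercommute with the left-invariant ones
(`leftOp_rightField_of_flat`). An operator which supercommutes with the odd left-invariant vector
fields is determined by its values on the body (`eq_zero_of_supercomm`), which reduces the bracket
relations of the right-invariant fields to those on the body (`rightOp_isSuperRepOn`). A superfunction
which is annihilated by all invariant fields has degree zero and a locally constant body.

*Uniqueness.* A superfunction is determined by its continuations to all Grassmann algebras, and this
remains true after multiplication by an odd generator which does not occur in the point
(`eq_zero_of_spareGen_mul_continuation`). Hence the defining relations determine the operators.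

*Isomorphisms.* All constructions are natural in the Lie superalgebra, the algebra of functions and the
derivations (`leftOp_sectionMap`, `rightOp_sectionMap`), so that an isomorphism of superpairs induces
an isomorphism of the supergroups.
-/

open scoped Manifold ContDiff TensorProduct
open TopologicalSpace (Opens)

noncomputable section
namespace BerezinConstruction

open TensorProduct (tmul_add tmul_zero map_tmul smul_tmul' zero_tmul add_tmul tmul_neg neg_tmul tmul_smul tmul_sum tmul_sub smul_tmul sub_tmul sum_tmul)
open Algebra.TensorProduct (tmul_mul_tmul)
open ExteriorAlgebra (ι)
open Module (finBasis)
open LinearMap (rTensor lTensor rTensor_tmul lTensor_tmul inl inr comp_apply mulLeft mulRight)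

/-- The exterior algebra of `M`. -/
local notation:max "Λ[" K "] " M:max => ExteriorAlgebra K M

/-- The exterior algebra of the dual space of `M`. -/
local notation:max "Λ*[" K "] " M:max => ExteriorAlgebra K (Module.Dual K M)

/-- The bilinear operations on `M`. -/
local notation:max "Bil[" K "] " M:max => M →ₗ[K] M →ₗ[K] M

/-- The Lie algebra of the group `G`, which is modelled on `E`. -/
local notation:max "Lie[" K ", " E "] " G:max => GroupLieAlgebra 𝓘(K, E) G

/-! ### Exponentials of nilpotent elements -/

section ExpNil

variable (𝕜 : Type*) [RCLike 𝕜] {A : Type*} [Ring A] [Algebra 𝕜 A]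

/-- The exponential `∑ aⁱ / i!` of a nilpotent element of a `𝕜`-algebra. -/
def expNil (a : A) : A := ∑ i ∈ Finset.range (nilpotencyClass a), ((i.factorial : 𝕜)⁻¹) • a ^ i

/-- The value `∑ aⁱ / (i + 1)!` of the series `(exp a - 1) / a` at a nilpotent element. -/
def phiNil (a : A) : A :=
  ∑ i ∈ Finset.range (nilpotencyClass a), (((i + 1).factorial : 𝕜)⁻¹) • a ^ i

theorem sum_range_smul_pow_eq {a : A} {k l : ℕ} (c : ℕ → 𝕜) (hk : a ^ k = 0) (hl : a ^ l = 0) :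
    ∑ i ∈ Finset.range k, c i • a ^ i = ∑ i ∈ Finset.range l, c i • a ^ i := by
  wlog h : k ≤ l generalizing k l
  · exact (this hl hk (le_of_not_ge h)).symm
  refine Finset.sum_subset (Finset.range_mono h) fun i _ hi => ?_
  rw [pow_eq_zero_of_le (by simpa using hi) hk, smul_zero]

variable {𝕜}

theorem expNil_eq_sum {a : A} {k : ℕ} (h : a ^ k = 0) :
    expNil 𝕜 a = ∑ i ∈ Finset.range k, ((i.factorial : 𝕜)⁻¹) • a ^ i :=
  sum_range_smul_pow_eq 𝕜 _ (pow_nilpotencyClass ⟨k, h⟩) h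

theorem phiNil_eq_sum {a : A} {k : ℕ} (h : a ^ k = 0) :
    phiNil 𝕜 a = ∑ i ∈ Finset.range k, (((i + 1).factorial : 𝕜)⁻¹) • a ^ i :=
  sum_range_smul_pow_eq 𝕜 _ (pow_nilpotencyClass ⟨k, h⟩) h

theorem expNil_zero : expNil 𝕜 (0 : A) = 1 := by
  simp [expNil_eq_sum (𝕜 := 𝕜) (pow_one (0 : A))]

theorem expNil_add {a b : A} (h : Commute a b) (ha : IsNilpotent a) (hb : IsNilpotent b) :
    expNil 𝕜 (a + b) = expNil 𝕜 a * expNil 𝕜 b := by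
  let _ : Module ℚ A := Module.compHom A (algebraMap ℚ 𝕜)
  have key : ∀ c : A, IsNilpotent.exp c = expNil 𝕜 c := fun c => by
    refine Finset.sum_congr rfl fun i _ => ?_
    change algebraMap ℚ 𝕜 ((i.factorial : ℚ)⁻¹) • c ^ i = _
    simp
  rw [← key, ← key, ← key, IsNilpotent.exp_add_of_commute h ha hb]

theorem expNil_mul_neg {a : A} (ha : IsNilpotent a) : expNil 𝕜 a * expNil 𝕜 (-a) = 1 := by
  rw [← expNil_add (Commute.neg_right rfl) ha ha.neg, add_neg_cancel, expNil_zero]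

theorem expNil_neg_mul {a : A} (ha : IsNilpotent a) : expNil 𝕜 (-a) * expNil 𝕜 a = 1 := by
  simpa using expNil_mul_neg (𝕜 := 𝕜) ha.neg

theorem expNil_map {B : Type*} [Ring B] [Algebra 𝕜 B] (f : A →ₐ[𝕜] B) {a : A}
    (ha : IsNilpotent a) : f (expNil 𝕜 a) = expNil 𝕜 (f a) := by
  obtain ⟨k, hk⟩ := ha
  have hk' : (f a) ^ k = 0 := by rw [← map_pow, hk, map_zero]
  simp [expNil_eq_sum hk, expNil_eq_sum hk']

theorem expNil_eq_one_add {a : A} (ha : IsNilpotent a) :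
    expNil 𝕜 a = 1 + phiNil 𝕜 a * a := by
  obtain ⟨k, hk⟩ := ha
  have hk' : a ^ (k + 1) = 0 := by rw [pow_succ, hk, zero_mul]
  rw [expNil_eq_sum hk', phiNil_eq_sum hk, Finset.sum_range_succ', Finset.sum_mul, add_comm]
  simp [pow_succ]

theorem commute_phiNil (a : A) : Commute a (phiNil 𝕜 a) :=
  Commute.sum_right _ _ _ fun i _ => ((Commute.refl a).pow_right i).smul_right _

end ExpNil

section ExpEnd

variable {𝕜 : Type*} [RCLike 𝕜] {M N Q : Type*} [AddCommGroup M] [Module 𝕜 M] [AddCommGroup N]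
  [Module 𝕜 N] [AddCommGroup Q] [Module 𝕜 Q]

theorem pow_intertwine {a : Module.End 𝕜 M} {b : Module.End 𝕜 N} {g : M →ₗ[𝕜] N}
    (h : ∀ x, b (g x) = g (a x)) (i : ℕ) (x : M) : (b ^ i) (g x) = g ((a ^ i) x) := by
  induction i with
  | zero => rfl
  | succ i ih => rw [pow_succ', pow_succ', Module.End.mul_apply, Module.End.mul_apply, ih, h]

theorem exists_pow_eq_zero {A B : Type*} [Ring A] [Ring B] {a : A} {b : B} (ha : IsNilpotent a)
    (hb : IsNilpotent b) : ∃ k, a ^ k = 0 ∧ b ^ k = 0 := by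
  obtain ⟨k, hk⟩ := ha
  obtain ⟨l, hl⟩ := hb
  exact ⟨max k l, pow_eq_zero_of_le (le_max_left _ _) hk, pow_eq_zero_of_le (le_max_right _ _) hl⟩

theorem expNil_intertwine {a : Module.End 𝕜 M} {b : Module.End 𝕜 N} {g : M →ₗ[𝕜] N}
    (ha : IsNilpotent a) (hb : IsNilpotent b) (h : ∀ x, b (g x) = g (a x)) (x : M) :
    expNil 𝕜 b (g x) = g (expNil 𝕜 a x) := by
  obtain ⟨k, hk, hl⟩ := exists_pow_eq_zero ha hb
  simp [expNil_eq_sum hk, expNil_eq_sum hl, LinearMap.sum_apply, pow_intertwine h]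

theorem phiNil_intertwine {a : Module.End 𝕜 M} {b : Module.End 𝕜 N} {g : M →ₗ[𝕜] N}
    (ha : IsNilpotent a) (hb : IsNilpotent b) (h : ∀ x, b (g x) = g (a x)) (x : M) :
    phiNil 𝕜 b (g x) = g (phiNil 𝕜 a x) := by
  obtain ⟨k, hk, hl⟩ := exists_pow_eq_zero ha hb
  simp [phiNil_eq_sum hk, phiNil_eq_sum hl, LinearMap.sum_apply, pow_intertwine h]

/-- The exponential of a derivation of a bilinear map is an automorphism of it. -/
theorem expNil_bilinear {a : Module.End 𝕜 M} {b : Module.End 𝕜 N} {c : Module.End 𝕜 Q}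
    (ha : IsNilpotent a) (hb : IsNilpotent b) (hc : IsNilpotent c) (B : M →ₗ[𝕜] N →ₗ[𝕜] Q)
    (h : ∀ x y, c (B x y) = B (a x) y + B x (b y)) (x : M) (y : N) :
    expNil 𝕜 c (B x y) = B (expNil 𝕜 a x) (expNil 𝕜 b y) := by
  have hL : IsNilpotent (rTensor N a) := ha.map (Module.End.rTensorAlgHom 𝕜 M N)
  have hR : IsNilpotent (lTensor M b) := hb.map (Module.End.lTensorAlgHom 𝕜 N M)
  have hcomm : Commute (rTensor N a) (lTensor M b) := by
    refine TensorProduct.ext' fun x y => ?_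
    simp
  have h1 := expNil_intertwine (g := TensorProduct.lift B) (hcomm.isNilpotent_add hL hR) hc
    (fun t => by
      have : c ∘ₗ TensorProduct.lift B =
          TensorProduct.lift B ∘ₗ (rTensor N a + lTensor M b) := by
        refine TensorProduct.ext' fun x y => ?_
        simp [h]
      exact LinearMap.congr_fun this t) (x ⊗ₜ y)
  rw [expNil_add hcomm hL hR] at h1
  have e1 := expNil_map (𝕜 := 𝕜) (Module.End.rTensorAlgHom 𝕜 M N) ha
  have e2 := expNil_map (𝕜 := 𝕜) (Module.End.lTensorAlgHom 𝕜 N M) hb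
  change rTensor N (expNil 𝕜 a) = expNil 𝕜 (rTensor N a) at e1
  change lTensor M (expNil 𝕜 b) = expNil 𝕜 (lTensor M b) at e2
  rw [← e1, ← e2] at h1
  simpa using h1

end ExpEnd

/-! ### The adjoint action in an associative algebra -/

section CommBr

variable {𝕜 : Type*} [RCLike 𝕜] {A : Type*} [Ring A] [Algebra 𝕜 A]

variable (𝕜 A) in
/-- The commutator of an associative algebra as a bilinear map. -/
def commBr : A →ₗ[𝕜] A →ₗ[𝕜] A := LinearMap.mul 𝕜 A - (LinearMap.mul 𝕜 A).flip

theorem commBr_apply (a b : A) : commBr 𝕜 A a b = a * b - b * a := rfl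

theorem mulRight_pow_apply (a b : A) (k : ℕ) : ((mulRight 𝕜 a) ^ k) b = b * a ^ k := by
  rw [LinearMap.pow_mulRight]; rfl

theorem isNilpotent_mulLeft {a : A} (ha : IsNilpotent a) : IsNilpotent (mulLeft 𝕜 a) := by
  obtain ⟨k, hk⟩ := ha
  exact ⟨k, by rw [LinearMap.pow_mulLeft, hk]; ext; simp⟩

theorem isNilpotent_mulRight {a : A} (ha : IsNilpotent a) :
    IsNilpotent (mulRight 𝕜 a) := by
  obtain ⟨k, hk⟩ := ha
  exact ⟨k, by rw [LinearMap.pow_mulRight, hk]; ext; simp⟩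

theorem isNilpotent_commBr {a : A} (ha : IsNilpotent a) : IsNilpotent (commBr 𝕜 A a) :=
  (LinearMap.commute_mulLeft_right (R := 𝕜) a a).isNilpotent_sub (isNilpotent_mulLeft ha)
    (isNilpotent_mulRight ha)

theorem expNil_commBr {a : A} (ha : IsNilpotent a) (b : A) :
    expNil 𝕜 (commBr 𝕜 A a) b = expNil 𝕜 a * b * expNil 𝕜 (-a) := by
  have e : commBr 𝕜 A a = mulLeft 𝕜 a + mulRight 𝕜 (-a) := by
    ext; simp [commBr_apply, sub_eq_add_neg]
  rw [e, expNil_add (LinearMap.commute_mulLeft_right (R := 𝕜) a (-a)) (isNilpotent_mulLeft ha)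
    (isNilpotent_mulRight ha.neg), Module.End.mul_apply]
  have h1 : ∀ c, expNil 𝕜 (mulLeft 𝕜 a) c = expNil 𝕜 a * c := fun c => by
    obtain ⟨k, hk⟩ := ha
    have hk' : (mulLeft 𝕜 a) ^ k = 0 := by
      rw [LinearMap.pow_mulLeft, hk]; ext; simp
    simp [expNil_eq_sum hk, expNil_eq_sum hk', LinearMap.sum_apply, LinearMap.pow_mulLeft,
      Finset.sum_mul]
  have h2 : ∀ c, expNil 𝕜 (mulRight 𝕜 (-a)) c = c * expNil 𝕜 (-a) := fun c => by
    obtain ⟨k, hk⟩ := ha.neg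
    have hk' : (mulRight 𝕜 (-a)) ^ k = 0 := by
      rw [LinearMap.pow_mulRight, hk]; ext; simp
    rw [expNil_eq_sum hk, expNil_eq_sum hk']
    simp only [LinearMap.sum_apply, LinearMap.smul_apply, mulRight_pow_apply, Finset.mul_sum,
      mul_smul_comm]
  rw [h1, h2, mul_assoc]

/-- The logarithmic derivative `E(exp z) exp(z)⁻¹ = φ(ad z)(E z)`, with `φ(u) = (exp u - 1) / u`,
for a derivation `E`. It is obtained by evaluating `exp(ad z) E = E + φ(ad z) [z, E]` in the
algebra of endomorphisms. -/
theorem derivation_expNil (D : A →ₗ[𝕜] A) (hD : ∀ a b, D (a * b) = D a * b + a * D b) {z : A}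
    (hz : IsNilpotent z) :
    D (expNil 𝕜 z) = phiNil 𝕜 (commBr 𝕜 A z) (D z) * expNil 𝕜 z := by
  have hL := isNilpotent_mulLeft (𝕜 := 𝕜) hz
  have hD1 : D 1 = 0 := by simpa using hD 1 1
  have h1 := expNil_commBr (𝕜 := 𝕜) (A := Module.End 𝕜 A) hL D
  rw [expNil_eq_one_add (isNilpotent_commBr hL)] at h1
  have h2 : commBr 𝕜 (Module.End 𝕜 A) (mulLeft 𝕜 z) D =
      -(LinearMap.mul 𝕜 A (D z)) := by
    ext b; simp [commBr_apply, hD]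
  have h3 : phiNil 𝕜 (commBr 𝕜 (Module.End 𝕜 A) (mulLeft 𝕜 z)) (LinearMap.mul 𝕜 A (D z))
      = LinearMap.mul 𝕜 A (phiNil 𝕜 (commBr 𝕜 A z) (D z)) :=
    phiNil_intertwine (g := LinearMap.mul 𝕜 A) (isNilpotent_commBr hz) (isNilpotent_commBr hL)
      (fun b => by ext c; simp [commBr_apply, mul_assoc]) (D z)
  have h4 : expNil 𝕜 (-mulLeft 𝕜 z) (expNil 𝕜 z) = (1 : A) := by
    have e : -mulLeft 𝕜 z = Algebra.lmul 𝕜 A (-z) := by ext; simp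
    rw [e, ← expNil_map (Algebra.lmul 𝕜 A) hz.neg]
    exact expNil_neg_mul hz
  have h5 := LinearMap.congr_fun h1 (expNil 𝕜 z)
  simp only [LinearMap.add_apply, Module.End.mul_apply, Module.End.one_apply, h2, map_neg, h3, h4,
    hD1, map_zero, LinearMap.neg_apply, LinearMap.mul_apply'] at h5
  exact eq_of_sub_eq_zero (by rw [sub_eq_add_neg]; exact h5)

end CommBr

/-! ### The series of the logarithm -/

section LogPoly

open Polynomial

variable (𝕜 : Type*) [RCLike 𝕜]

/-- The truncation of the series `log(1 + X) / X`. -/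
def psiPoly (N : ℕ) : 𝕜[X] := ∑ k ∈ Finset.range N, C ((-1) ^ k / (k + 1 : 𝕜)) * X ^ k

/-- The truncation of the series `(exp X - 1) / X`. -/
def phiPoly (N : ℕ) : 𝕜[X] := ∑ k ∈ Finset.range N, C (((k + 1).factorial : 𝕜)⁻¹) * X ^ k

variable {𝕜}

theorem X_pow_succ_dvd_of_derivative {f : 𝕜[X]} {N : ℕ} (h : X ^ N ∣ derivative f)
    (h0 : f.coeff 0 = 0) : X ^ (N + 1) ∣ f := by
  rw [X_pow_dvd_iff] at h ⊢
  intro d hd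
  rcases d with _ | e
  · exact h0
  · have := h e (by omega)
    rw [coeff_derivative] at this
    exact (mul_eq_zero.mp this).resolve_right (by exact_mod_cast Nat.succ_ne_zero e)

theorem derivative_X_mul_psiPoly (N : ℕ) :
    derivative (X * psiPoly 𝕜 N) * (1 + X) = 1 - (-X) ^ N := by
  have h : derivative (X * psiPoly 𝕜 N) = ∑ k ∈ Finset.range N, (-X : 𝕜[X]) ^ k := by
    rw [psiPoly, Finset.mul_sum, derivative_sum]
    refine Finset.sum_congr rfl fun k _ => ?_
    have : X * (C ((-1) ^ k / (k + 1 : 𝕜)) * X ^ k) = C ((-1) ^ k / (k + 1 : 𝕜)) * X ^ (k + 1) := by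
      ring
    rw [this, derivative_C_mul_X_pow]
    have hk : (k + 1 : 𝕜) ≠ 0 := by exact_mod_cast Nat.succ_ne_zero k
    have : (-1) ^ k / (k + 1 : 𝕜) * ((k + 1 : ℕ) : 𝕜) = (-1) ^ k := by
      push_cast; field_simp
    rw [this, neg_pow (X : 𝕜[X])]
    simp
  rw [h]
  have := geom_sum_mul (-X : 𝕜[X]) N
  linear_combination -this

theorem derivative_X_mul_phiPoly (N : ℕ) : derivative (X * phiPoly 𝕜 N) =
    1 + X * phiPoly 𝕜 N - C ((N.factorial : 𝕜)⁻¹) * X ^ N := by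
  induction N with
  | zero => simp [phiPoly]
  | succ N ih =>
    have e : X * phiPoly 𝕜 (N + 1) =
        X * phiPoly 𝕜 N + C (((N + 1).factorial : 𝕜)⁻¹) * X ^ (N + 1) := by
      rw [phiPoly, Finset.sum_range_succ, ← phiPoly]; ring
    rw [e, derivative_add, ih, derivative_C_mul_X_pow]
    have hN : (N + 1 : 𝕜) ≠ 0 := by exact_mod_cast Nat.succ_ne_zero N
    have : (((N + 1).factorial : 𝕜)⁻¹) * ((N + 1 : ℕ) : 𝕜) = (N.factorial : 𝕜)⁻¹ := by
      rw [Nat.factorial_succ]; push_cast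
      rw [mul_inv, mul_comm, ← mul_assoc, mul_inv_cancel₀ hN, one_mul]
    rw [this]
    simp only [add_tsub_cancel_right]
    ring

theorem psiPoly_comp_mul_phiPoly (N : ℕ) :
    X ^ N ∣ (psiPoly 𝕜 N).comp (X * phiPoly 𝕜 N) * phiPoly 𝕜 N - 1 := by
  set q : 𝕜[X] := X * phiPoly 𝕜 N with hq
  have h : X ^ (N + 1) ∣ (X * psiPoly 𝕜 N).comp q - X := by
    refine X_pow_succ_dvd_of_derivative ?_ ?_
    · have h1 := congrArg (fun p => p.comp q) (derivative_X_mul_psiPoly (𝕜 := 𝕜) N)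
      simp only [mul_comp, add_comp, one_comp, X_comp, sub_comp, pow_comp, neg_comp] at h1
      have h2 := derivative_X_mul_phiPoly (𝕜 := 𝕜) N
      rw [← hq] at h2
      rw [derivative_sub, derivative_comp, derivative_X, h2]
      have : (1 + q - C ((N.factorial : 𝕜)⁻¹) * X ^ N) *
          (derivative (X * psiPoly 𝕜 N)).comp q - 1 = -((-phiPoly 𝕜 N) ^ N) * X ^ N -
          C ((N.factorial : 𝕜)⁻¹) * (derivative (X * psiPoly 𝕜 N)).comp q * X ^ N := by
        have h3 : (-q) ^ N = (-phiPoly 𝕜 N) ^ N * X ^ N := by rw [hq, ← mul_pow]; ring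
        rw [h3] at h1
        linear_combination h1
      rw [this]
      exact dvd_sub (dvd_mul_left _ _) (dvd_mul_left _ _)
    · simp [hq, mul_comp]
  have h2 : (X * psiPoly 𝕜 N).comp q - X =
      X * ((psiPoly 𝕜 N).comp q * phiPoly 𝕜 N - 1) := by
    rw [mul_comp, X_comp]; conv_lhs => rw [hq]
    ring
  rw [h2, pow_succ'] at h
  exact (mul_dvd_mul_iff_left X_ne_zero).mp h

theorem phiPoly_comp_X_mul_psiPoly (N : ℕ) :
    X ^ (N + 1) ∣ (X * phiPoly 𝕜 N).comp (X * psiPoly 𝕜 N) - X := by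
  set l : 𝕜[X] := X * psiPoly 𝕜 N with hl
  set g : 𝕜[X] := (X * phiPoly 𝕜 N).comp l - X with hg
  have h0 : g.coeff 0 = 0 := by simp [hg, hl, mul_comp]
  have h1 : X ^ N ∣ derivative g * (1 + X) - g := by
    have h1 := congrArg (fun p => p.comp l) (derivative_X_mul_phiPoly (𝕜 := 𝕜) N)
    simp only [add_comp, one_comp, sub_comp, mul_comp (p := C _), C_comp, X_pow_comp] at h1
    have h2 := derivative_X_mul_psiPoly (𝕜 := 𝕜) N
    rw [← hl] at h2
    have h3 : l ^ N = psiPoly 𝕜 N ^ N * X ^ N := by rw [hl, mul_pow]; ring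
    have h4 : (-X : 𝕜[X]) ^ N = (-1) ^ N * X ^ N := neg_pow _ _
    have : derivative g * (1 + X) - g = X ^ N * (-(1 + (X * phiPoly 𝕜 N).comp l) * (-1) ^ N -
        C ((N.factorial : 𝕜)⁻¹) * psiPoly 𝕜 N ^ N * (1 - (-1) ^ N * X ^ N)) := by
      rw [hg, derivative_sub, derivative_comp, derivative_X, h1, h3]
      rw [h4] at h2
      linear_combination (1 + (X * phiPoly 𝕜 N).comp l -
        C ((N.factorial : 𝕜)⁻¹) * (psiPoly 𝕜 N ^ N * X ^ N)) * h2
    rw [this]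
    exact dvd_mul_right _ _
  have hc : IsCoprime (X : 𝕜[X]) (1 + X) := ⟨-1, 1, by ring⟩
  have h2 : ∀ j ≤ N, X ^ (j + 1) ∣ g := by
    intro j
    induction j with
    | zero => intro _; rw [zero_add, pow_one]; exact X_dvd_iff.mpr h0
    | succ j ih =>
      intro hj
      refine X_pow_succ_dvd_of_derivative ?_ h0
      have h3 : X ^ (j + 1) ∣ derivative g * (1 + X) := by
        have := dvd_add ((pow_dvd_pow X hj).trans h1) (ih (by omega))
        simpa using this
      exact (hc.pow_left).dvd_of_dvd_mul_right h3
  exact h2 N le_rfl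

variable {A : Type*} [Ring A] [Algebra 𝕜 A]

theorem aeval_eq_zero_of_X_pow_dvd {a : A} {N : ℕ} (ha : a ^ N = 0) {f : 𝕜[X]} (h : X ^ N ∣ f) :
    aeval a f = 0 := by
  obtain ⟨g, rfl⟩ := h
  simp [ha]

theorem aeval_phiPoly {a : A} {N : ℕ} (ha : a ^ N = 0) : aeval a (phiPoly 𝕜 N) = phiNil 𝕜 a := by
  rw [phiNil_eq_sum ha, phiPoly]
  simp [Algebra.smul_def]

theorem aeval_X_mul_phiPoly {a : A} {N : ℕ} (ha : a ^ N = 0) :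
    aeval a (X * phiPoly 𝕜 N) = expNil 𝕜 a - 1 := by
  rw [map_mul, aeval_phiPoly ha, aeval_X, expNil_eq_one_add ⟨N, ha⟩, add_sub_cancel_left,
    (commute_phiNil a).eq]

/-- The series `log(1 + X) / X` at `exp a - 1` is the inverse of `(exp a - 1) / a`. -/
theorem aeval_psiPoly_mul_phiNil {a : A} {N : ℕ} (ha : a ^ N = 0) :
    aeval (expNil 𝕜 a - 1) (psiPoly 𝕜 N) * phiNil 𝕜 a = 1 := by
  have h := aeval_eq_zero_of_X_pow_dvd ha (psiPoly_comp_mul_phiPoly (𝕜 := 𝕜) N)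
  rw [map_sub, map_mul, aeval_comp, aeval_X_mul_phiPoly ha, aeval_phiPoly ha, map_one] at h
  exact sub_eq_zero.mp h

theorem aeval_psiPoly {N : ℕ} (a : A) : aeval a (psiPoly 𝕜 N) =
    ∑ k ∈ Finset.range N, ((-1) ^ k / (k + 1 : 𝕜)) • a ^ k := by
  simp [psiPoly, Algebra.smul_def]

/-- The exponential of the logarithm of a unipotent element. -/
theorem expNil_log {a : A} {N : ℕ} (ha : a ^ N = 0) :
    expNil 𝕜 (aeval a (X * psiPoly 𝕜 N)) = 1 + a := by
  have h1 : (aeval a (X * psiPoly 𝕜 N)) ^ N = 0 := by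
    rw [← map_pow, mul_pow]
    exact aeval_eq_zero_of_X_pow_dvd ha (dvd_mul_right _ _)
  have h2 : a ^ (N + 1) = 0 := by rw [pow_succ, ha, zero_mul]
  have h := aeval_eq_zero_of_X_pow_dvd h2 (phiPoly_comp_X_mul_psiPoly (𝕜 := 𝕜) N)
  rw [map_sub, aeval_comp, aeval_X_mul_phiPoly h1, aeval_X] at h
  rw [← sub_eq_zero, ← h]; abel

end LogPoly

/-! ### The Baker-Campbell-Hausdorff formula -/

section BCHFormula

variable {𝕜 : Type*} [RCLike 𝕜] {M : Type*} [AddCommGroup M] [Module 𝕜 M]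

theorem nestedBracket_append (br : M →ₗ[𝕜] M →ₗ[𝕜] M) (l : List M) {l' : List M} (h : l' ≠ []) :
    nestedBracket br (l ++ l') = l.foldr (fun a m => br a m) (nestedBracket br l') := by
  induction l with
  | nil => rfl
  | cons a l ih =>
    rw [List.foldr_cons, ← ih, List.cons_append]
    cases hl : l ++ l' with
    | nil => exact absurd (List.append_eq_nil_iff.mp hl).2 h
    | cons b l'' => rfl

theorem foldr_replicate (br : M →ₗ[𝕜] M →ₗ[𝕜] M) (x m : M) (n : ℕ) :
    (List.replicate n x).foldr (fun a m => br a m) m = ((br x) ^ n) m := by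
  induction n with
  | zero => rfl
  | succ n ih => rw [List.replicate_succ, List.foldr_cons, ih, pow_succ', Module.End.mul_apply]

/-- The word `x ⋯ x y ⋯ y` with `q.1` letters `x` and `q.2` letters `y`. -/
def bchBlock (x y : M) (q : ℕ × ℕ) : List M := List.replicate q.1 x ++ List.replicate q.2 y

/-- The concatenation of the words given by a sequence of pairs. -/
def bchWord (x y : M) {k : ℕ} (w : Fin k → ℕ × ℕ) : List M :=
  (List.ofFn fun i => bchBlock x y (w i)).flatten

/-- The index set of a block in Dynkin's formula. -/
def bchPairs (N : ℕ) : Finset (ℕ × ℕ) :=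
  (Finset.range (N + 1) ×ˢ Finset.range (N + 1)).filter fun q => 0 < q.1 + q.2

theorem bch_eq (br : M →ₗ[𝕜] M →ₗ[𝕜] M) (N : ℕ) (x y : M) : bch br N x y =
    ∑ k ∈ Finset.Icc 1 N, ∑ w ∈ Fintype.piFinset (fun _ : Fin k => bchPairs N),
      ((-1 : 𝕜) ^ (k - 1) / ((k : 𝕜) * ((∑ i, ((w i).1 + (w i).2) : ℕ) : 𝕜) *
          ((∏ i, ((w i).1.factorial * (w i).2.factorial) : ℕ) : 𝕜))) •
        nestedBracket br (bchWord x y w) := rfl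

theorem bchWord_length {α : Type*} (x y : α) {k : ℕ} (w : Fin k → ℕ × ℕ) :
    (bchWord x y w).length = ∑ i, ((w i).1 + (w i).2) := by
  simp [bchWord, bchBlock, List.length_flatten, List.map_ofFn, List.sum_ofFn, Function.comp_def]

theorem mem_bchWord {α : Type*} {x y : α} {k : ℕ} {w : Fin k → ℕ × ℕ} {z : α} (hz : z ∈ bchWord x y w) :
    z = x ∨ z = y := by
  rw [bchWord, List.mem_flatten] at hz
  obtain ⟨l, hl, hz⟩ := hz
  obtain ⟨i, rfl⟩ := (List.mem_ofFn' _ _).mp hl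
  rcases List.mem_append.mp hz with h | h
  · exact Or.inl (List.eq_of_mem_replicate h)
  · exact Or.inr (List.eq_of_mem_replicate h)

theorem bchWord_succ {α : Type*} (x y : α) {k : ℕ} (q : ℕ × ℕ) (w : Fin k → ℕ × ℕ) :
    bchWord x y (Fin.cons q w : Fin (k + 1) → ℕ × ℕ) = bchBlock x y q ++ bchWord x y w := by
  simp [bchWord, List.ofFn_succ]

theorem bchWord_map {α : Type*} {M' : Type*} (f : α → M') (x y : α) {k : ℕ} (w : Fin k → ℕ × ℕ) :
    (bchWord x y w).map f = bchWord (f x) (f y) w := by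
  simp [bchWord, bchBlock, List.map_flatten, List.map_ofFn, Function.comp_def]

theorem card_le_sum_bchPairs {N k : ℕ} {w : Fin k → ℕ × ℕ}
    (hw : w ∈ Fintype.piFinset (fun _ : Fin k => bchPairs N)) :
    k ≤ ∑ i, ((w i).1 + (w i).2) := by
  have : ∑ _i : Fin k, 1 ≤ ∑ i, ((w i).1 + (w i).2) :=
    Finset.sum_le_sum fun i _ => (Finset.mem_filter.mp (Fintype.mem_piFinset.mp hw i)).2
  simpa using this

theorem nestedBracket_block_append (br : M →ₗ[𝕜] M →ₗ[𝕜] M) (x y : M) (q : ℕ × ℕ) {l : List M}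
    (h : l ≠ []) : nestedBracket br (bchBlock x y q ++ l) =
      ((br x) ^ q.1) (((br y) ^ q.2) (nestedBracket br l)) := by
  rw [nestedBracket_append br _ h, bchBlock, List.foldr_append, foldr_replicate, foldr_replicate]

theorem nestedBracket_replicate (br : M →ₗ[𝕜] M →ₗ[𝕜] M) {x : M} (hx : br x x = 0) (n : ℕ) :
    nestedBracket br (List.replicate n x) = if n = 1 then x else 0 := by
  rcases n with _ | _ | n
  · rfl
  · rfl
  · rw [List.replicate_succ', nestedBracket_append br _ (by simp), foldr_replicate, pow_succ]
    simp [nestedBracket, hx]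

theorem nestedBracket_block (br : M →ₗ[𝕜] M →ₗ[𝕜] M) {x y : M} (hx : br x x = 0)
    (hy : br y y = 0) (q : ℕ × ℕ) : nestedBracket br (bchBlock x y q) =
      (if q = (1, 0) then x else 0) + if q.2 = 1 then ((br x) ^ q.1) y else 0 := by
  obtain ⟨r, s⟩ := q
  rcases s with _ | s
  · simp [bchBlock, nestedBracket_replicate br hx]
  · rw [bchBlock, nestedBracket_append br _ (by simp), foldr_replicate,
      nestedBracket_replicate br hy]
    split_ifs <;> simp_all

/-- A derivation which fixes all letters multiplies nested brackets by their length. -/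
theorem derivation_nestedBracket (br : M →ₗ[𝕜] M →ₗ[𝕜] M) (D : M →ₗ[𝕜] M)
    (hD : ∀ a b, D (br a b) = br (D a) b + br a (D b)) :
    ∀ l : List M, (∀ a ∈ l, D a = a) → D (nestedBracket br l) = (l.length : 𝕜) • nestedBracket br l
  | [], _ => by simp [nestedBracket]
  | [a], h => by simpa [nestedBracket] using h
  | a :: b :: l, h => by
    have ih := derivation_nestedBracket br D hD (b :: l) fun c hc => h c (List.mem_cons_of_mem _ hc)
    rw [nestedBracket, hD, ih, h a (by simp), map_smul, List.length_cons (a := a)]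
    push_cast
    rw [add_smul, one_smul, add_comm]

theorem nestedBracket_map {M' : Type*} [AddCommGroup M'] [Module 𝕜 M']
    (br : M →ₗ[𝕜] M →ₗ[𝕜] M) (br' : M' →ₗ[𝕜] M' →ₗ[𝕜] M') (f : M →ₗ[𝕜] M') (S : Submodule 𝕜 M)
    (hS : ∀ x ∈ S, ∀ y ∈ S, br x y ∈ S) (hf : ∀ x ∈ S, ∀ y ∈ S, f (br x y) = br' (f x) (f y)) :
    ∀ l : List M, (∀ x ∈ l, x ∈ S) → f (nestedBracket br l) = nestedBracket br' (l.map f)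
  | [], _ => map_zero f
  | [x], _ => rfl
  | x :: y :: l, h => by
    have h' : ∀ z ∈ y :: l, z ∈ S := fun z hz => h z (List.mem_cons_of_mem _ hz)
    rw [nestedBracket, hf _ (h x (by simp)) _ (nestedBracket_mem br S hS _ h'),
      nestedBracket_map br br' f S hS hf (y :: l) h']
    rfl

theorem bch_map {M' : Type*} [AddCommGroup M'] [Module 𝕜 M']
    (br : M →ₗ[𝕜] M →ₗ[𝕜] M) (br' : M' →ₗ[𝕜] M' →ₗ[𝕜] M') (f : M →ₗ[𝕜] M') (S : Submodule 𝕜 M)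
    (hS : ∀ x ∈ S, ∀ y ∈ S, br x y ∈ S) (hf : ∀ x ∈ S, ∀ y ∈ S, f (br x y) = br' (f x) (f y))
    (N : ℕ) {x y : M} (hx : x ∈ S) (hy : y ∈ S) :
    f (bch br N x y) = bch br' N (f x) (f y) := by
  simp only [bch_eq, map_sum, map_smul]
  refine Finset.sum_congr rfl fun k _ => Finset.sum_congr rfl fun w _ => ?_
  rw [nestedBracket_map br br' f S hS hf, bchWord_map]
  intro z hz
  rcases mem_bchWord hz with rfl | rfl
  exacts [hx, hy]

/-- Dynkin's formula does not depend on the order of truncation, as soon as it contains all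
brackets which do not vanish. -/
theorem bch_eq_of_le (br : M →ₗ[𝕜] M →ₗ[𝕜] M) {N N' : ℕ} (hN : N ≤ N') {x y : M}
    (h : ∀ l : List M, (∀ z ∈ l, z = x ∨ z = y) → N < l.length → nestedBracket br l = 0) :
    bch br N' x y = bch br N x y := by
  rw [bch_eq, bch_eq]
  symm
  have hP : bchPairs N ⊆ bchPairs N' := fun q hq => by
    simp only [bchPairs, Finset.mem_filter, Finset.mem_product, Finset.mem_range] at hq ⊢
    omega
  have h0 : ∀ k ∈ Finset.Icc 1 N', ∑ w ∈ Fintype.piFinset (fun _ : Fin k => bchPairs N),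
      ((-1 : 𝕜) ^ (k - 1) / ((k : 𝕜) * ((∑ i, ((w i).1 + (w i).2) : ℕ) : 𝕜) *
          ((∏ i, ((w i).1.factorial * (w i).2.factorial) : ℕ) : 𝕜))) •
        nestedBracket br (bchWord x y w) =
      ∑ w ∈ Fintype.piFinset (fun _ : Fin k => bchPairs N'),
      ((-1 : 𝕜) ^ (k - 1) / ((k : 𝕜) * ((∑ i, ((w i).1 + (w i).2) : ℕ) : 𝕜) *
          ((∏ i, ((w i).1.factorial * (w i).2.factorial) : ℕ) : 𝕜))) •
        nestedBracket br (bchWord x y w) := by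
    intro k _
    refine Finset.sum_subset (Fintype.piFinset_subset _ _ fun _ => hP) fun w hw hw' => ?_
    have : ∃ i, w i ∉ bchPairs N := by
      by_contra hc
      push Not at hc
      exact hw' (Fintype.mem_piFinset.mpr hc)
    obtain ⟨i, hi⟩ := this
    have hi' := Fintype.mem_piFinset.mp hw i
    have h1 : N < (w i).1 + (w i).2 := by
      simp only [bchPairs, Finset.mem_filter, Finset.mem_product, Finset.mem_range] at hi hi'
      omega
    rw [h _ (fun z hz => mem_bchWord hz) (by
      rw [bchWord_length]
      exact h1.trans_le (Finset.single_le_sum (f := fun i => (w i).1 + (w i).2)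
        (fun _ _ => Nat.zero_le _) (Finset.mem_univ i))), smul_zero]
  rw [← Finset.sum_congr rfl h0]
  refine Finset.sum_subset (Finset.Icc_subset_Icc le_rfl hN) fun k hk hk' => ?_
  refine Finset.sum_eq_zero fun w hw => ?_
  rw [h _ (fun z hz => mem_bchWord hz), smul_zero]
  rw [bchWord_length]
  have := card_le_sum_bchPairs hw
  simp only [Finset.mem_Icc] at hk hk'
  omega

/-- The coefficient `1 / (r! s!)` of a block. -/
def blockCoeff (𝕜 : Type*) [RCLike 𝕜] (q : ℕ × ℕ) : 𝕜 :=
  ((q.1.factorial : 𝕜))⁻¹ * ((q.2.factorial : 𝕜))⁻¹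

theorem sum_piFinset_succ {α R : Type*} [AddCommMonoid R] (s : Finset α) (k : ℕ)
    (f : (Fin (k + 1) → α) → R) : ∑ w ∈ Fintype.piFinset (fun _ : Fin (k + 1) => s), f w =
      ∑ q ∈ s, ∑ w ∈ Fintype.piFinset (fun _ : Fin k => s), f (Fin.cons q w) := by
  rw [← Finset.sum_product']
  refine (Finset.sum_bij' (fun p _ => (Fin.cons p.1 p.2 : Fin (k + 1) → α))
    (fun w _ => (w 0, Fin.tail w)) ?_ ?_ ?_ ?_ ?_).symm
  · rintro ⟨q, w⟩ h
    rw [Finset.mem_product] at h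
    rw [Fintype.mem_piFinset]
    intro i
    refine Fin.cases ?_ (fun i => ?_) i
    · exact h.1
    · simpa using Fintype.mem_piFinset.mp h.2 i
  · intro w h
    rw [Fintype.mem_piFinset] at h
    exact Finset.mem_product.mpr ⟨h 0, Fintype.mem_piFinset.mpr fun i => h i.succ⟩
  · rintro ⟨q, w⟩ _; simp
  · intro w _; simp
  · intro _ _; rfl

theorem sum_nestedBracket_words (br : M →ₗ[𝕜] M →ₗ[𝕜] M) (N : ℕ) (x y : M) (k : ℕ) :
    ∑ w ∈ Fintype.piFinset (fun _ : Fin (k + 1) => bchPairs N),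
      (∏ i, blockCoeff 𝕜 (w i)) • nestedBracket br (bchWord x y w) =
    ((∑ q ∈ bchPairs N, blockCoeff 𝕜 q • ((br x) ^ q.1 * (br y) ^ q.2)) ^ k)
      (∑ q ∈ bchPairs N, blockCoeff 𝕜 q • nestedBracket br (bchBlock x y q)) := by
  induction k with
  | zero =>
    rw [sum_piFinset_succ, pow_zero, Module.End.one_apply]
    refine Finset.sum_congr rfl fun q _ => ?_
    simp [bchWord]
  | succ k ih =>
    rw [sum_piFinset_succ, pow_succ', Module.End.mul_apply, ← ih, LinearMap.sum_apply]
    refine Finset.sum_congr rfl fun q _ => ?_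
    simp only [LinearMap.smul_apply, Module.End.mul_apply, map_sum, map_smul]
    refine Finset.sum_congr rfl fun w hw => ?_
    have hne : bchWord x y w ≠ [] := by
      intro h
      have h1 := card_le_sum_bchPairs hw
      rw [← bchWord_length x y, h] at h1
      simp at h1
    rw [bchWord_succ, nestedBracket_block_append br x y q hne, Fin.prod_univ_succ, mul_comm, mul_smul]
    simp

theorem derivation_bch (br : M →ₗ[𝕜] M →ₗ[𝕜] M) (D : M →ₗ[𝕜] M)
    (hD : ∀ a b, D (br a b) = br (D a) b + br a (D b)) (N : ℕ) {x y : M} (hx : D x = x)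
    (hy : D y = y) : D (bch br N x y) = ∑ k ∈ Finset.range N, ((-1) ^ k / (k + 1 : 𝕜)) •
      (((∑ q ∈ bchPairs N, blockCoeff 𝕜 q • ((br x) ^ q.1 * (br y) ^ q.2)) ^ k)
        (∑ q ∈ bchPairs N, blockCoeff 𝕜 q • nestedBracket br (bchBlock x y q))) := by
  rw [bch_eq, map_sum]
  refine Finset.sum_nbij' (fun k => k - 1) (fun k => k + 1) (fun k hk => ?_) (fun k hk => ?_)
    (fun k hk => ?_) (fun k hk => ?_) (fun k hk => ?_)
  · simp only [Finset.mem_Icc, Finset.mem_range] at hk ⊢; omega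
  · simp only [Finset.mem_Icc, Finset.mem_range] at hk ⊢; omega
  · simp only [Finset.mem_Icc] at hk; omega
  · rfl
  obtain ⟨j, rfl⟩ : ∃ j, k = j + 1 := ⟨k - 1, by simp only [Finset.mem_Icc] at hk; omega⟩
  rw [add_tsub_cancel_right, ← sum_nestedBracket_words, map_sum, Finset.smul_sum]
  refine Finset.sum_congr rfl fun w hw => ?_
  rw [map_smul, derivation_nestedBracket br D hD _ (fun a ha => ?_), smul_smul, smul_smul]
  · congr 1
    rw [bchWord_length]
    have h1 : ((∑ i, ((w i).1 + (w i).2) : ℕ) : 𝕜) ≠ 0 := by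
      have := card_le_sum_bchPairs hw
      exact_mod_cast (by omega : (∑ i, ((w i).1 + (w i).2)) ≠ 0)
    have h2 : ((j + 1 : ℕ) : 𝕜) ≠ 0 := by exact_mod_cast Nat.succ_ne_zero j
    have h3 : ∏ i, blockCoeff 𝕜 (w i) =
        ((∏ i, ((w i).1.factorial * (w i).2.factorial) : ℕ) : 𝕜)⁻¹ := by
      simp [blockCoeff, Finset.prod_mul_distrib, mul_comm]
    rw [h3]
    set d := ((∑ i, ((w i).1 + (w i).2) : ℕ) : 𝕜)
    set f := ((∏ i, ((w i).1.factorial * (w i).2.factorial) : ℕ) : 𝕜)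
    push_cast at h2 ⊢
    field_simp
  · rcases mem_bchWord ha with rfl | rfl
    exacts [hx, hy]

end BCHFormula

section BCHAssoc

variable {𝕜 : Type*} [RCLike 𝕜] {A : Type*} [Ring A] [Algebra 𝕜 A]

/-- Dynkin's formula, in differentiated form: if `E` is a derivation with `E x = x` and `E y = y`,
and `exp z = exp x exp y`, then `φ(ad z)(E z) = E(exp z) exp(-z) = x + exp(ad x) y`, and `φ(ad z)` is
inverted by the series of the logarithm in `exp(ad z) = exp(ad x) exp(ad y)`. -/
theorem derivation_log_eq_derivation_bch (D : A →ₗ[𝕜] A)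
    (hD : ∀ a b, D (a * b) = D a * b + a * D b) {x y z : A} (hx : IsNilpotent x)
    (hy : IsNilpotent y) (hz : IsNilpotent z) (hDx : D x = x) (hDy : D y = y)
    (hxyz : expNil 𝕜 z = expNil 𝕜 x * expNil 𝕜 y) {N : ℕ} (hN : 0 < N)
    (hNx : (commBr 𝕜 A x) ^ (N + 1) = 0)
    (hNy : (commBr 𝕜 A y) ^ (N + 1) = 0) (hNz : (commBr 𝕜 A z) ^ N = 0) :
    D z = D (bch (commBr 𝕜 A) N x y) := by
  have hDbr : ∀ a b, D (commBr 𝕜 A a b) = commBr 𝕜 A (D a) b + commBr 𝕜 A a (D b) := by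
    intro a b; simp only [commBr_apply, map_sub, hD]; abel
  have hself : ∀ a : A, commBr 𝕜 A a a = 0 := fun a => sub_self _
  have hphi : ∀ a : A, IsNilpotent a → phiNil 𝕜 (commBr 𝕜 A a) a = a := fun a ha => by
    obtain ⟨k, hk⟩ := isNilpotent_commBr (𝕜 := 𝕜) ha
    have hk' : (commBr 𝕜 A a) ^ (k + 1) = 0 := by rw [pow_succ, hk, zero_mul]
    rw [phiNil_eq_sum hk', LinearMap.sum_apply, Finset.sum_range_succ', Finset.sum_eq_zero]
    · simp
    · intro i _
      rw [LinearMap.smul_apply, pow_succ, Module.End.mul_apply, hself, map_zero, smul_zero]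
  have hneg : expNil 𝕜 (-z) = expNil 𝕜 (-y) * expNil 𝕜 (-x) := by
    have h1 : expNil 𝕜 z * (expNil 𝕜 (-y) * expNil 𝕜 (-x)) = 1 := by
      rw [hxyz, mul_assoc, ← mul_assoc (expNil 𝕜 y), expNil_mul_neg hy, one_mul,
        expNil_mul_neg hx]
    calc expNil 𝕜 (-z) = expNil 𝕜 (-z) * (expNil 𝕜 z * (expNil 𝕜 (-y) * expNil 𝕜 (-x))) := by
          rw [h1, mul_one]
      _ = _ := by rw [← mul_assoc, expNil_neg_mul hz, one_mul]
  have hAd : expNil 𝕜 (commBr 𝕜 A z) = expNil 𝕜 (commBr 𝕜 A x) * expNil 𝕜 (commBr 𝕜 A y) := by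
    ext b
    rw [Module.End.mul_apply, expNil_commBr hx, expNil_commBr hy, expNil_commBr hz, hneg, hxyz]
    simp only [mul_assoc]
  have hlog : phiNil 𝕜 (commBr 𝕜 A z) (D z) = x + expNil 𝕜 (commBr 𝕜 A x) y := by
    have h1 := derivation_expNil D hD hz
    rw [hxyz, hD, derivation_expNil D hD hx, derivation_expNil D hD hy, hDx, hDy, hphi x hx,
      hphi y hy] at h1
    have h2 := congrArg (fun a => a * expNil 𝕜 (-z)) h1
    have h3 : expNil 𝕜 x * expNil 𝕜 y * expNil 𝕜 (-z) = 1 := by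
      rw [← hxyz, expNil_mul_neg hz]
    simp only [mul_assoc, add_mul] at h2 h3
    rw [h3, mul_one, mul_one] at h2
    rw [← h2, hneg, ← mul_assoc (expNil 𝕜 y), expNil_mul_neg hy, one_mul, expNil_commBr hx,
      mul_assoc]
  have hE : ∑ q ∈ bchPairs N, blockCoeff 𝕜 q • ((commBr 𝕜 A x) ^ q.1 * (commBr 𝕜 A y) ^ q.2) =
      expNil 𝕜 (commBr 𝕜 A z) - 1 := by
    have h1 : expNil 𝕜 (commBr 𝕜 A x) * expNil 𝕜 (commBr 𝕜 A y) =
        ∑ q ∈ Finset.range (N + 1) ×ˢ Finset.range (N + 1),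
          blockCoeff 𝕜 q • ((commBr 𝕜 A x) ^ q.1 * (commBr 𝕜 A y) ^ q.2) := by
      rw [expNil_eq_sum hNx, expNil_eq_sum hNy, Finset.sum_mul_sum, Finset.sum_product]
      refine Finset.sum_congr rfl fun r _ => Finset.sum_congr rfl fun s _ => ?_
      rw [smul_mul_smul_comm]; rfl
    rw [hAd, h1, ← Finset.sum_filter_add_sum_filter_not (Finset.range (N + 1) ×ˢ
      Finset.range (N + 1)) (fun q : ℕ × ℕ => 0 < q.1 + q.2)]
    have h2 : (Finset.range (N + 1) ×ˢ Finset.range (N + 1)).filter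
        (fun q : ℕ × ℕ => ¬ 0 < q.1 + q.2) = {(0, 0)} := by
      ext ⟨r, s⟩
      simp only [Finset.mem_filter, Finset.mem_product, Finset.mem_range, Finset.mem_singleton,
        Prod.mk.injEq]
      omega
    rw [h2, Finset.sum_singleton]
    simp [blockCoeff, bchPairs]
  have hv : ∑ q ∈ bchPairs N, blockCoeff 𝕜 q • nestedBracket (commBr 𝕜 A) (bchBlock x y q) =
      x + expNil 𝕜 (commBr 𝕜 A x) y := by
    simp only [nestedBracket_block _ (hself x) (hself y), smul_add, Finset.sum_add_distrib]
    congr 1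
    · rw [Finset.sum_eq_single (1, 0)]
      · simp [blockCoeff]
      · intro q _ hq; simp [hq]
      · intro h; exact absurd (by simp [bchPairs]; omega) h
    · rw [expNil_eq_sum hNx, LinearMap.sum_apply]
      symm
      refine Finset.sum_of_injOn (fun r => (r, 1)) ?_ ?_ ?_ ?_
      · intro r _ s _ h; simpa using h
      · intro r hr
        simp only [Finset.coe_range, Set.mem_Iio, bchPairs, Finset.coe_filter,
          Finset.mem_product, Finset.mem_range, Set.mem_ofPred_eq] at hr ⊢
        omega
      · rintro ⟨r, s⟩ hq h
        simp only [bchPairs, Finset.mem_filter, Finset.mem_product, Finset.mem_range] at hq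
        have : s ≠ 1 := by
          rintro rfl
          exact h ⟨r, by simpa using hq.1.1, rfl⟩
        simp [this]
      · intro r _
        simp [blockCoeff]
  rw [derivation_bch _ D hDbr N hDx hDy, hE, hv, ← hlog]
  have h1 := aeval_psiPoly_mul_phiNil (𝕜 := 𝕜) hNz
  have h2 := LinearMap.congr_fun h1 (D z)
  rw [Module.End.mul_apply, aeval_psiPoly, LinearMap.sum_apply, Module.End.one_apply] at h2
  exact h2.symm

/-- The Euler derivation `X d/dX` of the polynomial ring over an associative algebra. -/
def eulerDer (𝕜 A : Type*) [RCLike 𝕜] [Ring A] [Algebra 𝕜 A] :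
    Polynomial A →ₗ[𝕜] Polynomial A where
  toFun p := Polynomial.X * Polynomial.derivative p
  map_add' p q := by rw [map_add, mul_add]
  map_smul' c p := by rw [Polynomial.derivative_smul, mul_smul_comm]; rfl

theorem eulerDer_mul (p q : Polynomial A) :
    eulerDer 𝕜 A (p * q) = eulerDer 𝕜 A p * q + p * eulerDer 𝕜 A q := by
  change Polynomial.X * Polynomial.derivative (p * q) = Polynomial.X * Polynomial.derivative p * q +
    p * (Polynomial.X * Polynomial.derivative q)
  rw [Polynomial.derivative_mul, mul_add, mul_assoc, ← mul_assoc Polynomial.X p,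
    Polynomial.X_mul (p := p), mul_assoc p]

theorem eulerDer_C_mul_X (a : A) :
    eulerDer 𝕜 A (Polynomial.C a * Polynomial.X) = Polynomial.C a * Polynomial.X := by
  change Polynomial.X * Polynomial.derivative _ = _
  rw [Polynomial.derivative_C_mul, Polynomial.derivative_X, mul_one, Polynomial.X_mul]

theorem eulerDer_injective {p q : Polynomial A} (h : eulerDer 𝕜 A p = eulerDer 𝕜 A q)
    (h0 : p.coeff 0 = q.coeff 0) : p = q := by
  ext n
  rcases n with _ | n
  · exact h0
  · have h1 := congrArg (fun r : Polynomial A => r.coeff (n + 1)) h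
    change (Polynomial.X * Polynomial.derivative p).coeff (n + 1) =
      (Polynomial.X * Polynomial.derivative q).coeff (n + 1) at h1
    rw [Polynomial.coeff_X_mul, Polynomial.coeff_X_mul, Polynomial.coeff_derivative,
      Polynomial.coeff_derivative] at h1
    have hn : ((n + 1 : ℕ) : 𝕜) ≠ 0 := by exact_mod_cast Nat.succ_ne_zero n
    have h2 : ∀ a : A, a * ((n : A) + 1) = ((n + 1 : ℕ) : 𝕜) • a := fun a => by
      rw [Algebra.smul_def, map_natCast, Nat.cast_comm]; push_cast; rfl
    rw [h2, h2] at h1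
    exact smul_right_injective _ hn h1

/-- The polynomials whose coefficient of degree `k` lies in `J ^ k`. -/
def reesSubalgebra (J : Submodule 𝕜 A) : Subalgebra 𝕜 (Polynomial A) where
  carrier := {p | ∀ k, p.coeff k ∈ J ^ k}
  mul_mem' := by
    intro p q hp hq k
    rw [Polynomial.coeff_mul]
    refine Submodule.sum_mem _ fun i hi => ?_
    rw [← Finset.HasAntidiagonal.mem_antidiagonal.mp hi, pow_add]
    exact Submodule.mul_mem_mul (hp _) (hq _)
  add_mem' := by
    intro p q hp hq k
    rw [Polynomial.coeff_add]
    exact Submodule.add_mem _ (hp k) (hq k)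
  algebraMap_mem' := by
    intro r k
    rw [Polynomial.algebraMap_apply, Polynomial.coeff_C]
    split_ifs with h
    · rw [h, pow_zero]; exact Submodule.mem_one.mpr ⟨r, rfl⟩
    · exact Submodule.zero_mem _

theorem pow_eq_zero_of_mem_reesSubalgebra {J : Submodule 𝕜 A} {N : ℕ} (hJ : J ^ (N + 1) = ⊥)
    {p : Polynomial A} (hp : p ∈ reesSubalgebra J) (h0 : p.coeff 0 = 0) : p ^ (N + 1) = 0 := by
  ext k
  rw [Polynomial.coeff_zero]
  by_cases hk : k < N + 1
  · obtain ⟨q, rfl⟩ := Polynomial.X_dvd_iff.mpr h0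
    rw [(Polynomial.commute_X q).mul_pow, Polynomial.coeff_X_pow_mul', if_neg (by omega)]
  · have h1 : (p ^ (N + 1)).coeff k ∈ J ^ k := (reesSubalgebra J).pow_mem hp _ k
    obtain ⟨j, rfl⟩ := Nat.exists_eq_add_of_le (not_lt.mp hk)
    rw [pow_add, hJ, Submodule.bot_mul] at h1
    exact (Submodule.mem_bot 𝕜).mp h1

/-- The Baker-Campbell-Hausdorff formula for two elements of an associative algebra, all products of
more than `N` of which vanish. The differentiated formula is applied to `x X` and `y X` in the ring of
polynomials, where the Euler derivation determines a polynomial up to its constant term. -/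
theorem expNil_bch {x y : A} {N : ℕ} (h : (Submodule.span 𝕜 {x, y}) ^ (N + 1) = ⊥) :
    expNil 𝕜 (bch (commBr 𝕜 A) N x y) = expNil 𝕜 x * expNil 𝕜 y := by
  set J := Submodule.span 𝕜 {x, y} with hJ
  have hxJ : x ∈ J := Submodule.subset_span (by simp)
  have hyJ : y ∈ J := Submodule.subset_span (by simp)
  have hC : ∀ a ∈ J, Polynomial.C a * Polynomial.X ∈ reesSubalgebra J := by
    intro a ha k
    rw [Polynomial.coeff_C_mul_X]
    split_ifs with hk
    · rw [hk, pow_one]; exact ha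
    · exact Submodule.zero_mem _
  set X := Polynomial.C x * Polynomial.X with hX
  set Y := Polynomial.C y * Polynomial.X with hY
  have hX0 : X.coeff 0 = 0 := by simp [hX]
  have hY0 : Y.coeff 0 = 0 := by simp [hY]
  have hXn := pow_eq_zero_of_mem_reesSubalgebra h (hC x hxJ) hX0
  have hYn := pow_eq_zero_of_mem_reesSubalgebra h (hC y hyJ) hY0
  have hexp : ∀ p ∈ reesSubalgebra J, p.coeff 0 = 0 → expNil 𝕜 p ∈ reesSubalgebra J ∧
      (expNil 𝕜 p).coeff 0 = 1 := by
    intro p hp hp0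
    refine ⟨Subalgebra.sum_mem _ fun i _ => Subalgebra.smul_mem _ (Subalgebra.pow_mem _ hp _) _, ?_⟩
    rw [expNil_eq_one_add ⟨_, pow_eq_zero_of_mem_reesSubalgebra h hp hp0⟩, Polynomial.coeff_add,
      Polynomial.mul_coeff_zero, hp0]
    simp
  obtain ⟨hXe, hXe0⟩ := hexp X (hC x hxJ) hX0
  obtain ⟨hYe, hYe0⟩ := hexp Y (hC y hyJ) hY0
  set a := expNil 𝕜 X * expNil 𝕜 Y - 1 with ha
  have ha0 : a.coeff 0 = 0 := by
    rw [ha, Polynomial.coeff_sub, Polynomial.mul_coeff_zero, hXe0, hYe0]; simp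
  have han : a ^ (N + 1) = 0 := pow_eq_zero_of_mem_reesSubalgebra h
    (Subalgebra.sub_mem _ (Subalgebra.mul_mem _ hXe hYe) (Subalgebra.one_mem _)) ha0
  set Z := Polynomial.aeval a (Polynomial.X * psiPoly 𝕜 (N + 1)) with hZ
  have hZe : expNil 𝕜 Z = expNil 𝕜 X * expNil 𝕜 Y := by
    rw [hZ, expNil_log han, ha]; abel
  have hZ0 : Z.coeff 0 = 0 := by
    rw [hZ, map_mul, Polynomial.aeval_X, Polynomial.mul_coeff_zero, ha0, zero_mul]
  have hZn : IsNilpotent Z := ⟨N + 1, by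
    rw [hZ, ← map_pow, mul_pow]
    exact aeval_eq_zero_of_X_pow_dvd han (dvd_mul_right _ _)⟩
  obtain ⟨k₁, hk₁⟩ := isNilpotent_commBr (𝕜 := 𝕜) ⟨_, hXn⟩
  obtain ⟨k₂, hk₂⟩ := isNilpotent_commBr (𝕜 := 𝕜) ⟨_, hYn⟩
  obtain ⟨k₃, hk₃⟩ := isNilpotent_commBr (𝕜 := 𝕜) hZn
  set K := N + k₁ + k₂ + k₃ + 1 with hK
  have key : Z = bch (commBr 𝕜 (Polynomial A)) K X Y := by
    refine eulerDer_injective (𝕜 := 𝕜) ?_ ?_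
    · exact derivation_log_eq_derivation_bch (eulerDer 𝕜 A) eulerDer_mul ⟨_, hXn⟩ ⟨_, hYn⟩ hZn
        (eulerDer_C_mul_X x) (eulerDer_C_mul_X y) hZe (by omega)
        (pow_eq_zero_of_le (by omega) hk₁) (pow_eq_zero_of_le (by omega) hk₂)
        (pow_eq_zero_of_le (by omega) hk₃)
    · let S : Submodule 𝕜 (Polynomial A) :=
        { carrier := {p | p.coeff 0 = 0}
          add_mem' := fun {p q} hp hq => by
            change (p + q).coeff 0 = 0
            rw [Polynomial.coeff_add, hp, hq, add_zero]
          zero_mem' := Polynomial.coeff_zero 0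
          smul_mem' := fun c p hp => by
            change (c • p).coeff 0 = 0
            rw [Polynomial.coeff_smul, hp, smul_zero] }
      have hS : ∀ p ∈ S, ∀ q ∈ S, commBr 𝕜 (Polynomial A) p q ∈ S := by
        intro p hp q hq
        change (p * q - q * p).coeff 0 = 0
        rw [Polynomial.coeff_sub, Polynomial.mul_coeff_zero, Polynomial.mul_coeff_zero, hp, hq]
        simp
      rw [hZ0]
      exact (bch_mem _ S hS K hX0 hY0).symm
  let ev : Polynomial A →ₐ[𝕜] A :=
    { Polynomial.eval₂RingHom' (RingHom.id A) 1 (fun a => Commute.one_right a) with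
      commutes' := fun r => by simp [Polynomial.algebraMap_apply] }
  have hevC : ∀ b, ev (Polynomial.C b * Polynomial.X) = b := fun b => by
    change Polynomial.eval₂ (RingHom.id A) 1 (Polynomial.C b * Polynomial.X) = b
    simp
  have h1 := congrArg ev hZe
  have h2 : ev Z = bch (commBr 𝕜 A) K x y := by
    have := bch_map (commBr 𝕜 (Polynomial A)) (commBr 𝕜 A) ev.toLinearMap ⊤ (fun _ _ _ _ => trivial)
      (fun p _ q _ => by simp [commBr_apply]) K (x := X) (y := Y) trivial trivial
    rw [← key] at this
    simpa [hX, hY, hevC] using this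
  rw [map_mul, expNil_map ev hZn, expNil_map ev ⟨_, hXn⟩, expNil_map ev ⟨_, hYn⟩, h2, hevC, hevC,
    bch_eq_of_le (N := N)] at h1
  · exact h1
  · omega
  intro l hl hlen
  have h3 : ∀ l : List A, (∀ z ∈ l, z = x ∨ z = y) → l ≠ [] →
      nestedBracket (commBr 𝕜 A) l ∈ J ^ l.length := by
    intro l
    induction l with
    | nil => intro _ h; exact absurd rfl h
    | cons b l ih =>
      intro hl _
      have hb : b ∈ J := by rcases hl b (by simp) with rfl | rfl <;> assumption
      rcases l with _ | ⟨c, l⟩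
      · simpa [nestedBracket] using hb
      · have := ih (fun z hz => hl z (List.mem_cons_of_mem _ hz)) (by simp)
        rw [nestedBracket, commBr_apply, List.length_cons (a := b)]
        refine Submodule.sub_mem _ ?_ ?_
        · rw [pow_succ']; exact Submodule.mul_mem_mul hb this
        · rw [pow_succ]; exact Submodule.mul_mem_mul this hb
  have h4 := h3 l hl (by rintro rfl; simp at hlen)
  obtain ⟨j, hj⟩ := Nat.exists_eq_add_of_le hlen
  rw [hj, pow_add, h, Submodule.bot_mul] at h4
  exact (Submodule.mem_bot 𝕜).mp h4

end BCHAssoc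

/-! ### Contractions, parity and filtration of Grassmann algebras -/

section GrassmannAux

variable {𝕜 : Type*} [RCLike 𝕜] {W : Type*} [AddCommGroup W] [Module 𝕜 W]

theorem extInvol_ι (v : W) : extInvol 𝕜 W (ι 𝕜 v) = -ι 𝕜 v :=
  CliffordAlgebra.involute_ι v

theorem extInvol_extInvol (a : Λ[𝕜] W) : extInvol 𝕜 W (extInvol 𝕜 W a) = a :=
  CliffordAlgebra.involute_involute a

theorem extInvol_even {a : Λ[𝕜] W} (ha : a ∈ extParity 𝕜 W 0) :
    extInvol 𝕜 W a = a := CliffordAlgebra.involute_eq_of_mem_even ha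

theorem extInvol_odd {a : Λ[𝕜] W} (ha : a ∈ extParity 𝕜 W 1) :
    extInvol 𝕜 W a = -a := CliffordAlgebra.involute_eq_of_mem_odd ha

theorem one_mem_extParity : (1 : Λ[𝕜] W) ∈ extParity 𝕜 W 0 :=
  Submodule.one_le.mp (CliffordAlgebra.one_le_evenOdd_zero _)

theorem ι_mem_extParity (v : W) : ι 𝕜 v ∈ extParity 𝕜 W 1 :=
  CliffordAlgebra.ι_mem_evenOdd_one _ v

theorem exists_even_add_odd (a : Λ[𝕜] W) :
    ∃ b ∈ extParity 𝕜 W 0, ∃ c ∈ extParity 𝕜 W 1, a = b + c := by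
  have h : a ∈ extParity 𝕜 W 0 ⊔ extParity 𝕜 W 1 := by
    rw [(CliffordAlgebra.evenOdd_isCompl (0 : QuadraticForm 𝕜 W)).sup_eq_top]; trivial
  obtain ⟨b, hb, c, hc, rfl⟩ := Submodule.mem_sup.mp h
  exact ⟨b, hb, c, hc, rfl⟩

theorem mem_extParity_zero_iff {a : Λ[𝕜] W} :
    a ∈ extParity 𝕜 W 0 ↔ extInvol 𝕜 W a = a := by
  refine ⟨extInvol_even, fun h => ?_⟩
  obtain ⟨b, hb, c, hc, rfl⟩ := exists_even_add_odd a
  rw [map_add, extInvol_even hb, extInvol_odd hc] at h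
  have : c = 0 := by
    have h2 : (2 : 𝕜) • c = 0 := by
      rw [two_smul]; exact add_eq_zero_iff_eq_neg.mpr (add_left_cancel h).symm
    exact (smul_eq_zero.mp h2).resolve_left two_ne_zero
  rw [this, add_zero]; exact hb

theorem mem_extParity_one_iff {a : Λ[𝕜] W} :
    a ∈ extParity 𝕜 W 1 ↔ extInvol 𝕜 W a = -a := by
  refine ⟨extInvol_odd, fun h => ?_⟩
  obtain ⟨b, hb, c, hc, rfl⟩ := exists_even_add_odd a
  rw [map_add, extInvol_even hb, extInvol_odd hc, neg_add] at h
  have : b = 0 := by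
    have h2 : (2 : 𝕜) • b = 0 := by
      rw [two_smul]; exact add_eq_zero_iff_eq_neg.mpr (add_right_cancel h)
    exact (smul_eq_zero.mp h2).resolve_left two_ne_zero
  rw [this, zero_add]; exact hc

theorem ext_even_mul {y : Λ[𝕜] W} (hy : y ∈ extParity 𝕜 W 0)
    (x : Λ[𝕜] W) : y * x = x * y := by
  induction x using ExteriorAlgebra.induction with
  | algebraMap r => rw [Algebra.commutes]
  | ι w => rw [ext_ι_mul w y, extInvol_even hy]
  | mul a b ha hb => rw [← mul_assoc, ha, mul_assoc, hb, ← mul_assoc]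
  | add a b ha hb => rw [mul_add, ha, hb, add_mul]

theorem ext_mul_odd {y : Λ[𝕜] W} (hy : y ∈ extParity 𝕜 W 1)
    (x : Λ[𝕜] W) : x * y = y * extInvol 𝕜 W x := by
  rw [ext_odd_mul hy, extInvol_extInvol]

/-- The odd derivation `ι(w) ↦ φ(w)` of the exterior algebra. -/
def extContract (φ : Module.Dual 𝕜 W) : Module.End 𝕜 (Λ[𝕜] W) :=
  CliffordAlgebra.contractLeft (Q := (0 : QuadraticForm 𝕜 W)) φ

theorem extContract_add (φ ψ : Module.Dual 𝕜 W) :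
    extContract (φ + ψ) = extContract φ + extContract ψ :=
  map_add (CliffordAlgebra.contractLeft (Q := (0 : QuadraticForm 𝕜 W))) φ ψ

theorem extContract_smul (c : 𝕜) (φ : Module.Dual 𝕜 W) :
    extContract (c • φ) = c • extContract φ :=
  map_smul (CliffordAlgebra.contractLeft (Q := (0 : QuadraticForm 𝕜 W))) c φ

theorem extContract_ι (φ : Module.Dual 𝕜 W) (w : W) :
    extContract φ (ι 𝕜 w) = algebraMap 𝕜 _ (φ w) :=
  CliffordAlgebra.contractLeft_ι _ φ w

theorem extContract_algebraMap (φ : Module.Dual 𝕜 W) (r : 𝕜) :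
    extContract φ (algebraMap 𝕜 (Λ[𝕜] W) r) = 0 :=
  CliffordAlgebra.contractLeft_algebraMap _ φ r

theorem extContract_one (φ : Module.Dual 𝕜 W) : extContract φ 1 = 0 :=
  CliffordAlgebra.contractLeft_one _ φ

theorem extContract_ι_mul (φ : Module.Dual 𝕜 W) (w : W) (a : Λ[𝕜] W) :
    extContract φ (ι 𝕜 w * a) = φ w • a - ι 𝕜 w * extContract φ a :=
  CliffordAlgebra.contractLeft_ι_mul φ w a

theorem extContract_comm (φ ψ : Module.Dual 𝕜 W) (a : Λ[𝕜] W) :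
    extContract φ (extContract ψ a) = -extContract ψ (extContract φ a) :=
  CliffordAlgebra.contractLeft_comm φ ψ a

theorem ext_left_induction {motive : Λ[𝕜] W → Prop}
    (algebraMap : ∀ r : 𝕜, motive (algebraMap 𝕜 _ r))
    (add : ∀ x y, motive x → motive y → motive (x + y))
    (ι_mul : ∀ x w, motive x → motive (ι 𝕜 w * x)) (x : Λ[𝕜] W) :
    motive x :=
  CliffordAlgebra.left_induction (Q := (0 : QuadraticForm 𝕜 W)) algebraMap add ι_mul x

theorem extContract_mul (φ : Module.Dual 𝕜 W) (a b : Λ[𝕜] W) :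
    extContract φ (a * b) = extContract φ a * b + extInvol 𝕜 W a * extContract φ b := by
  induction a using ext_left_induction with
  | algebraMap r =>
    rw [extContract_algebraMap, zero_mul, zero_add, AlgHom.commutes, ← Algebra.smul_def, map_smul,
      Algebra.smul_def]
  | add x y hx hy => rw [add_mul, map_add, hx, hy, map_add, map_add, add_mul, add_mul]; abel
  | ι_mul x w hx =>
    rw [mul_assoc, extContract_ι_mul, hx, extContract_ι_mul, map_mul, extInvol_ι, sub_mul,
      smul_mul_assoc, mul_add, neg_mul, neg_mul, mul_assoc, mul_assoc]
    abel

theorem extContract_extInvol (φ : Module.Dual 𝕜 W) (a : Λ[𝕜] W) :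
    extContract φ (extInvol 𝕜 W a) = -extInvol 𝕜 W (extContract φ a) := by
  induction a using ext_left_induction with
  | algebraMap r => rw [AlgHom.commutes, extContract_algebraMap, map_zero, neg_zero]
  | add x y hx hy => rw [map_add, map_add, hx, hy, map_add, map_add, neg_add]
  | ι_mul x w hx =>
    rw [map_mul, extInvol_ι, neg_mul, map_neg, extContract_ι_mul, hx, extContract_ι_mul, map_sub,
      map_smul, map_mul, extInvol_ι, mul_neg, neg_mul]

theorem extContract_mem {i : ZMod 2} (φ : Module.Dual 𝕜 W) {a : Λ[𝕜] W}
    (ha : a ∈ extParity 𝕜 W i) : extContract φ a ∈ extParity 𝕜 W (i + 1) := by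
  have h := extContract_extInvol φ a
  fin_cases i
  · change extContract φ a ∈ extParity 𝕜 W 1
    rw [extInvol_even ha] at h
    rw [mem_extParity_one_iff]; exact (neg_eq_iff_eq_neg.mpr h).symm.trans (neg_neg _).symm |>.trans (neg_neg _)
  · change extContract φ a ∈ extParity 𝕜 W 0
    rw [extInvol_odd ha, map_neg, neg_inj] at h
    rw [mem_extParity_zero_iff]; exact h.symm

variable (𝕜 W) in
/-- The `k`-th power of the augmentation ideal of `ΛW`, i.e. the sums of the products of elements of
degree at least `k`. -/
def extPow (k : ℕ) : Submodule 𝕜 (Λ[𝕜] W) :=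
  LinearMap.range (ι 𝕜 (M := W)) ^ k * ⊤

theorem mem_extPow_zero (a : Λ[𝕜] W) : a ∈ extPow 𝕜 W 0 := by
  rw [extPow, pow_zero, one_mul]; trivial

theorem ι_mem_extPow (w : W) : ι 𝕜 w ∈ extPow 𝕜 W 1 := by
  rw [extPow, pow_one, ← mul_one (ι 𝕜 w)]
  exact Submodule.mul_mem_mul ⟨w, rfl⟩ trivial

theorem top_mul_range_ι_le : (⊤ : Submodule 𝕜 (Λ[𝕜] W)) *
    LinearMap.range (ι 𝕜 (M := W)) ≤
      LinearMap.range (ι 𝕜 (M := W)) * ⊤ := by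
  refine Submodule.mul_le.mpr ?_
  rintro a - _ ⟨w, rfl⟩
  have : a * ι 𝕜 w = ι 𝕜 w * extInvol 𝕜 W a := by
    rw [ext_ι_mul, extInvol_extInvol]
  rw [this]
  exact Submodule.mul_mem_mul ⟨w, rfl⟩ trivial

theorem top_mul_range_ι_pow_le (k : ℕ) : (⊤ : Submodule 𝕜 (Λ[𝕜] W)) *
    LinearMap.range (ι 𝕜 (M := W)) ^ k ≤
      LinearMap.range (ι 𝕜 (M := W)) ^ k * ⊤ := by
  set R := LinearMap.range (ι 𝕜 (M := W)) with hR
  induction k with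
  | zero => rw [pow_zero, one_mul, mul_one]
  | succ k ih =>
    calc ⊤ * R ^ (k + 1) = ⊤ * R ^ k * R := by rw [pow_succ, mul_assoc]
      _ ≤ R ^ k * ⊤ * R := mul_le_mul' ih le_rfl
      _ = R ^ k * (⊤ * R) := mul_assoc _ _ _
      _ ≤ R ^ k * (R * ⊤) := mul_le_mul' le_rfl top_mul_range_ι_le
      _ = R ^ (k + 1) * ⊤ := by rw [pow_succ, mul_assoc]

theorem extPow_mul_mem {k l : ℕ} {a b : Λ[𝕜] W} (ha : a ∈ extPow 𝕜 W k)
    (hb : b ∈ extPow 𝕜 W l) : a * b ∈ extPow 𝕜 W (k + l) := by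
  set R := LinearMap.range (ι 𝕜 (M := W)) with hR
  have h : extPow 𝕜 W k * extPow 𝕜 W l ≤ extPow 𝕜 W (k + l) := by
    calc R ^ k * ⊤ * (R ^ l * ⊤) = R ^ k * (⊤ * R ^ l) * ⊤ := by simp only [mul_assoc]
      _ ≤ R ^ k * (R ^ l * ⊤) * ⊤ :=
        mul_le_mul' (mul_le_mul' le_rfl (top_mul_range_ι_pow_le l)) le_rfl
      _ = R ^ (k + l) * (⊤ * ⊤) := by rw [pow_add]; simp only [mul_assoc]
      _ ≤ R ^ (k + l) * ⊤ := mul_le_mul' le_rfl le_top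
  exact h (Submodule.mul_mem_mul ha hb)

theorem extInvol_mem_extPow {k : ℕ} {a : Λ[𝕜] W} (ha : a ∈ extPow 𝕜 W k) :
    extInvol 𝕜 W a ∈ extPow 𝕜 W k := by
  have h : (extPow 𝕜 W k).map (extInvol 𝕜 W).toLinearMap ≤ extPow 𝕜 W k := by
    rw [extPow, Submodule.map_mul, Submodule.map_pow]
    refine mul_le_mul' (pow_le_pow_left' ?_ k) le_top
    rintro _ ⟨_, ⟨w, rfl⟩, rfl⟩
    exact ⟨-w, by rw [map_neg]; exact (extInvol_ι w).symm⟩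
  exact h ⟨a, ha, rfl⟩

theorem mem_extPow_one {a : Λ[𝕜] W} (ha : ExteriorAlgebra.algebraMapInv a = 0) :
    a ∈ extPow 𝕜 W 1 := by
  have h : a - algebraMap 𝕜 _ (ExteriorAlgebra.algebraMapInv a) ∈ extPow 𝕜 W 1 := by
    clear ha
    induction a using ext_left_induction with
    | algebraMap r => simp
    | add x y hx hy =>
      rw [map_add, map_add, add_sub_add_comm]; exact Submodule.add_mem _ hx hy
    | ι_mul x w hx =>
      have : ExteriorAlgebra.algebraMapInv (ι 𝕜 w * x) = 0 := by
        simp [ExteriorAlgebra.algebraMapInv]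
      rw [this, map_zero, sub_zero, extPow, pow_one]
      exact Submodule.mul_mem_mul ⟨w, rfl⟩ trivial
  rwa [ha, map_zero, sub_zero] at h

theorem extPow_eq_bot [FiniteDimensional 𝕜 W] : extPow 𝕜 W (Module.finrank 𝕜 W + 1) = ⊥ := by
  have h := ExteriorAlgebra.ιMulti_span_fixedDegree 𝕜 (M := W) (Module.finrank 𝕜 W + 1)
  rw [ExteriorAlgebra.exteriorPower] at h
  rw [extPow, ← h, Submodule.span_eq_bot.mpr, Submodule.bot_mul]
  rintro _ ⟨v, rfl⟩
  refine AlternatingMap.map_linearDependent _ v fun hv => ?_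
  have := hv.fintype_card_le_finrank
  simp at this

variable (𝕜 W) in
/-- The filtration of `ΛW ⊗ M` by the powers of the augmentation ideal. -/
def extFil (M : Type*) [AddCommGroup M] [Module 𝕜 M] (k : ℕ) :
    Submodule 𝕜 (Λ[𝕜] W ⊗[𝕜] M) :=
  Submodule.map₂ (TensorProduct.mk 𝕜 _ _) (extPow 𝕜 W k) ⊤

section Fil

variable {M : Type*} [AddCommGroup M] [Module 𝕜 M]

theorem tmul_mem_extFil {k : ℕ} {a : Λ[𝕜] W} (ha : a ∈ extPow 𝕜 W k) (x : M) :
    a ⊗ₜ x ∈ extFil 𝕜 W M k := Submodule.apply_mem_map₂ _ ha trivial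

theorem extFil_zero : extFil 𝕜 W M 0 = ⊤ := by
  rw [eq_top_iff]
  rintro t -
  induction t with
  | zero => exact Submodule.zero_mem _
  | add x y hx hy => exact Submodule.add_mem _ hx hy
  | tmul a x => exact tmul_mem_extFil (mem_extPow_zero a) x

theorem extFil_eq_bot [FiniteDimensional 𝕜 W] : extFil 𝕜 W M (Module.finrank 𝕜 W + 1) = ⊥ := by
  rw [extFil, extPow_eq_bot, Submodule.map₂_bot_left]

/-- The operators which raise the filtration degree. -/
def raising (𝕜 W M : Type*) [RCLike 𝕜] [AddCommGroup W] [Module 𝕜 W] [AddCommGroup M]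
    [Module 𝕜 M] : Submodule 𝕜 (Module.End 𝕜 (Λ[𝕜] W ⊗[𝕜] M)) where
  carrier := {O | ∀ k, ∀ t ∈ extFil 𝕜 W M k, O t ∈ extFil 𝕜 W M (k + 1)}
  add_mem' h h' k t ht := Submodule.add_mem _ (h k t ht) (h' k t ht)
  zero_mem' _ _ _ := Submodule.zero_mem _
  smul_mem' c _ h k t ht := Submodule.smul_mem _ c (h k t ht)

theorem raising_pow_eq_bot [FiniteDimensional 𝕜 W] :
    raising 𝕜 W M ^ (Module.finrank 𝕜 W + 1) = ⊥ := by
  have h : ∀ j, ∀ O ∈ raising 𝕜 W M ^ j, ∀ k, ∀ t ∈ extFil 𝕜 W M k,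
      O t ∈ extFil 𝕜 W M (k + j) := by
    intro j
    induction j with
    | zero =>
      intro O hO k t ht
      rw [pow_zero] at hO
      obtain ⟨c, rfl⟩ := Submodule.mem_one.mp hO
      exact Submodule.smul_mem _ c ht
    | succ j ih =>
      intro O hO
      rw [pow_succ'] at hO
      refine Submodule.mul_induction_on hO (fun O₁ h₁ O₂ h₂ k t ht => ?_) fun O₁ O₂ h₁ h₂ k t ht => ?_
      · exact h₁ _ _ (ih O₂ h₂ k t ht)
      · exact Submodule.add_mem _ (h₁ k t ht) (h₂ k t ht)
  rw [eq_bot_iff]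
  intro O hO
  refine LinearMap.ext fun t => ?_
  have := h _ O hO 0 t (by rw [extFil_zero]; trivial)
  rw [zero_add, extFil_eq_bot] at this
  exact (Submodule.mem_bot 𝕜).mp this

theorem pow_eq_zero_of_mem_raising [FiniteDimensional 𝕜 W]
    {O : Module.End 𝕜 (Λ[𝕜] W ⊗[𝕜] M)} (hO : O ∈ raising 𝕜 W M) :
    O ^ (Module.finrank 𝕜 W + 1) = 0 := by
  have := Submodule.pow_mem_pow _ hO (Module.finrank 𝕜 W + 1)
  rw [raising_pow_eq_bot] at this
  exact (Submodule.mem_bot 𝕜).mp this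

end Fil

end GrassmannAux

/-! ### Actions of the Grassmann envelope of a Lie superalgebra -/

section SuperAct

variable {𝕜 : Type*} [RCLike 𝕜] {L V : Type*} [AddCommGroup L] [Module 𝕜 L] [AddCommGroup V]
  [Module 𝕜 V] {S : Type*} [AddCommGroup S] [Module 𝕜 S] {W : Type*} [AddCommGroup W] [Module 𝕜 W]

/-- For a linear map `ρ` from `𝔤 = L ⊕ V` to the endomorphisms of `S`, the operators
`a ⊗ X : b ⊗ s ↦ (-1)^{|X||b|} ab ⊗ ρ(X)s` on `ΛW ⊗ S`. For the adjoint action of `𝔤` on itself this is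
the bracket of the Grassmann envelope. -/
def superAct (W : Type*) [AddCommGroup W] [Module 𝕜 W] (ρ : (L × V) →ₗ[𝕜] S →ₗ[𝕜] S) :
    Λ[𝕜] W ⊗[𝕜] (L × V) →ₗ[𝕜] Λ[𝕜] W ⊗[𝕜] S →ₗ[𝕜]
      Λ[𝕜] W ⊗[𝕜] S :=
  TensorProduct.map₂ (LinearMap.mul 𝕜 (Λ[𝕜] W))
      (ρ ∘ₗ inl 𝕜 L V ∘ₗ LinearMap.fst 𝕜 L V) +
    TensorProduct.map₂ ((LinearMap.mul 𝕜 (Λ[𝕜] W)).compl₂ (extInvol 𝕜 W).toLinearMap)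
      (ρ ∘ₗ inr 𝕜 L V ∘ₗ LinearMap.snd 𝕜 L V)

theorem superAct_even (ρ : (L × V) →ₗ[𝕜] S →ₗ[𝕜] S) (a b : Λ[𝕜] W) (X : L) (s : S) :
    superAct W ρ (a ⊗ₜ (X, 0)) (b ⊗ₜ s) = (a * b) ⊗ₜ ρ (X, 0) s := by
  change (a * b) ⊗ₜ ρ (X, 0) s + (a * extInvol 𝕜 W b) ⊗ₜ ρ (0, 0) s = _
  rw [show ((0, 0) : L × V) = 0 from rfl, map_zero, LinearMap.zero_apply, tmul_zero,
    add_zero]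

theorem superAct_odd (ρ : (L × V) →ₗ[𝕜] S →ₗ[𝕜] S) (a b : Λ[𝕜] W) (v : V) (s : S) :
    superAct W ρ (a ⊗ₜ (0, v)) (b ⊗ₜ s) = (a * extInvol 𝕜 W b) ⊗ₜ ρ (0, v) s := by
  change (a * b) ⊗ₜ ρ (0, 0) s + (a * extInvol 𝕜 W b) ⊗ₜ ρ (0, v) s = _
  rw [show ((0, 0) : L × V) = 0 from rfl, map_zero, LinearMap.zero_apply, tmul_zero,
    zero_add]

/-- An element of `A ⊗ 𝔤` is a sum of elements `a ⊗ X` with homogeneous `X`. -/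
theorem env_induction {A : Type*} [AddCommGroup A] [Module 𝕜 A] {motive : A ⊗[𝕜] (L × V) → Prop}
    (zero : motive 0) (add : ∀ x y, motive x → motive y → motive (x + y))
    (even : ∀ (a : A) (X : L), motive (a ⊗ₜ (X, 0)))
    (odd : ∀ (a : A) (v : V), motive (a ⊗ₜ (0, v))) (z : A ⊗[𝕜] (L × V)) : motive z := by
  induction z with
  | zero => exact zero
  | add x y hx hy => exact add x y hx hy
  | tmul a X =>
    have : a ⊗ₜ[𝕜] X = a ⊗ₜ (X.1, 0) + a ⊗ₜ (0, X.2) := by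
      rw [← tmul_add, Prod.mk_add_mk, add_zero, zero_add]
    rw [this]
    exact add _ _ (even a X.1) (odd a X.2)

/-- Two linear maps on `A ⊗ 𝔤` agree if they agree on `A ⊗ 𝔤₀` and on `A ⊗ 𝔤₁`. -/
theorem env_ext {A N : Type*} [AddCommGroup A] [Module 𝕜 A] [AddCommGroup N] [Module 𝕜 N]
    {f g : A ⊗[𝕜] (L × V) →ₗ[𝕜] N} (even : ∀ (a : A) (X : L), f (a ⊗ₜ (X, 0)) = g (a ⊗ₜ (X, 0)))
    (odd : ∀ (a : A) (v : V), f (a ⊗ₜ (0, v)) = g (a ⊗ₜ (0, v))) (z : A ⊗[𝕜] (L × V)) :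
    f z = g z := by
  induction z using env_induction with
  | zero => rw [map_zero, map_zero]
  | add x y hx hy => rw [map_add, map_add, hx, hy]
  | even a X => exact even a X
  | odd a v => exact odd a v

theorem mem_homog_zero {X : L × V} : X ∈ homog 𝕜 L V 0 ↔ X.2 = 0 := by
  change X ∈ LinearMap.range (inl 𝕜 L V) ↔ _
  constructor
  · rintro ⟨x, rfl⟩; rfl
  · intro h; exact ⟨X.1, by ext <;> simp [h]⟩

theorem mem_homog_one {X : L × V} : X ∈ homog 𝕜 L V 1 ↔ X.1 = 0 := by
  change X ∈ LinearMap.range (inr 𝕜 L V) ↔ _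
  constructor
  · rintro ⟨x, rfl⟩; rfl
  · intro h; exact ⟨X.2, by ext <;> simp [h]⟩

theorem ssign_of_left_even (j : ZMod 2) : ssign 𝕜 0 j = 1 := by
  rw [ssign, if_neg (by simp)]

theorem ssign_of_right_even (i : ZMod 2) : ssign 𝕜 i 0 = 1 := by
  rw [ssign, if_neg (by simp)]

theorem ssign_odd : ssign 𝕜 1 1 = -1 := by
  rw [ssign, if_pos (by simp)]

theorem superAct_of_even (ρ : (L × V) →ₗ[𝕜] S →ₗ[𝕜] S) {X : L × V} (hX : X ∈ homog 𝕜 L V 0)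
    (a b : Λ[𝕜] W) (s : S) :
    superAct W ρ (a ⊗ₜ X) (b ⊗ₜ s) = (a * b) ⊗ₜ ρ X s := by
  obtain ⟨X, rfl⟩ : X ∈ LinearMap.range (inl 𝕜 L V) := hX
  exact superAct_even ρ a b X s

theorem superAct_of_odd (ρ : (L × V) →ₗ[𝕜] S →ₗ[𝕜] S) {X : L × V} (hX : X ∈ homog 𝕜 L V 1)
    (a b : Λ[𝕜] W) (s : S) :
    superAct W ρ (a ⊗ₜ X) (b ⊗ₜ s) = (a * extInvol 𝕜 W b) ⊗ₜ ρ X s := by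
  obtain ⟨v, rfl⟩ : X ∈ LinearMap.range (inr 𝕜 L V) := hX
  exact superAct_odd ρ a b v s

/-- The parity involution of the Grassmann envelope. -/
def envInvol : Λ[𝕜] W ⊗[𝕜] (L × V) →ₗ[𝕜] Λ[𝕜] W ⊗[𝕜] (L × V) :=
  TensorProduct.map (extInvol 𝕜 W).toLinearMap (LinearMap.prodMap LinearMap.id (-LinearMap.id))

theorem envInvol_even (a : Λ[𝕜] W) (X : L) :
    envInvol (a ⊗ₜ ((X, 0) : L × V)) = extInvol 𝕜 W a ⊗ₜ (X, 0) := by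
  simp [envInvol]

theorem envInvol_odd (a : Λ[𝕜] W) (v : V) :
    envInvol (a ⊗ₜ ((0, v) : L × V)) = -(extInvol 𝕜 W a ⊗ₜ (0, v)) := by
  rw [envInvol, map_tmul, ← tmul_neg]
  congr 1
  exact Prod.ext (by simp) (by simp)

/-- `ρ` is a representation of the Lie superalgebra `(L ⊕ V, br)` on `S`. -/
def IsSuperRepOn (br : Bil[𝕜] (L × V)) (ρ : (L × V) →ₗ[𝕜] S →ₗ[𝕜] S) : Prop :=
  ∀ (i j : ZMod 2), ∀ X ∈ homog 𝕜 L V i, ∀ Y ∈ homog 𝕜 L V j, ∀ s,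
    ρ X (ρ Y s) = ρ (br X Y) s + ssign 𝕜 i j • ρ Y (ρ X s)

/-- `br` is the bracket of a Lie superalgebra `L ⊕ V`. -/
structure IsLieSuper (br : Bil[𝕜] (L × V)) : Prop where
  mem : ∀ (i j : ZMod 2), ∀ X ∈ homog 𝕜 L V i, ∀ Y ∈ homog 𝕜 L V j, br X Y ∈ homog 𝕜 L V (i + j)
  skew : ∀ (i j : ZMod 2), ∀ X ∈ homog 𝕜 L V i, ∀ Y ∈ homog 𝕜 L V j,
    br X Y = -(ssign 𝕜 i j • br Y X)
  jacobi : IsSuperRepOn br br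

theorem even_mem_homog (X : L) : ((X, 0) : L × V) ∈ homog 𝕜 L V 0 := ⟨X, rfl⟩

theorem odd_mem_homog (v : V) : ((0, v) : L × V) ∈ homog 𝕜 L V 1 := ⟨v, rfl⟩

namespace IsLieSuper

variable {br : Bil[𝕜] (L × V)} (h : IsLieSuper br)
include h

theorem even_even (X Y : L) : br (X, 0) (Y, 0) = ((br (X, 0) (Y, 0)).1, 0) :=
  Prod.ext rfl (mem_homog_zero.mp (h.mem 0 0 _ (even_mem_homog X) _ (even_mem_homog Y)))

theorem even_odd (X : L) (v : V) : br (X, 0) (0, v) = (0, (br (X, 0) (0, v)).2) :=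
  Prod.ext (mem_homog_one.mp (h.mem 0 1 _ (even_mem_homog X) _ (odd_mem_homog v))) rfl

theorem odd_even (v : V) (X : L) : br (0, v) (X, 0) = (0, (br (0, v) (X, 0)).2) :=
  Prod.ext (mem_homog_one.mp (h.mem 1 0 _ (odd_mem_homog v) _ (even_mem_homog X))) rfl

theorem odd_odd (v w : V) : br (0, v) (0, w) = ((br (0, v) (0, w)).1, 0) :=
  Prod.ext rfl (mem_homog_zero.mp (h.mem 1 1 _ (odd_mem_homog v) _ (odd_mem_homog w)))

theorem skew_odd_even (v : V) (X : L) : br (0, v) (X, 0) = -br (X, 0) (0, v) := by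
  rw [h.skew 1 0 _ (odd_mem_homog v) _ (even_mem_homog X), ssign_of_right_even, one_smul]

theorem skew_even_odd (v : V) (X : L) : br (X, 0) (0, v) = -br (0, v) (X, 0) := by
  rw [h.skew_odd_even, neg_neg]

theorem skew_even_even (X Y : L) : br (X, 0) (Y, 0) = -br (Y, 0) (X, 0) := by
  rw [h.skew 0 0 _ (even_mem_homog X) _ (even_mem_homog Y), ssign_of_right_even, one_smul]

theorem symm_odd_odd (v w : V) : br (0, v) (0, w) = br (0, w) (0, v) := by
  rw [h.skew 1 1 _ (odd_mem_homog v) _ (odd_mem_homog w), ssign_odd, neg_one_smul, neg_neg]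

end IsLieSuper

variable (𝕜 L V W) in
/-- The elements of `ΛW ⊗ 𝔤` of total parity `i`. -/
def totalParity (i : ZMod 2) : Submodule 𝕜 (Λ[𝕜] W ⊗[𝕜] (L × V)) :=
  Submodule.map₂ (TensorProduct.mk 𝕜 _ _) (extParity 𝕜 W i) (homog 𝕜 L V 0) ⊔
    Submodule.map₂ (TensorProduct.mk 𝕜 _ _) (extParity 𝕜 W (i + 1)) (homog 𝕜 L V 1)

theorem tmul_even_mem_totalParity {i : ZMod 2} {a : Λ[𝕜] W} (ha : a ∈ extParity 𝕜 W i)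
    (X : L) : a ⊗ₜ ((X, 0) : L × V) ∈ totalParity 𝕜 L V W i :=
  Submodule.mem_sup_left (Submodule.apply_mem_map₂ _ ha (even_mem_homog X))

theorem tmul_odd_mem_totalParity {i : ZMod 2} {a : Λ[𝕜] W}
    (ha : a ∈ extParity 𝕜 W (i + 1)) (v : V) :
    a ⊗ₜ ((0, v) : L × V) ∈ totalParity 𝕜 L V W i :=
  Submodule.mem_sup_right (Submodule.apply_mem_map₂ _ ha (odd_mem_homog v))

theorem totalParity_le {i : ZMod 2} {P : Submodule 𝕜 (Λ[𝕜] W ⊗[𝕜] (L × V))}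
    (even : ∀ a ∈ extParity 𝕜 W i, ∀ X : L, a ⊗ₜ (X, 0) ∈ P)
    (odd : ∀ a ∈ extParity 𝕜 W (i + 1), ∀ v : V, a ⊗ₜ (0, v) ∈ P) : totalParity 𝕜 L V W i ≤ P := by
  refine sup_le (Submodule.map₂_le.2 ?_) (Submodule.map₂_le.2 ?_)
  · rintro a ha _ ⟨X, rfl⟩; exact even a ha X
  · rintro a ha _ ⟨v, rfl⟩; exact odd a ha v

/-- Linear identities on `(ΛW ⊗ 𝔤)_i` may be tested on the elements `a ⊗ X` with homogeneous `a` and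
`X`. -/
theorem totalParity_ext {i : ZMod 2} {N : Type*} [AddCommGroup N] [Module 𝕜 N]
    {f g : Λ[𝕜] W ⊗[𝕜] (L × V) →ₗ[𝕜] N}
    (even : ∀ a ∈ extParity 𝕜 W i, ∀ X : L, f (a ⊗ₜ (X, 0)) = g (a ⊗ₜ (X, 0)))
    (odd : ∀ a ∈ extParity 𝕜 W (i + 1), ∀ v : V, f (a ⊗ₜ (0, v)) = g (a ⊗ₜ (0, v)))
    {z : Λ[𝕜] W ⊗[𝕜] (L × V)} (hz : z ∈ totalParity 𝕜 L V W i) : f z = g z :=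
  totalParity_le (P := LinearMap.eqLocus f g) even odd hz

variable {br : Bil[𝕜] (L × V)} {ρ : (L × V) →ₗ[𝕜] S →ₗ[𝕜] S}

/-- An even element `n` of the Grassmann envelope acts on `ΛW ⊗ S` by an operator whose commutator
with the operator given by `x` is the operator given by the bracket of `n` and `x`. -/
theorem superAct_superAct (hbr : IsLieSuper br) (hρ : IsSuperRepOn br ρ) {n : Λ[𝕜] W ⊗[𝕜] (L × V)}
    (hn : n ∈ totalParity 𝕜 L V W 0) (x : Λ[𝕜] W ⊗[𝕜] (L × V))
    (t : Λ[𝕜] W ⊗[𝕜] S) :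
    superAct W ρ n (superAct W ρ x t) =
      superAct W ρ (superAct W br n x) t + superAct W ρ x (superAct W ρ n t) := by
  revert n
  suffices H : ∀ a X, (a ∈ extParity 𝕜 W 0 ∧ X ∈ homog 𝕜 L V 0 ∨
      a ∈ extParity 𝕜 W 1 ∧ X ∈ homog 𝕜 L V 1) → superAct W ρ (a ⊗ₜ X) (superAct W ρ x t) =
        superAct W ρ (superAct W br (a ⊗ₜ X) x) t + superAct W ρ x (superAct W ρ (a ⊗ₜ X) t) by
    intro n hn
    exact totalParity_ext (f := (superAct W ρ).flip (superAct W ρ x t))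
      (g := (superAct W ρ).flip t ∘ₗ (superAct W br).flip x + superAct W ρ x ∘ₗ (superAct W ρ).flip t)
      (fun a ha X => H a _ (Or.inl ⟨ha, even_mem_homog X⟩))
      (fun a ha v => H a _ (Or.inr ⟨by simpa using ha, odd_mem_homog v⟩)) hn
  intro a X haX
  induction t with
  | zero => simp only [map_zero, add_zero]
  | add t t' ht ht' => simp only [map_add, ht, ht']; abel
  | tmul c s =>
    -- the four cases are the axiom of a representation together with the sign rule of `ΛW`
    induction x using env_induction with
    | zero => simp only [map_zero, LinearMap.zero_apply, add_zero]
    | add x y hx hy => simp only [map_add, LinearMap.add_apply, hx, hy]; abel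
    | even b Y =>
      have hY := even_mem_homog (𝕜 := 𝕜) (V := V) Y
      rcases haX with ⟨ha, hX⟩ | ⟨ha, hX⟩
      · have hr := hρ 0 0 X hX _ hY s
        rw [ssign_of_left_even, one_smul] at hr
        rw [superAct_of_even br hX, superAct_of_even ρ hY, superAct_of_even ρ hX,
          superAct_of_even ρ (hbr.mem 0 0 X hX _ hY), superAct_of_even ρ hX,
          superAct_of_even ρ hY, hr, tmul_add, mul_assoc, ← mul_assoc b,
          ← ext_even_mul ha b, mul_assoc]
      · have hr := hρ 1 0 X hX _ hY s
        rw [ssign_of_right_even, one_smul] at hr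
        rw [superAct_of_odd br hX, superAct_of_even ρ hY, superAct_of_odd ρ hX,
          superAct_of_odd ρ (hbr.mem 1 0 X hX _ hY), superAct_of_odd ρ hX,
          superAct_of_even ρ hY, hr, tmul_add, map_mul, mul_assoc, ← mul_assoc b,
          ext_mul_odd ha b, mul_assoc]
    | odd b v =>
      have hY := odd_mem_homog (𝕜 := 𝕜) (L := L) v
      rcases haX with ⟨ha, hX⟩ | ⟨ha, hX⟩
      · have hr := hρ 0 1 X hX _ hY s
        rw [ssign_of_left_even, one_smul] at hr
        rw [superAct_of_even br hX, superAct_of_odd ρ hY, superAct_of_even ρ hX,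
          superAct_of_odd ρ (hbr.mem 0 1 X hX _ hY), superAct_of_even ρ hX,
          superAct_of_odd ρ hY, hr, tmul_add, map_mul, extInvol_even ha, mul_assoc,
          ← mul_assoc b, ← ext_even_mul ha b, mul_assoc]
      · have hr := hρ 1 1 X hX _ hY s
        rw [ssign_odd, neg_one_smul] at hr
        rw [superAct_of_odd br hX, superAct_of_odd ρ hY, superAct_of_odd ρ hX,
          superAct_of_even ρ (hbr.mem 1 1 X hX _ hY), superAct_of_odd ρ hX,
          superAct_of_odd ρ hY, hr, tmul_add, map_mul, map_mul, extInvol_extInvol,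
          extInvol_odd ha, tmul_neg, ← neg_tmul, neg_mul, mul_neg,
          mul_assoc, ← mul_assoc b, ext_mul_odd ha b, mul_assoc]

/-- The bracket of the Grassmann envelope satisfies the Jacobi identity. -/
theorem superAct_jacobi {n : Λ[𝕜] W ⊗[𝕜] (L × V)} (hbr : IsLieSuper br)
    (hn : n ∈ totalParity 𝕜 L V W 0) (x y : Λ[𝕜] W ⊗[𝕜] (L × V)) :
    superAct W br n (superAct W br x y) =
      superAct W br (superAct W br n x) y + superAct W br x (superAct W br n y) :=
  superAct_superAct hbr hbr.jacobi hn x y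

/-- The bracket with an odd element `w` is graded skew-symmetric. -/
theorem superAct_skew (hbr : IsLieSuper br) {w : Λ[𝕜] W ⊗[𝕜] (L × V)}
    (hw : w ∈ totalParity 𝕜 L V W 1) (z : Λ[𝕜] W ⊗[𝕜] (L × V)) :
    superAct W br z w = -superAct W br w (envInvol z) := by
  refine totalParity_ext (f := superAct W br z) (g := -(superAct W br).flip (envInvol z)) ?_ ?_ hw
  · intro a ha X
    refine env_ext (f := (superAct W br).flip (a ⊗ₜ (X, 0)))
      (g := -(superAct W br (a ⊗ₜ (X, 0)) ∘ₗ envInvol)) (fun b Y => ?_) (fun b v => ?_) z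
    · change superAct W br (b ⊗ₜ (Y, 0)) (a ⊗ₜ (X, 0)) = -superAct W br (a ⊗ₜ (X, 0)) (envInvol (b ⊗ₜ (Y, 0)))
      rw [envInvol_even, superAct_even, superAct_even, ext_mul_odd ha, hbr.skew_even_even,
        tmul_neg]
    · change superAct W br (b ⊗ₜ (0, v)) (a ⊗ₜ (X, 0)) = -superAct W br (a ⊗ₜ (X, 0)) (envInvol (b ⊗ₜ (0, v)))
      rw [envInvol_odd, superAct_odd, map_neg, superAct_even, extInvol_odd ha, mul_neg,
        ext_mul_odd ha, hbr.skew_odd_even, tmul_neg, neg_tmul, neg_neg]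
  · intro a ha X
    replace ha : a ∈ extParity 𝕜 W 0 := ha
    refine env_ext (f := (superAct W br).flip (a ⊗ₜ (0, X)))
      (g := -(superAct W br (a ⊗ₜ (0, X)) ∘ₗ envInvol)) (fun b Y => ?_) (fun b v => ?_) z
    · change superAct W br (b ⊗ₜ (Y, 0)) (a ⊗ₜ (0, X)) = -superAct W br (a ⊗ₜ (0, X)) (envInvol (b ⊗ₜ (Y, 0)))
      rw [envInvol_even, superAct_odd, superAct_even, extInvol_extInvol, ext_even_mul ha,
        hbr.skew_even_odd, tmul_neg]
    · change superAct W br (b ⊗ₜ (0, v)) (a ⊗ₜ (0, X)) = -superAct W br (a ⊗ₜ (0, X)) (envInvol (b ⊗ₜ (0, v)))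
      rw [envInvol_odd, superAct_odd, map_neg, superAct_odd, extInvol_extInvol, extInvol_even ha,
        ext_even_mul ha, hbr.symm_odd_odd, neg_neg]

/-- The action is linear over the Grassmann algebra as far as even elements are concerned. -/
theorem superAct_mulLeft {n : Λ[𝕜] W ⊗[𝕜] (L × V)} (hn : n ∈ totalParity 𝕜 L V W 0)
    (a : Λ[𝕜] W) (t : Λ[𝕜] W ⊗[𝕜] S) :
    superAct W ρ n (a • t) = a • superAct W ρ n t := by
  induction t with
  | zero => rw [smul_zero, map_zero, smul_zero]
  | add t t' ht ht' => rw [smul_add, map_add, ht, ht', map_add, smul_add]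
  | tmul b s =>
    refine totalParity_ext (f := (superAct W ρ).flip (a • b ⊗ₜ s))
      (g := Module.toModuleEnd 𝕜 (S := Λ[𝕜] W) (Λ[𝕜] W ⊗[𝕜] S) a ∘ₗ
        (superAct W ρ).flip (b ⊗ₜ s)) ?_ ?_ hn
    · intro c hc X
      change superAct W ρ (c ⊗ₜ (X, 0)) (a • b ⊗ₜ s) = a • superAct W ρ (c ⊗ₜ (X, 0)) (b ⊗ₜ s)
      rw [smul_tmul', smul_eq_mul, superAct_even, superAct_even,
        smul_tmul', smul_eq_mul, ← mul_assoc, ext_even_mul hc, mul_assoc]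
    · intro c hc v
      change superAct W ρ (c ⊗ₜ (0, v)) (a • b ⊗ₜ s) = a • superAct W ρ (c ⊗ₜ (0, v)) (b ⊗ₜ s)
      rw [smul_tmul', smul_eq_mul, superAct_odd, superAct_odd,
        smul_tmul', smul_eq_mul, map_mul, ← mul_assoc c, ← mul_assoc a,
        ← ext_mul_odd (show c ∈ extParity 𝕜 W 1 by simpa using hc)]

/-- Naturality of the action of the Grassmann envelope. -/
theorem superAct_natural {W' L' V' S' : Type*} [AddCommGroup W'] [Module 𝕜 W'] [AddCommGroup L']
    [Module 𝕜 L'] [AddCommGroup V'] [Module 𝕜 V'] [AddCommGroup S'] [Module 𝕜 S']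
    {ρ' : (L' × V') →ₗ[𝕜] S' →ₗ[𝕜] S'} {j : Λ[𝕜] W →ₐ[𝕜] Λ[𝕜] W'}
    (hj : ∀ a, j (extInvol 𝕜 W a) = extInvol 𝕜 W' (j a)) {φ₀ : L →ₗ[𝕜] L'} {φ₁ : V →ₗ[𝕜] V'}
    {ψ : S →ₗ[𝕜] S'} (hψ : ∀ X s, ψ (ρ X s) = ρ' (φ₀.prodMap φ₁ X) (ψ s))
    (z : Λ[𝕜] W ⊗[𝕜] (L × V)) (t : Λ[𝕜] W ⊗[𝕜] S) :
    TensorProduct.map j.toLinearMap ψ (superAct W ρ z t) =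
      superAct W' ρ' (TensorProduct.map j.toLinearMap (φ₀.prodMap φ₁) z)
        (TensorProduct.map j.toLinearMap ψ t) := by
  induction t with
  | zero => simp only [map_zero]
  | add t t' ht ht' => simp only [map_add, ht, ht']
  | tmul b s =>
    induction z using env_induction with
    | zero => simp only [map_zero, LinearMap.zero_apply]
    | add x y hx hy => simp only [map_add, LinearMap.add_apply, hx, hy]
    | even a X =>
      have hX : φ₀.prodMap φ₁ (X, 0) = (φ₀ X, 0) := by simp
      rw [superAct_even, map_tmul, map_tmul, map_tmul,
        hψ, hX, superAct_even]
      simp only [AlgHom.toLinearMap_apply, map_mul]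
    | odd a v =>
      have hX : φ₀.prodMap φ₁ (0, v) = (0, φ₁ v) := by simp
      rw [superAct_odd, map_tmul, map_tmul, map_tmul,
        hψ, hX, superAct_odd]
      simp only [AlgHom.toLinearMap_apply, map_mul, hj]

/-- An element with coefficients in the augmentation ideal acts by a raising operator. -/
theorem superAct_mem_raising {n : Λ[𝕜] W ⊗[𝕜] (L × V)}
    (hn : n ∈ extFil 𝕜 W (L × V) 1) : superAct W ρ n ∈ raising 𝕜 W S := by
  have h : extFil 𝕜 W (L × V) 1 ≤ (raising 𝕜 W S).comap (superAct W ρ) := by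
    refine Submodule.map₂_le.2 fun a ha X _ k t ht => ?_
    have h2 : extFil 𝕜 W S k ≤ (extFil 𝕜 W S (k + 1)).comap (superAct W ρ (a ⊗ₜ X)) := by
      refine Submodule.map₂_le.2 fun b hb s _ => ?_
      change (a * b) ⊗ₜ[𝕜] ρ (X.1, 0) s + (a * extInvol 𝕜 W b) ⊗ₜ[𝕜] ρ (0, X.2) s ∈
        extFil 𝕜 W S (k + 1)
      rw [add_comm k]
      exact Submodule.add_mem _ (tmul_mem_extFil (extPow_mul_mem ha hb) _)
        (tmul_mem_extFil (extPow_mul_mem ha (extInvol_mem_extPow hb)) _)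
    exact h2 ht
  exact h hn

end SuperAct

/-! ### Vector fields with coefficients in a Grassmann algebra -/

section VectorFields

variable {𝕜 : Type*} [RCLike 𝕜] {L V : Type*} [AddCommGroup L] [Module 𝕜 L] [AddCommGroup V]
  [Module 𝕜 V] {W : Type*} [AddCommGroup W] [Module 𝕜 W]

/-- The projection of `A ⊗ (L ⊕ V)` onto `A ⊗ L`. -/
def evenPart {A : Type*} [AddCommGroup A] [Module 𝕜 A] : Module.End 𝕜 (A ⊗[𝕜] (L × V)) :=
  lTensor A (inl 𝕜 L V ∘ₗ LinearMap.fst 𝕜 L V)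

/-- The projection of `A ⊗ (L ⊕ V)` onto `A ⊗ V`. -/
def oddPart {A : Type*} [AddCommGroup A] [Module 𝕜 A] : Module.End 𝕜 (A ⊗[𝕜] (L × V)) :=
  lTensor A (inr 𝕜 L V ∘ₗ LinearMap.snd 𝕜 L V)

section Parts

variable {A : Type*} [AddCommGroup A] [Module 𝕜 A]

theorem evenPart_even (a : A) (X : L) :
    evenPart (a ⊗ₜ[𝕜] ((X, 0) : L × V)) = a ⊗ₜ (X, 0) := rfl

theorem evenPart_odd (a : A) (v : V) : evenPart (a ⊗ₜ[𝕜] ((0, v) : L × V)) = 0 :=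
  tmul_zero _ a

theorem oddPart_even (a : A) (X : L) : oddPart (a ⊗ₜ[𝕜] ((X, 0) : L × V)) = 0 :=
  tmul_zero _ a

theorem oddPart_odd (a : A) (v : V) : oddPart (a ⊗ₜ[𝕜] ((0, v) : L × V)) = a ⊗ₜ (0, v) := rfl

theorem evenPart_add_oddPart (z : A ⊗[𝕜] (L × V)) : evenPart z + oddPart z = z := by
  refine env_ext (f := evenPart + oddPart) (g := LinearMap.id) (fun a X => ?_) (fun a v => ?_) z
  · simp only [LinearMap.add_apply, evenPart_even, oddPart_even, add_zero]; rfl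
  · simp only [LinearMap.add_apply, evenPart_odd, oddPart_odd, zero_add]; rfl

end Parts

theorem rTensor_superAct_of_even {br : Bil[𝕜] (L × V)}
    {E : Module.End 𝕜 (Λ[𝕜] W)} (hE : ∀ a b, E (a * b) = E a * b + a * E b)
    (hE' : ∀ a, E (extInvol 𝕜 W a) = extInvol 𝕜 W (E a))
    (z w : Λ[𝕜] W ⊗[𝕜] (L × V)) :
    rTensor (L × V) E (superAct W br z w) =
      superAct W br (rTensor _ E z) w + superAct W br z (rTensor _ E w) := by
  induction w with
  | zero => simp only [map_zero, add_zero]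
  | add t t' ht ht' => simp only [map_add, ht, ht']; abel
  | tmul b Y =>
    induction z using env_induction with
    | zero => simp only [map_zero, LinearMap.zero_apply, add_zero]
    | add x y hx hy => simp only [map_add, LinearMap.add_apply, hx, hy]; abel
    | even a X =>
      simp only [superAct_even, rTensor_tmul, hE, add_tmul]
    | odd a v =>
      simp only [superAct_odd, rTensor_tmul, hE, add_tmul, hE']

theorem rTensor_superAct_of_odd {br : Bil[𝕜] (L × V)}
    {δ : Module.End 𝕜 (Λ[𝕜] W)}
    (hδ : ∀ a b, δ (a * b) = δ a * b + extInvol 𝕜 W a * δ b)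
    (hδ' : ∀ a, δ (extInvol 𝕜 W a) = -extInvol 𝕜 W (δ a))
    (z w : Λ[𝕜] W ⊗[𝕜] (L × V)) :
    rTensor (L × V) δ (superAct W br z w) =
      superAct W br (rTensor _ δ z) w +
        superAct W br (envInvol z) (rTensor _ δ w) := by
  induction w with
  | zero => simp only [map_zero, add_zero]
  | add t t' ht ht' => simp only [map_add, ht, ht']; abel
  | tmul b Y =>
    induction z using env_induction with
    | zero => simp only [map_zero, LinearMap.zero_apply, add_zero]
    | add x y hx hy => simp only [map_add, LinearMap.add_apply, hx, hy]; abel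
    | even a X =>
      simp only [superAct_even, rTensor_tmul, hδ, add_tmul, envInvol_even]
    | odd a v =>
      simp only [superAct_odd, rTensor_tmul, hδ, add_tmul, hδ',
        envInvol_odd, mul_neg, neg_tmul, map_neg, LinearMap.neg_apply]

theorem extContract_zero : extContract (0 : Module.Dual 𝕜 W) = 0 :=
  map_zero (CliffordAlgebra.contractLeft (Q := (0 : QuadraticForm 𝕜 W)))

/-- The derivation `a ∂_v` of `ΛV*` which is given by the odd component of an element `a ⊗ (X, v)` of
`ΛV* ⊗ 𝔤`. -/
def oddField : Λ*[𝕜] V ⊗[𝕜] (L × V) →ₗ[𝕜]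
    Module.End 𝕜 (Λ*[𝕜] V) :=
  TensorProduct.lift (LinearMap.mk₂ 𝕜
    (fun a X => mulLeft 𝕜 a * extContract (Module.Dual.eval 𝕜 V X.2))
    (fun a b X => LinearMap.ext fun x => add_mul a b _)
    (fun c a X => LinearMap.ext fun x => smul_mul_assoc c a _)
    (fun a X Y => by simp only [Prod.snd_add, map_add, extContract_add, mul_add])
    (fun c a X => by simp only [Prod.smul_snd, map_smul, extContract_smul, mul_smul_comm]))

theorem oddField_tmul (a b : Λ*[𝕜] V) (X : L × V) :
    oddField (a ⊗ₜ X) b = a * extContract (Module.Dual.eval 𝕜 V X.2) b := rfl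

theorem oddField_even (a : Λ*[𝕜] V) (X : L) :
    oddField (a ⊗ₜ ((X, 0) : L × V)) = 0 := by
  change mulLeft 𝕜 a * extContract (Module.Dual.eval 𝕜 V 0) = 0
  simp only [map_zero, extContract_zero, mul_zero]

theorem oddPart_smul (a : Λ*[𝕜] V)
    (z : Λ*[𝕜] V ⊗[𝕜] (L × V)) :
    oddPart (a • z) = a • oddPart z := by
  induction z with
  | zero => simp only [smul_zero, map_zero]
  | add x y hx hy => simp only [smul_add, map_add, hx, hy]
  | tmul b X => rfl

section Parity

variable {x : Λ*[𝕜] V ⊗[𝕜] (L × V)}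

theorem oddField_mul_of_even (hx : x ∈ totalParity 𝕜 L V (Module.Dual 𝕜 V) 0)
    (a b : Λ*[𝕜] V) :
    oddField x (a * b) = oddField x a * b + a * oddField x b := by
  refine totalParity_ext (f := oddField.flip (a * b)) (g := mulRight 𝕜 b ∘ₗ
    oddField.flip a + mulLeft 𝕜 a ∘ₗ oddField.flip b) (fun c hc X => ?_)
    (fun c hc v => ?_) hx
  · change oddField (c ⊗ₜ (X, 0)) (a * b) =
      oddField (c ⊗ₜ (X, 0)) a * b + a * oddField (c ⊗ₜ (X, 0)) b
    simp only [oddField_even, LinearMap.zero_apply, zero_mul, mul_zero, add_zero]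
  · change oddField (c ⊗ₜ (0, v)) (a * b) =
      oddField (c ⊗ₜ (0, v)) a * b + a * oddField (c ⊗ₜ (0, v)) b
    rw [oddField_tmul, oddField_tmul, oddField_tmul, extContract_mul, mul_add, ← mul_assoc,
      ← mul_assoc c (extInvol _ _ a), ← ext_mul_odd (show c ∈ extParity 𝕜 _ 1 by simpa using hc),
      mul_assoc a]

theorem oddField_extInvol_of_even (hx : x ∈ totalParity 𝕜 L V (Module.Dual 𝕜 V) 0)
    (a : Λ*[𝕜] V) :
    oddField x (extInvol 𝕜 _ a) = extInvol 𝕜 _ (oddField x a) := by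
  refine totalParity_ext (f := oddField.flip (extInvol 𝕜 _ a)) (g := (extInvol 𝕜 _).toLinearMap ∘ₗ
    oddField.flip a) (fun c hc X => ?_) (fun c hc v => ?_) hx
  · change oddField (c ⊗ₜ (X, 0)) (extInvol 𝕜 _ a) = extInvol 𝕜 _ (oddField (c ⊗ₜ (X, 0)) a)
    simp only [oddField_even, LinearMap.zero_apply, map_zero]
  · change oddField (c ⊗ₜ (0, v)) (extInvol 𝕜 _ a) = extInvol 𝕜 _ (oddField (c ⊗ₜ (0, v)) a)
    simp only [oddField_tmul, map_mul, extContract_extInvol,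
      extInvol_odd (show c ∈ extParity 𝕜 _ 1 by simpa using hc), neg_mul, mul_neg]

theorem oddField_mul_of_odd (hx : x ∈ totalParity 𝕜 L V (Module.Dual 𝕜 V) 1)
    (a b : Λ*[𝕜] V) :
    oddField x (a * b) = oddField x a * b + extInvol 𝕜 _ a * oddField x b := by
  refine totalParity_ext (f := oddField.flip (a * b)) (g := mulRight 𝕜 b ∘ₗ
    oddField.flip a + mulLeft 𝕜 (extInvol 𝕜 _ a) ∘ₗ oddField.flip b) (fun c hc X => ?_)
    (fun c hc v => ?_) hx
  · change oddField (c ⊗ₜ (X, 0)) (a * b) =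
      oddField (c ⊗ₜ (X, 0)) a * b + extInvol 𝕜 _ a * oddField (c ⊗ₜ (X, 0)) b
    simp only [oddField_even, LinearMap.zero_apply, zero_mul, mul_zero, add_zero]
  · change oddField (c ⊗ₜ (0, v)) (a * b) =
      oddField (c ⊗ₜ (0, v)) a * b + extInvol 𝕜 _ a * oddField (c ⊗ₜ (0, v)) b
    rw [oddField_tmul, oddField_tmul, oddField_tmul, extContract_mul, mul_add, ← mul_assoc,
      ← mul_assoc c (extInvol _ _ a), ext_even_mul (show c ∈ extParity 𝕜 _ 0 from hc) (extInvol _ _ a),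
      mul_assoc (extInvol _ _ a)]

theorem oddField_extInvol_of_odd (hx : x ∈ totalParity 𝕜 L V (Module.Dual 𝕜 V) 1)
    (a : Λ*[𝕜] V) :
    oddField x (extInvol 𝕜 _ a) = -extInvol 𝕜 _ (oddField x a) := by
  refine totalParity_ext (f := oddField.flip (extInvol 𝕜 _ a))
    (g := -((extInvol 𝕜 _).toLinearMap ∘ₗ oddField.flip a)) (fun c hc X => ?_) (fun c hc v => ?_) hx
  · change oddField (c ⊗ₜ (X, 0)) (extInvol 𝕜 _ a) = -extInvol 𝕜 _ (oddField (c ⊗ₜ (X, 0)) a)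
    simp only [oddField_even, LinearMap.zero_apply, map_zero, neg_zero]
  · change oddField (c ⊗ₜ (0, v)) (extInvol 𝕜 _ a) = -extInvol 𝕜 _ (oddField (c ⊗ₜ (0, v)) a)
    simp only [oddField_tmul, map_mul, extContract_extInvol,
      extInvol_even (show c ∈ extParity 𝕜 _ 0 from hc), mul_neg]

end Parity

/-! ### The canonical odd element -/

variable [FiniteDimensional 𝕜 V]

variable (𝕜 L V) in
/-- The canonical element `∑ θʲ ⊗ Ξⱼ` of `V* ⊗ V`, in the Grassmann envelope over `ΛV*`. -/
def oddGen : Λ*[𝕜] V ⊗[𝕜] (L × V) :=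
  ∑ i, ι 𝕜 ((finBasis 𝕜 V).coord i) ⊗ₜ (0, finBasis 𝕜 V i)

theorem oddGen_mem_totalParity : oddGen 𝕜 L V ∈ totalParity 𝕜 L V (Module.Dual 𝕜 V) 0 :=
  Submodule.sum_mem _ fun _ _ =>
    tmul_odd_mem_totalParity (by simpa using ι_mem_extParity (𝕜 := 𝕜) _) _

theorem oddGen_mem_extFil : oddGen 𝕜 L V ∈ extFil 𝕜 (Module.Dual 𝕜 V) (L × V) 1 :=
  Submodule.sum_mem _ fun _ _ => tmul_mem_extFil (ι_mem_extPow _) _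

theorem oddPart_oddGen : oddPart (oddGen 𝕜 L V) = oddGen 𝕜 L V := by
  rw [oddGen, map_sum]; rfl

/-- For a linear form `α` on `V`, contraction of the canonical element with `α` gives `ι(α)`. -/
theorem sum_apply_smul_ι (α : Module.Dual 𝕜 V) :
    ∑ i, α (finBasis 𝕜 V i) • ι 𝕜 ((finBasis 𝕜 V).coord i) =
      ι 𝕜 α := by
  conv_rhs => rw [← (finBasis 𝕜 V).sum_dual_apply_smul_coord α, map_sum]
  exact Finset.sum_congr rfl fun i _ => (map_smul _ _ _).symm

/-- A vector field `x` maps the canonical element to the odd component of `x`. -/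
theorem rTensor_oddField_oddGen (x : Λ*[𝕜] V ⊗[𝕜] (L × V)) :
    rTensor (L × V) (oddField x) (oddGen 𝕜 L V) = oddPart x := by
  induction x using env_induction with
  | zero => simp only [map_zero, LinearMap.rTensor_zero, LinearMap.zero_apply]
  | add x y hx hy => simp only [map_add, LinearMap.rTensor_add, LinearMap.add_apply, hx, hy]
  | even a X => simp only [oddField_even, oddPart_even, LinearMap.rTensor_zero,
      LinearMap.zero_apply]
  | odd a v =>
    have h : a ⊗ₜ[𝕜] ((0, v) : L × V) =
        ∑ i, a ⊗ₜ ((finBasis 𝕜 V).coord i v • ((0, finBasis 𝕜 V i) : L × V)) := by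
      rw [← tmul_sum]
      congr 1
      refine Prod.ext (by simp [Prod.fst_sum]) ?_
      rw [Prod.snd_sum]
      exact ((finBasis 𝕜 V).sum_repr v).symm
    rw [oddPart_odd]
    refine Eq.trans ?_ h.symm
    rw [oddGen, map_sum]
    refine Finset.sum_congr rfl fun i _ => ?_
    simp only [rTensor_tmul, oddField_tmul, extContract_ι, ← Algebra.commutes,
      ← Algebra.smul_def, smul_tmul]
    rfl

end VectorFields

/-! ### The coefficients of the invariant vector fields -/

section Coefficients

variable {𝕜 : Type*} [RCLike 𝕜] {L V : Type*} [AddCommGroup L] [Module 𝕜 L] [AddCommGroup V]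
  [Module 𝕜 V] [FiniteDimensional 𝕜 V]

/-- The adjoint action `u = ad(∑ θʲ ⊗ Ξⱼ)` of the canonical odd element on `ΛV* ⊗ 𝔤`. -/
def adGen (br : Bil[𝕜] (L × V)) :
    Module.End 𝕜 (Λ*[𝕜] V ⊗[𝕜] (L × V)) :=
  superAct (Module.Dual 𝕜 V) br (oddGen 𝕜 L V)

variable {br : Bil[𝕜] (L × V)}

theorem isNilpotent_of_mem_raising {W M : Type*} [AddCommGroup W] [Module 𝕜 W]
    [FiniteDimensional 𝕜 W] [AddCommGroup M] [Module 𝕜 M]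
    {O : Module.End 𝕜 (Λ[𝕜] W ⊗[𝕜] M)} (hO : O ∈ raising 𝕜 W M) : IsNilpotent O :=
  ⟨_, pow_eq_zero_of_mem_raising hO⟩

theorem adGen_mem_raising : adGen br ∈ raising 𝕜 (Module.Dual 𝕜 V) (L × V) :=
  superAct_mem_raising oddGen_mem_extFil

theorem isNilpotent_adGen : IsNilpotent (adGen br) :=
  isNilpotent_of_mem_raising adGen_mem_raising

variable (br) in
/-- The left logarithmic differential `T = p₀ + φ(u) p₁`, `φ(u) = (eᵘ - 1)/u`, of the exponential map
`θ ↦ exp(∑ θʲ Ξⱼ)`, followed by the translation to the right. -/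
def logDiff : Module.End 𝕜 (Λ*[𝕜] V ⊗[𝕜] (L × V)) :=
  evenPart + phiNil 𝕜 (adGen br) * oddPart

theorem extPow_succ_le {W : Type*} [AddCommGroup W] [Module 𝕜 W] (k : ℕ) :
    extPow 𝕜 W (k + 1) ≤ extPow 𝕜 W k := by
  simp only [extPow, pow_succ, mul_assoc]
  exact mul_le_mul' le_rfl le_top

theorem extFil_succ_le {W M : Type*} [AddCommGroup W] [Module 𝕜 W] [AddCommGroup M] [Module 𝕜 M]
    (k : ℕ) : extFil 𝕜 W M (k + 1) ≤ extFil 𝕜 W M k :=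
  Submodule.map₂_le_map₂_left (extPow_succ_le k)

theorem lTensor_mem_extFil {W M : Type*} [AddCommGroup W] [Module 𝕜 W] [AddCommGroup M] [Module 𝕜 M]
    {N : Type*} [AddCommGroup N] [Module 𝕜 N] (f : M →ₗ[𝕜] N) {k : ℕ}
    {t : Λ[𝕜] W ⊗[𝕜] M} (ht : t ∈ extFil 𝕜 W M k) :
    lTensor _ f t ∈ extFil 𝕜 W N k := by
  have h : extFil 𝕜 W M k ≤ (extFil 𝕜 W N k).comap (lTensor _ f) :=
    Submodule.map₂_le.2 fun a ha x _ => tmul_mem_extFil ha _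
  exact h ht

/-- `φ(u) ≡ 1` modulo raising operators. -/
theorem phiNil_sub_one_mem_raising {W M : Type*} [AddCommGroup W] [Module 𝕜 W]
    [FiniteDimensional 𝕜 W] [AddCommGroup M] [Module 𝕜 M]
    {O : Module.End 𝕜 (Λ[𝕜] W ⊗[𝕜] M)} (hO : O ∈ raising 𝕜 W M) :
    phiNil 𝕜 O - 1 ∈ raising 𝕜 W M := by
  have hpow : ∀ i, O ^ (i + 1) ∈ raising 𝕜 W M := by
    intro i
    induction i with
    | zero => rwa [zero_add, pow_one]
    | succ i ih =>
      rw [pow_succ']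
      exact fun k t ht => extFil_succ_le _ (hO _ _ (ih k t ht))
  rw [phiNil_eq_sum (pow_eq_zero_of_mem_raising hO), Finset.sum_range_succ']
  simp only [zero_add, Nat.factorial_one, Nat.cast_one, inv_one, pow_zero, one_smul]
  have e : ∀ A : Module.End 𝕜 (Λ[𝕜] W ⊗[𝕜] M), A + 1 - 1 = A :=
    fun A => add_sub_cancel_right A 1
  rw [e]
  exact Submodule.sum_mem _ fun i _ => Submodule.smul_mem _ _ (hpow i)

theorem logDiff_sub_one_mem_raising :
    logDiff br - 1 ∈ raising 𝕜 (Module.Dual 𝕜 V) (L × V) := by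
  have h : logDiff br - 1 = (phiNil 𝕜 (adGen br) - 1) * oddPart := by
    simp only [logDiff, sub_mul (phiNil 𝕜 (adGen br)), one_mul]
    have : (1 : Module.End 𝕜 (Λ*[𝕜] V ⊗[𝕜] (L × V))) = evenPart + oddPart :=
      LinearMap.ext fun z => (evenPart_add_oddPart z).symm
    rw [this]; abel
  rw [h]
  exact fun k t ht => phiNil_sub_one_mem_raising adGen_mem_raising k _ (lTensor_mem_extFil _ ht)

theorem isUnit_logDiff : IsUnit (logDiff br) := by
  have : logDiff br = 1 + (logDiff br - 1) := by abel
  rw [this]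
  have h : IsNilpotent (logDiff br - 1) := isNilpotent_of_mem_raising logDiff_sub_one_mem_raising
  exact IsNilpotent.isUnit_one_add
    (R := Module.End 𝕜 (Λ*[𝕜] V ⊗[𝕜] (L × V))) h

variable (br) in
/-- The inverse of the logarithmic differential. -/
def logDiffInv : Module.End 𝕜 (Λ*[𝕜] V ⊗[𝕜] (L × V)) :=
  Ring.inverse (logDiff br)

theorem logDiff_logDiffInv (z : Λ*[𝕜] V ⊗[𝕜] (L × V)) :
    logDiff br (logDiffInv br z) = z :=
  LinearMap.congr_fun (Ring.mul_inverse_cancel _ isUnit_logDiff) z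

theorem logDiffInv_logDiff (z : Λ*[𝕜] V ⊗[𝕜] (L × V)) :
    logDiffInv br (logDiff br z) = z :=
  LinearMap.congr_fun (Ring.inverse_mul_cancel _ isUnit_logDiff) z

theorem logDiff_apply (z : Λ*[𝕜] V ⊗[𝕜] (L × V)) :
    logDiff br z = evenPart z + phiNil 𝕜 (adGen br) (oddPart z) := rfl

theorem logDiff_even (a : Λ*[𝕜] V) (X : L) :
    logDiff br (a ⊗ₜ (X, 0)) = a ⊗ₜ (X, 0) := by
  simp only [logDiff_apply, evenPart_even, oddPart_even, map_zero, add_zero]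

theorem logDiffInv_even (a : Λ*[𝕜] V) (X : L) :
    logDiffInv br (a ⊗ₜ (X, 0)) = a ⊗ₜ (X, 0) := by
  conv_lhs => rw [← logDiff_even (br := br) a X]
  exact logDiffInv_logDiff _

theorem logDiff_injective {z w : Λ*[𝕜] V ⊗[𝕜] (L × V)}
    (h : logDiff br z = logDiff br w) : z = w := by
  rw [← logDiffInv_logDiff (br := br) z, h, logDiffInv_logDiff]

theorem adGen_smul (a : Λ*[𝕜] V)
    (z : Λ*[𝕜] V ⊗[𝕜] (L × V)) :
    adGen br (a • z) = a • adGen br z := superAct_mulLeft oddGen_mem_totalParity a z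

end Coefficients

section Coefficients

variable {𝕜 : Type*} [RCLike 𝕜] {L V : Type*} [AddCommGroup L] [Module 𝕜 L] [AddCommGroup V]
  [Module 𝕜 V] {br : Bil[𝕜] (L × V)}

theorem eq_zero_of_eq_neg_self {M : Type*} [AddCommGroup M] [Module 𝕜 M] {x : M} (h : x = -x) : x = 0 := by
  have h2 : (2 : 𝕜) • x = 0 := by rw [two_smul]; exact add_eq_zero_iff_eq_neg.mpr h
  exact (smul_eq_zero.mp h2).resolve_left two_ne_zero

section EnvParity

variable {W : Type*} [AddCommGroup W] [Module 𝕜 W]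

theorem envInvol_of_even {z : Λ[𝕜] W ⊗[𝕜] (L × V)} (hz : z ∈ totalParity 𝕜 L V W 0) :
    envInvol z = z :=
  totalParity_ext (f := envInvol) (g := LinearMap.id)
    (fun a ha X => by rw [envInvol_even, extInvol_even ha]; rfl)
    (fun a ha v => by
      rw [envInvol_odd, extInvol_odd (show a ∈ extParity 𝕜 W 1 by simpa using ha),
        neg_tmul, neg_neg]; rfl) hz

theorem envInvol_of_odd {z : Λ[𝕜] W ⊗[𝕜] (L × V)} (hz : z ∈ totalParity 𝕜 L V W 1) :
    envInvol z = -z :=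
  totalParity_ext (f := envInvol) (g := -LinearMap.id)
    (fun a ha X => by rw [envInvol_even, extInvol_odd ha, neg_tmul]; rfl)
    (fun a ha v => by
      rw [envInvol_odd, extInvol_even (show a ∈ extParity 𝕜 W 0 from ha)]; rfl) hz

theorem exists_totalParity_add (z : Λ[𝕜] W ⊗[𝕜] (L × V)) :
    ∃ x ∈ totalParity 𝕜 L V W 0, ∃ y ∈ totalParity 𝕜 L V W 1, z = x + y := by
  induction z using env_induction with
  | zero => exact ⟨0, Submodule.zero_mem _, 0, Submodule.zero_mem _, (add_zero 0).symm⟩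
  | add z z' hz hz' =>
    obtain ⟨x, hx, y, hy, rfl⟩ := hz
    obtain ⟨x', hx', y', hy', rfl⟩ := hz'
    exact ⟨x + x', Submodule.add_mem _ hx hx', y + y', Submodule.add_mem _ hy hy', by abel⟩
  | even a X =>
    obtain ⟨b, hb, c, hc, rfl⟩ := exists_even_add_odd a
    exact ⟨_, tmul_even_mem_totalParity hb X, _, tmul_even_mem_totalParity hc X,
      add_tmul _ _ _⟩
  | odd a v =>
    obtain ⟨b, hb, c, hc, rfl⟩ := exists_even_add_odd a
    exact ⟨_, tmul_odd_mem_totalParity (i := 0) (by simpa using hc) v, _,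
      tmul_odd_mem_totalParity (i := 1) hb v,
      by rw [add_tmul, add_comm]⟩

theorem mem_totalParity_zero_iff {z : Λ[𝕜] W ⊗[𝕜] (L × V)} :
    z ∈ totalParity 𝕜 L V W 0 ↔ envInvol z = z := by
  refine ⟨envInvol_of_even, fun h => ?_⟩
  obtain ⟨x, hx, y, hy, rfl⟩ := exists_totalParity_add z
  rw [map_add, envInvol_of_even hx, envInvol_of_odd hy] at h
  rw [eq_zero_of_eq_neg_self (𝕜 := 𝕜) (add_left_cancel h).symm, add_zero]
  exact hx

theorem mem_totalParity_one_iff {z : Λ[𝕜] W ⊗[𝕜] (L × V)} :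
    z ∈ totalParity 𝕜 L V W 1 ↔ envInvol z = -z := by
  refine ⟨envInvol_of_odd, fun h => ?_⟩
  obtain ⟨x, hx, y, hy, rfl⟩ := exists_totalParity_add z
  rw [map_add, envInvol_of_even hx, envInvol_of_odd hy, neg_add] at h
  rw [eq_zero_of_eq_neg_self (𝕜 := 𝕜) (add_right_cancel h), zero_add]
  exact hy

theorem mem_totalParity_of_commute {O : Module.End 𝕜 (Λ[𝕜] W ⊗[𝕜] (L × V))}
    (hO : ∀ z, envInvol (O z) = O (envInvol z)) {i : ZMod 2}
    {z : Λ[𝕜] W ⊗[𝕜] (L × V)} (hz : z ∈ totalParity 𝕜 L V W i) :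
    O z ∈ totalParity 𝕜 L V W i := by
  fin_cases i
  · exact mem_totalParity_zero_iff.mpr (by rw [hO, envInvol_of_even hz])
  · exact mem_totalParity_one_iff.mpr (by rw [hO, envInvol_of_odd hz, map_neg])

theorem envInvol_superAct (hbr : IsLieSuper br) (z w : Λ[𝕜] W ⊗[𝕜] (L × V)) :
    envInvol (superAct W br z w) = superAct W br (envInvol z) (envInvol w) := by
  refine superAct_natural (fun a => rfl) (fun X Y => ?_) z w
  have hX : ∀ X : L × V, X = (X.1, 0) + (0, X.2) := fun X => by simp
  have hneg : ∀ v : V, ((0, -v) : L × V) = -(0, v) := fun v => by simp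
  have h1 : ∀ X : L, (LinearMap.id.prodMap (-LinearMap.id) : (L × V) →ₗ[𝕜] L × V) (X, 0) = (X, 0) :=
    fun X => by simp
  have h2 : ∀ v : V, (LinearMap.id.prodMap (-LinearMap.id) : (L × V) →ₗ[𝕜] L × V) (0, v) = -(0, v) :=
    fun v => by simp
  rw [hX X, hX Y]
  simp only [map_add, LinearMap.add_apply, h1, h2, map_neg, LinearMap.neg_apply]
  rw [hbr.even_even, hbr.even_odd, hbr.odd_even, hbr.odd_odd, h1, h1, h2, h2]
  abel

end EnvParity

theorem envInvol_oddPart (z : Λ*[𝕜] V ⊗[𝕜] (L × V)) :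
    envInvol (oddPart z) = oddPart (envInvol z) := by
  refine env_ext (f := envInvol ∘ₗ oddPart) (g := oddPart ∘ₗ envInvol) (fun a X => ?_)
    (fun a v => ?_) z <;>
  simp only [comp_apply, envInvol_even, envInvol_odd, oddPart_even, oddPart_odd, map_zero,
    map_neg]

theorem evenPart_eq (z : Λ*[𝕜] V ⊗[𝕜] (L × V)) :
    evenPart z = z - oddPart z := by
  rw [eq_sub_iff_add_eq, evenPart_add_oddPart]

variable [FiniteDimensional 𝕜 V]

theorem envInvol_adGen (hbr : IsLieSuper br) (z : Λ*[𝕜] V ⊗[𝕜] (L × V)) :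
    envInvol (adGen br z) = adGen br (envInvol z) := by
  rw [adGen, envInvol_superAct hbr, envInvol_of_even oddGen_mem_totalParity]

/-- An operator which commutes with `u` and with the projections commutes with `T`. -/
theorem commute_logDiff {O : Module.End 𝕜 (Λ*[𝕜] V ⊗[𝕜] (L × V))}
    (hu : ∀ z, O (adGen br z) = adGen br (O z)) (hp : ∀ z, O (oddPart z) = oddPart (O z))
    (z : Λ*[𝕜] V ⊗[𝕜] (L × V)) :
    O (logDiff br z) = logDiff br (O z) := by
  rw [logDiff_apply, logDiff_apply, map_add, evenPart_eq, evenPart_eq, map_sub, hp, ← hp,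
    ← phiNil_intertwine isNilpotent_adGen isNilpotent_adGen (fun z => (hu z).symm), hp]

theorem commute_logDiffInv {O : Module.End 𝕜 (Λ*[𝕜] V ⊗[𝕜] (L × V))}
    (hu : ∀ z, O (adGen br z) = adGen br (O z)) (hp : ∀ z, O (oddPart z) = oddPart (O z))
    (z : Λ*[𝕜] V ⊗[𝕜] (L × V)) :
    O (logDiffInv br z) = logDiffInv br (O z) := by
  apply logDiff_injective (br := br)
  rw [← commute_logDiff hu hp, logDiff_logDiffInv, logDiff_logDiffInv]

theorem commute_expNil_adGen {O : Module.End 𝕜 (Λ*[𝕜] V ⊗[𝕜] (L × V))}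
    (hu : ∀ z, O (adGen br z) = adGen br (O z))
    (z : Λ*[𝕜] V ⊗[𝕜] (L × V)) :
    O (expNil 𝕜 (adGen br) z) = expNil 𝕜 (adGen br) (O z) :=
  (expNil_intertwine isNilpotent_adGen isNilpotent_adGen (fun z => (hu z).symm) z).symm

theorem logDiffInv_smul (a : Λ*[𝕜] V)
    (z : Λ*[𝕜] V ⊗[𝕜] (L × V)) :
    logDiffInv br (a • z) = a • logDiffInv br z :=
  (commute_logDiffInv (O := Module.toModuleEnd 𝕜 (S := Λ*[𝕜] V) _ a)
    (fun z => (adGen_smul a z).symm) (fun z => (oddPart_smul a z).symm) z).symm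

variable (br) in
/-- The coefficients `T⁻¹ eᵘ (1 ⊗ X)` of the left-invariant vector field which is given by `X`. -/
def leftCoeff : (L × V) →ₗ[𝕜] Λ*[𝕜] V ⊗[𝕜] (L × V) :=
  logDiffInv br ∘ₗ expNil 𝕜 (adGen br) ∘ₗ TensorProduct.mk 𝕜 _ _ 1

variable (br) in
/-- The coefficients `T⁻¹ (1 ⊗ Z)` of the vector field `Z` which is translated from the right to the
left at the points of `G`. -/
def rightCoeff : (L × V) →ₗ[𝕜] Λ*[𝕜] V ⊗[𝕜] (L × V) :=
  logDiffInv br ∘ₗ TensorProduct.mk 𝕜 _ _ 1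

theorem logDiff_leftCoeff (X : L × V) :
    logDiff br (leftCoeff br X) = expNil 𝕜 (adGen br) (1 ⊗ₜ X) := logDiff_logDiffInv _

theorem logDiff_rightCoeff (X : L × V) : logDiff br (rightCoeff br X) = 1 ⊗ₜ X :=
  logDiff_logDiffInv _

omit [FiniteDimensional 𝕜 V] in
theorem one_tmul_mem_totalParity {i : ZMod 2} {X : L × V} (hX : X ∈ homog 𝕜 L V i) :
    (1 : Λ*[𝕜] V) ⊗ₜ X ∈ totalParity 𝕜 L V (Module.Dual 𝕜 V) i := by
  fin_cases i
  · obtain ⟨X, rfl⟩ : X ∈ LinearMap.range (inl 𝕜 L V) := hX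
    exact tmul_even_mem_totalParity one_mem_extParity X
  · obtain ⟨v, rfl⟩ : X ∈ LinearMap.range (inr 𝕜 L V) := hX
    refine tmul_odd_mem_totalParity (i := 1) ?_ v
    rw [show (1 : ZMod 2) + 1 = 0 from rfl]
    exact one_mem_extParity

theorem envInvol_logDiffInv (hbr : IsLieSuper br)
    (z : Λ*[𝕜] V ⊗[𝕜] (L × V)) :
    envInvol (logDiffInv br z) = logDiffInv br (envInvol z) :=
  commute_logDiffInv (O := envInvol) (envInvol_adGen hbr) envInvol_oddPart z

theorem envInvol_expNil_adGen (hbr : IsLieSuper br)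
    (z : Λ*[𝕜] V ⊗[𝕜] (L × V)) :
    envInvol (expNil 𝕜 (adGen br) z) = expNil 𝕜 (adGen br) (envInvol z) :=
  commute_expNil_adGen (O := envInvol) (envInvol_adGen hbr) z

theorem rightCoeff_mem (hbr : IsLieSuper br) {i : ZMod 2} {X : L × V} (hX : X ∈ homog 𝕜 L V i) :
    rightCoeff br X ∈ totalParity 𝕜 L V (Module.Dual 𝕜 V) i :=
  mem_totalParity_of_commute (O := logDiffInv br) (envInvol_logDiffInv hbr)
    (one_tmul_mem_totalParity hX)

theorem leftCoeff_mem (hbr : IsLieSuper br) {i : ZMod 2} {X : L × V} (hX : X ∈ homog 𝕜 L V i) :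
    leftCoeff br X ∈ totalParity 𝕜 L V (Module.Dual 𝕜 V) i :=
  mem_totalParity_of_commute (O := logDiffInv br) (envInvol_logDiffInv hbr)
    (mem_totalParity_of_commute (O := expNil 𝕜 (adGen br)) (envInvol_expNil_adGen hbr)
      (one_tmul_mem_totalParity hX))

/-- `u` exchanges the even and the odd part. -/
theorem oddPart_adGen_even (hbr : IsLieSuper br) (a : Λ*[𝕜] V) (X : L) :
    oddPart (adGen br (a ⊗ₜ (X, 0))) = adGen br (a ⊗ₜ (X, 0)) := by
  rw [adGen, oddGen, map_sum, LinearMap.sum_apply, map_sum]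
  refine Finset.sum_congr rfl fun i _ => ?_
  rw [superAct_odd, hbr.odd_even, oddPart_odd]

theorem rightCoeff_even (X : L) : rightCoeff br (X, 0) = 1 ⊗ₜ (X, 0) := logDiffInv_even 1 X

/-- The coefficients of the left-invariant vector field given by `X ∈ 𝔤₀` are linear in `θ`. -/
theorem leftCoeff_even (hbr : IsLieSuper br) (X : L) :
    leftCoeff br (X, 0) = 1 ⊗ₜ (X, 0) + adGen br (1 ⊗ₜ (X, 0)) := by
  apply logDiff_injective (br := br)
  have h : evenPart (adGen br ((1 : Λ*[𝕜] V) ⊗ₜ[𝕜] ((X, 0) : L × V))) = 0 := by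
    rw [evenPart_eq, oddPart_adGen_even hbr, sub_self]
  rw [logDiff_leftCoeff, map_add, logDiff_even, logDiff_apply, h, zero_add, oddPart_adGen_even hbr,
    expNil_eq_one_add isNilpotent_adGen]
  rfl

theorem phiNil_apply_of_apply_eq_zero {M : Type*} [AddCommGroup M] [Module 𝕜 M] {O : Module.End 𝕜 M}
    (hO : IsNilpotent O) {x : M} (hx : O x = 0) : phiNil 𝕜 O x = x := by
  obtain ⟨k, hk⟩ := hO
  rw [phiNil_eq_sum (pow_eq_zero_of_le (Nat.le_succ k) hk), Finset.sum_range_succ', LinearMap.add_apply,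
    LinearMap.sum_apply, Finset.sum_eq_zero fun i _ => ?_]
  · simp
  · rw [LinearMap.smul_apply, pow_succ, Module.End.mul_apply, hx, map_zero, smul_zero]

theorem adGen_oddGen (hbr : IsLieSuper br) : adGen br (oddGen 𝕜 L V) = 0 := by
  apply eq_zero_of_eq_neg_self (𝕜 := 𝕜)
  rw [adGen, oddGen, map_sum]
  simp only [map_sum, LinearMap.sum_apply, superAct_odd, extInvol_ι]
  conv_lhs => rw [Finset.sum_comm]
  rw [← Finset.sum_neg_distrib]
  refine Finset.sum_congr rfl fun i _ => ?_
  rw [← Finset.sum_neg_distrib]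
  refine Finset.sum_congr rfl fun j _ => ?_
  rw [hbr.symm_odd_odd, ← neg_tmul, ext_ι_mul, map_neg, extInvol_ι, neg_neg, mul_neg,
    neg_neg]

theorem logDiff_oddGen (hbr : IsLieSuper br) : logDiff br (oddGen 𝕜 L V) = oddGen 𝕜 L V := by
  rw [logDiff_apply, evenPart_eq, oddPart_oddGen, sub_self, zero_add,
    phiNil_apply_of_apply_eq_zero isNilpotent_adGen (adGen_oddGen hbr)]

/-- Contracted with the odd coordinates, the coefficients of the left-invariant vector fields are those
of the Euler vector field. -/
theorem sum_ι_smul_leftCoeff (hbr : IsLieSuper br) :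
    ∑ i, ι 𝕜 ((finBasis 𝕜 V).coord i) •
      leftCoeff br (0, finBasis 𝕜 V i) = oddGen 𝕜 L V := by
  have hn : expNil 𝕜 (adGen br) (oddGen 𝕜 L V) = oddGen 𝕜 L V := by
    rw [expNil_eq_one_add isNilpotent_adGen, LinearMap.add_apply, Module.End.mul_apply,
      adGen_oddGen hbr, map_zero, add_zero]
    rfl
  have hsmul : ∀ (a : Λ*[𝕜] V) X,
      a • leftCoeff br X = logDiffInv br (expNil 𝕜 (adGen br) (a ⊗ₜ X)) := by
    intro a X
    rw [leftCoeff, comp_apply, ← logDiffInv_smul, comp_apply]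
    congr 1
    have := commute_expNil_adGen (br := br)
      (O := Module.toModuleEnd 𝕜 (S := Λ*[𝕜] V) _ a)
      (fun z => (adGen_smul a z).symm) (1 ⊗ₜ X)
    refine this.trans ?_
    congr 1
    change (a * 1) ⊗ₜ X = _
    rw [mul_one]
  simp only [hsmul]
  rw [← map_sum, ← map_sum]
  apply logDiff_injective (br := br)
  rw [logDiff_logDiffInv, logDiff_oddGen hbr]
  exact hn

end Coefficients

/-! ### Superderivations of `F ⊗ ΛV*` -/

section FieldOp

variable {𝕜 : Type*} [RCLike 𝕜] {L V : Type*} [AddCommGroup L] [Module 𝕜 L] [AddCommGroup V]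
  [Module 𝕜 V] {F : Type*} [CommRing F] [Algebra 𝕜 F] {D : L →ₗ[𝕜] Module.End 𝕜 F}

variable (V D) in
/-- The operators `f ⊗ c ↦ D_X f ⊗ ac`. -/
def evenFieldOp : Λ*[𝕜] V ⊗[𝕜] (L × V) →ₗ[𝕜]
    Module.End 𝕜 (F ⊗[𝕜] Λ*[𝕜] V) :=
  TensorProduct.lift (LinearMap.mk₂ 𝕜
    (fun a X => TensorProduct.map (D X.1) (mulLeft 𝕜 a))
    (fun a b X => by
      rw [← TensorProduct.map_add_right]
      exact congrArg _ (LinearMap.ext fun x => add_mul a b x))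
    (fun c a X => by
      rw [← TensorProduct.map_smul_right]
      exact congrArg _ (LinearMap.ext fun x => smul_mul_assoc c a x))
    (fun a X Y => by simp only [Prod.fst_add, map_add, TensorProduct.map_add_left])
    (fun c a X => by simp only [Prod.smul_fst, map_smul, TensorProduct.map_smul_left]))

variable (V D) in
/-- The superderivation of `F ⊗ ΛV*` with the coefficients `a ⊗ (X, v)`: it is `a (D_X + ∂_v)`, where
`L` acts on `F` by the derivations `D`. -/
def fieldOp : Λ*[𝕜] V ⊗[𝕜] (L × V) →ₗ[𝕜]
    Module.End 𝕜 (F ⊗[𝕜] Λ*[𝕜] V) :=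
  evenFieldOp V D + LinearMap.lTensorHom F ∘ₗ oddField

theorem fieldOp_even (a c : Λ*[𝕜] V) (X : L) (f : F) :
    fieldOp V D (a ⊗ₜ (X, 0)) (f ⊗ₜ c) = D X f ⊗ₜ (a * c) := by
  change D X f ⊗ₜ (a * c) + f ⊗ₜ oddField (a ⊗ₜ (X, 0)) c = _
  simp only [oddField_even, LinearMap.zero_apply, tmul_zero, add_zero]

theorem fieldOp_odd (a c : Λ*[𝕜] V) (v : V) (f : F) :
    fieldOp V D (a ⊗ₜ (0, v)) (f ⊗ₜ c) = f ⊗ₜ oddField (a ⊗ₜ ((0, v) : L × V)) c := by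
  change D 0 f ⊗ₜ (a * c) + f ⊗ₜ oddField (a ⊗ₜ ((0, v) : L × V)) c = _
  simp only [map_zero, LinearMap.zero_apply, zero_tmul, zero_add]

theorem fieldOp_oddPart (z : Λ*[𝕜] V ⊗[𝕜] (L × V)) (f : F)
    (c : Λ*[𝕜] V) :
    fieldOp V D (oddPart z) (f ⊗ₜ c) = f ⊗ₜ oddField z c := by
  induction z using env_induction with
  | zero => simp only [map_zero, LinearMap.zero_apply, tmul_zero]
  | add x y hx hy =>
    simp only [map_add, LinearMap.add_apply, hx, hy, tmul_add]
  | even a X =>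
    simp only [oddPart_even, oddField_even, map_zero, LinearMap.zero_apply,
      tmul_zero]
  | odd a v => rw [oddPart_odd, fieldOp_odd]

theorem fieldOp_smul (a : Λ*[𝕜] V)
    (z : Λ*[𝕜] V ⊗[𝕜] (L × V))
    (t : F ⊗[𝕜] Λ*[𝕜] V) :
    fieldOp V D (a • z) t = (1 ⊗ₜ a) * fieldOp V D z t := by
  induction t with
  | zero => simp only [map_zero, mul_zero]
  | add t t' ht ht' => simp only [map_add, ht, ht', mul_add]
  | tmul f c =>
    induction z using env_induction with
    | zero => simp only [smul_zero, map_zero, LinearMap.zero_apply, mul_zero]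
    | add x y hx hy =>
      simp only [smul_add, map_add, LinearMap.add_apply, hx, hy, mul_add]
    | even b X =>
      simp only [smul_tmul', smul_eq_mul, fieldOp_even,
        tmul_mul_tmul, one_mul, mul_assoc]
    | odd b v =>
      simp only [smul_tmul', smul_eq_mul, fieldOp_odd,
        tmul_mul_tmul, one_mul, oddField_tmul, mul_assoc]

variable (𝕜 V F) in
/-- The elements of `F ⊗ ΛV*` of parity `j`. -/
def sectionParity (j : ZMod 2) : Submodule 𝕜 (F ⊗[𝕜] Λ*[𝕜] V) :=
  LinearMap.range (lTensor F (extParity 𝕜 (Module.Dual 𝕜 V) j).subtype)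

theorem tmul_mem_sectionParity {j : ZMod 2} (f : F) {c : Λ*[𝕜] V}
    (hc : c ∈ extParity 𝕜 (Module.Dual 𝕜 V) j) : f ⊗ₜ c ∈ sectionParity 𝕜 V F j :=
  ⟨f ⊗ₜ ⟨c, hc⟩, rfl⟩

theorem sectionParity_le {j : ZMod 2}
    {Q : Submodule 𝕜 (F ⊗[𝕜] Λ*[𝕜] V)}
    (h : ∀ (f : F), ∀ c ∈ extParity 𝕜 (Module.Dual 𝕜 V) j, f ⊗ₜ c ∈ Q) :
    sectionParity 𝕜 V F j ≤ Q := by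
  rintro _ ⟨t, rfl⟩
  induction t with
  | zero => rw [map_zero]; exact Submodule.zero_mem _
  | add x y hx hy => rw [map_add]; exact Submodule.add_mem _ hx hy
  | tmul f c => exact h f c.1 c.2

theorem ext_mul_swap {W : Type*} [AddCommGroup W] [Module 𝕜 W] {i j : ZMod 2}
    {a c : Λ[𝕜] W} (ha : a ∈ extParity 𝕜 W i)
    (hc : c ∈ extParity 𝕜 W j) : a * c = ssign 𝕜 i j • (c * a) := by
  fin_cases i
  · change _ = ssign 𝕜 0 j • _
    rw [ssign_of_left_even, one_smul]; exact ext_even_mul ha c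
  · fin_cases j
    · change _ = ssign 𝕜 1 0 • _
      rw [ssign_of_right_even, one_smul]; exact (ext_even_mul hc a).symm
    · change _ = ssign 𝕜 1 1 • _
      simp only [ssign_odd, neg_one_smul, ext_odd_mul ha, extInvol_odd hc, neg_mul]

theorem oddField_mul {i j : ZMod 2} {x : Λ*[𝕜] V ⊗[𝕜] (L × V)}
    (hx : x ∈ totalParity 𝕜 L V (Module.Dual 𝕜 V) i) {a : Λ*[𝕜] V}
    (ha : a ∈ extParity 𝕜 _ j) (b : Λ*[𝕜] V) :
    oddField x (a * b) = oddField x a * b + ssign 𝕜 i j • (a * oddField x b) := by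
  fin_cases i
  · change _ = _ + ssign 𝕜 0 j • _
    rw [ssign_of_left_even, one_smul]; exact oddField_mul_of_even hx a b
  · refine (oddField_mul_of_odd hx a b).trans ?_
    fin_cases j
    · change _ = _ + ssign 𝕜 1 0 • _
      simp only [ssign_of_right_even, one_smul, extInvol_even ha]
    · change _ = _ + ssign 𝕜 1 1 • _
      simp only [ssign_odd, neg_one_smul, extInvol_odd ha, neg_mul]

/-- `fieldOp` is a superderivation. -/
theorem fieldOp_mul (hD : ∀ X f g, D X (f * g) = D X f * g + f * D X g) {i j : ZMod 2}
    {x : Λ*[𝕜] V ⊗[𝕜] (L × V)}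
    (hx : x ∈ totalParity 𝕜 L V (Module.Dual 𝕜 V) i)
    {s : F ⊗[𝕜] Λ*[𝕜] V} (hs : s ∈ sectionParity 𝕜 V F j)
    (t : F ⊗[𝕜] Λ*[𝕜] V) :
    fieldOp V D x (s * t) = fieldOp V D x s * t + ssign 𝕜 i j • (s * fieldOp V D x t) := by
  revert s
  suffices H : ∀ (f : F), ∀ c ∈ extParity 𝕜 (Module.Dual 𝕜 V) j,
      fieldOp V D x ((f ⊗ₜ c) * t) = fieldOp V D x (f ⊗ₜ c) * t +
        ssign 𝕜 i j • ((f ⊗ₜ c) * fieldOp V D x t) from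
    fun s hs => sectionParity_le (Q := LinearMap.eqLocus
      (fieldOp V D x ∘ₗ mulRight 𝕜 t)
      (mulRight 𝕜 t ∘ₗ fieldOp V D x +
        ssign 𝕜 i j • mulRight 𝕜 (fieldOp V D x t))) H hs
  intro f c hc
  induction t with
  | zero => simp only [map_zero, mul_zero, smul_zero, add_zero]
  | add t t' ht ht' => simp only [mul_add, map_add, ht, ht', smul_add]; abel
  | tmul g d =>
    refine totalParity_ext (f := (fieldOp V D).flip ((f ⊗ₜ c) * (g ⊗ₜ d)))
      (g := mulRight 𝕜 (g ⊗ₜ d) ∘ₗ (fieldOp V D).flip (f ⊗ₜ c) +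
        ssign 𝕜 i j • (mulLeft 𝕜 (f ⊗ₜ c) ∘ₗ (fieldOp V D).flip (g ⊗ₜ d)))
      (fun a ha X => ?_) (fun a ha v => ?_) hx
    · change fieldOp V D (a ⊗ₜ (X, 0)) ((f ⊗ₜ c) * (g ⊗ₜ d)) =
        fieldOp V D (a ⊗ₜ (X, 0)) (f ⊗ₜ c) * (g ⊗ₜ d) +
          ssign 𝕜 i j • ((f ⊗ₜ c) * fieldOp V D (a ⊗ₜ (X, 0)) (g ⊗ₜ d))
      simp only [fieldOp_even, tmul_mul_tmul, hD, add_tmul,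
        ← mul_assoc, ← tmul_smul, ← smul_mul_assoc, ← ext_mul_swap ha hc]
    · change fieldOp V D (a ⊗ₜ (0, v)) ((f ⊗ₜ c) * (g ⊗ₜ d)) =
        fieldOp V D (a ⊗ₜ (0, v)) (f ⊗ₜ c) * (g ⊗ₜ d) +
          ssign 𝕜 i j • ((f ⊗ₜ c) * fieldOp V D (a ⊗ₜ (0, v)) (g ⊗ₜ d))
      simp only [fieldOp_odd, tmul_mul_tmul, ← tmul_smul,
        ← tmul_add, oddField_mul (tmul_odd_mem_totalParity ha v) hc]

theorem fieldOp_mem {i j : ZMod 2} {x : Λ*[𝕜] V ⊗[𝕜] (L × V)}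
    (hx : x ∈ totalParity 𝕜 L V (Module.Dual 𝕜 V) i)
    {s : F ⊗[𝕜] Λ*[𝕜] V} (hs : s ∈ sectionParity 𝕜 V F j) :
    fieldOp V D x s ∈ sectionParity 𝕜 V F (i + j) := by
  refine sectionParity_le (Q := (sectionParity 𝕜 V F (i + j)).comap (fieldOp V D x))
    (fun f c hc => ?_) hs
  refine totalParity_le (P := (sectionParity 𝕜 V F (i + j)).comap ((fieldOp V D).flip (f ⊗ₜ c)))
    (fun a ha X => ?_) (fun a ha v => ?_) hx
  · change fieldOp V D (a ⊗ₜ (X, 0)) (f ⊗ₜ c) ∈ sectionParity 𝕜 V F (i + j)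
    rw [fieldOp_even]
    exact tmul_mem_sectionParity _ (extParity_mul ha hc)
  · change fieldOp V D (a ⊗ₜ (0, v)) (f ⊗ₜ c) ∈ sectionParity 𝕜 V F (i + j)
    rw [fieldOp_odd, oddField_tmul]
    refine tmul_mem_sectionParity _ ?_
    have h := extParity_mul ha (extContract_mem (Module.Dual.eval 𝕜 V v) hc)
    rwa [add_add_add_comm, show (1 : ZMod 2) + 1 = 0 from rfl, add_zero] at h

end FieldOp

/-! ### Commutators with the left-invariant vector fields -/

section Brackets

variable {𝕜 : Type*} [RCLike 𝕜] {L V : Type*} [AddCommGroup L] [Module 𝕜 L] [AddCommGroup V]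
  [Module 𝕜 V] [FiniteDimensional 𝕜 V] {br : Bil[𝕜] (L × V)}

/-- The derivation `E` of `ΛV*` which is given by the nilpotent part `∑ θʲ [Ξⱼ, X]` of the
left-invariant vector field of `X ∈ 𝔤₀`. -/
def evenRot (br : Bil[𝕜] (L × V)) (X : L) :
    Module.End 𝕜 (Λ*[𝕜] V) :=
  oddField (adGen br (1 ⊗ₜ (X, 0)))

theorem adGen_even_mem (hbr : IsLieSuper br) (X : L) :
    adGen br (1 ⊗ₜ (X, 0)) ∈ totalParity 𝕜 L V (Module.Dual 𝕜 V) 0 :=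
  mem_totalParity_of_commute (O := adGen br) (envInvol_adGen hbr)
    (one_tmul_mem_totalParity (even_mem_homog X))

theorem evenRot_mul (hbr : IsLieSuper br) (X : L) (a b : Λ*[𝕜] V) :
    evenRot br X (a * b) = evenRot br X a * b + a * evenRot br X b :=
  oddField_mul_of_even (adGen_even_mem hbr X) a b

theorem evenRot_extInvol (hbr : IsLieSuper br) (X : L) (a : Λ*[𝕜] V) :
    evenRot br X (extInvol 𝕜 _ a) = extInvol 𝕜 _ (evenRot br X a) :=
  oddField_extInvol_of_even (adGen_even_mem hbr X) a

/-- The action of `[·, X]` on `V`. -/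
def oddAdRight (br : Bil[𝕜] (L × V)) (X : L) : V →ₗ[𝕜] V :=
  LinearMap.snd 𝕜 L V ∘ₗ br.flip (X, 0) ∘ₗ inr 𝕜 L V

theorem evenRot_ι (hbr : IsLieSuper br) (X : L) (α : Module.Dual 𝕜 V) :
    evenRot br X (ι 𝕜 α) = ι 𝕜 (α ∘ₗ oddAdRight br X) := by
  simp only [← sum_apply_smul_ι (α ∘ₗ oddAdRight br X), evenRot, adGen, oddGen, map_sum,
    LinearMap.sum_apply]
  refine Finset.sum_congr rfl fun i _ => ?_
  rw [superAct_odd, hbr.odd_even, oddField_tmul, map_one, mul_one, extContract_ι,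
    ← Algebra.commutes, ← Algebra.smul_def]
  rfl

theorem evenRot_extContract (hbr : IsLieSuper br) (X : L) (v : V)
    (a : Λ*[𝕜] V) :
    evenRot br X (extContract (Module.Dual.eval 𝕜 V v) a) =
      extContract (Module.Dual.eval 𝕜 V v) (evenRot br X a) +
        extContract (Module.Dual.eval 𝕜 V (br (X, 0) (0, v)).2) a := by
  have h1 : ∀ r : 𝕜, evenRot br X (algebraMap 𝕜 _ r) = 0 := by
    intro r
    have h := evenRot_mul hbr X 1 1
    rw [mul_one, one_mul, mul_one, left_eq_add] at h
    simp only [Algebra.algebraMap_eq_smul_one, map_smul, h, smul_zero]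
  induction a using ext_left_induction with
  | algebraMap r => simp only [h1, extContract_algebraMap, map_zero, add_zero]
  | add x y hx hy => simp only [map_add, hx, hy]; abel
  | ι_mul x α hx =>
    have hs : (br (X, 0) (0, v)).2 = -oddAdRight br X v := by
      rw [hbr.skew_even_odd]; rfl
    simp only [extContract_ι_mul, map_sub, map_smul, evenRot_mul hbr, hx, map_add, evenRot_ι hbr,
      mul_add]
    simp only [Module.Dual.eval_apply, comp_apply, hs, map_neg, neg_smul,
      LinearMap.neg_apply]
    abel

/-- The action of the left-invariant vector field of `X ∈ 𝔤₀` on the coefficients of vector fields. -/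
def lieOp (br : Bil[𝕜] (L × V)) (X : L) :
    Module.End 𝕜 (Λ*[𝕜] V ⊗[𝕜] (L × V)) :=
  rTensor (L × V) (evenRot br X) + superAct (Module.Dual 𝕜 V) br (1 ⊗ₜ (X, 0))

theorem lieOp_one_tmul (X : L) (Z : L × V) : lieOp br X (1 ⊗ₜ Z) = 1 ⊗ₜ br (X, 0) Z := by
  have h : ∀ z : Λ*[𝕜] V ⊗[𝕜] (L × V), oddField z 1 = 0 := by
    intro z
    induction z with
    | zero => rw [map_zero, LinearMap.zero_apply]
    | add x y hx hy => simp only [map_add, LinearMap.add_apply, hx, hy, add_zero]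
    | tmul a Y => simp only [oddField_tmul, extContract_one, mul_zero]
  simp only [lieOp, LinearMap.add_apply, rTensor_tmul, evenRot, h,
    zero_tmul, zero_add, superAct_even, one_mul]

theorem lieOp_oddGen (hbr : IsLieSuper br) (X : L) : lieOp br X (oddGen 𝕜 L V) = 0 := by
  rw [lieOp, LinearMap.add_apply, evenRot, rTensor_oddField_oddGen, oddPart_adGen_even hbr, adGen,
    oddGen, map_sum, map_sum, LinearMap.sum_apply, ← Finset.sum_add_distrib]
  refine Finset.sum_eq_zero fun i _ => ?_
  rw [superAct_odd, superAct_even, map_one, mul_one, one_mul, hbr.skew_odd_even,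
    tmul_neg, neg_add_cancel]

theorem lieOp_adGen (hbr : IsLieSuper br) (X : L)
    (z : Λ*[𝕜] V ⊗[𝕜] (L × V)) :
    lieOp br X (adGen br z) = adGen br (lieOp br X z) := by
  have h := lieOp_oddGen hbr X
  have h1 := rTensor_superAct_of_even (br := br) (evenRot_mul hbr X) (evenRot_extInvol hbr X)
    (oddGen 𝕜 L V) z
  have h2 := superAct_jacobi hbr (one_tmul_mem_totalParity (even_mem_homog X)) (oddGen 𝕜 L V) z
  rw [lieOp, LinearMap.add_apply] at h ⊢
  simp only [adGen, h1, h2, LinearMap.add_apply, map_add]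
  have h3 : superAct (Module.Dual 𝕜 V) br (rTensor (L × V) (evenRot br X) (oddGen 𝕜 L V)) z +
      superAct (Module.Dual 𝕜 V) br (superAct (Module.Dual 𝕜 V) br (1 ⊗ₜ (X, 0)) (oddGen 𝕜 L V)) z = 0 := by
    simp only [← LinearMap.add_apply, ← map_add, h, map_zero, LinearMap.zero_apply]
  rw [add_add_add_comm, h3, zero_add]

theorem lieOp_oddPart (hbr : IsLieSuper br) (X : L)
    (z : Λ*[𝕜] V ⊗[𝕜] (L × V)) :
    lieOp br X (oddPart z) = oddPart (lieOp br X z) := by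
  refine env_ext (f := lieOp br X ∘ₗ oddPart) (g := oddPart ∘ₗ lieOp br X) (fun a Y => ?_)
    (fun a v => ?_) z
  · rw [comp_apply, comp_apply, oddPart_even, map_zero, lieOp,
      LinearMap.add_apply, rTensor_tmul, superAct_even, map_add, oddPart_even,
      hbr.even_even, oddPart_even, add_zero]
  · rw [comp_apply, comp_apply, oddPart_odd, lieOp,
      LinearMap.add_apply, rTensor_tmul, superAct_even, map_add, oddPart_odd,
      hbr.even_odd, oddPart_odd]

theorem lieOp_leftCoeff (hbr : IsLieSuper br) (X : L) (Z : L × V) :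
    lieOp br X (leftCoeff br Z) = leftCoeff br (br (X, 0) Z) := by
  rw [leftCoeff, comp_apply, comp_apply,
    commute_logDiffInv (O := lieOp br X) (lieOp_adGen hbr X) (lieOp_oddPart hbr X),
    commute_expNil_adGen (O := lieOp br X) (lieOp_adGen hbr X), TensorProduct.mk_apply, lieOp_one_tmul]
  rfl

theorem lieOp_rightCoeff (hbr : IsLieSuper br) (X : L) (Z : L × V) :
    lieOp br X (rightCoeff br Z) = rightCoeff br (br (X, 0) Z) := by
  rw [rightCoeff, comp_apply,
    commute_logDiffInv (O := lieOp br X) (lieOp_adGen hbr X) (lieOp_oddPart hbr X),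
    TensorProduct.mk_apply, lieOp_one_tmul]
  rfl

variable {F : Type*} [CommRing F] [Algebra 𝕜 F] {D : L →ₗ[𝕜] Module.End 𝕜 F}

theorem fieldOp_leftCoeff_even (hbr : IsLieSuper br) (X : L) (f : F)
    (c : Λ*[𝕜] V) :
    fieldOp V D (leftCoeff br (X, 0)) (f ⊗ₜ c) = D X f ⊗ₜ c + f ⊗ₜ evenRot br X c := by
  rw [leftCoeff_even hbr, map_add, LinearMap.add_apply, fieldOp_even, one_mul,
    ← oddPart_adGen_even hbr, fieldOp_oddPart]
  rfl

theorem lieOp_tmul_even (hbr : IsLieSuper br) (X Y : L) (b : Λ*[𝕜] V) :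
    lieOp br X (b ⊗ₜ (Y, 0)) = evenRot br X b ⊗ₜ (Y, 0) + b ⊗ₜ ((br (X, 0) (Y, 0)).1, 0) := by
  rw [lieOp, LinearMap.add_apply, rTensor_tmul, superAct_even, one_mul, hbr.even_even]

theorem lieOp_tmul_odd (hbr : IsLieSuper br) (X : L) (v : V)
    (b : Λ*[𝕜] V) :
    lieOp br X (b ⊗ₜ (0, v)) = evenRot br X b ⊗ₜ (0, v) + b ⊗ₜ (0, (br (X, 0) (0, v)).2) := by
  rw [lieOp, LinearMap.add_apply, rTensor_tmul, superAct_even, one_mul, hbr.even_odd]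

theorem fieldOp_commutator_tmul_even (hbr : IsLieSuper br)
    (hDbr : ∀ X Y f, D ((br (X, 0) (Y, 0)).1) f = D X (D Y f) - D Y (D X f)) (X Y : L)
    (b c : Λ*[𝕜] V) (f : F) :
    fieldOp V D (leftCoeff br (X, 0)) (fieldOp V D (b ⊗ₜ (Y, 0)) (f ⊗ₜ c)) =
      fieldOp V D (lieOp br X (b ⊗ₜ (Y, 0))) (f ⊗ₜ c) +
        fieldOp V D (b ⊗ₜ (Y, 0)) (fieldOp V D (leftCoeff br (X, 0)) (f ⊗ₜ c)) := by
  simp only [fieldOp_even, fieldOp_leftCoeff_even hbr, map_add, lieOp_tmul_even hbr,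
    LinearMap.add_apply, evenRot_mul hbr, hDbr, tmul_add, sub_tmul]
  abel

theorem fieldOp_commutator_tmul_odd (hbr : IsLieSuper br) (X : L) (v : V)
    (b c : Λ*[𝕜] V) (f : F) :
    fieldOp V D (leftCoeff br (X, 0)) (fieldOp V D (b ⊗ₜ (0, v)) (f ⊗ₜ c)) =
      fieldOp V D (lieOp br X (b ⊗ₜ (0, v))) (f ⊗ₜ c) +
        fieldOp V D (b ⊗ₜ (0, v)) (fieldOp V D (leftCoeff br (X, 0)) (f ⊗ₜ c)) := by
  simp only [fieldOp_odd, fieldOp_leftCoeff_even hbr, map_add, lieOp_tmul_odd hbr,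
    LinearMap.add_apply]
  simp only [oddField_tmul]
  simp only [evenRot_mul hbr, evenRot_extContract hbr, mul_add, tmul_add]
  abel

/-- The commutator of the left-invariant vector field of `X ∈ 𝔤₀` with an arbitrary vector field. -/
theorem fieldOp_commutator_even (hbr : IsLieSuper br)
    (hDbr : ∀ X Y f, D ((br (X, 0) (Y, 0)).1) f = D X (D Y f) - D Y (D X f)) (X : L)
    (y : Λ*[𝕜] V ⊗[𝕜] (L × V))
    (t : F ⊗[𝕜] Λ*[𝕜] V) :
    fieldOp V D (leftCoeff br (X, 0)) (fieldOp V D y t) =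
      fieldOp V D (lieOp br X y) t + fieldOp V D y (fieldOp V D (leftCoeff br (X, 0)) t) := by
  generalize hO : fieldOp V D (leftCoeff br (X, 0)) = O
  have hadd : ∀ x y : Λ*[𝕜] V ⊗[𝕜] (L × V), ∀ t,
      fieldOp V D (x + y) t = fieldOp V D x t + fieldOp V D y t := fun x y t => by
    rw [map_add (fieldOp V D)]; rfl
  induction t with
  | zero => simp only [map_zero, add_zero]
  | add t t' ht ht' =>
    simp only [map_add]
    rw [ht, ht']; exact add_add_add_comm _ _ _ _
  | tmul f c =>
    induction y using env_induction with
    | zero =>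
      simp only [map_zero (lieOp br X), map_zero (fieldOp V D), LinearMap.zero_apply, map_zero,
        add_zero]
    | add x y hx hy =>
      rw [hadd, map_add, hx, hy, map_add (lieOp br X), hadd, hadd]
      exact add_add_add_comm _ _ _ _
    | even b Y => rw [← hO]; exact fieldOp_commutator_tmul_even hbr hDbr X Y b c f
    | odd b v => rw [← hO]; exact fieldOp_commutator_tmul_odd hbr X v b c f

end Brackets

/-! ### Supercommutators of odd vector fields -/

section OddBrackets

variable {𝕜 : Type*} [RCLike 𝕜] {L V : Type*} [AddCommGroup L] [Module 𝕜 L] [AddCommGroup V]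
  [Module 𝕜 V] {br : Bil[𝕜] (L × V)}

theorem totalParity_induction {W : Type*} [AddCommGroup W] [Module 𝕜 W] {i : ZMod 2}
    {motive : Λ[𝕜] W ⊗[𝕜] (L × V) → Prop} (zero : motive 0)
    (add : ∀ x y, motive x → motive y → motive (x + y))
    (smul : ∀ (c : 𝕜) x, motive x → motive (c • x))
    (even : ∀ a ∈ extParity 𝕜 W i, ∀ X : L, motive (a ⊗ₜ (X, 0)))
    (odd : ∀ a ∈ extParity 𝕜 W (i + 1), ∀ v : V, motive (a ⊗ₜ (0, v)))
    {z : Λ[𝕜] W ⊗[𝕜] (L × V)} (hz : z ∈ totalParity 𝕜 L V W i) : motive z :=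
  let P : Submodule 𝕜 (Λ[𝕜] W ⊗[𝕜] (L × V)) :=
    { carrier := {z | motive z}
      add_mem' := fun {x y} => add x y
      zero_mem' := zero
      smul_mem' := smul }
  totalParity_le (P := P) even odd hz

/-- The supercommutator of the odd vector fields with the coefficients `x` and `y`. -/
def oddFieldBracket (br : Bil[𝕜] (L × V))
    (x y : Λ*[𝕜] V ⊗[𝕜] (L × V)) :
    Λ*[𝕜] V ⊗[𝕜] (L × V) :=
  rTensor (L × V) (oddField x) y + rTensor (L × V) (oddField y) x +
    superAct (Module.Dual 𝕜 V) br (evenPart x) (evenPart y)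

theorem oddFieldBracket_add_left (x x' y : Λ*[𝕜] V ⊗[𝕜] (L × V)) :
    oddFieldBracket br (x + x') y = oddFieldBracket br x y + oddFieldBracket br x' y := by
  simp only [oddFieldBracket, map_add, LinearMap.rTensor_add, LinearMap.add_apply]
  abel

theorem oddFieldBracket_add_right (x y y' : Λ*[𝕜] V ⊗[𝕜] (L × V)) :
    oddFieldBracket br x (y + y') = oddFieldBracket br x y + oddFieldBracket br x y' := by
  simp only [oddFieldBracket, map_add, LinearMap.rTensor_add, LinearMap.add_apply]
  abel

theorem oddFieldBracket_smul_left (c : 𝕜)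
    (x y : Λ*[𝕜] V ⊗[𝕜] (L × V)) :
    oddFieldBracket br (c • x) y = c • oddFieldBracket br x y := by
  simp only [oddFieldBracket, map_smul, LinearMap.rTensor_smul, LinearMap.smul_apply, smul_add]

theorem oddFieldBracket_smul_right (c : 𝕜)
    (x y : Λ*[𝕜] V ⊗[𝕜] (L × V)) :
    oddFieldBracket br x (c • y) = c • oddFieldBracket br x y := by
  simp only [oddFieldBracket, map_smul, LinearMap.rTensor_smul, LinearMap.smul_apply, smul_add]

section Cases

variable (a b c : Λ*[𝕜] V) (X Y : L) (v w : V)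

theorem oddFieldBracket_even_even (hbr : IsLieSuper br) :
    oddFieldBracket br (a ⊗ₜ (X, 0)) (b ⊗ₜ (Y, 0)) = (a * b) ⊗ₜ ((br (X, 0) (Y, 0)).1, 0) := by
  rw [oddFieldBracket, oddField_even, oddField_even, evenPart_even, evenPart_even, superAct_even,
    LinearMap.rTensor_zero, LinearMap.zero_apply, LinearMap.zero_apply, add_zero, zero_add,
    hbr.even_even]

theorem oddFieldBracket_even_odd : oddFieldBracket br (a ⊗ₜ (X, 0)) (b ⊗ₜ (0, w)) =
    (b * extContract (Module.Dual.eval 𝕜 V w) a) ⊗ₜ (X, 0) := by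
  simp only [oddFieldBracket, oddField_even, evenPart_even, evenPart_odd, map_zero,
    LinearMap.rTensor_zero, LinearMap.zero_apply, add_zero, zero_add, rTensor_tmul,
    oddField_tmul]

theorem oddFieldBracket_odd_even : oddFieldBracket br (a ⊗ₜ (0, v)) (b ⊗ₜ (Y, 0)) =
    (a * extContract (Module.Dual.eval 𝕜 V v) b) ⊗ₜ (Y, 0) := by
  simp only [oddFieldBracket, oddField_even, evenPart_even, evenPart_odd, map_zero,
    LinearMap.zero_apply, LinearMap.rTensor_zero, add_zero, rTensor_tmul, oddField_tmul]

theorem oddFieldBracket_odd_odd : oddFieldBracket br (a ⊗ₜ (0, v)) (b ⊗ₜ (0, w)) =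
    (a * extContract (Module.Dual.eval 𝕜 V v) b) ⊗ₜ (0, w) +
      (b * extContract (Module.Dual.eval 𝕜 V w) a) ⊗ₜ (0, v) := by
  simp only [oddFieldBracket, evenPart_odd, map_zero, add_zero, rTensor_tmul,
    oddField_tmul]

variable {a b} {F : Type*} [CommRing F] [Algebra 𝕜 F] {D : L →ₗ[𝕜] Module.End 𝕜 F} (f : F)

theorem fieldOp_anticomm_even_even (hbr : IsLieSuper br)
    (hDbr : ∀ X Y f, D ((br (X, 0) (Y, 0)).1) f = D X (D Y f) - D Y (D X f))
    (ha : a ∈ extParity 𝕜 _ 1) (hb : b ∈ extParity 𝕜 _ 1) :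
    fieldOp V D (a ⊗ₜ (X, 0)) (fieldOp V D (b ⊗ₜ (Y, 0)) (f ⊗ₜ c)) +
      fieldOp V D (b ⊗ₜ (Y, 0)) (fieldOp V D (a ⊗ₜ (X, 0)) (f ⊗ₜ c)) =
      fieldOp V D (oddFieldBracket br (a ⊗ₜ (X, 0)) (b ⊗ₜ (Y, 0))) (f ⊗ₜ c) := by
  have h : b * a = -(a * b) := by rw [ext_odd_mul hb, extInvol_odd ha, neg_mul]
  rw [oddFieldBracket_even_even a b X Y hbr]
  simp only [fieldOp_even, ← mul_assoc]
  rw [h, hDbr, neg_mul, tmul_neg, sub_tmul, sub_eq_add_neg]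

theorem fieldOp_anticomm_even_odd (ha : a ∈ extParity 𝕜 _ 1) (hb : b ∈ extParity 𝕜 _ 0) :
    fieldOp V D (a ⊗ₜ (X, 0)) (fieldOp V D (b ⊗ₜ (0, w)) (f ⊗ₜ c)) +
      fieldOp V D (b ⊗ₜ (0, w)) (fieldOp V D (a ⊗ₜ (X, 0)) (f ⊗ₜ c)) =
      fieldOp V D (oddFieldBracket br (a ⊗ₜ (X, 0)) (b ⊗ₜ (0, w))) (f ⊗ₜ c) := by
  rw [oddFieldBracket_even_odd a b X w]
  simp only [fieldOp_even, fieldOp_odd, oddField_tmul]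
  simp only [extContract_mul, extInvol_odd ha, ← tmul_add, neg_mul, mul_add, mul_neg,
    ← mul_assoc a b, ← ext_even_mul hb a]
  simp only [mul_assoc]
  congr 1
  abel

theorem fieldOp_anticomm_odd_odd (ha : a ∈ extParity 𝕜 _ 0) (hb : b ∈ extParity 𝕜 _ 0) :
    fieldOp V D (a ⊗ₜ (0, v)) (fieldOp V D (b ⊗ₜ (0, w)) (f ⊗ₜ c)) +
      fieldOp V D (b ⊗ₜ (0, w)) (fieldOp V D (a ⊗ₜ (0, v)) (f ⊗ₜ c)) =
      fieldOp V D (oddFieldBracket br (a ⊗ₜ (0, v)) (b ⊗ₜ (0, w))) (f ⊗ₜ c) := by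
  simp only [oddFieldBracket_odd_odd a b v w, map_add, LinearMap.add_apply]
  simp only [fieldOp_odd, oddField_tmul]
  simp only [extContract_mul, extInvol_even ha, extInvol_even hb,
    extContract_comm (Module.Dual.eval 𝕜 V w), ← tmul_add, mul_add, mul_neg,
    ← mul_assoc b a, ext_even_mul hb a]
  simp only [mul_assoc]
  congr 1
  abel

end Cases

theorem exists_submodule_anticomm {M S : Type*} [AddCommGroup M] [Module 𝕜 M] [AddCommGroup S] [Module 𝕜 S]
    (φ : M →ₗ[𝕜] Module.End 𝕜 S) (y : M) (t : S) {b : M → M → M} (hadd : ∀ x x', b (x + x') y = b x y + b x' y)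
    (hsmul : ∀ (r : 𝕜) x, b (r • x) y = r • b x y) :
    ∃ Q : Submodule 𝕜 M, ∀ x, x ∈ Q ↔ φ x (φ y t) + φ y (φ x t) = φ (b x y) t :=
  ⟨LinearMap.eqLocus (φ.flip (φ y t) + φ y ∘ₗ φ.flip t) (φ.flip t ∘ₗ
    { toFun := fun x => b x y
      map_add' := hadd
      map_smul' := hsmul }), fun _ => Iff.rfl⟩

/-- The supercommutator of two odd vector fields. -/
theorem fieldOp_anticomm {F : Type*} [CommRing F] [Algebra 𝕜 F] {D : L →ₗ[𝕜] Module.End 𝕜 F}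
    (hbr : IsLieSuper br) (hDbr : ∀ X Y f, D ((br (X, 0) (Y, 0)).1) f = D X (D Y f) - D Y (D X f))
    {x y : Λ*[𝕜] V ⊗[𝕜] (L × V)}
    (hx : x ∈ totalParity 𝕜 L V (Module.Dual 𝕜 V) 1) (hy : y ∈ totalParity 𝕜 L V (Module.Dual 𝕜 V) 1)
    (t : F ⊗[𝕜] Λ*[𝕜] V) :
    fieldOp V D x (fieldOp V D y t) + fieldOp V D y (fieldOp V D x t) =
      fieldOp V D (oddFieldBracket br x y) t := by
  have h11 : (1 : ZMod 2) + 1 = 0 := rfl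
  induction t with
  | zero => simp only [map_zero, add_zero]
  | add t t' ht ht' => simp only [map_add, ← ht, ← ht']; exact add_add_add_comm _ _ _ _
  | tmul f c =>
    have hleft : ∀ y, ∃ Q : Submodule 𝕜 (Λ*[𝕜] V ⊗[𝕜] (L × V)), ∀ x, x ∈ Q ↔
        fieldOp V D x (fieldOp V D y (f ⊗ₜ c)) + fieldOp V D y (fieldOp V D x (f ⊗ₜ c)) =
          fieldOp V D (oddFieldBracket br x y) (f ⊗ₜ c) := fun y =>
      exists_submodule_anticomm (𝕜 := 𝕜) (fieldOp V D) y (f ⊗ₜ c) (fun x x' => oddFieldBracket_add_left x x' y)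
        (fun r x => oddFieldBracket_smul_left r x y)
    have hright : ∀ x, ∃ Q : Submodule 𝕜 (Λ*[𝕜] V ⊗[𝕜] (L × V)), ∀ y, y ∈ Q ↔
        fieldOp V D y (fieldOp V D x (f ⊗ₜ c)) + fieldOp V D x (fieldOp V D y (f ⊗ₜ c)) =
          fieldOp V D (oddFieldBracket br x y) (f ⊗ₜ c) := fun x =>
      exists_submodule_anticomm (𝕜 := 𝕜) (fieldOp V D) x (f ⊗ₜ c) (b := fun y x => oddFieldBracket br x y)
        (fun y y' => oddFieldBracket_add_right x y y') (fun r y => oddFieldBracket_smul_right r x y)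
    obtain ⟨Q, hQ⟩ := hleft y
    refine (hQ x).mp (totalParity_induction (motive := (· ∈ Q)) Q.zero_mem (fun _ _ => Q.add_mem)
      (fun r _ => Q.smul_mem r) (fun a ha X => (hQ _).mpr ?_) (fun a ha v => (hQ _).mpr ?_) hx)
    · obtain ⟨R, hR⟩ := hright (a ⊗ₜ (X, 0))
      refine (add_comm _ _).trans ((hR y).mp (totalParity_induction (motive := (· ∈ R)) R.zero_mem
        (fun _ _ => R.add_mem) (fun r _ => R.smul_mem r) (fun b hb Y => (hR _).mpr ?_)
        (fun b hb w => (hR _).mpr ?_) hy))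
      · exact (add_comm _ _).trans (fieldOp_anticomm_even_even c X Y f hbr hDbr ha hb)
      · exact (add_comm _ _).trans (fieldOp_anticomm_even_odd c X w f ha (h11 ▸ hb))
    · obtain ⟨R, hR⟩ := hright (a ⊗ₜ (0, v))
      refine (add_comm _ _).trans ((hR y).mp (totalParity_induction (motive := (· ∈ R)) R.zero_mem
        (fun _ _ => R.add_mem) (fun r _ => R.smul_mem r) (fun b hb Y => (hR _).mpr ?_)
        (fun b hb w => (hR _).mpr ?_) hy))
      · simp only [fieldOp_anticomm_even_odd (br := br) (D := D) c Y v f hb (h11 ▸ ha),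
          oddFieldBracket_odd_even, oddFieldBracket_even_odd]
      · exact (add_comm _ _).trans (fieldOp_anticomm_odd_odd c v w f (h11 ▸ ha) (h11 ▸ hb))

end OddBrackets

/-! ### The brackets of the odd invariant vector fields -/

section AffineExtension

variable {𝕜 : Type*} [RCLike 𝕜] {M : Type*} [AddCommGroup M] [Module 𝕜 M]

/-- The extension of `u` to `𝕜 δ ⊕ M` which maps the formal generator `δ` to `-w`. -/
def affineExt (u : Module.End 𝕜 M) (w : M) : Module.End 𝕜 (𝕜 × M) :=
  inr 𝕜 _ _ ∘ₗ
    (u ∘ₗ LinearMap.snd 𝕜 _ _ - LinearMap.toSpanSingleton 𝕜 _ w ∘ₗ LinearMap.fst 𝕜 _ _)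

variable {u : Module.End 𝕜 M} {w : M}

theorem affineExt_apply (c : 𝕜) (z : M) : affineExt u w (c, z) = (0, u z - c • w) := rfl

theorem affineExt_pow (k : ℕ) (c : 𝕜) (z : M) :
    (affineExt u w ^ (k + 1)) (c, z) = (0, (u ^ (k + 1)) z - c • (u ^ k) w) := by
  induction k with
  | zero => simp only [zero_add, pow_one, pow_zero, affineExt_apply]; rfl
  | succ k ih =>
    rw [pow_succ', Module.End.mul_apply, ih, affineExt_apply, zero_smul, sub_zero, map_sub, map_smul,
      ← Module.End.mul_apply, ← Module.End.mul_apply, ← pow_succ', ← pow_succ']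

theorem affineExt_pow_eq_zero {k : ℕ} (hk : u ^ k = 0) : affineExt u w ^ (k + 1) = 0 := by
  refine LinearMap.ext fun p => ?_
  rw [show p = (p.1, p.2) from rfl, affineExt_pow, pow_succ, hk, zero_mul, LinearMap.zero_apply,
    LinearMap.zero_apply, smul_zero, sub_zero]
  rfl

theorem isNilpotent_affineExt (hu : IsNilpotent u) : IsNilpotent (affineExt u w) := by
  obtain ⟨k, hk⟩ := hu
  exact ⟨k + 1, affineExt_pow_eq_zero hk⟩

/-- `e^u δ = δ - φ(u) w`. -/
theorem expNil_affineExt (hu : IsNilpotent u) (c : 𝕜) (z : M) :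
    expNil 𝕜 (affineExt u w) (c, z) = (c, expNil 𝕜 u z - c • phiNil 𝕜 u w) := by
  obtain ⟨k, hk⟩ := hu
  have hk1 : u ^ (k + 1) = 0 := by simp only [pow_succ, hk, zero_mul]
  rw [expNil_eq_sum (affineExt_pow_eq_zero hk), expNil_eq_sum hk1, phiNil_eq_sum hk,
    LinearMap.sum_apply,
    LinearMap.sum_apply, LinearMap.sum_apply, Finset.sum_range_succ', Finset.sum_range_succ',
    Finset.smul_sum, add_sub_right_comm, ← Finset.sum_sub_distrib]
  have h0 : ((((0 : ℕ).factorial : 𝕜)⁻¹ • affineExt u w ^ 0) (c, z)) = (c, z) := by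
    rw [Nat.factorial_zero, Nat.cast_one, inv_one, one_smul, pow_zero]; rfl
  have h0' : ((((0 : ℕ).factorial : 𝕜)⁻¹ • u ^ 0) z) = z := by
    rw [Nat.factorial_zero, Nat.cast_one, inv_one, one_smul, pow_zero]; rfl
  rw [h0, h0']
  refine Prod.ext ?_ ?_
  · rw [Prod.fst_add, Prod.fst_sum, Finset.sum_eq_zero fun i _ => ?_, zero_add]
    simp only [LinearMap.smul_apply, affineExt_pow, Prod.smul_fst, smul_zero]
  · rw [Prod.snd_add, Prod.snd_sum]
    refine congrArg (· + z) (Finset.sum_congr rfl fun i _ => ?_)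
    simp only [LinearMap.smul_apply, affineExt_pow, Prod.smul_snd, smul_sub, smul_comm c]

/-- The bracket of `c δ_x + z` with `c' δ_y + z'`, as an element of `𝕜 [δ_x, δ_y] ⊕ M`; here `dx` and
`dy` are the actions of `δ_x` and `δ_y` on `M`, and `σ` is the parity automorphism of `M`. -/
def affineBracket (B : M →ₗ[𝕜] M →ₗ[𝕜] M) (dx dy σ : Module.End 𝕜 M) :
    𝕜 × M →ₗ[𝕜] 𝕜 × M →ₗ[𝕜] 𝕜 × M :=
  LinearMap.mk₂ 𝕜 (fun p q => (p.1 * q.1, p.1 • dx q.2 - q.1 • dy (σ p.2) + B p.2 q.2))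
    (fun p p' q => by
      refine Prod.ext (add_mul _ _ _) ?_
      simp only [Prod.fst_add, Prod.snd_add, map_add, LinearMap.add_apply, add_smul, smul_add]
      abel)
    (fun c p q => by
      refine Prod.ext (mul_assoc c _ _) ?_
      simp only [Prod.smul_fst, Prod.smul_snd, map_smul, LinearMap.smul_apply, smul_eq_mul,
        smul_add, smul_sub, smul_smul, mul_comm c])
    (fun p q q' => by
      refine Prod.ext (mul_add _ _ _) ?_
      simp only [Prod.fst_add, Prod.snd_add, map_add, add_smul, smul_add]
      abel)
    (fun c p q => by
      refine Prod.ext (mul_left_comm _ _ _) ?_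
      simp only [Prod.smul_fst, Prod.smul_snd, map_smul, smul_eq_mul,
        smul_add, smul_sub, smul_smul, mul_comm c])

variable {B : M →ₗ[𝕜] M →ₗ[𝕜] M} {dx dy σ : Module.End 𝕜 M} {wx wy : M}

theorem affineBracket_apply (p q : 𝕜 × M) : affineBracket B dx dy σ p q =
    (p.1 * q.1, p.1 • dx q.2 - q.1 • dy (σ p.2) + B p.2 q.2) := rfl

/-- Compatibility of the exponential with the bracket. -/
theorem expNil_affineBracket (hu : IsNilpotent u) (hdx : ∀ z, dx (u z) = B wx z + u (dx z))
    (hdy : ∀ z, dy (u z) = B wy z + u (dy z)) (hσ : ∀ z, σ (u z) = u (σ z)) (hwx : σ wx = -wx)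
    (hB : ∀ z, B z wy = -B wy (σ z)) (huB : ∀ z z', u (B z z') = B (u z) z' + B z (u z'))
    (p q : 𝕜 × M) :
    expNil 𝕜 (affineExt u (dx wy + dy wx)) (affineBracket B dx dy σ p q) =
      affineBracket B dx dy σ (expNil 𝕜 (affineExt u wx) p) (expNil 𝕜 (affineExt u wy) q) := by
  refine expNil_bilinear (isNilpotent_affineExt hu) (isNilpotent_affineExt hu)
    (isNilpotent_affineExt hu) _ ?_ p q
  rintro ⟨c, z⟩ ⟨c', z'⟩
  simp only [affineBracket_apply, affineExt_apply]
  refine Prod.ext (by simp) ?_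
  simp only [Prod.snd_add, zero_smul, map_add, map_sub, map_smul, LinearMap.sub_apply,
    LinearMap.smul_apply, hdx, hdy, hσ, hwx, hB, huB, map_neg, smul_add, smul_sub, smul_neg, mul_smul]
  rw [smul_comm c' c]
  abel

/-- The component in `M` of `expNil_affineBracket`, for elements `δ_x + ξ` and `δ_y + η`. -/
theorem expNil_affineBracket_snd (hu : IsNilpotent u) (hdx : ∀ z, dx (u z) = B wx z + u (dx z))
    (hdy : ∀ z, dy (u z) = B wy z + u (dy z)) (hσ : ∀ z, σ (u z) = u (σ z)) (hwx : σ wx = -wx)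
    (hB : ∀ z, B z wy = -B wy (σ z)) (huB : ∀ z z', u (B z z') = B (u z) z' + B z (u z'))
    {ξ η px py : M} (hpx : px + phiNil 𝕜 u wx = expNil 𝕜 u ξ)
    (hpy : py + phiNil 𝕜 u wy = expNil 𝕜 u η) :
    expNil 𝕜 u (dx η - dy (σ ξ) + B ξ η) =
      dx py - dy (σ px) + B px py + phiNil 𝕜 u (dx wy + dy wx) := by
  have h := congrArg Prod.snd
    (expNil_affineBracket hu hdx hdy hσ hwx hB huB ((1 : 𝕜), ξ) ((1 : 𝕜), η))
  rw [expNil_affineExt hu, expNil_affineExt hu, affineBracket_apply, affineBracket_apply,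
    expNil_affineExt hu, ← hpx, ← hpy] at h
  simp only [one_smul, mul_one, add_sub_cancel_right] at h
  exact sub_eq_iff_eq_add.mp h

end AffineExtension

section Flatness

variable {𝕜 : Type*} [RCLike 𝕜] {L V : Type*} [AddCommGroup L] [Module 𝕜 L] [AddCommGroup V]
  [Module 𝕜 V] [FiniteDimensional 𝕜 V] {br : Bil[𝕜] (L × V)}

variable {x y : Λ*[𝕜] V ⊗[𝕜] (L × V)}

/-- `[u, δ] = -ad(δ(∑ θʲ ⊗ Ξⱼ))` for odd vector fields. -/
theorem adGen_rTensor (hx : x ∈ totalParity 𝕜 L V (Module.Dual 𝕜 V) 1)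
    (z : Λ*[𝕜] V ⊗[𝕜] (L × V)) :
    rTensor (L × V) (oddField x) (adGen br z) =
      superAct (Module.Dual 𝕜 V) br (oddPart x) z +
        adGen br (rTensor (L × V) (oddField x) z) := by
  simp only [adGen, rTensor_superAct_of_odd (oddField_mul_of_odd hx) (oddField_extInvol_of_odd hx),
    rTensor_oddField_oddGen, envInvol_of_even oddGen_mem_totalParity]

omit [FiniteDimensional 𝕜 V] in
theorem oddPart_mem {i : ZMod 2} (hx : x ∈ totalParity 𝕜 L V (Module.Dual 𝕜 V) i) :
    oddPart x ∈ totalParity 𝕜 L V (Module.Dual 𝕜 V) i :=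
  mem_totalParity_of_commute envInvol_oddPart hx

omit [FiniteDimensional 𝕜 V] in
theorem evenPart_mem {i : ZMod 2} (hx : x ∈ totalParity 𝕜 L V (Module.Dual 𝕜 V) i) :
    evenPart x ∈ totalParity 𝕜 L V (Module.Dual 𝕜 V) i := by
  rw [evenPart_eq]; exact Submodule.sub_mem _ hx (oddPart_mem hx)

omit [FiniteDimensional 𝕜 V] in
theorem oddPart_rTensor (E : Module.End 𝕜 (Λ*[𝕜] V))
    (z : Λ*[𝕜] V ⊗[𝕜] (L × V)) :
    oddPart (rTensor (L × V) E z) = rTensor (L × V) E (oddPart z) := by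
  induction z with
  | zero => simp only [map_zero]
  | add x y hx hy => simp only [map_add, hx, hy]
  | tmul a X => rfl

omit [FiniteDimensional 𝕜 V] in
theorem rTensor_oddField_one_tmul (X : L × V) :
    rTensor (L × V) (oddField x) ((1 : Λ*[𝕜] V) ⊗ₜ X) = 0 := by
  have h : oddField x 1 = 0 := by
    induction x with
    | zero => rw [map_zero, LinearMap.zero_apply]
    | add x y hx hy => simp only [map_add, LinearMap.add_apply, hx, hy, add_zero]
    | tmul a Y => simp only [oddField_tmul, extContract_one, mul_zero]
  simp only [rTensor_tmul, h, zero_tmul]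

omit [FiniteDimensional 𝕜 V] in
theorem oddPart_superAct_evenPart (hbr : IsLieSuper br) (x y : Λ*[𝕜] V ⊗[𝕜] (L × V)) :
    oddPart (superAct (Module.Dual 𝕜 V) br (evenPart x) (evenPart y)) = 0 := by
  induction x using env_induction with
  | zero => simp only [map_zero, LinearMap.zero_apply]
  | add x x' hx hx' => simp only [map_add, LinearMap.add_apply, hx, hx', add_zero]
  | odd a v => simp only [evenPart_odd, map_zero, LinearMap.zero_apply]
  | even a X =>
    induction y using env_induction with
    | zero => simp only [map_zero]
    | add x x' hx hx' => simp only [map_add, hx, hx', add_zero]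
    | odd a v => simp only [evenPart_odd, map_zero]
    | even b Y => rw [evenPart_even, evenPart_even, superAct_even, hbr.even_even, oddPart_even]

omit [FiniteDimensional 𝕜 V] in
theorem oddPart_oddFieldBracket (hbr : IsLieSuper br)
    (x y : Λ*[𝕜] V ⊗[𝕜] (L × V)) :
    oddPart (oddFieldBracket br x y) = rTensor (L × V) (oddField x) (oddPart y) +
        rTensor (L × V) (oddField y) (oddPart x) := by
  simp only [oddFieldBracket, map_add, oddPart_superAct_evenPart hbr, add_zero, oddPart_rTensor]

omit [FiniteDimensional 𝕜 V] in
theorem evenPart_oddFieldBracket (hbr : IsLieSuper br)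
    (x y : Λ*[𝕜] V ⊗[𝕜] (L × V)) :
    evenPart (oddFieldBracket br x y) = rTensor (L × V) (oddField x) (evenPart y) +
        rTensor (L × V) (oddField y) (evenPart x) +
        superAct (Module.Dual 𝕜 V) br (evenPart x) (evenPart y) := by
  have e (E : Module.End 𝕜 (Λ*[𝕜] V))
      (z : Λ*[𝕜] V ⊗[𝕜] (L × V)) :
      rTensor (L × V) E (evenPart z) =
        rTensor (L × V) E z - rTensor (L × V) E (oddPart z) := by
    rw [evenPart_eq, map_sub]
  rw [e, e, evenPart_eq (oddFieldBracket br x y), oddPart_oddFieldBracket hbr, oddFieldBracket]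
  abel

omit [FiniteDimensional 𝕜 V] in
theorem superAct_one_tmul (X Y : L × V) :
    superAct (Module.Dual 𝕜 V) br (1 ⊗ₜ X) (1 ⊗ₜ Y) = 1 ⊗ₜ br X Y := by
  have hX : X = (X.1, 0) + (0, X.2) := by simp
  rw [hX, tmul_add, map_add, LinearMap.add_apply, superAct_even, superAct_odd, map_one,
    mul_one, ← tmul_add, map_add, LinearMap.add_apply]

omit [FiniteDimensional 𝕜 V] in
theorem rTensor_oddField_envInvol_one_tmul {X : L × V} (hX : X ∈ homog 𝕜 L V 1) :
    rTensor (L × V) (oddField y) (envInvol ((1 : Λ*[𝕜] V) ⊗ₜ X)) =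
      0 := by
  simp only [envInvol_of_odd (one_tmul_mem_totalParity hX), map_neg, rTensor_oddField_one_tmul,
    neg_zero]

/-- The bracket of two odd vector fields `x` and `y` whose images under the logarithmic derivative are
the exponentials of `1 ⊗ X` and of `η`, up to the terms of degree zero. -/
theorem expNil_oddFieldBracket (hbr : IsLieSuper br)
    (hx : x ∈ totalParity 𝕜 L V (Module.Dual 𝕜 V) 1)
    (hy : y ∈ totalParity 𝕜 L V (Module.Dual 𝕜 V) 1)
    {ξ η px py : Λ*[𝕜] V ⊗[𝕜] (L × V)}
    (hpx : px + phiNil 𝕜 (adGen br) (oddPart x) = expNil 𝕜 (adGen br) ξ)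
    (hpy : py + phiNil 𝕜 (adGen br) (oddPart y) = expNil 𝕜 (adGen br) η)
    (hη : rTensor (L × V) (oddField x) η = 0)
    (hξ : rTensor (L × V) (oddField y) (envInvol ξ) = 0) :
    expNil 𝕜 (adGen br) (superAct (Module.Dual 𝕜 V) br ξ η) =
      rTensor (L × V) (oddField x) py -
        rTensor (L × V) (oddField y) (envInvol px) +
        superAct (Module.Dual 𝕜 V) br px py +
        phiNil 𝕜 (adGen br) (oddPart (oddFieldBracket br x y)) := by
  have h := expNil_affineBracket_snd isNilpotent_adGen (adGen_rTensor (br := br) hx)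
    (adGen_rTensor hy) (envInvol_adGen hbr) (envInvol_of_odd (oddPart_mem hx))
    (superAct_skew hbr (oddPart_mem hy)) (superAct_jacobi hbr oddGen_mem_totalParity) hpx hpy
  rw [hη, hξ, sub_zero, zero_add, ← oddPart_oddFieldBracket hbr] at h
  exact h

theorem evenPart_add_phiNil_leftCoeff (X : L × V) :
    evenPart (leftCoeff br X) + phiNil 𝕜 (adGen br) (oddPart (leftCoeff br X)) =
      expNil 𝕜 (adGen br) (1 ⊗ₜ X) := by
  rw [← logDiff_leftCoeff, logDiff_apply]

theorem evenPart_add_phiNil_rightCoeff (Z : L × V) :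
    evenPart (rightCoeff br Z) - 1 ⊗ₜ Z + phiNil 𝕜 (adGen br) (oddPart (rightCoeff br Z)) =
      expNil 𝕜 (adGen br) 0 := by
  simp only [map_zero, sub_add_eq_add_sub, ← logDiff_apply, logDiff_rightCoeff, sub_self]

/-- The left-invariant odd vector fields satisfy the bracket relations. -/
theorem oddFieldBracket_leftCoeff (hbr : IsLieSuper br) {X Y : L × V} (hX : X ∈ homog 𝕜 L V 1)
    (hY : Y ∈ homog 𝕜 L V 1) :
    oddFieldBracket br (leftCoeff br X) (leftCoeff br Y) = leftCoeff br (br X Y) := by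
  have hx := leftCoeff_mem hbr hX
  have h := expNil_oddFieldBracket hbr hx (leftCoeff_mem hbr hY) (evenPart_add_phiNil_leftCoeff X)
    (evenPart_add_phiNil_leftCoeff Y) (rTensor_oddField_one_tmul Y)
    (rTensor_oddField_envInvol_one_tmul hX)
  apply logDiff_injective (br := br)
  rw [logDiff_leftCoeff, logDiff_apply, evenPart_oddFieldBracket hbr, ← superAct_one_tmul, h,
    envInvol_of_odd (evenPart_mem hx), map_neg, sub_neg_eq_add]

/-- The bracket of a left-invariant odd vector field with a vector field which is translated from the
right to the left. -/
theorem oddFieldBracket_rightCoeff (hbr : IsLieSuper br) {X Z : L × V} (hX : X ∈ homog 𝕜 L V 1)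
    (hZ : Z ∈ homog 𝕜 L V 1) :
    oddFieldBracket br (leftCoeff br X) (rightCoeff br Z) =
      logDiffInv br (superAct (Module.Dual 𝕜 V) br (evenPart (leftCoeff br X)) (1 ⊗ₜ Z)) := by
  have hx := leftCoeff_mem hbr hX
  have h := expNil_oddFieldBracket hbr hx (rightCoeff_mem hbr hZ) (evenPart_add_phiNil_leftCoeff X)
    (evenPart_add_phiNil_rightCoeff Z) (map_zero _) (rTensor_oddField_envInvol_one_tmul hX)
  rw [map_zero, map_zero, envInvol_of_odd (evenPart_mem hx), map_neg, sub_neg_eq_add, map_sub,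
    map_sub, rTensor_oddField_one_tmul, sub_zero] at h
  apply logDiff_injective (br := br)
  rw [logDiff_logDiffInv, logDiff_apply, evenPart_oddFieldBracket hbr]
  generalize superAct (Module.Dual 𝕜 V) br (evenPart (leftCoeff br X)) (1 ⊗ₜ Z) = q at h ⊢
  rw [← sub_eq_zero]
  refine Eq.trans ?_ h.symm
  abel

end Flatness

/-! ### The left-invariant vector fields -/

section LeftOp

variable {𝕜 : Type*} [RCLike 𝕜] {L V : Type*} [AddCommGroup L] [Module 𝕜 L] [AddCommGroup V]
  [Module 𝕜 V] [FiniteDimensional 𝕜 V] {br : Bil[𝕜] (L × V)}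
  {F : Type*} [CommRing F] [Algebra 𝕜 F] {D : L →ₗ[𝕜] Module.End 𝕜 F}

variable (br D) in
/-- The left-invariant vector fields: the action of `𝔤` on `F ⊗ ΛV*`. -/
def leftOp : (L × V) →ₗ[𝕜] Module.End 𝕜 (F ⊗[𝕜] Λ*[𝕜] V) :=
  fieldOp V D ∘ₗ leftCoeff br

theorem leftOp_apply (X : L × V) : leftOp br D X = fieldOp V D (leftCoeff br X) := rfl

theorem leftOp_even_apply (hbr : IsLieSuper br)
    (hDbr : ∀ X Y f, D ((br (X, 0) (Y, 0)).1) f = D X (D Y f) - D Y (D X f)) (X : L) (Y : L × V)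
    (s : F ⊗[𝕜] Λ*[𝕜] V) :
    leftOp br D (X, 0) (leftOp br D Y s) =
      leftOp br D (br (X, 0) Y) s + leftOp br D Y (leftOp br D (X, 0) s) := by
  rw [leftOp_apply, leftOp_apply, fieldOp_commutator_even hbr hDbr, lieOp_leftCoeff hbr]
  rfl

theorem leftOp_isSuperRepOn (hbr : IsLieSuper br)
    (hDbr : ∀ X Y f, D ((br (X, 0) (Y, 0)).1) f = D X (D Y f) - D Y (D X f)) :
    IsSuperRepOn br (leftOp br D) := by
  intro i j X hX Y hY s
  by_cases hi : i = 0
  · subst hi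
    obtain ⟨x, rfl⟩ : ∃ x, X = (x, 0) := ⟨X.1, Prod.ext rfl (mem_homog_zero.mp hX)⟩
    simp only [ssign_of_left_even, one_smul, leftOp_even_apply hbr hDbr]
  by_cases hj : j = 0
  · subst hj
    obtain ⟨y, rfl⟩ : ∃ y, Y = (y, 0) := ⟨Y.1, Prod.ext rfl (mem_homog_zero.mp hY)⟩
    have hsk : br X (y, 0) = -br (y, 0) X := by
      simp only [hbr.skew i 0 X hX _ hY, ssign_of_right_even, one_smul]
    simp only [ssign_of_right_even, one_smul, leftOp_even_apply hbr hDbr, hsk,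
      map_neg (leftOp br D), LinearMap.neg_apply]
    exact (neg_add_cancel_left _ _).symm
  · have h1 : ∀ k : ZMod 2, k ≠ 0 → k = 1 := by decide
    obtain rfl := h1 i hi
    obtain rfl := h1 j hj
    have h := fieldOp_anticomm hbr hDbr (leftCoeff_mem hbr hX) (leftCoeff_mem hbr hY) s
    rw [oddFieldBracket_leftCoeff hbr hX hY] at h
    rw [ssign_odd, neg_one_smul]
    exact eq_add_neg_of_add_eq h

theorem leftOp_mul (hbr : IsLieSuper br) (hD : ∀ X f g, D X (f * g) = D X f * g + f * D X g)
    {i j : ZMod 2} {X : L × V} (hX : X ∈ homog 𝕜 L V i)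
    {s : F ⊗[𝕜] Λ*[𝕜] V} (hs : s ∈ sectionParity 𝕜 V F j)
    (t : F ⊗[𝕜] Λ*[𝕜] V) :
    leftOp br D X (s * t) = leftOp br D X s * t + ssign 𝕜 i j • (s * leftOp br D X t) :=
  fieldOp_mul hD (leftCoeff_mem hbr hX) hs t

theorem leftOp_mem (hbr : IsLieSuper br) {i j : ZMod 2} {X : L × V} (hX : X ∈ homog 𝕜 L V i)
    {s : F ⊗[𝕜] Λ*[𝕜] V} (hs : s ∈ sectionParity 𝕜 V F j) :
    leftOp br D X s ∈ sectionParity 𝕜 V F (i + j) :=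
  fieldOp_mem (leftCoeff_mem hbr hX) hs

theorem evenRot_one (hbr : IsLieSuper br) (X : L) :
    evenRot br X (1 : Λ*[𝕜] V) = 0 := by
  have h := evenRot_mul hbr X 1 1
  rw [mul_one, mul_one, one_mul] at h
  exact left_eq_add.mp h

theorem leftOp_even_tmul_one (hbr : IsLieSuper br) (X : L) (f : F) :
    leftOp br D (X, 0) (f ⊗ₜ 1) = D X f ⊗ₜ 1 := by
  simp only [leftOp_apply, fieldOp_leftCoeff_even hbr, evenRot_one hbr, tmul_zero,
    add_zero]

theorem leftOp_even_one_tmul_ι (hbr : IsLieSuper br)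
    (hD : ∀ X f g, D X (f * g) = D X f * g + f * D X g) (X : L) (α : Module.Dual 𝕜 V) :
    leftOp br D (X, 0) (1 ⊗ₜ ι 𝕜 α) =
      1 ⊗ₜ ι 𝕜 (α ∘ₗ oddAdRight br X) := by
  have h1 : D X 1 = 0 := by
    have h := hD X 1 1
    rw [mul_one, mul_one, one_mul] at h
    exact left_eq_add.mp h
  simp only [leftOp_apply, fieldOp_leftCoeff_even hbr, h1, zero_tmul, zero_add,
    evenRot_ι hbr]

end LeftOp

/-! ### The Taylor formula in the odd directions -/

section Falling

variable {𝕜 : Type*} [RCLike 𝕜] {S : Type*} [AddCommGroup S] [Module 𝕜 S]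

/-- If `E` acts by `k` on the `k`-th graded piece of a filtration, then `s` is determined by the leading
terms of the elements `E (E - 1) ⋯ (E - k + 1) s`. -/
theorem eq_sum_of_leading_terms (Fil : ℕ → Submodule 𝕜 S) (h0 : Fil 0 = ⊤)
    (hanti : ∀ k, Fil (k + 1) ≤ Fil k) (E : Module.End 𝕜 S)
    (hE : ∀ k, ∀ s ∈ Fil k, E s - (k : 𝕜) • s ∈ Fil (k + 1)) (Y h : ℕ → S)
    (hY : ∀ k, Y (k + 1) = E (Y k) - (k : 𝕜) • Y k) (hh : ∀ k, E (h k) = (k : 𝕜) • h k)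
    (hYh : ∀ k, Y k - h k ∈ Fil (k + 1)) (k : ℕ) :
    Y 0 - ∑ j ∈ Finset.range k, ((j.factorial : 𝕜)⁻¹) • h j ∈ Fil k := by
  let P : ℕ → Module.End 𝕜 S := fun i => Nat.rec 1 (fun i p => (E - (i : 𝕜) • 1) * p) i
  have hP : ∀ i s, P (i + 1) s = E (P i s) - (i : 𝕜) • P i s := fun i s => rfl
  have hPY : ∀ i, P i (Y 0) = Y i := by
    intro i
    induction i with
    | zero => rfl
    | succ i ih => simp only [hP, ih, hY]
  have hPh : ∀ i j, P i (h j) = (∏ l ∈ Finset.range i, ((j : 𝕜) - l)) • h j := by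
    intro i j
    induction i with
    | zero => simp only [Finset.range_zero, Finset.prod_empty, one_smul]; rfl
    | succ i ih =>
      simp only [hP, ih, map_smul, hh, Finset.prod_range_succ, ← smul_assoc, ← sub_smul,
        smul_eq_mul]
      congr 1; ring
  have hEk : ∀ k, ∀ s ∈ Fil (k + 1), E s ∈ Fil (k + 1) := fun k s hs => by
    have := Submodule.add_mem _ (hanti _ (hE (k + 1) s hs)) (Submodule.smul_mem _ ((k + 1 : ℕ) : 𝕜) hs)
    rwa [sub_add_cancel] at this
  have hPz : ∀ i k, ∀ z ∈ Fil k, P i z - (∏ l ∈ Finset.range i, ((k : 𝕜) - l)) • z ∈ Fil (k + 1) := by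
    intro i k z hz
    induction i with
    | zero => simp only [Finset.range_zero, Finset.prod_empty, one_smul]; exact (sub_self z).symm ▸ zero_mem _
    | succ i ih =>
      rw [hP, Finset.prod_range_succ]
      generalize (∏ l ∈ Finset.range i, ((k : 𝕜) - l)) = c at ih ⊢
      have e : E (P i z) - (i : 𝕜) • P i z - (c * ((k : 𝕜) - i)) • z =
          E (P i z - c • z) - (i : 𝕜) • (P i z - c • z) + c • (E z - (k : 𝕜) • z) := by
        rw [map_sub, map_smul]; module
      rw [e]
      exact Submodule.add_mem _ (Submodule.sub_mem _ (hEk _ _ ih) (Submodule.smul_mem _ _ ih))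
        (Submodule.smul_mem _ _ (hE k z hz))
  have hfac : ∀ k : ℕ, (∏ l ∈ Finset.range k, ((k : 𝕜) - l)) = (k.factorial : 𝕜) := fun k => by
    rw [← Nat.descFactorial_self, Nat.descFactorial_eq_prod_range, Nat.cast_prod]
    exact Finset.prod_congr rfl fun l hl => (Nat.cast_sub (Finset.mem_range.mp hl).le).symm
  induction k with
  | zero => rw [h0]; trivial
  | succ k ih =>
    set z := Y 0 - ∑ j ∈ Finset.range k, ((j.factorial : 𝕜)⁻¹) • h j with hz
    have hkf : (k.factorial : 𝕜) ≠ 0 := Nat.cast_ne_zero.mpr k.factorial_ne_zero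
    have h1 : P k z = Y k := by
      rw [hz, map_sub, hPY, map_sum, Finset.sum_eq_zero, sub_zero]
      intro j hj
      rw [map_smul, hPh, Finset.prod_eq_zero hj (sub_self _), zero_smul, smul_zero]
    have h2 := hPz k k z ih
    rw [h1, hfac] at h2
    have h3 : (k.factorial : 𝕜) • z - h k ∈ Fil (k + 1) := by
      have := Submodule.sub_mem _ (hYh k) h2
      rwa [sub_sub_sub_cancel_left] at this
    have h4 := Submodule.smul_mem _ ((k.factorial : 𝕜)⁻¹) h3
    rw [smul_sub, inv_smul_smul₀ hkf] at h4
    rw [Finset.sum_range_succ, ← sub_sub]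
    exact h4

end Falling

section Ray

variable {𝕜 : Type*} [RCLike 𝕜] {L V : Type*} [AddCommGroup L] [Module 𝕜 L] [AddCommGroup V]
  [Module 𝕜 V] {F : Type*} [AddCommGroup F] [Module 𝕜 F]

/-- Multiplication of sections of `F ⊗ ΛV*` by elements of `ΛV*`. -/
def mulSection : Λ*[𝕜] V ⊗[𝕜]
    (F ⊗[𝕜] Λ*[𝕜] V) →ₗ[𝕜] F ⊗[𝕜] Λ*[𝕜] V :=
  TensorProduct.lift (LinearMap.lTensorHom F ∘ₗ LinearMap.mul 𝕜 _)

theorem mulSection_tmul (a b : Λ*[𝕜] V) (f : F) :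
    mulSection (a ⊗ₜ (f ⊗ₜ b)) = f ⊗ₜ (a * b) := rfl

/-- The body of a section of `F ⊗ ΛV*`: its component of degree zero. -/
def bodyMap : F ⊗[𝕜] Λ*[𝕜] V →ₗ[𝕜] F :=
  (TensorProduct.rid 𝕜 F).toLinearMap ∘ₗ
    lTensor F (ExteriorAlgebra.algebraMapInv (R := 𝕜) (M := Module.Dual 𝕜 V)).toLinearMap

theorem bodyMap_tmul (b : Λ*[𝕜] V) (f : F) :
    bodyMap (f ⊗ₜ b) = ExteriorAlgebra.algebraMapInv b • f := rfl

/-- The body of the second factor of `A ⊗ (F ⊗ ΛV*)`. -/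
def bodySection {A : Type*} [AddCommGroup A] [Module 𝕜 A] :
    A ⊗[𝕜] (F ⊗[𝕜] Λ*[𝕜] V) →ₗ[𝕜] F ⊗[𝕜] A :=
  (TensorProduct.comm 𝕜 A F).toLinearMap ∘ₗ lTensor A bodyMap

theorem bodySection_tmul' {A : Type*} [AddCommGroup A] [Module 𝕜 A] (a : A)
    (s : F ⊗[𝕜] Λ*[𝕜] V) :
    bodySection (a ⊗ₜ s) = bodyMap s ⊗ₜ a := rfl

theorem bodySection_tmul {A : Type*} [AddCommGroup A] [Module 𝕜 A] (a : A)
    (b : Λ*[𝕜] V) (f : F) :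
    bodySection (a ⊗ₜ (f ⊗ₜ b)) = (ExteriorAlgebra.algebraMapInv b • f) ⊗ₜ a := rfl

variable (𝕜 V F) in
/-- The filtration of the sections of `F ⊗ ΛV*` by the degree in the odd coordinates. -/
def sectionFil (k : ℕ) : Submodule 𝕜 (F ⊗[𝕜] Λ*[𝕜] V) :=
  Submodule.map₂ (TensorProduct.mk 𝕜 _ _) ⊤ (extPow 𝕜 (Module.Dual 𝕜 V) k)

theorem tmul_mem_sectionFil {k : ℕ} (f : F) {a : Λ*[𝕜] V}
    (ha : a ∈ extPow 𝕜 (Module.Dual 𝕜 V) k) : f ⊗ₜ a ∈ sectionFil 𝕜 V F k :=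
  Submodule.apply_mem_map₂ _ trivial ha

theorem sectionFil_zero : sectionFil 𝕜 V F 0 = ⊤ := by
  rw [eq_top_iff]
  rintro t -
  induction t with
  | zero => exact zero_mem _
  | add s t hs ht => exact add_mem hs ht
  | tmul f a => exact tmul_mem_sectionFil f (mem_extPow_zero a)

theorem sectionFil_succ_le (k : ℕ) : sectionFil 𝕜 V F (k + 1) ≤ sectionFil 𝕜 V F k :=
  Submodule.map₂_le_map₂_right (extPow_succ_le k)

theorem mulSection_sub_bodySection_mem {k : ℕ}
    {t : Λ*[𝕜] V ⊗[𝕜] (F ⊗[𝕜] Λ*[𝕜] V)}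
    (ht : t ∈ extFil 𝕜 (Module.Dual 𝕜 V) (F ⊗[𝕜] Λ*[𝕜] V) k) :
    mulSection t - bodySection t ∈ sectionFil 𝕜 V F (k + 1) := by
  have h : extFil 𝕜 (Module.Dual 𝕜 V) (F ⊗[𝕜] Λ*[𝕜] V) k ≤
      (sectionFil 𝕜 V F (k + 1)).comap (mulSection - bodySection) := by
    refine Submodule.map₂_le.2 fun a ha s _ => ?_
    change mulSection (a ⊗ₜ s) - bodySection (a ⊗ₜ s) ∈ sectionFil 𝕜 V F (k + 1)
    induction s with
    | zero => rw [tmul_zero, map_zero, map_zero, sub_zero]; exact zero_mem _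
    | add s t hs ht =>
      rw [tmul_add, map_add, map_add, add_sub_add_comm]
      exact add_mem (hs trivial) (ht trivial)
    | tmul f b =>
      rw [mulSection_tmul, bodySection_tmul, smul_tmul, ← tmul_sub]
      refine tmul_mem_sectionFil f ?_
      have hb : b - algebraMap 𝕜 _ (ExteriorAlgebra.algebraMapInv b) ∈
          extPow 𝕜 (Module.Dual 𝕜 V) 1 := by
        refine mem_extPow_one ?_
        rw [map_sub, ExteriorAlgebra.algebraMap_leftInverse, sub_self]
      have h := extPow_mul_mem ha hb
      rwa [mul_sub, ← Algebra.commutes, ← Algebra.smul_def] at h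
  exact h ht

variable [FiniteDimensional 𝕜 V]

variable (𝕜 V) in
/-- The Euler derivation of `ΛV*`. -/
def euler : Module.End 𝕜 (Λ*[𝕜] V) :=
  ∑ i, mulLeft 𝕜 (ι 𝕜 ((finBasis 𝕜 V).coord i)) *
    extContract (Module.Dual.eval 𝕜 V (finBasis 𝕜 V i))

theorem euler_apply (a : Λ*[𝕜] V) : euler 𝕜 V a =
    ∑ i, ι 𝕜 ((finBasis 𝕜 V).coord i) *
      extContract (Module.Dual.eval 𝕜 V (finBasis 𝕜 V i)) a := by
  rw [euler, LinearMap.sum_apply]; rfl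

theorem oddField_oddGen : oddField (oddGen 𝕜 L V) = euler 𝕜 V := by
  rw [oddGen, map_sum]; rfl

theorem euler_mul (a b : Λ*[𝕜] V) :
    euler 𝕜 V (a * b) = euler 𝕜 V a * b + a * euler 𝕜 V b := by
  rw [← oddField_oddGen (L := 𝕜)]
  exact oddField_mul_of_even oddGen_mem_totalParity a b

theorem euler_ι (α : Module.Dual 𝕜 V) :
    euler 𝕜 V (ι 𝕜 α) = ι 𝕜 α := by
  rw [euler_apply]
  refine Eq.trans (Finset.sum_congr rfl fun i _ => ?_) (sum_apply_smul_ι α)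
  simp only [extContract_ι, ← Algebra.commutes, ← Algebra.smul_def]
  rfl

theorem euler_ι_mul_sub (k : ℕ) (α : Module.Dual 𝕜 V) (b : Λ*[𝕜] V) :
    euler 𝕜 V (ι 𝕜 α * b) - ((k + 1 : ℕ) : 𝕜) • (ι 𝕜 α * b) =
      ι 𝕜 α * (euler 𝕜 V b - (k : 𝕜) • b) := by
  simp only [euler_mul, euler_ι, mul_sub, mul_smul_comm, Nat.cast_succ, add_smul, one_smul]
  abel

theorem extPow_succ (W : Type*) [AddCommGroup W] [Module 𝕜 W] (k : ℕ) : extPow 𝕜 W (k + 1) =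
    LinearMap.range (ι 𝕜 (M := W)) * extPow 𝕜 W k := by
  simp only [extPow, pow_succ', mul_assoc]

theorem euler_sub_mem {k : ℕ} {a : Λ*[𝕜] V}
    (ha : a ∈ extPow 𝕜 (Module.Dual 𝕜 V) k) :
    euler 𝕜 V a - (k : 𝕜) • a ∈ extPow 𝕜 (Module.Dual 𝕜 V) (k + 1) := by
  induction k generalizing a with
  | zero =>
    simp only [Nat.cast_zero, zero_smul, sub_zero, euler_apply]
    rw [zero_add]
    exact Submodule.sum_mem _ fun i _ =>
      extPow_mul_mem (k := 1) (l := 0) (ι_mem_extPow _) (mem_extPow_zero _)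
  | succ k ih =>
    rw [extPow_succ] at ha
    refine Submodule.mul_induction_on ha ?_ fun x y hx hy => ?_
    · rintro _ ⟨α, rfl⟩ b hb
      rw [euler_ι_mul_sub, extPow_succ]
      exact Submodule.mul_mem_mul ⟨α, rfl⟩ (ih hb)
    · simp only [map_add, smul_add, add_sub_add_comm]
      exact Submodule.add_mem _ hx hy

theorem lTensor_euler_sub_mem {k : ℕ} {s : F ⊗[𝕜] Λ*[𝕜] V}
    (hs : s ∈ sectionFil 𝕜 V F k) :
    lTensor F (euler 𝕜 V) s - (k : 𝕜) • s ∈ sectionFil 𝕜 V F (k + 1) := by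
  have h : sectionFil 𝕜 V F k ≤ (sectionFil 𝕜 V F (k + 1)).comap
      (lTensor F (euler 𝕜 V) - (k : 𝕜) • LinearMap.id) := by
    refine Submodule.map₂_le.2 fun f _ a ha => ?_
    change f ⊗ₜ euler 𝕜 V a - (k : 𝕜) • (f ⊗ₜ a) ∈ sectionFil 𝕜 V F (k + 1)
    rw [← tmul_smul, ← tmul_sub]
    exact tmul_mem_sectionFil f (euler_sub_mem ha)
  exact h hs

variable {S : Type*} [AddCommGroup S] [Module 𝕜 S] {ρ : (L × V) →ₗ[𝕜] S →ₗ[𝕜] S}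

theorem superAct_oddGen (a : Λ*[𝕜] V) (s : S) :
    superAct (Module.Dual 𝕜 V) ρ (oddGen 𝕜 L V) (a ⊗ₜ s) =
      ∑ i, (a * ι 𝕜 ((finBasis 𝕜 V).coord i)) ⊗ₜ
        ρ (0, finBasis 𝕜 V i) s := by
  simp only [oddGen, map_sum, LinearMap.sum_apply]
  refine Finset.sum_congr rfl fun i _ => ?_
  rw [superAct_odd, ext_mul_odd (ι_mem_extParity _)]

theorem rTensor_euler_superAct
    (t : Λ*[𝕜] V ⊗[𝕜] S) :
    rTensor S (euler 𝕜 V) (superAct (Module.Dual 𝕜 V) ρ (oddGen 𝕜 L V) t) =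
      superAct (Module.Dual 𝕜 V) ρ (oddGen 𝕜 L V) (rTensor S (euler 𝕜 V) t) +
        superAct (Module.Dual 𝕜 V) ρ (oddGen 𝕜 L V) t := by
  induction t with
  | zero => simp only [map_zero, add_zero]
  | add t t' ht ht' => simp only [map_add, ht, ht']; exact add_add_add_comm _ _ _ _
  | tmul a s =>
    simp only [superAct_oddGen, map_sum, rTensor_tmul, ← Finset.sum_add_distrib]
    refine Finset.sum_congr rfl fun i _ => ?_
    simp only [euler_mul, euler_ι, add_tmul]

/-- The `k`-th power of the canonical odd element has degree `k` in the parameters. -/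
theorem rTensor_euler_superAct_pow (k : ℕ) (s : S) :
    rTensor S (euler 𝕜 V)
        ((superAct (Module.Dual 𝕜 V) ρ (oddGen 𝕜 L V) ^ k) (1 ⊗ₜ s)) =
      (k : 𝕜) • (superAct (Module.Dual 𝕜 V) ρ (oddGen 𝕜 L V) ^ k) (1 ⊗ₜ s) := by
  induction k with
  | zero =>
    have h1 : euler 𝕜 V 1 = 0 := by
      have h := euler_mul (1 : Λ*[𝕜] V) 1
      rw [mul_one, mul_one, one_mul] at h
      exact left_eq_add.mp h
    simp only [pow_zero, Nat.cast_zero, zero_smul, Module.End.one_apply, rTensor_tmul,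
      h1, zero_tmul]
  | succ k ih =>
    simp only [pow_succ', Module.End.mul_apply, rTensor_euler_superAct, ih, map_smul,
      Nat.cast_succ, add_smul, one_smul]

end Ray

section Falling

variable {𝕜 : Type*} [RCLike 𝕜] {S M : Type*} [AddCommGroup S] [Module 𝕜 S] [AddCommGroup M]
  [Module 𝕜 M]

theorem sub_sum_pow_mem (Fil : ℕ → Submodule 𝕜 S) (h0 : Fil 0 = ⊤)
    (hanti : ∀ k, Fil (k + 1) ≤ Fil k) {E : Module.End 𝕜 S}
    (hE : ∀ k, ∀ s ∈ Fil k, E s - (k : 𝕜) • s ∈ Fil (k + 1)) {μ β : M →ₗ[𝕜] S}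
    {A N : Module.End 𝕜 M} (hμ : ∀ t, μ (A t) = E (μ t) - μ (N t)) (hβ : ∀ t, E (β t) = β (N t))
    {t : M} (hN : ∀ k : ℕ, N ((A ^ k) t) = (k : 𝕜) • (A ^ k) t)
    (hμβ : ∀ k, μ ((A ^ k) t) - β ((A ^ k) t) ∈ Fil (k + 1)) (n : ℕ) :
    μ t - ∑ k ∈ Finset.range n, ((k.factorial : 𝕜)⁻¹) • β ((A ^ k) t) ∈ Fil n :=
  eq_sum_of_leading_terms Fil h0 hanti E hE (fun k => μ ((A ^ k) t)) (fun k => β ((A ^ k) t))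
    (fun k => by simp only [pow_succ', Module.End.mul_apply, hμ, hN, map_smul])
    (fun k => by simp only [hβ, hN, map_smul]) hμβ n

end Falling

section RayTheorem

variable {𝕜 : Type*} [RCLike 𝕜] {L V : Type*} [AddCommGroup L] [Module 𝕜 L] [AddCommGroup V]
  [Module 𝕜 V] [FiniteDimensional 𝕜 V] {F : Type*} [AddCommGroup F] [Module 𝕜 F]
  {ρ : (L × V) →ₗ[𝕜] Module.End 𝕜 (F ⊗[𝕜] Λ*[𝕜] V)}

variable (ρ) in
/-- Contracted with the odd coordinates, the odd vector fields are the Euler vector field. -/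
def IsRadial : Prop := ∀ s : F ⊗[𝕜] Λ*[𝕜] V,
  ∑ i, mulSection (ι 𝕜 ((finBasis 𝕜 V).coord i) ⊗ₜ
    ρ (0, finBasis 𝕜 V i) s) = lTensor F (euler 𝕜 V) s

omit [FiniteDimensional 𝕜 V] in
theorem mulSection_mul_tmul (a b : Λ*[𝕜] V)
    (s : F ⊗[𝕜] Λ*[𝕜] V) :
    mulSection ((a * b) ⊗ₜ s) = mulSection (a ⊗ₜ mulSection (b ⊗ₜ s)) := by
  induction s with
  | zero => simp only [tmul_zero, map_zero]
  | add s t hs ht => simp only [tmul_add, map_add, hs, ht]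
  | tmul f c => simp only [mulSection_tmul, mul_assoc]

theorem lTensor_euler_mulSection (a : Λ*[𝕜] V)
    (s : F ⊗[𝕜] Λ*[𝕜] V) :
    lTensor F (euler 𝕜 V) (mulSection (a ⊗ₜ s)) =
      mulSection (euler 𝕜 V a ⊗ₜ s) + mulSection (a ⊗ₜ lTensor F (euler 𝕜 V) s) := by
  induction s with
  | zero => simp only [tmul_zero, map_zero, add_zero]
  | add s t hs ht =>
    simp only [tmul_add, map_add, hs, ht]; exact add_add_add_comm _ _ _ _
  | tmul f c =>
    simp only [mulSection_tmul, lTensor_tmul, euler_mul, tmul_add]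

theorem mulSection_superAct (hρ : IsRadial ρ)
    (t : Λ*[𝕜] V ⊗[𝕜] (F ⊗[𝕜] Λ*[𝕜] V)) :
    mulSection (superAct (Module.Dual 𝕜 V) ρ (oddGen 𝕜 L V) t) =
      lTensor F (euler 𝕜 V) (mulSection t) -
        mulSection (rTensor _ (euler 𝕜 V) t) := by
  induction t with
  | zero => simp only [map_zero, sub_zero]
  | add t t' ht ht' => simp only [map_add, ht, ht']; exact sub_add_sub_comm _ _ _ _
  | tmul a s =>
    simp only [superAct_oddGen, rTensor_tmul, lTensor_euler_mulSection,
      add_sub_cancel_left, ← hρ s, tmul_sum, map_sum]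
    exact Finset.sum_congr rfl fun i _ => mulSection_mul_tmul _ _ _

theorem lTensor_euler_bodySection
    (t : Λ*[𝕜] V ⊗[𝕜] (F ⊗[𝕜] Λ*[𝕜] V)) :
    lTensor F (euler 𝕜 V) (bodySection t) =
      bodySection (rTensor _ (euler 𝕜 V) t) := by
  induction t with
  | zero => simp only [map_zero]
  | add t t' ht ht' => simp only [map_add, ht, ht']
  | tmul a s => rfl

theorem superAct_oddGen_pow_eq_zero {S : Type*} [AddCommGroup S] [Module 𝕜 S]
    {ρ : (L × V) →ₗ[𝕜] S →ₗ[𝕜] S} : superAct (Module.Dual 𝕜 V) ρ (oddGen 𝕜 L V) ^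
      (Module.finrank 𝕜 (Module.Dual 𝕜 V) + 1) = 0 :=
  pow_eq_zero_of_mem_raising (superAct_mem_raising oddGen_mem_extFil)

theorem superAct_oddGen_pow_mem {S : Type*} [AddCommGroup S] [Module 𝕜 S]
    {ρ : (L × V) →ₗ[𝕜] S →ₗ[𝕜] S} (k : ℕ) (s : S) :
    (superAct (Module.Dual 𝕜 V) ρ (oddGen 𝕜 L V) ^ k) (1 ⊗ₜ s) ∈
      extFil 𝕜 (Module.Dual 𝕜 V) S k := by
  induction k with
  | zero => rw [extFil_zero]; trivial
  | succ k ih =>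
    rw [pow_succ', Module.End.mul_apply]
    exact superAct_mem_raising oddGen_mem_extFil k _ ih

omit [FiniteDimensional 𝕜 V] in
theorem mulSection_one_tmul (s : F ⊗[𝕜] Λ*[𝕜] V) :
    mulSection (1 ⊗ₜ s) = s := by
  induction s with
  | zero => simp only [tmul_zero, map_zero]
  | add s t hs ht => simp only [tmul_add, map_add, hs, ht]
  | tmul f c => rw [mulSection_tmul, one_mul]

theorem sectionFil_eq_bot :
    sectionFil 𝕜 V F (Module.finrank 𝕜 (Module.Dual 𝕜 V) + 1) = ⊥ := by
  simp only [sectionFil, extPow_eq_bot, Submodule.map₂_bot_right]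

theorem eq_sum_bodySection_pow (hρ : IsRadial ρ)
    (s : F ⊗[𝕜] Λ*[𝕜] V) (n : ℕ) :
    s - ∑ k ∈ Finset.range n, ((k.factorial : 𝕜)⁻¹) •
      bodySection ((superAct (Module.Dual 𝕜 V) ρ (oddGen 𝕜 L V) ^ k) (1 ⊗ₜ s)) ∈
        sectionFil 𝕜 V F n := by
  have h := sub_sum_pow_mem (sectionFil 𝕜 V F) sectionFil_zero sectionFil_succ_le
    (fun k s hs => lTensor_euler_sub_mem hs) (mulSection_superAct hρ) lTensor_euler_bodySection
    (fun k => rTensor_euler_superAct_pow k s)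
    (fun k => mulSection_sub_bodySection_mem (superAct_oddGen_pow_mem k s)) n
  rwa [mulSection_one_tmul] at h

/-- The Taylor formula in the odd directions: the body of the section translated by the exponential of
the canonical odd element is the section itself. The left-invariant vector fields of the odd generators
agree with the coordinate vector fields along the odd rays, where they add up to the Euler vector
field. -/
theorem bodySection_expNil_oddGen (hρ : IsRadial ρ)
    (s : F ⊗[𝕜] Λ*[𝕜] V) :
    bodySection (expNil 𝕜 (superAct (Module.Dual 𝕜 V) ρ (oddGen 𝕜 L V)) (1 ⊗ₜ s)) = s := by
  have h := eq_sum_bodySection_pow hρ s (Module.finrank 𝕜 (Module.Dual 𝕜 V) + 1)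
  rw [sectionFil_eq_bot, Submodule.mem_bot, sub_eq_zero] at h
  rw [expNil_eq_sum superAct_oddGen_pow_eq_zero, LinearMap.sum_apply, map_sum]
  refine Eq.trans (Finset.sum_congr rfl fun i _ => ?_) h.symm
  rw [LinearMap.smul_apply, map_smul]

theorem bodySection_superAct_oddGen_eq_zero
    {t : Λ*[𝕜] V ⊗[𝕜] (F ⊗[𝕜] Λ*[𝕜] V)}
    {I : Submodule 𝕜 (F ⊗[𝕜] Λ*[𝕜] V)}
    (hb : ∀ v, ∀ s ∈ I, bodyMap (ρ (0, v) s) = 0)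
    (ht : t ∈ Submodule.map₂ (TensorProduct.mk 𝕜 _ _) ⊤ I) :
    bodySection (superAct (Module.Dual 𝕜 V) ρ (oddGen 𝕜 L V) t) = 0 := by
  have h : Submodule.map₂ (TensorProduct.mk 𝕜 (Λ*[𝕜] V) _) ⊤ I ≤
      LinearMap.ker (bodySection ∘ₗ superAct (Module.Dual 𝕜 V) ρ (oddGen 𝕜 L V)) := by
    refine Submodule.map₂_le.2 fun a _ s hs => ?_
    change bodySection (superAct (Module.Dual 𝕜 V) ρ (oddGen 𝕜 L V) (a ⊗ₜ s)) = 0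
    rw [superAct_oddGen, map_sum]
    refine Finset.sum_eq_zero fun i _ => ?_
    simp only [bodySection_tmul', hb _ s hs, zero_tmul]
  exact h ht

theorem superAct_oddGen_mem_map₂ {S : Type*} [AddCommGroup S] [Module 𝕜 S]
    {ρ : (L × V) →ₗ[𝕜] S →ₗ[𝕜] S} {I : Submodule 𝕜 S} (hI : ∀ v, ∀ s ∈ I, ρ (0, v) s ∈ I)
    {t : Λ*[𝕜] V ⊗[𝕜] S}
    (ht : t ∈ Submodule.map₂ (TensorProduct.mk 𝕜 _ _) ⊤ I) :
    superAct (Module.Dual 𝕜 V) ρ (oddGen 𝕜 L V) t ∈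
      Submodule.map₂ (TensorProduct.mk 𝕜 _ _) ⊤ I := by
  have h : Submodule.map₂ (TensorProduct.mk 𝕜 (Λ*[𝕜] V) _) ⊤ I ≤
      (Submodule.map₂ (TensorProduct.mk 𝕜 _ _) ⊤ I).comap
        (superAct (Module.Dual 𝕜 V) ρ (oddGen 𝕜 L V)) := by
    refine Submodule.map₂_le.2 fun a _ s hs => ?_
    change superAct (Module.Dual 𝕜 V) ρ (oddGen 𝕜 L V) (a ⊗ₜ s) ∈
      Submodule.map₂ (TensorProduct.mk 𝕜 _ _) ⊤ I
    rw [superAct_oddGen]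
    exact Submodule.sum_mem _ fun i _ => Submodule.apply_mem_map₂ _ trivial (hI _ s hs)
  exact h ht

theorem superAct_oddGen_pow_mem_map₂ {S : Type*} [AddCommGroup S] [Module 𝕜 S]
    {ρ : (L × V) →ₗ[𝕜] S →ₗ[𝕜] S} {I : Submodule 𝕜 S} (hI : ∀ v, ∀ s ∈ I, ρ (0, v) s ∈ I)
    {s : S} (hs : s ∈ I) (k : ℕ) :
    (superAct (Module.Dual 𝕜 V) ρ (oddGen 𝕜 L V) ^ k) (1 ⊗ₜ s) ∈
      Submodule.map₂ (TensorProduct.mk 𝕜 _ _) ⊤ I := by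
  induction k with
  | zero => exact Submodule.apply_mem_map₂ _ trivial hs
  | succ k ih => rw [pow_succ', Module.End.mul_apply]; exact superAct_oddGen_mem_map₂ hI ih

/-- A section has degree zero if it and all the sections obtained from it by odd left-invariant vector
fields have odd derivatives which vanish on the body. -/
theorem eq_bodyMap_tmul_one (hρ : IsRadial ρ)
    {I : Submodule 𝕜 (F ⊗[𝕜] Λ*[𝕜] V)}
    (hI : ∀ v, ∀ s ∈ I, ρ (0, v) s ∈ I) (hb : ∀ v, ∀ s ∈ I, bodyMap (ρ (0, v) s) = 0)
    {s : F ⊗[𝕜] Λ*[𝕜] V} (hs : s ∈ I) : s = bodyMap s ⊗ₜ 1 := by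
  have h := eq_sum_bodySection_pow hρ s (Module.finrank 𝕜 (Module.Dual 𝕜 V) + 1)
  rw [sectionFil_eq_bot, Submodule.mem_bot, sub_eq_zero, Finset.sum_range_succ',
    Finset.sum_eq_zero fun i _ => ?_, zero_add, Nat.factorial_zero, Nat.cast_one, inv_one, one_smul]
    at h
  · exact h
  · simp only [pow_succ', Module.End.mul_apply,
      bodySection_superAct_oddGen_eq_zero hb (superAct_oddGen_pow_mem_map₂ hI hs i), smul_zero]

theorem lTensor_superAct_comm {O : Module.End 𝕜 (F ⊗[𝕜] Λ*[𝕜] V)}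
    {j : Module.End 𝕜 (Λ*[𝕜] V)} {c : 𝕜}
    (hj : ∀ a α, j (a * ι 𝕜 α) = c • (j a * ι 𝕜 α))
    (hO : ∀ v s, c • O (ρ (0, v) s) = ρ (0, v) (O s))
    (t : Λ*[𝕜] V ⊗[𝕜] (F ⊗[𝕜] Λ*[𝕜] V)) :
    superAct (Module.Dual 𝕜 V) ρ (oddGen 𝕜 L V) (TensorProduct.map j O t) =
      TensorProduct.map j O (superAct (Module.Dual 𝕜 V) ρ (oddGen 𝕜 L V) t) := by
  induction t with
  | zero => simp only [map_zero]
  | add t t' ht ht' => simp only [map_add, ht, ht']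
  | tmul a s =>
    simp only [map_tmul, superAct_oddGen, map_sum]
    refine Finset.sum_congr rfl fun i _ => ?_
    simp only [hj, ← hO, tmul_smul, smul_tmul']

/-- An operator which commutes, up to a sign, with the odd left-invariant vector fields vanishes if its
values vanish on the body. -/
theorem eq_zero_of_comm (hρ : IsRadial ρ)
    {O : Module.End 𝕜 (F ⊗[𝕜] Λ*[𝕜] V)}
    {j : Module.End 𝕜 (Λ*[𝕜] V)} {c : 𝕜} (hj1 : j 1 = 1)
    (hj : ∀ a α, j (a * ι 𝕜 α) = c • (j a * ι 𝕜 α))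
    (hO : ∀ v s, c • O (ρ (0, v) s) = ρ (0, v) (O s)) (hb : ∀ s, bodyMap (O s) = 0) : O = 0 := by
  refine LinearMap.ext fun s => ?_
  have h0 : ∀ t, bodySection (TensorProduct.map j O t) = 0 := fun t => by
    induction t with
    | zero => simp only [map_zero]
    | add t t' ht ht' => simp only [map_add, ht, ht', add_zero]
    | tmul a s => simp only [map_tmul, bodySection_tmul', hb, zero_tmul]
  have hnil : IsNilpotent (superAct (Module.Dual 𝕜 V) ρ (oddGen 𝕜 L V)) :=
    ⟨_, superAct_oddGen_pow_eq_zero⟩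
  rw [← bodySection_expNil_oddGen hρ (O s), ← hj1, ← map_tmul,
    expNil_intertwine hnil hnil (lTensor_superAct_comm hj hO), h0]
  rfl

end RayTheorem

/-! ### Vector fields on the body -/

section Body

variable {𝕜 : Type*} [RCLike 𝕜] {L V : Type*} [AddCommGroup L] [Module 𝕜 L] [AddCommGroup V]
  [Module 𝕜 V] {F : Type*} [CommRing F] [Algebra 𝕜 F] {D : L →ₗ[𝕜] Module.End 𝕜 F}

theorem one_tmul_mul_eq_mulSection (a : Λ*[𝕜] V)
    (s : F ⊗[𝕜] Λ*[𝕜] V) : (1 ⊗ₜ a) * s = mulSection (a ⊗ₜ s) := by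
  induction s with
  | zero => simp only [mul_zero, tmul_zero, map_zero]
  | add s t hs ht => simp only [mul_add, tmul_add, map_add, hs, ht]
  | tmul f b => simp only [tmul_mul_tmul, one_mul, mulSection_tmul]

theorem fieldOp_smul_eq_mulSection (a : Λ*[𝕜] V)
    (z : Λ*[𝕜] V ⊗[𝕜] (L × V))
    (t : F ⊗[𝕜] Λ*[𝕜] V) :
    fieldOp V D (a • z) t = mulSection (a ⊗ₜ fieldOp V D z t) := by
  rw [fieldOp_smul, one_tmul_mul_eq_mulSection]

theorem bodyMap_mulSection (a : Λ*[𝕜] V)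
    (s : F ⊗[𝕜] Λ*[𝕜] V) :
    bodyMap (mulSection (a ⊗ₜ s)) = ExteriorAlgebra.algebraMapInv a • bodyMap s := by
  induction s with
  | zero => simp only [tmul_zero, map_zero, smul_zero]
  | add s t hs ht => simp only [tmul_add, map_add, hs, ht, smul_add]
  | tmul f b => simp only [mulSection_tmul, bodyMap_tmul, map_mul, mul_smul]

theorem bodyMap_tmul_one_mul (f : F) (s : F ⊗[𝕜] Λ*[𝕜] V) :
    bodyMap ((f ⊗ₜ 1) * s) = f * bodyMap s := by
  induction s with
  | zero => simp only [mul_zero, map_zero]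
  | add s t hs ht => simp only [mul_add, map_add, hs, ht]
  | tmul g b =>
    simp only [tmul_mul_tmul, one_mul, bodyMap_tmul, mul_smul_comm]

/-- The component of degree zero of an element of `ΛW ⊗ M`. -/
def envBody {W M : Type*} [AddCommGroup W] [Module 𝕜 W] [AddCommGroup M] [Module 𝕜 M] :
    Λ[𝕜] W ⊗[𝕜] M →ₗ[𝕜] M :=
  (TensorProduct.lid 𝕜 M).toLinearMap ∘ₗ
    rTensor M (ExteriorAlgebra.algebraMapInv (R := 𝕜) (M := W)).toLinearMap

theorem envBody_tmul {W M : Type*} [AddCommGroup W] [Module 𝕜 W] [AddCommGroup M] [Module 𝕜 M]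
    (a : Λ[𝕜] W) (x : M) : envBody (a ⊗ₜ x) = ExteriorAlgebra.algebraMapInv a • x := rfl

/-- On the body, a vector field is determined by its coefficients of degree zero. -/
theorem bodyMap_fieldOp (z : Λ*[𝕜] V ⊗[𝕜] (L × V))
    (s : F ⊗[𝕜] Λ*[𝕜] V) :
    bodyMap (fieldOp V D z s) = bodyMap (fieldOp V D (1 ⊗ₜ envBody z) s) := by
  induction z with
  | zero => rw [map_zero envBody, tmul_zero]
  | add x y hx hy =>
    rw [map_add envBody, tmul_add, map_add (fieldOp V D), map_add (fieldOp V D),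
      LinearMap.add_apply, LinearMap.add_apply, map_add, map_add, hx, hy]
  | tmul a X =>
    have h : a ⊗ₜ[𝕜] X = a • (1 ⊗ₜ[𝕜] X) := by rw [smul_tmul', smul_eq_mul, mul_one]
    rw [envBody_tmul, tmul_smul, map_smul (fieldOp V D), LinearMap.smul_apply, map_smul,
      h, fieldOp_smul_eq_mulSection, bodyMap_mulSection]

variable [FiniteDimensional 𝕜 V] {br : Bil[𝕜] (L × V)}

theorem fieldOp_oddGen (s : F ⊗[𝕜] Λ*[𝕜] V) :
    fieldOp V D (oddGen 𝕜 L V) s = lTensor F (euler 𝕜 V) s := by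
  induction s with
  | zero => rw [map_zero, map_zero]
  | add s t hs ht => simp only [map_add, hs, ht]
  | tmul f c => rw [← oddPart_oddGen, fieldOp_oddPart, oddField_oddGen, lTensor_tmul]

theorem leftOp_isRadial (hbr : IsLieSuper br) : IsRadial (leftOp br D) := by
  intro s
  simp only [leftOp_apply, ← fieldOp_smul_eq_mulSection]
  simp only [← LinearMap.sum_apply, ← map_sum (fieldOp V D), sum_ι_smul_leftCoeff hbr,
    fieldOp_oddGen]

theorem envBody_adGen (z : Λ*[𝕜] V ⊗[𝕜] (L × V)) :
    envBody (adGen br z) = 0 := by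
  induction z with
  | zero => rw [map_zero, map_zero]
  | add x y hx hy => simp only [map_add, hx, hy, add_zero]
  | tmul a X =>
    simp only [adGen, superAct_oddGen, map_sum]
    refine Finset.sum_eq_zero fun i _ => ?_
    simp only [envBody_tmul, map_mul, algebraMapInv_odd (ι_mem_extParity _), mul_zero, zero_smul]

theorem phiNil_zero {A : Type*} [Ring A] [Algebra 𝕜 A] : phiNil 𝕜 (0 : A) = 1 := by
  simp [phiNil_eq_sum (𝕜 := 𝕜) (pow_one (0 : A))]

theorem envBody_expNil (z : Λ*[𝕜] V ⊗[𝕜] (L × V)) :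
    envBody (expNil 𝕜 (adGen br) z) = envBody z := by
  have h := expNil_intertwine (b := (0 : Module.End 𝕜 (L × V))) (g := envBody)
    (isNilpotent_adGen (br := br)) IsNilpotent.zero (fun x => (envBody_adGen x).symm) z
  rw [← h, expNil_zero]; rfl

theorem envBody_phiNil (z : Λ*[𝕜] V ⊗[𝕜] (L × V)) :
    envBody (phiNil 𝕜 (adGen br) z) = envBody z := by
  have h := phiNil_intertwine (b := (0 : Module.End 𝕜 (L × V))) (g := envBody)
    (isNilpotent_adGen (br := br)) IsNilpotent.zero (fun x => (envBody_adGen x).symm) z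
  rw [← h, phiNil_zero]; rfl

theorem envBody_logDiff (z : Λ*[𝕜] V ⊗[𝕜] (L × V)) :
    envBody (logDiff br z) = envBody z := by
  rw [logDiff_apply, map_add, envBody_phiNil, ← map_add, evenPart_add_oddPart]

omit [FiniteDimensional 𝕜 V] in
theorem envBody_one_tmul (X : L × V) :
    envBody ((1 : Λ*[𝕜] V) ⊗ₜ[𝕜] X) = X := by
  simp only [envBody_tmul, map_one, one_smul]

theorem envBody_leftCoeff (X : L × V) : envBody (leftCoeff br X) = X := by
  rw [← envBody_logDiff (br := br), logDiff_leftCoeff, envBody_expNil, envBody_one_tmul]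

theorem envBody_rightCoeff (X : L × V) : envBody (rightCoeff br X) = X := by
  rw [← envBody_logDiff (br := br), logDiff_rightCoeff, envBody_one_tmul]

theorem bodyMap_fieldOp_rightCoeff (X : L × V)
    (s : F ⊗[𝕜] Λ*[𝕜] V) :
    bodyMap (fieldOp V D (rightCoeff br X) s) = bodyMap (leftOp br D X s) := by
  rw [leftOp_apply, bodyMap_fieldOp, envBody_rightCoeff, bodyMap_fieldOp (leftCoeff br X),
    envBody_leftCoeff]

end Body

/-! ### Vector fields which are right-invariant in the odd directions -/

section RightField

variable {𝕜 : Type*} [RCLike 𝕜] {L V : Type*} [AddCommGroup L] [Module 𝕜 L] [AddCommGroup V]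
  [Module 𝕜 V] [FiniteDimensional 𝕜 V] {br : Bil[𝕜] (L × V)}
  {F : Type*} [CommRing F] [Algebra 𝕜 F] {D : L →ₗ[𝕜] Module.End 𝕜 F}

variable (br D) in
/-- The vector field `∑ fⱼ r(Zⱼ)`, where `r(Z)` is the vector field which is right-invariant in the odd
directions and has the value `Z` on the body. -/
def rightField : F ⊗[𝕜] (L × V) →ₗ[𝕜] Module.End 𝕜 (F ⊗[𝕜] Λ*[𝕜] V) :=
  TensorProduct.lift (((LinearMap.mul 𝕜 (Module.End 𝕜 (F ⊗[𝕜] Λ*[𝕜] V))) ∘ₗ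
    LinearMap.mul 𝕜 (F ⊗[𝕜] Λ*[𝕜] V) ∘ₗ
      (TensorProduct.mk 𝕜 F (Λ*[𝕜] V)).flip 1).compl₂
        (fieldOp V D ∘ₗ rightCoeff br))

theorem rightField_tmul (f : F) (Z : L × V) (s : F ⊗[𝕜] Λ*[𝕜] V) :
    rightField br D (f ⊗ₜ Z) s = (f ⊗ₜ 1) * fieldOp V D (rightCoeff br Z) s := rfl

variable (br D) in
/-- The derivative `f ⊗ Z ↦ D_X f ⊗ Z + f ⊗ [X, Z]` of functions with values in `𝔤`. -/
def coeffDer : (L × V) →ₗ[𝕜] Module.End 𝕜 (F ⊗[𝕜] (L × V)) :=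
  LinearMap.rTensorHom (L × V) ∘ₗ D ∘ₗ LinearMap.fst 𝕜 L V + LinearMap.lTensorHom F ∘ₗ br

omit [FiniteDimensional 𝕜 V] in
theorem coeffDer_tmul (X : L × V) (f : F) (Z : L × V) :
    coeffDer br D X (f ⊗ₜ Z) = D X.1 f ⊗ₜ Z + f ⊗ₜ br X Z := rfl

variable (𝕜 F L V) in
/-- The functions with values in the part of parity `j` of `𝔤`. -/
def coeffParity (j : ZMod 2) : Submodule 𝕜 (F ⊗[𝕜] (L × V)) :=
  Submodule.map₂ (TensorProduct.mk 𝕜 _ _) ⊤ (homog 𝕜 L V j)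

omit [FiniteDimensional 𝕜 V] in
theorem tmul_one_mem_sectionParity (f : F) :
    (f ⊗ₜ 1 : F ⊗[𝕜] Λ*[𝕜] V) ∈ sectionParity 𝕜 V F 0 :=
  tmul_mem_sectionParity f one_mem_extParity

theorem leftOp_tmul_one_mul (hbr : IsLieSuper br)
    (hD : ∀ X f g, D X (f * g) = D X f * g + f * D X g) {i : ZMod 2} {X : L × V}
    (hX : X ∈ homog 𝕜 L V i) (f : F) (t : F ⊗[𝕜] Λ*[𝕜] V) :
    leftOp br D X ((f ⊗ₜ 1) * t) = leftOp br D X (f ⊗ₜ 1) * t + (f ⊗ₜ 1) * leftOp br D X t := by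
  simp only [leftOp_mul hbr hD hX (tmul_one_mem_sectionParity f), ssign_of_right_even, one_smul]

theorem leftOp_even_rightField (hbr : IsLieSuper br)
    (hD : ∀ X f g, D X (f * g) = D X f * g + f * D X g)
    (hDbr : ∀ X Y f, D ((br (X, 0) (Y, 0)).1) f = D X (D Y f) - D Y (D X f)) (X : L)
    (α : F ⊗[𝕜] (L × V)) (s : F ⊗[𝕜] Λ*[𝕜] V) :
    leftOp br D (X, 0) (rightField br D α s) =
      rightField br D (coeffDer br D (X, 0) α) s + rightField br D α (leftOp br D (X, 0) s) := by
  induction α with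
  | zero => simp only [map_zero, LinearMap.zero_apply, add_zero]
  | add α β hα hβ =>
    simp only [map_add, LinearMap.add_apply, hα, hβ]; exact add_add_add_comm _ _ _ _
  | tmul f Z =>
    rw [rightField_tmul, leftOp_tmul_one_mul hbr hD (even_mem_homog X), leftOp_even_tmul_one hbr,
      coeffDer_tmul, map_add, LinearMap.add_apply, rightField_tmul, rightField_tmul, rightField_tmul,
      leftOp_apply, fieldOp_commutator_even hbr hDbr, lieOp_rightCoeff hbr, mul_add, add_assoc]

end RightField

section RightField

variable {𝕜 : Type*} [RCLike 𝕜] {L V : Type*} [AddCommGroup L] [Module 𝕜 L] [AddCommGroup V]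
  [Module 𝕜 V] {br : Bil[𝕜] (L × V)}
  {F : Type*} [CommRing F] [Algebra 𝕜 F] {D : L →ₗ[𝕜] Module.End 𝕜 F}

/-- For `w = ∑ aᵢ ⊗ (Xᵢ, vᵢ)` the sum `∑ aᵢ Φ(Xᵢ)`. -/
def evenContract (w : Λ*[𝕜] V ⊗[𝕜] (L × V))
    (Φ : (L × V) →ₗ[𝕜] F ⊗[𝕜] Λ*[𝕜] V) :
    F ⊗[𝕜] Λ*[𝕜] V :=
  mulSection (lTensor _ Φ (evenPart w))

variable {Φ Ψ : (L × V) →ₗ[𝕜] F ⊗[𝕜] Λ*[𝕜] V}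

theorem evenContract_zero : evenContract 0 Φ = 0 := by simp only [evenContract, map_zero]

theorem evenContract_add_left (w w' : Λ*[𝕜] V ⊗[𝕜] (L × V)) :
    evenContract (w + w') Φ = evenContract w Φ + evenContract w' Φ := by
  simp only [evenContract, map_add]

theorem evenContract_even (a : Λ*[𝕜] V) (X : L) :
    evenContract (a ⊗ₜ (X, 0)) Φ = mulSection (a ⊗ₜ Φ (X, 0)) := rfl

theorem evenContract_odd (a : Λ*[𝕜] V) (v : V) :
    evenContract (a ⊗ₜ (0, v)) Φ = 0 := by
  simp only [evenContract, evenPart_odd, map_zero]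

theorem evenContract_add (w : Λ*[𝕜] V ⊗[𝕜] (L × V)) :
    evenContract w (Φ + Ψ) = evenContract w Φ + evenContract w Ψ := by
  simp only [evenContract, LinearMap.lTensor_add, LinearMap.add_apply, map_add]

theorem evenContract_eq_zero (h : ∀ X : L, Φ (X, 0) = 0)
    (w : Λ*[𝕜] V ⊗[𝕜] (L × V)) : evenContract w Φ = 0 := by
  induction w using env_induction with
  | zero => exact evenContract_zero
  | add x y hx hy => simp only [evenContract_add_left, hx, hy, add_zero]
  | even a X => simp only [evenContract_even, h, tmul_zero, map_zero]
  | odd a v => exact evenContract_odd a v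

theorem mulSection_mul (a : Λ*[𝕜] V)
    (s t : F ⊗[𝕜] Λ*[𝕜] V) :
    mulSection (a ⊗ₜ s) * t = mulSection (a ⊗ₜ (s * t)) := by
  simp only [← one_tmul_mul_eq_mulSection, mul_assoc]

theorem tmul_one_mul_mulSection (f : F) (a : Λ*[𝕜] V)
    (t : F ⊗[𝕜] Λ*[𝕜] V) :
    (f ⊗ₜ 1) * mulSection (a ⊗ₜ t) = mulSection (a ⊗ₜ ((f ⊗ₜ 1) * t)) := by
  simp only [← one_tmul_mul_eq_mulSection, ← mul_assoc, tmul_mul_tmul,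
    mul_one, one_mul]

theorem fieldOp_tmul_one_mul (w : Λ*[𝕜] V ⊗[𝕜] (L × V)) (f : F)
    (t : F ⊗[𝕜] Λ*[𝕜] V)
    (hΦ : ∀ X : L, Φ (X, 0) = (D X f ⊗ₜ 1) * t) :
    fieldOp V D w (f ⊗ₜ 1) * t = evenContract w Φ := by
  induction w using env_induction with
  | zero => simp only [map_zero (fieldOp V D), LinearMap.zero_apply, zero_mul, evenContract_zero]
  | add x y hx hy =>
    simp only [map_add (fieldOp V D), LinearMap.add_apply, add_mul, hx, hy, evenContract_add_left]
  | even a X =>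
    simp only [evenContract_even, hΦ, fieldOp_even, ← mulSection_mul, mulSection_tmul]
  | odd a v =>
    simp only [evenContract_odd, fieldOp_odd, oddField_tmul, extContract_one, mul_zero,
      tmul_zero, zero_mul]

theorem tmul_one_mul_evenContract (w : Λ*[𝕜] V ⊗[𝕜] (L × V)) (f : F)
    (hΦ : ∀ X : L, Φ (X, 0) = (f ⊗ₜ 1) * Ψ (X, 0)) :
    (f ⊗ₜ 1) * evenContract w Ψ = evenContract w Φ := by
  induction w using env_induction with
  | zero => simp only [evenContract_zero, mul_zero]
  | add x y hx hy => simp only [evenContract_add_left, mul_add, hx, hy]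
  | even a X => simp only [evenContract_even, hΦ, tmul_one_mul_mulSection]
  | odd a v => simp only [evenContract_odd, mul_zero]

variable [FiniteDimensional 𝕜 V]

omit [FiniteDimensional 𝕜 V] in
theorem fieldOp_even_comm_even
    (hDbr : ∀ X Y f, D ((br (X, 0) (Y, 0)).1) f = D X (D Y f) - D Y (D X f)) (X Z : L)
    (a : Λ*[𝕜] V) (s : F ⊗[𝕜] Λ*[𝕜] V) :
    fieldOp V D (a ⊗ₜ (X, 0)) (fieldOp V D (1 ⊗ₜ (Z, 0)) s) =
      fieldOp V D (1 ⊗ₜ (Z, 0)) (fieldOp V D (a ⊗ₜ (X, 0)) s) +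
        mulSection (a ⊗ₜ fieldOp V D (1 ⊗ₜ ((br (X, 0) (Z, 0)).1, 0)) s) := by
  induction s with
  | zero => simp only [map_zero, tmul_zero, add_zero]
  | add s t hs ht =>
    simp only [map_add, tmul_add]
    rw [hs, ht]
    exact add_add_add_comm _ _ _ _
  | tmul f c =>
    simp only [fieldOp_even, mulSection_tmul, hDbr, one_mul, ← add_tmul,
      add_sub_cancel]

omit [FiniteDimensional 𝕜 V] in
theorem fieldOp_even_comm_odd (v : V) (Z : L) (a : Λ*[𝕜] V)
    (s : F ⊗[𝕜] Λ*[𝕜] V) :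
    fieldOp V D (a ⊗ₜ (0, v)) (fieldOp V D (1 ⊗ₜ (Z, 0)) s) =
      fieldOp V D (1 ⊗ₜ (Z, 0)) (fieldOp V D (a ⊗ₜ (0, v)) s) := by
  induction s with
  | zero => simp only [map_zero]
  | add s t hs ht => simp only [map_add]; rw [hs, ht]
  | tmul f c => simp only [fieldOp_even, fieldOp_odd, one_mul]

theorem fieldOp_even_comm
    (hDbr : ∀ X Y f, D ((br (X, 0) (Y, 0)).1) f = D X (D Y f) - D Y (D X f)) (hbr : IsLieSuper br)
    (w : Λ*[𝕜] V ⊗[𝕜] (L × V)) (Z : L)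
    (s : F ⊗[𝕜] Λ*[𝕜] V) :
    fieldOp V D w (fieldOp V D (1 ⊗ₜ (Z, 0)) s) = fieldOp V D (1 ⊗ₜ (Z, 0)) (fieldOp V D w s) +
      evenContract w ((fieldOp V D ∘ₗ rightCoeff br ∘ₗ br.flip (Z, 0)).flip s) := by
  have hadd : ∀ x y : Λ*[𝕜] V ⊗[𝕜] (L × V), ∀ t,
      fieldOp V D (x + y) t = fieldOp V D x t + fieldOp V D y t := fun x y t => by
    rw [map_add (fieldOp V D)]; rfl
  induction w using env_induction with
  | zero =>
    simp only [map_zero (fieldOp V D), LinearMap.zero_apply, evenContract_zero, map_zero, add_zero]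
  | add x y hx hy =>
    rw [hadd, hadd, hx, hy, evenContract_add_left, map_add]; exact add_add_add_comm _ _ _ _
  | even a X =>
    have h : (fieldOp V D ∘ₗ rightCoeff br ∘ₗ br.flip (Z, 0)).flip s (X, 0) =
        fieldOp V D (1 ⊗ₜ ((br (X, 0) (Z, 0)).1, 0)) s := by
      change fieldOp V D (rightCoeff br (br (X, 0) (Z, 0))) s = _
      rw [hbr.even_even, rightCoeff_even]
    simp only [evenContract_even, h, fieldOp_even_comm_even hDbr]
  | odd a v => simp only [evenContract_odd, add_zero, fieldOp_even_comm_odd]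

theorem fieldOp_logDiffInv_superAct (w : Λ*[𝕜] V ⊗[𝕜] (L × V)) (Z : L × V)
    (s : F ⊗[𝕜] Λ*[𝕜] V) :
    fieldOp V D (logDiffInv br (superAct (Module.Dual 𝕜 V) br (evenPart w) (1 ⊗ₜ Z))) s =
      evenContract w ((fieldOp V D ∘ₗ rightCoeff br ∘ₗ br.flip Z).flip s) := by
  induction w using env_induction with
  | zero => simp only [map_zero, LinearMap.zero_apply, evenContract_zero]
  | add x y hx hy =>
    simp only [evenContract_add_left, ← hx, ← hy]
    simp only [map_add, LinearMap.add_apply]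
  | even a X =>
    have h : (a * 1) ⊗ₜ[𝕜] br (X, 0) Z = a • (1 ⊗ₜ[𝕜] br (X, 0) Z) := by
      rw [smul_tmul', smul_eq_mul]
    simp only [evenPart_even, superAct_even, h, logDiffInv_smul, fieldOp_smul_eq_mulSection,
      evenContract_even]
    rfl
  | odd a v =>
    rw [evenPart_odd, evenContract_odd]
    simp only [map_zero, LinearMap.zero_apply]

/-- The supercommutator of an odd left-invariant vector field with `r(Z)`. -/
theorem leftOp_odd_rightCoeff
    (hDbr : ∀ X Y f, D ((br (X, 0) (Y, 0)).1) f = D X (D Y f) - D Y (D X f)) (hbr : IsLieSuper br)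
    {j : ZMod 2} {X Z : L × V} (hX : X ∈ homog 𝕜 L V 1) (hZ : Z ∈ homog 𝕜 L V j)
    (s : F ⊗[𝕜] Λ*[𝕜] V) :
    leftOp br D X (fieldOp V D (rightCoeff br Z) s) =
      ssign 𝕜 1 j • fieldOp V D (rightCoeff br Z) (leftOp br D X s) +
        evenContract (leftCoeff br X) ((fieldOp V D ∘ₗ rightCoeff br ∘ₗ br.flip Z).flip s) := by
  by_cases hj : j = 0
  · subst hj
    obtain ⟨z, rfl⟩ : ∃ z, Z = (z, 0) := ⟨Z.1, Prod.ext rfl (mem_homog_zero.mp hZ)⟩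
    simp only [ssign_of_right_even, one_smul, rightCoeff_even, leftOp_apply,
      fieldOp_even_comm hDbr hbr]
  · have h1 : ∀ k : ZMod 2, k ≠ 0 → k = 1 := by decide
    obtain rfl := h1 j hj
    have h := fieldOp_anticomm hbr hDbr (leftCoeff_mem hbr hX) (rightCoeff_mem hbr hZ) s
    rw [oddFieldBracket_rightCoeff hbr hX hZ, fieldOp_logDiffInv_superAct] at h
    simp only [ssign_odd, neg_one_smul, ← h]
    exact (neg_add_cancel_left _ _).symm.trans (by rw [leftOp_apply]; abel)

set_option maxHeartbeats 600000 in
theorem leftOp_odd_rightField (hbr : IsLieSuper br)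
    (hD : ∀ X f g, D X (f * g) = D X f * g + f * D X g)
    (hDbr : ∀ X Y f, D ((br (X, 0) (Y, 0)).1) f = D X (D Y f) - D Y (D X f)) {j : ZMod 2}
    {X Z : L × V} (hX : X ∈ homog 𝕜 L V 1) (hZ : Z ∈ homog 𝕜 L V j) (f : F)
    (s : F ⊗[𝕜] Λ*[𝕜] V) :
    leftOp br D X (rightField br D (f ⊗ₜ Z) s) =
      ssign 𝕜 1 j • rightField br D (f ⊗ₜ Z) (leftOp br D X s) +
        evenContract (leftCoeff br X)
          ((rightField br D ∘ₗ (coeffDer br D).flip (f ⊗ₜ Z)).flip s) := by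
  have e : (rightField br D ∘ₗ (coeffDer br D).flip (f ⊗ₜ Z)).flip s =
      (rightField br D ∘ₗ (TensorProduct.mk 𝕜 F (L × V)).flip Z ∘ₗ D.flip f ∘ₗ LinearMap.fst 𝕜 L V).flip s +
      (rightField br D ∘ₗ TensorProduct.mk 𝕜 F (L × V) f ∘ₗ br.flip Z).flip s := by
    refine LinearMap.ext fun Y => ?_
    change rightField br D (coeffDer br D Y (f ⊗ₜ Z)) s = _
    rw [coeffDer_tmul, map_add]
    rfl
  have e1 := fieldOp_tmul_one_mul (D := D) (leftCoeff br X) f (fieldOp V D (rightCoeff br Z) s)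
    (Φ := (rightField br D ∘ₗ (TensorProduct.mk 𝕜 F (L × V)).flip Z ∘ₗ D.flip f ∘ₗ
      LinearMap.fst 𝕜 L V).flip s) fun Y => rfl
  have e2 := tmul_one_mul_evenContract (leftCoeff br X) f
    (Φ := (rightField br D ∘ₗ TensorProduct.mk 𝕜 F (L × V) f ∘ₗ br.flip Z).flip s)
    (Ψ := (fieldOp V D ∘ₗ rightCoeff br ∘ₗ br.flip Z).flip s) fun Y => rfl
  rw [e, evenContract_add, rightField_tmul, leftOp_tmul_one_mul hbr hD hX,
    leftOp_odd_rightCoeff hDbr hbr hX hZ, rightField_tmul, mul_add, mul_smul_comm, leftOp_apply X,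
    e1, e2]
  exact add_left_comm _ _ _

end RightField

section Coeff

variable {𝕜 : Type*} [RCLike 𝕜] {L V : Type*} [AddCommGroup L] [Module 𝕜 L] [AddCommGroup V]
  [Module 𝕜 V] {F : Type*} [CommRing F] [Algebra 𝕜 F]

theorem coeffParity_induction {j : ZMod 2} {motive : F ⊗[𝕜] (L × V) → Prop} (zero : motive 0)
    (add : ∀ α β, motive α → motive β → motive (α + β))
    (smul : ∀ (c : 𝕜) α, motive α → motive (c • α))
    (tmul : ∀ f, ∀ Z ∈ homog 𝕜 L V j, motive (f ⊗ₜ Z)) {α : F ⊗[𝕜] (L × V)}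
    (hα : α ∈ coeffParity 𝕜 L V F j) : motive α :=
  let P : Submodule 𝕜 (F ⊗[𝕜] (L × V)) :=
    { carrier := {z | motive z}
      add_mem' := fun {x y} => add x y
      zero_mem' := zero
      smul_mem' := smul }
  (show coeffParity 𝕜 L V F j ≤ P from Submodule.map₂_le.2 fun f _ Z hZ => tmul f Z hZ) hα

/-- The value at a point of a function with values in `𝔤`. -/
def evalCoeff (ev : F →ₗ[𝕜] 𝕜) : F ⊗[𝕜] (L × V) →ₗ[𝕜] L × V :=
  (TensorProduct.lid 𝕜 (L × V)).toLinearMap ∘ₗ rTensor (L × V) ev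

theorem evalCoeff_tmul (ev : F →ₗ[𝕜] 𝕜) (f : F) (Z : L × V) :
    evalCoeff ev (f ⊗ₜ Z) = ev f • Z := rfl

theorem evalCoeff_mem (ev : F →ₗ[𝕜] 𝕜) {j : ZMod 2} {α : F ⊗[𝕜] (L × V)}
    (hα : α ∈ coeffParity 𝕜 L V F j) : evalCoeff ev α ∈ homog 𝕜 L V j :=
  coeffParity_induction (motive := fun α => evalCoeff ev α ∈ homog 𝕜 L V j)
    (by rw [map_zero]; exact Submodule.zero_mem _)
    (fun α β hα hβ => by rw [map_add]; exact Submodule.add_mem _ hα hβ)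
    (fun c α hα => by rw [map_smul]; exact Submodule.smul_mem _ c hα)
    (fun f Z hZ => Submodule.smul_mem _ _ hZ) hα

variable {Φ : (L × V) →ₗ[𝕜] F ⊗[𝕜] Λ*[𝕜] V}

theorem evenContract_smul (c : 𝕜) (w : Λ*[𝕜] V ⊗[𝕜] (L × V)) :
    evenContract w (c • Φ) = c • evenContract w Φ := by
  simp only [evenContract, LinearMap.lTensor_smul, LinearMap.smul_apply, map_smul]

end Coeff

section RightField

variable {𝕜 : Type*} [RCLike 𝕜] {L V : Type*} [AddCommGroup L] [Module 𝕜 L] [AddCommGroup V]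
  [Module 𝕜 V] [FiniteDimensional 𝕜 V] {br : Bil[𝕜] (L × V)}
  {F : Type*} [CommRing F] [Algebra 𝕜 F] {D : L →ₗ[𝕜] Module.End 𝕜 F}

theorem rightField_add_apply (α β : F ⊗[𝕜] (L × V))
    (s : F ⊗[𝕜] Λ*[𝕜] V) :
    rightField br D (α + β) s = rightField br D α s + rightField br D β s := by
  rw [map_add (rightField br D)]; rfl

theorem rightField_smul_apply (c : 𝕜) (α : F ⊗[𝕜] (L × V))
    (s : F ⊗[𝕜] Λ*[𝕜] V) :
    rightField br D (c • α) s = c • rightField br D α s := by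
  rw [map_smul (rightField br D)]; rfl

theorem rightField_zero_apply (s : F ⊗[𝕜] Λ*[𝕜] V) :
    rightField br D 0 s = 0 := by
  rw [map_zero (rightField br D)]; rfl

set_option maxHeartbeats 600000 in
theorem leftOp_odd_rightField_of_flat (hbr : IsLieSuper br)
    (hD : ∀ X f g, D X (f * g) = D X f * g + f * D X g)
    (hDbr : ∀ X Y f, D ((br (X, 0) (Y, 0)).1) f = D X (D Y f) - D Y (D X f)) {j : ZMod 2}
    {X : L × V} (hX : X ∈ homog 𝕜 L V 1) {α : F ⊗[𝕜] (L × V)} (hα : α ∈ coeffParity 𝕜 L V F j)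
    (hα0 : ∀ Y : L, coeffDer br D (Y, 0) α = 0)
    (s : F ⊗[𝕜] Λ*[𝕜] V) :
    leftOp br D X (rightField br D α s) =
      ssign 𝕜 1 j • rightField br D α (leftOp br D X s) := by
  have h : leftOp br D X (rightField br D α s) =
      ssign 𝕜 1 j • rightField br D α (leftOp br D X s) +
        evenContract (leftCoeff br X) ((rightField br D ∘ₗ (coeffDer br D).flip α).flip s) := by
    clear hα0
    refine coeffParity_induction (motive := fun α => leftOp br D X (rightField br D α s) =
      ssign 𝕜 1 j • rightField br D α (leftOp br D X s) + evenContract (leftCoeff br X)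
        ((rightField br D ∘ₗ (coeffDer br D).flip α).flip s)) ?_ (fun α β hα hβ => ?_)
      (fun c α hα => ?_) (fun f Z hZ => leftOp_odd_rightField hbr hD hDbr hX hZ f s) hα
    · rw [rightField_zero_apply, rightField_zero_apply, map_zero, smul_zero, zero_add,
        evenContract_eq_zero]
      intro Y
      change rightField br D (coeffDer br D (Y, 0) 0) s = 0
      rw [map_zero, rightField_zero_apply]
    · have e : (rightField br D ∘ₗ (coeffDer br D).flip (α + β)).flip s =
          (rightField br D ∘ₗ (coeffDer br D).flip α).flip s +
            (rightField br D ∘ₗ (coeffDer br D).flip β).flip s := LinearMap.ext fun Y => by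
        change rightField br D (coeffDer br D Y (α + β)) s = rightField br D (coeffDer br D Y α) s +
          rightField br D (coeffDer br D Y β) s
        rw [map_add, rightField_add_apply]
      rw [e, evenContract_add, rightField_add_apply, rightField_add_apply, map_add, hα, hβ, smul_add]
      exact add_add_add_comm _ _ _ _
    · have e : (rightField br D ∘ₗ (coeffDer br D).flip (c • α)).flip s =
          c • (rightField br D ∘ₗ (coeffDer br D).flip α).flip s := LinearMap.ext fun Y => by
        change rightField br D (coeffDer br D Y (c • α)) s = c • rightField br D (coeffDer br D Y α) s
        rw [map_smul, rightField_smul_apply]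
      rw [e, evenContract_smul, rightField_smul_apply, rightField_smul_apply, map_smul, hα, smul_add,
        smul_comm c]
  rw [h, evenContract_eq_zero, add_zero]
  intro Y
  change rightField br D (coeffDer br D (Y, 0) α) s = 0
  rw [hα0, rightField_zero_apply]

theorem ssign_comm (i j : ZMod 2) : ssign 𝕜 i j = ssign 𝕜 j i := by
  simp only [ssign, and_comm]

theorem ssign_mul_self (i j : ZMod 2) : ssign 𝕜 i j * ssign 𝕜 i j = 1 := by
  rw [ssign]; split_ifs <;> norm_num

theorem ssign_add_right (i j k : ZMod 2) : ssign 𝕜 i (j + k) = ssign 𝕜 i j * ssign 𝕜 i k := by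
  have h : ∀ l : ZMod 2, l = 0 ∨ l = 1 := by decide
  rcases h i with rfl | rfl
  · simp only [ssign_of_left_even, one_mul]
  rcases h j with rfl | rfl
  · simp only [zero_add, ssign_of_right_even, one_mul]
  rcases h k with rfl | rfl
  · simp only [add_zero, ssign_of_right_even, mul_one]
  · simp only [show (1 : ZMod 2) + 1 = 0 from rfl, ssign_of_right_even, ssign_odd]
    norm_num

theorem leftOp_rightField_of_flat (hbr : IsLieSuper br)
    (hD : ∀ X f g, D X (f * g) = D X f * g + f * D X g)
    (hDbr : ∀ X Y f, D ((br (X, 0) (Y, 0)).1) f = D X (D Y f) - D Y (D X f)) {i j : ZMod 2}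
    {X : L × V} (hX : X ∈ homog 𝕜 L V i) {α : F ⊗[𝕜] (L × V)} (hα : α ∈ coeffParity 𝕜 L V F j)
    (hα0 : ∀ Y : L, coeffDer br D (Y, 0) α = 0)
    (s : F ⊗[𝕜] Λ*[𝕜] V) :
    leftOp br D X (rightField br D α s) =
      ssign 𝕜 i j • rightField br D α (leftOp br D X s) := by
  by_cases hi : i = 0
  · subst hi
    obtain ⟨x, rfl⟩ : ∃ x, X = (x, 0) := ⟨X.1, Prod.ext rfl (mem_homog_zero.mp hX)⟩
    simp only [ssign_of_left_even, one_smul, leftOp_even_rightField hbr hD hDbr, hα0,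
      rightField_zero_apply, zero_add]
  · have h1 : ∀ k : ZMod 2, k ≠ 0 → k = 1 := by decide
    obtain rfl := h1 i hi
    exact leftOp_odd_rightField_of_flat hbr hD hDbr hX hα hα0 s

omit [FiniteDimensional 𝕜 V] in
theorem tmul_one_mul_comm (f : F) (s : F ⊗[𝕜] Λ*[𝕜] V) :
    (f ⊗ₜ[𝕜] (1 : Λ*[𝕜] V)) * s = s * (f ⊗ₜ 1) := by
  induction s with
  | zero => rw [mul_zero, zero_mul]
  | add s t hs ht => simp only [mul_add, add_mul, hs, ht]
  | tmul g c => simp only [tmul_mul_tmul, one_mul, mul_one, mul_comm]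

theorem rightField_tmul_mul (hbr : IsLieSuper br)
    (hD : ∀ X f g, D X (f * g) = D X f * g + f * D X g) {i j : ZMod 2} (f : F) {Z : L × V}
    (hZ : Z ∈ homog 𝕜 L V i) {s : F ⊗[𝕜] Λ*[𝕜] V}
    (hs : s ∈ sectionParity 𝕜 V F j) (t : F ⊗[𝕜] Λ*[𝕜] V) :
    rightField br D (f ⊗ₜ Z) (s * t) =
      rightField br D (f ⊗ₜ Z) s * t + ssign 𝕜 i j • (s * rightField br D (f ⊗ₜ Z) t) := by
  simp only [rightField_tmul, fieldOp_mul hD (rightCoeff_mem hbr hZ) hs]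
  generalize fieldOp V D (rightCoeff br Z) s = u
  generalize fieldOp V D (rightCoeff br Z) t = u'
  have h1 : ((f ⊗ₜ[𝕜] (1 : Λ*[𝕜] V)) * u) * t = (f ⊗ₜ 1) * (u * t) :=
    mul_assoc _ _ _
  have h2 : (f ⊗ₜ[𝕜] (1 : Λ*[𝕜] V)) * (s * u') =
      s * ((f ⊗ₜ 1) * u') := by
    simp only [tmul_one_mul_comm, mul_assoc]
  simp only [h1, ← h2, mul_add, mul_smul_comm]

theorem rightField_mul (hbr : IsLieSuper br) (hD : ∀ X f g, D X (f * g) = D X f * g + f * D X g)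
    {i j : ZMod 2} {α : F ⊗[𝕜] (L × V)} (hα : α ∈ coeffParity 𝕜 L V F i)
    {s : F ⊗[𝕜] Λ*[𝕜] V} (hs : s ∈ sectionParity 𝕜 V F j)
    (t : F ⊗[𝕜] Λ*[𝕜] V) :
    rightField br D α (s * t) =
      rightField br D α s * t + ssign 𝕜 i j • (s * rightField br D α t) := by
  refine coeffParity_induction (motive := fun α => rightField br D α (s * t) =
      rightField br D α s * t + ssign 𝕜 i j • (s * rightField br D α t)) ?_ (fun α β hα hβ => ?_)
      (fun c α hα => ?_) (fun f Z hZ => ?_) hα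
  · simp only [rightField_zero_apply, zero_mul, mul_zero, smul_zero, add_zero]
  · simp only [rightField_add_apply, hα, hβ, add_mul, mul_add, smul_add]
    exact add_add_add_comm _ _ _ _
  · simp only [rightField_smul_apply, hα, smul_mul_assoc, mul_smul_comm, smul_add, smul_comm c]
  · exact rightField_tmul_mul hbr hD f hZ hs t

theorem rightField_mem (hbr : IsLieSuper br) {i j : ZMod 2} {α : F ⊗[𝕜] (L × V)}
    (hα : α ∈ coeffParity 𝕜 L V F i)
    {s : F ⊗[𝕜] Λ*[𝕜] V} (hs : s ∈ sectionParity 𝕜 V F j) :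
    rightField br D α s ∈ sectionParity 𝕜 V F (i + j) := by
  refine coeffParity_induction (motive := fun α => rightField br D α s ∈ sectionParity 𝕜 V F (i + j))
    ?_ (fun α β hα hβ => ?_) (fun c α hα => ?_) (fun f Z hZ => ?_) hα
  · rw [rightField_zero_apply]; exact Submodule.zero_mem _
  · rw [rightField_add_apply]; exact Submodule.add_mem _ hα hβ
  · rw [rightField_smul_apply]; exact Submodule.smul_mem _ c hα
  · rw [rightField_tmul]
    refine sectionParity_le (Q := (sectionParity 𝕜 V F (i + j)).comap (mulLeft 𝕜 (f ⊗ₜ 1)))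
      (fun g c hc => ?_) (fieldOp_mem (rightCoeff_mem hbr hZ) hs)
    change (f ⊗ₜ 1) * (g ⊗ₜ c) ∈ sectionParity 𝕜 V F (i + j)
    rw [tmul_mul_tmul, one_mul]
    exact tmul_mem_sectionParity _ hc

theorem bodyMap_rightField_tmul (f : F) (Z : L × V)
    (s : F ⊗[𝕜] Λ*[𝕜] V) :
    bodyMap (rightField br D (f ⊗ₜ Z) s) = f * bodyMap (leftOp br D Z s) := by
  simp only [rightField_tmul, bodyMap_tmul_one_mul, bodyMap_fieldOp_rightCoeff]

theorem eval_bodyMap_rightField {ev : F →ₗ[𝕜] 𝕜} (hev : ∀ f g, ev (f * g) = ev f * ev g)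
    (α : F ⊗[𝕜] (L × V)) (s : F ⊗[𝕜] Λ*[𝕜] V) :
    ev (bodyMap (rightField br D α s)) = ev (bodyMap (leftOp br D (evalCoeff ev α) s)) := by
  induction α with
  | zero =>
    simp only [map_zero (evalCoeff ev), map_zero (leftOp br D), rightField_zero_apply,
      LinearMap.zero_apply]
  | add α β hα hβ =>
    simp only [map_add (evalCoeff ev), map_add (leftOp br D), LinearMap.add_apply, map_add, hα, hβ]
  | tmul f Z =>
    simp only [bodyMap_rightField_tmul, hev, evalCoeff_tmul, map_smul (leftOp br D),
      LinearMap.smul_apply, map_smul, smul_eq_mul]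

theorem rightField_even_tmul_one (f g : F) (Z : L) :
    rightField br D (f ⊗ₜ (Z, 0)) (g ⊗ₜ 1) = (f * D Z g) ⊗ₜ 1 := by
  simp only [rightField_tmul, rightCoeff_even, fieldOp_even, tmul_mul_tmul,
    one_mul]

end RightField

/-! ### The right-invariant vector fields -/

section RightOp

variable {𝕜 : Type*} [RCLike 𝕜] {L V : Type*} [AddCommGroup L] [Module 𝕜 L] [AddCommGroup V]
  [Module 𝕜 V] {br : Bil[𝕜] (L × V)}
  {F : Type*} [CommRing F] [Algebra 𝕜 F] {D : L →ₗ[𝕜] Module.End 𝕜 F}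

theorem supercomm_defect {R : Type*} [Ring R] [Algebra 𝕜 R] {d x y z : R} {a b : 𝕜}
    (hx : d * x = a • (x * d)) (hy : d * y = b • (y * d)) (hz : d * z = (a * b) • (z * d)) (c : 𝕜) :
    d * (x * y - z - c • (y * x)) = (a * b) • ((x * y - z - c • (y * x)) * d) := by
  have e1 : d * (x * y) = (a * b) • (x * y * d) := by
    rw [← mul_assoc, hx, smul_mul_assoc, mul_assoc, hy, mul_smul_comm, smul_smul, mul_assoc]
  have e2 : d * (y * x) = (a * b) • (y * x * d) := by
    rw [← mul_assoc, hy, smul_mul_assoc, mul_assoc, hx, mul_smul_comm, smul_smul, mul_assoc, mul_comm b]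
  rw [mul_sub, mul_sub, e1, hz, mul_smul_comm, e2, sub_mul, sub_mul, smul_sub, smul_sub, smul_mul_assoc,
    smul_comm c]

/-- The function algebra `F` with the derivations `D` and the points `ev`, and a family `α` of functions
with values in `𝔤` which has the properties of the functions `g ↦ Ad(g⁻¹) X`, `X ∈ 𝔤`. -/
structure IsRightFrame (br : Bil[𝕜] (L × V)) (D : L →ₗ[𝕜] Module.End 𝕜 F)
    {T : Type*} (ev : T → F →ₗ[𝕜] 𝕜) (α : (L × V) →ₗ[𝕜] F ⊗[𝕜] (L × V)) : Prop where
  lie : IsLieSuper br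
  der : ∀ X f g, D X (f * g) = D X f * g + f * D X g
  der_bracket : ∀ X Y f, D ((br (X, 0) (Y, 0)).1) f = D X (D Y f) - D Y (D X f)
  ev_mul : ∀ p f g, ev p (f * g) = ev p f * ev p g
  ev_ext : ∀ f, (∀ p, ev p f = 0) → f = 0
  mem : ∀ i, ∀ X ∈ homog 𝕜 L V i, α X ∈ coeffParity 𝕜 L V F i
  flat : ∀ X (Y : L), coeffDer br D (Y, 0) (α X) = 0
  bracket : ∀ p X Y, evalCoeff (ev p) (α (br X Y)) = br (evalCoeff (ev p) (α X)) (evalCoeff (ev p) (α Y))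
  surj : ∀ p, Function.Surjective fun X => evalCoeff (ev p) (α X)

variable [FiniteDimensional 𝕜 V]

variable (br D) in
/-- The right-invariant vector fields: the action of `X` is the left-invariant vector field of
`-Ad(g⁻¹) X` on the body, and is right-invariant in the odd directions. -/
def rightOp (α : (L × V) →ₗ[𝕜] F ⊗[𝕜] (L × V)) :
    (L × V) →ₗ[𝕜] Module.End 𝕜 (F ⊗[𝕜] Λ*[𝕜] V) :=
  -(rightField br D ∘ₗ α)

theorem rightOp_apply (α : (L × V) →ₗ[𝕜] F ⊗[𝕜] (L × V)) (X : L × V)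
    (s : F ⊗[𝕜] Λ*[𝕜] V) :
    rightOp br D α X s = -rightField br D (α X) s := rfl

variable {T : Type*} {ev : T → F →ₗ[𝕜] 𝕜} {α : (L × V) →ₗ[𝕜] F ⊗[𝕜] (L × V)}

namespace IsRightFrame

theorem leftOp_rightOp (h : IsRightFrame br D ev α) {i j : ZMod 2} {X Y : L × V}
    (hX : X ∈ homog 𝕜 L V i) (hY : Y ∈ homog 𝕜 L V j)
    (s : F ⊗[𝕜] Λ*[𝕜] V) :
    leftOp br D X (rightOp br D α Y s) = ssign 𝕜 i j • rightOp br D α Y (leftOp br D X s) := by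
  simp only [rightOp_apply, map_neg,
    leftOp_rightField_of_flat h.lie h.der h.der_bracket hX (h.mem j Y hY) (h.flat Y), smul_neg]

theorem rightOp_leftOp (h : IsRightFrame br D ev α) {i j : ZMod 2} {X Y : L × V}
    (hX : X ∈ homog 𝕜 L V i) (hY : Y ∈ homog 𝕜 L V j)
    (s : F ⊗[𝕜] Λ*[𝕜] V) :
    rightOp br D α X (leftOp br D Y s) = ssign 𝕜 i j • leftOp br D Y (rightOp br D α X s) := by
  simp only [h.leftOp_rightOp hY hX, smul_smul, ssign_comm j i, ssign_mul_self, one_smul]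

theorem eval_bodyMap_rightOp (h : IsRightFrame br D ev α) (p : T) (X : L × V)
    (s : F ⊗[𝕜] Λ*[𝕜] V) :
    ev p (bodyMap (rightOp br D α X s)) =
      -ev p (bodyMap (leftOp br D (evalCoeff (ev p) (α X)) s)) := by
  simp only [rightOp_apply, map_neg, eval_bodyMap_rightField (h.ev_mul p)]

theorem rightOp_mul (h : IsRightFrame br D ev α) {i j : ZMod 2} {X : L × V}
    (hX : X ∈ homog 𝕜 L V i) {s : F ⊗[𝕜] Λ*[𝕜] V}
    (hs : s ∈ sectionParity 𝕜 V F j) (t : F ⊗[𝕜] Λ*[𝕜] V) :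
    rightOp br D α X (s * t) = rightOp br D α X s * t + ssign 𝕜 i j • (s * rightOp br D α X t) := by
  simp only [rightOp_apply, rightField_mul h.lie h.der (h.mem i X hX) hs, neg_add, neg_mul,
    mul_neg, smul_neg]

theorem rightOp_mem (h : IsRightFrame br D ev α) {i j : ZMod 2} {X : L × V} (hX : X ∈ homog 𝕜 L V i)
    {s : F ⊗[𝕜] Λ*[𝕜] V} (hs : s ∈ sectionParity 𝕜 V F j) :
    rightOp br D α X s ∈ sectionParity 𝕜 V F (i + j) := by
  rw [rightOp_apply]
  exact Submodule.neg_mem _ (rightField_mem h.lie (h.mem i X hX) hs)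

/-- An operator which supercommutes with the odd left-invariant vector fields vanishes if its values
vanish on the body. -/
theorem eq_zero_of_supercomm (h : IsRightFrame br D ev α) (k : ZMod 2)
    {O : Module.End 𝕜 (F ⊗[𝕜] Λ*[𝕜] V)}
    (hO : ∀ v s, leftOp br D (0, v) (O s) = ssign 𝕜 1 k • O (leftOp br D (0, v) s))
    (hb : ∀ p s, ev p (bodyMap (O s)) = 0) : O = 0 := by
  have hb' : ∀ s, bodyMap (O s) = 0 := fun s => h.ev_ext _ fun p => hb p s
  by_cases hk : k = 0
  · subst hk
    refine eq_zero_of_comm (leftOp_isRadial (D := D) h.lie) (j := LinearMap.id) (c := 1) rfl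
      (fun a β => by rw [one_smul]; rfl) (fun v s => ?_) hb'
    rw [hO, ssign_of_right_even]
  · have h1 : ∀ k : ZMod 2, k ≠ 0 → k = 1 := by decide
    obtain rfl := h1 k hk
    refine eq_zero_of_comm (leftOp_isRadial (D := D) h.lie) (j := (extInvol 𝕜 _).toLinearMap) (c := -1)
      (map_one (extInvol 𝕜 _)) (fun a β => ?_) (fun v s => ?_) hb'
    · rw [AlgHom.toLinearMap_apply, map_mul, extInvol_ι, mul_neg, neg_one_smul]
      rfl
    · rw [hO, ssign_odd]

/-- The bracket relations of the right-invariant vector fields hold on the body, where the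
right-invariant vector fields are negatives of left-invariant ones. -/
theorem eval_bodyMap_rightOp_bracket (h : IsRightFrame br D ev α) (p : T) {i j : ZMod 2} {X Y : L × V}
    (hX : X ∈ homog 𝕜 L V i) (hY : Y ∈ homog 𝕜 L V j)
    (s : F ⊗[𝕜] Λ*[𝕜] V) :
    ev p (bodyMap (rightOp br D α X (rightOp br D α Y s))) -
        ev p (bodyMap (rightOp br D α (br X Y) s)) -
      ssign 𝕜 i j * ev p (bodyMap (rightOp br D α Y (rightOp br D α X s))) = 0 := by
  have hx := evalCoeff_mem (ev p) (h.mem i X hX)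
  have hy := evalCoeff_mem (ev p) (h.mem j Y hY)
  have hrep := congrArg (fun t => ev p (bodyMap t))
    (leftOp_isSuperRepOn (D := D) h.lie h.der_bracket i j _ hx _ hy s)
  have e1 : ∀ {i j : ZMod 2} {X Y : L × V}, X ∈ homog 𝕜 L V i → Y ∈ homog 𝕜 L V j →
      ev p (bodyMap (rightOp br D α X (rightOp br D α Y s))) = ssign 𝕜 i j *
        ev p (bodyMap (leftOp br D (evalCoeff (ev p) (α Y)) (leftOp br D (evalCoeff (ev p) (α X)) s))) := by
    intro i j X Y hX hY
    simp only [h.eval_bodyMap_rightOp, h.leftOp_rightOp (evalCoeff_mem (ev p) (h.mem i X hX)) hY,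
      map_smul, smul_eq_mul, mul_neg, neg_neg]
  rw [map_add, map_add, map_smul, map_smul, smul_eq_mul] at hrep
  simp only [e1 hX hY, e1 hY hX, h.eval_bodyMap_rightOp, h.bracket, ssign_comm j i]
  have := ssign_mul_self (𝕜 := 𝕜) i j
  linear_combination (-ev p (bodyMap (leftOp br D (evalCoeff (ev p) (α X))
    (leftOp br D (evalCoeff (ev p) (α Y)) s)))) * this - hrep

/-- The right-invariant vector fields form a representation. Both sides of each bracket relation
supercommute with the left-invariant vector fields, so that they have to be compared on the body only. -/
theorem rightOp_isSuperRepOn (h : IsRightFrame br D ev α) : IsSuperRepOn br (rightOp br D α) := by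
  intro i j X hX Y hY s
  have hc : ∀ {k : ZMod 2} (v : V) {Z : L × V}, Z ∈ homog 𝕜 L V k →
      leftOp br D (0, v) * rightOp br D α Z = ssign 𝕜 1 k • (rightOp br D α Z * leftOp br D (0, v)) :=
    fun v Z hZ => LinearMap.ext fun s => h.leftOp_rightOp (odd_mem_homog v) hZ s
  have H : rightOp br D α X * rightOp br D α Y - rightOp br D α (br X Y) -
      ssign 𝕜 i j • (rightOp br D α Y * rightOp br D α X) = 0 := by
    refine h.eq_zero_of_supercomm (i + j) (fun v => ?_) (fun p s => ?_)
    · have hXY := hc v (h.lie.mem i j X hX Y hY)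
      rw [ssign_add_right] at hXY ⊢
      exact LinearMap.congr_fun (supercomm_defect (hc v hX) (hc v hY) hXY (ssign 𝕜 i j))
    · refine Eq.trans ?_ (h.eval_bodyMap_rightOp_bracket p hX hY s)
      simp only [LinearMap.sub_apply, LinearMap.smul_apply, map_sub, map_smul, smul_eq_mul]
      rfl
  have := LinearMap.congr_fun H s
  exact sub_eq_iff_eq_add'.mp ((sub_sub _ _ _).symm.trans this) |>.trans (add_zero _)

end IsRightFrame

omit [FiniteDimensional 𝕜 V] in
theorem tmul_one_eq_zero {f : F}
    (h : (f ⊗ₜ 1 : F ⊗[𝕜] Λ*[𝕜] V) = 0) : f = 0 := by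
  have := congrArg bodyMap h
  rwa [bodyMap_tmul, map_one, one_smul, map_zero] at this

/-- The superfunctions which are annihilated by all left-invariant vector fields are of degree zero. -/
theorem eq_tmul_one_of_leftOp_eq_zero (hbr : IsLieSuper br)
    {s : F ⊗[𝕜] Λ*[𝕜] V} (hs : ∀ X, leftOp br D X s = 0) :
    s = bodyMap s ⊗ₜ 1 ∧ ∀ X, D X (bodyMap s) = 0 := by
  have h : s = bodyMap s ⊗ₜ 1 := by
    refine eq_bodyMap_tmul_one (leftOp_isRadial (D := D) hbr) (I := 𝕜 ∙ s) ?_ ?_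
      (Submodule.mem_span_singleton_self s)
    · intro v t ht
      obtain ⟨c, rfl⟩ := Submodule.mem_span_singleton.mp ht
      simp only [map_smul, hs, smul_zero]
      exact Submodule.zero_mem _
    · intro v t ht
      obtain ⟨c, rfl⟩ := Submodule.mem_span_singleton.mp ht
      simp only [map_smul, hs, smul_zero, map_zero]
  refine ⟨h, fun X => tmul_one_eq_zero (𝕜 := 𝕜) (V := V) ?_⟩
  simp only [← leftOp_even_tmul_one hbr, ← h, hs]

/-- The superfunctions which are annihilated by all right-invariant vector fields are of degree zero. -/
theorem eq_tmul_one_of_rightOp_eq_zero (h : IsRightFrame br D ev α)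
    {s : F ⊗[𝕜] Λ*[𝕜] V} (hs : ∀ X, rightOp br D α X s = 0) :
    s = bodyMap s ⊗ₜ 1 ∧ ∀ X, D X (bodyMap s) = 0 := by
  let I : Submodule 𝕜 (F ⊗[𝕜] Λ*[𝕜] V) :=
    ⨅ X, LinearMap.ker (rightOp br D α X)
  have hI : ∀ t, t ∈ I ↔ ∀ X, rightOp br D α X t = 0 := fun t => by
    rw [Submodule.mem_iInf]; rfl
  have hb : ∀ X, ∀ t ∈ I, bodyMap (leftOp br D X t) = 0 := by
    intro X t ht
    refine h.ev_ext _ fun p => ?_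
    obtain ⟨Y, hY⟩ := h.surj p X
    simp only [← hY, ← neg_eq_zero, ← h.eval_bodyMap_rightOp, (hI t).mp ht, map_zero]
  have hs' : s = bodyMap s ⊗ₜ 1 := by
    refine eq_bodyMap_tmul_one (leftOp_isRadial (D := D) h.lie) (I := I) ?_ (fun v => hb _)
      ((hI s).mpr hs)
    intro v t ht
    rw [hI] at ht ⊢
    intro X
    have hv := odd_mem_homog (𝕜 := 𝕜) (L := L) v
    rw [show X = (X.1, 0) + (0, X.2) by simp, map_add, LinearMap.add_apply,
      h.rightOp_leftOp (even_mem_homog X.1) hv, h.rightOp_leftOp (odd_mem_homog X.2) hv, ht, ht,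
      map_zero, smul_zero, smul_zero, add_zero]
  refine ⟨hs', fun X => tmul_one_eq_zero (𝕜 := 𝕜) (V := V) ?_⟩
  have := hb (X, 0) s ((hI s).mpr hs)
  rw [hs', leftOp_even_tmul_one h.lie, bodyMap_tmul, map_one, one_smul] at this
  rw [this, zero_tmul]

end RightOp

/-! ### Derivatives at the identity of a Lie group -/

section OneDer

variable {𝕜 : Type*} [RCLike 𝕜] {E : Type*} [NormedAddCommGroup E] [NormedSpace 𝕜 E]
  {G : Type*} [TopologicalSpace G] [ChartedSpace E G] [Group G]

/-- The derivative at the identity of a numerical function in the direction `X`. -/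
def oneDer (X : Lie[𝕜, E] G) (u : G → 𝕜) : 𝕜 :=
  (mfderiv 𝓘(𝕜, E) 𝓘(𝕜, 𝕜) u 1 X : 𝕜)

variable {X Y : Lie[𝕜, E] G} {u v : G → 𝕜}

theorem oneDer_congr (h : u =ᶠ[nhds 1] v) : oneDer X u = oneDer X v := by
  rw [oneDer, oneDer]
  exact congrArg (fun A : E →L[𝕜] 𝕜 => A X) (Filter.EventuallyEq.mfderiv_eq h)

theorem oneDer_add_dir : oneDer (X + Y) u = oneDer X u + oneDer Y u :=
  (mfderiv 𝓘(𝕜, E) 𝓘(𝕜, 𝕜) u 1).map_add X Y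

theorem oneDer_smul_dir (c : 𝕜) : oneDer (c • X) u = c * oneDer X u :=
  (mfderiv 𝓘(𝕜, E) 𝓘(𝕜, 𝕜) u 1).map_smul c X

theorem oneDer_sum_dir {ι : Type*} (s : Finset ι) (c : ι → 𝕜) (X : ι → Lie[𝕜, E] G) :
    oneDer (∑ i ∈ s, c i • X i) u = ∑ i ∈ s, c i * oneDer (X i) u := by
  classical
  induction s using Finset.induction_on with
  | empty => exact (mfderiv 𝓘(𝕜, E) 𝓘(𝕜, 𝕜) u 1).map_zero
  | insert i s hi ih => simp only [Finset.sum_insert hi, oneDer_add_dir, oneDer_smul_dir, ih]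

theorem oneDer_const (c : 𝕜) : oneDer X (fun _ => c) = 0 := by
  rw [oneDer, mfderiv_const]; rfl

theorem oneDer_mul (hu : MDifferentiableAt 𝓘(𝕜, E) 𝓘(𝕜, 𝕜) u 1)
    (hv : MDifferentiableAt 𝓘(𝕜, E) 𝓘(𝕜, 𝕜) v 1) :
    oneDer X (fun h => u h * v h) = oneDer X u * v 1 + u 1 * oneDer X v := by
  have h := (hu.hasMFDerivAt.mul hv.hasMFDerivAt).mfderiv
  refine (congrArg (fun A : E →L[𝕜] 𝕜 => A X) h).trans ?_
  change u 1 * oneDer X v + v 1 * oneDer X u = _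
  ring

theorem oneDer_add (hu : MDifferentiableAt 𝓘(𝕜, E) 𝓘(𝕜, 𝕜) u 1)
    (hv : MDifferentiableAt 𝓘(𝕜, E) 𝓘(𝕜, 𝕜) v 1) :
    oneDer X (fun h => u h + v h) = oneDer X u + oneDer X v := by
  have h := (hu.hasMFDerivAt.add hv.hasMFDerivAt).mfderiv
  exact congrArg (fun A : E →L[𝕜] 𝕜 => A X) h

omit [Group G] in
theorem mdifferentiableAt_sum_fun {ι : Type*} (s : Finset ι) {u : ι → G → 𝕜} {g : G}
    (hu : ∀ i ∈ s, MDifferentiableAt 𝓘(𝕜, E) 𝓘(𝕜, 𝕜) (u i) g) :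
    MDifferentiableAt 𝓘(𝕜, E) 𝓘(𝕜, 𝕜) (fun h => ∑ i ∈ s, u i h) g := by
  classical
  induction s using Finset.induction_on with
  | empty => simp only [Finset.sum_empty]; exact mdifferentiableAt_const
  | insert i s hi ih =>
    simp only [Finset.sum_insert hi]
    exact (hu i (Finset.mem_insert_self i s)).add (ih fun j hj => hu j (Finset.mem_insert_of_mem hj))

theorem oneDer_sum {ι : Type*} (s : Finset ι) {u : ι → G → 𝕜}
    (hu : ∀ i ∈ s, MDifferentiableAt 𝓘(𝕜, E) 𝓘(𝕜, 𝕜) (u i) 1) :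
    oneDer X (fun h => ∑ i ∈ s, u i h) = ∑ i ∈ s, oneDer X (u i) := by
  classical
  induction s using Finset.induction_on with
  | empty => simp only [Finset.sum_empty, oneDer_const]
  | insert i s hi ih =>
    have hs : ∀ j ∈ s, MDifferentiableAt 𝓘(𝕜, E) 𝓘(𝕜, 𝕜) (u j) 1 := fun j hj =>
      hu j (Finset.mem_insert_of_mem hj)
    simp only [Finset.sum_insert hi]
    rw [← ih hs]
    exact oneDer_add (hu i (Finset.mem_insert_self i s)) (mdifferentiableAt_sum_fun s hs)

theorem oneDer_sum_mul {ι : Type*} [Fintype ι] (u v : ι → G → 𝕜)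
    (hu : ∀ i, MDifferentiableAt 𝓘(𝕜, E) 𝓘(𝕜, 𝕜) (u i) 1)
    (hv : ∀ i, MDifferentiableAt 𝓘(𝕜, E) 𝓘(𝕜, 𝕜) (v i) 1) :
    oneDer X (fun h => ∑ i, u i h * v i h) =
      ∑ i, oneDer X (u i) * v i 1 + ∑ i, u i 1 * oneDer X (v i) := by
  rw [oneDer_sum (u := fun i h => u i h * v i h) _ fun i _ => (hu i).mul (hv i), ← Finset.sum_add_distrib]
  exact Finset.sum_congr rfl fun i _ => oneDer_mul (hu i) (hv i)

/-- In the chart at the identity, `oneDer` is an ordinary derivative. -/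
theorem oneDer_eq_fderiv (hu : MDifferentiableAt 𝓘(𝕜, E) 𝓘(𝕜, 𝕜) u 1) :
    oneDer X u = fderiv 𝕜 (u ∘ (chartAt E (1 : G)).symm) (chartAt E (1 : G) 1) X := by
  rw [oneDer, hu.mfderiv]
  simp only [mfld_simps, fderivWithin_univ]
  rfl

theorem contDiffAt_chart {n : ℕ∞ω} {Φ : G × G → 𝕜}
    (hΦ : ContMDiffAt (𝓘(𝕜, E).prod 𝓘(𝕜, E)) 𝓘(𝕜, 𝕜) n Φ (1, 1)) :
    ContDiffAt 𝕜 n (fun z : E × E => Φ ((chartAt E (1 : G)).symm z.1, (chartAt E (1 : G)).symm z.2))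
      (chartAt E (1 : G) 1, chartAt E (1 : G) 1) := by
  have h := (contMDiffAt_iff.mp hΦ).2
  rw [(𝓘(𝕜, E).prod 𝓘(𝕜, E)).range_eq_univ, contDiffWithinAt_univ] at h
  exact h

variable [IsManifold 𝓘(𝕜, E) 1 G]

theorem oneDer_oneDer_eq {F : E × E → 𝕜} {x : E} (hx : x = chartAt E (1 : G) 1)
    (hF : ContDiffAt 𝕜 2 F (x, x)) (ι₁ ι₂ : E →L[𝕜] E × E) (hι : ι₁ x + ι₂ x = (x, x)) {Ψ : G → G → 𝕜}
    (hΨ : ∀ᶠ k in nhds 1, MDifferentiableAt 𝓘(𝕜, E) 𝓘(𝕜, 𝕜) (Ψ k) 1)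
    (hΨF : ∀ k ∈ (chartAt E (1 : G)).source, ∀ y,
      Ψ k ((chartAt E (1 : G)).symm y) = F (ι₁ (chartAt E (1 : G) k) + ι₂ y))
    (X Y : Lie[𝕜, E] G) :
    oneDer X (fun k => oneDer Y (Ψ k)) = fderiv 𝕜 (fderiv 𝕜 F) (x, x) (ι₁ X) (ι₂ Y) := by
  let φ := chartAt E (1 : G)
  have h1s : (1 : G) ∈ φ.source := mem_chart_source E 1
  let W : E → 𝕜 := fun y => fderiv 𝕜 F (ι₁ y + ι₂ x) (ι₂ Y)
  have hd : DifferentiableAt 𝕜 (fderiv 𝕜 F) (ι₁ x + ι₂ x) := by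
    rw [hι]; exact (hF.fderiv_right (m := 1) le_rfl).differentiableAt (by simp)
  have hW : HasFDerivAt W ((ContinuousLinearMap.apply 𝕜 𝕜 (ι₂ Y)) ∘L
      (fderiv 𝕜 (fderiv 𝕜 F) (ι₁ x + ι₂ x)) ∘L ι₁) x := by
    have h1 : HasFDerivAt (fun y => ι₁ y + ι₂ x) ι₁ x := ι₁.hasFDerivAt.add_const _
    exact (ContinuousLinearMap.apply 𝕜 𝕜 (ι₂ Y)).hasFDerivAt.comp x (hd.hasFDerivAt.comp x h1)
  have hFd : ∀ᶠ z in nhds (x, x), DifferentiableAt 𝕜 F z :=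
    (hF.eventually (by simp)).mono fun z hz => hz.differentiableAt (by simp)
  have hc : Filter.Tendsto (fun k => ι₁ (φ k) + ι₂ x) (nhds 1) (nhds (x, x)) := by
    have : ContinuousAt (fun k => ι₁ (φ k) + ι₂ x) 1 :=
      (ι₁.continuous.continuousAt.comp (φ.continuousAt h1s)).add continuousAt_const
    rw [ContinuousAt] at this
    rwa [show ι₁ (φ 1) + ι₂ x = (x, x) by rw [← hι]; rw [hx]] at this
  have hev : (fun k => oneDer Y (Ψ k)) =ᶠ[nhds 1] W ∘ φ := by
    filter_upwards [hΨ, hc.eventually hFd, φ.open_source.mem_nhds h1s] with k hk hk' hks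
    rw [oneDer_eq_fderiv hk, ← hx]
    have e : Ψ k ∘ φ.symm = F ∘ fun y => ι₁ (φ k) + ι₂ y := funext fun y => hΨF k hks y
    rw [e]
    have h2 : HasFDerivAt (fun y => ι₁ (φ k) + ι₂ y) ι₂ x := ι₂.hasFDerivAt.const_add _
    rw [(hk'.hasFDerivAt.comp x h2).fderiv]
    rfl
  rw [oneDer_congr hev]
  have hφ : MDifferentiableAt 𝓘(𝕜, E) 𝓘(𝕜, E) φ 1 := mdifferentiableAt_atlas (chart_mem_atlas E 1) h1s
  have hWφ : MDifferentiableAt 𝓘(𝕜, E) 𝓘(𝕜, 𝕜) (W ∘ φ) 1 := by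
    refine MDifferentiableAt.comp (I' := 𝓘(𝕜, E)) 1 ?_ hφ
    change MDifferentiableAt 𝓘(𝕜, E) 𝓘(𝕜, 𝕜) W (chartAt E (1 : G) 1)
    rw [← hx]
    exact hW.differentiableAt.mdifferentiableAt
  rw [oneDer_eq_fderiv hWφ, ← hx]
  have hxt : x ∈ φ.target := by rw [hx]; exact φ.map_source h1s
  have hev2 : (W ∘ φ) ∘ φ.symm =ᶠ[nhds x] W := by
    filter_upwards [φ.open_target.mem_nhds hxt] with y hy
    exact congrArg W (φ.right_inv hy)
  rw [hev2.fderiv_eq, hW.fderiv, hι]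
  rfl

/-- Derivatives in two variables commute. -/
theorem oneDer_comm [IsManifold 𝓘(𝕜, E) 2 G] {Φ : G × G → 𝕜}
    (hΦ : ContMDiffAt (𝓘(𝕜, E).prod 𝓘(𝕜, E)) 𝓘(𝕜, 𝕜) 2 Φ (1, 1))
    (X Y : Lie[𝕜, E] G) :
    oneDer X (fun k => oneDer Y fun h => Φ (k, h)) = oneDer Y fun h => oneDer X fun k => Φ (k, h) := by
  have hF := contDiffAt_chart hΦ
  have hev : ∀ᶠ z in nhds ((1, 1) : G × G), MDifferentiableAt (𝓘(𝕜, E).prod 𝓘(𝕜, E)) 𝓘(𝕜, 𝕜) Φ z :=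
    ((contMDiffAt_iff_contMDiffAt_nhds (by simp)).mp hΦ).mono fun z hz => hz.mdifferentiableAt (by simp)
  have c1 : Filter.Tendsto (fun k : G => (k, (1 : G))) (nhds 1) (nhds (1, 1)) :=
    (continuous_id.prodMk continuous_const).continuousAt
  have c2 : Filter.Tendsto (fun k : G => ((1 : G), k)) (nhds 1) (nhds (1, 1)) :=
    (continuous_const.prodMk continuous_id).continuousAt
  rw [oneDer_oneDer_eq rfl hF (ContinuousLinearMap.inl 𝕜 E E) (ContinuousLinearMap.inr 𝕜 E E) (by simp)
      (Ψ := fun k h => Φ (k, h)) ?_ ?_ X Y,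
    oneDer_oneDer_eq rfl hF (ContinuousLinearMap.inr 𝕜 E E) (ContinuousLinearMap.inl 𝕜 E E) (by simp)
      (Ψ := fun h k => Φ (k, h)) ?_ ?_ Y X]
  · exact hF.isSymmSndFDerivAt (by simp) _ _
  · filter_upwards [c2.eventually hev] with h hh
    exact hh.comp (1 : G) (mdifferentiableAt_id.prodMk mdifferentiableAt_const)
  · intro k hk y
    simp [(chartAt E (1 : G)).left_inv hk]
  · filter_upwards [c1.eventually hev] with h hh
    exact hh.comp (1 : G) (mdifferentiableAt_const.prodMk mdifferentiableAt_id)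
  · intro k hk y
    simp [(chartAt E (1 : G)).left_inv hk]

omit [Group G] in
/-- A function on an open set is locally constant if its derivative vanishes. -/
theorem isLocallyConstant_of_mfderiv_eq_zero {U : Opens G} (f : NumFun 𝕜 E U)
    (hf : ∀ x ∈ U, mfderiv 𝓘(𝕜, E) 𝓘(𝕜, 𝕜) (extendZero f) x = 0) : IsLocallyConstant f := by
  refine IsLocallyConstant.iff_eventually_eq f |>.mpr fun x => ?_
  let φ := chartAt E (x : G)
  have hs : IsOpen (φ.target ∩ φ.symm ⁻¹' U) := φ.isOpen_inter_preimage_symm U.2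
  have hd : ∀ y ∈ φ.target ∩ φ.symm ⁻¹' U, HasFDerivAt (extendZero f ∘ φ.symm) (0 : E →L[𝕜] 𝕜) y := by
    intro y hy
    have h1 := ((contMDiffAt_extendZero f hy.2).mdifferentiableAt (by simp)).hasMFDerivAt.comp y
      (mdifferentiableAt_atlas_symm (I := 𝓘(𝕜, E)) (chart_mem_atlas E (x : G)) hy.1).hasMFDerivAt
    rw [hf _ hy.2, ContinuousLinearMap.zero_comp] at h1
    exact hasMFDerivAt_iff_hasFDerivAt.mp h1
  have hx : (x : G) ∈ φ.source := mem_chart_source E _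
  have hxs : φ x ∈ φ.target ∩ φ.symm ⁻¹' U :=
    ⟨φ.map_source hx, by rw [Set.mem_preimage, φ.left_inv hx]; exact x.2⟩
  let _ : NormedSpace ℝ E := NormedSpace.restrictScalars ℝ 𝕜 E
  obtain ⟨r, hr, hb⟩ := Metric.isOpen_iff.mp hs _ hxs
  have hc : ∀ᶠ y : U in nhds x, φ y ∈ Metric.ball (φ x) r :=
    ((φ.continuousAt hx).comp continuous_subtype_val.continuousAt).eventually_mem
      (Metric.ball_mem_nhds _ hr)
  have hy' : ∀ᶠ y : U in nhds x, (y : G) ∈ φ.source :=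
    continuous_subtype_val.continuousAt.eventually_mem (φ.open_source.mem_nhds hx)
  filter_upwards [hc, hy'] with y hy hy'
  have := Metric.isOpen_ball.is_const_of_fderiv_eq_zero (𝕜 := 𝕜)
    (convex_ball (φ x) r).isPreconnected
    (fun z hz => (hd z (hb hz)).differentiableAt.differentiableWithinAt)
    (fun z hz => (hd z (hb hz)).fderiv) hy (Metric.mem_ball_self hr)
  rw [Function.comp, Function.comp, φ.left_inv hy', φ.left_inv hx] at this
  simpa [extendZero] using this

end OneDer

/-! ### Invariant derivations on a Lie group -/

section InvariantDerivations

variable {𝕜 : Type*} [RCLike 𝕜] {E : Type*} [NormedAddCommGroup E] [NormedSpace 𝕜 E]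
  {G : Type*} [TopologicalSpace G] [ChartedSpace E G]

instance [FiniteDimensional 𝕜 E] [Group G] : FiniteDimensional 𝕜 (Lie[𝕜, E] G) :=
  inferInstanceAs (FiniteDimensional 𝕜 E)

theorem extendZero_apply {U : Opens G} (f : NumFun 𝕜 E U) {g : G} (hg : g ∈ U) :
    extendZero f g = f ⟨g, hg⟩ := dif_pos hg

theorem extendZero_mul {U : Opens G} (f f' : NumFun 𝕜 E U) (g : G) :
    extendZero (f * f') g = extendZero f g * extendZero f' g := by
  by_cases h : g ∈ U <;> simp [extendZero, h]

theorem extendZero_res {U W : Opens G} (h : U ≤ W) (f : NumFun 𝕜 E W) {g : G} (hg : g ∈ U) :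
    extendZero (NumFun.res h f) g = extendZero f g := by
  rw [extendZero_apply _ hg, extendZero_apply _ (h hg)]
  rfl

variable [Group G] [LieGroup 𝓘(𝕜, E) ∞ G]

theorem leftDer_apply {U : Opens G} (X : Lie[𝕜, E] G) (f : NumFun 𝕜 E U) (g : U) :
    leftDer U X f g = oneDer X fun h => extendZero f (g * h) := rfl

theorem rightDer_apply {U : Opens G} (X : Lie[𝕜, E] G) (f : NumFun 𝕜 E U) (g : U) :
    rightDer U X f g = -oneDer X fun h => extendZero f (h * g) := rfl

theorem contMDiffAt_extendZero_mul {U : Opens G} (f : NumFun 𝕜 E U) {g h : G} (hgh : g * h ∈ U) :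
    ContMDiffAt 𝓘(𝕜, E) 𝓘(𝕜, 𝕜) ∞ (fun k => extendZero f (g * k)) h :=
  ContMDiffAt.comp (I' := 𝓘(𝕜, E)) h (contMDiffAt_extendZero f hgh) (contMDiff_mul_left.contMDiffAt)

theorem mdifferentiableAt_extendZero_mul {U : Opens G} (f : NumFun 𝕜 E U) {g : G} (hg : g ∈ U) :
    MDifferentiableAt 𝓘(𝕜, E) 𝓘(𝕜, 𝕜) (fun k => extendZero f (g * k)) 1 :=
  (contMDiffAt_extendZero_mul f (by rwa [mul_one])).mdifferentiableAt (by simp)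

theorem leftDer_mul {U : Opens G} (X : Lie[𝕜, E] G) (f f' : NumFun 𝕜 E U) :
    leftDer U X (f * f') = leftDer U X f * f' + f * leftDer U X f' := by
  ext g
  change leftDer U X (f * f') g = leftDer U X f g * f' g + f g * leftDer U X f' g
  have h := oneDer_mul (X := X) (mdifferentiableAt_extendZero_mul f g.2)
    (mdifferentiableAt_extendZero_mul f' g.2)
  rw [mul_one, extendZero_apply f g.2, extendZero_apply f' g.2] at h
  simp only [leftDer_apply, ← h]
  simp only [extendZero_mul]

theorem leftDer_res {U W : Opens G} (h : U ≤ W) (X : Lie[𝕜, E] G) (f : NumFun 𝕜 E W) :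
    leftDer U X (NumFun.res h f) = NumFun.res h (leftDer W X f) := by
  ext g
  change leftDer U X (NumFun.res h f) g = leftDer W X f ⟨g, h g.2⟩
  rw [leftDer_apply, leftDer_apply]
  refine oneDer_congr ?_
  have : ∀ᶠ k : G in nhds 1, (g : G) * k ∈ U :=
    (contMDiff_mul_left (I := 𝓘(𝕜, E)) (n := ∞) (a := (g : G))).continuous.continuousAt.eventually_mem
      (U.2.mem_nhds (by rw [mul_one]; exact g.2))
  filter_upwards [this] with k hk
  exact extendZero_res h f hk

/-- A second derivative is a derivative in two variables. -/
theorem leftDer_leftDer_apply {U : Opens G} (X Y : Lie[𝕜, E] G) (f : NumFun 𝕜 E U)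
    (g : U) : leftDer U X (leftDer U Y f) g =
      oneDer X fun k => oneDer Y fun h => extendZero f (g * k * h) := by
  rw [leftDer_apply]
  refine oneDer_congr ?_
  have : ∀ᶠ k : G in nhds 1, (g : G) * k ∈ U :=
    (contMDiff_mul_left (I := 𝓘(𝕜, E)) (n := ∞) (a := (g : G))).continuous.continuousAt.eventually_mem
      (U.2.mem_nhds (by rw [mul_one]; exact g.2))
  filter_upwards [this] with k hk
  rw [extendZero_apply _ hk, leftDer_apply]

/-- A numerical function is locally constant if and only if all invariant derivatives vanish. -/
theorem isLocallyConstant_iff_leftDer {U : Opens G} (f : NumFun 𝕜 E U) :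
    IsLocallyConstant f ↔ ∀ X, leftDer U X f = 0 := by
  constructor
  · intro hf X
    ext g
    change leftDer U X f g = 0
    rw [leftDer_apply, ← oneDer_const (X := X) (extendZero f g)]
    refine oneDer_congr ?_
    have h1 : ∀ᶠ y : G in nhds (g : G), ∀ hy : y ∈ U, f ⟨y, hy⟩ = f g := by
      have h0 := (IsLocallyConstant.iff_eventually_eq f).mp hf g
      rw [nhds_subtype, Filter.eventually_comap] at h0
      filter_upwards [h0] with y hy hyU using hy ⟨y, hyU⟩ rfl
    have ht : Filter.Tendsto (fun k : G => (g : G) * k) (nhds 1) (nhds g) := by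
      have := (contMDiff_mul_left (I := 𝓘(𝕜, E)) (n := ∞) (a := (g : G))).continuous.tendsto 1
      rwa [mul_one] at this
    filter_upwards [ht.eventually h1, ht.eventually (U.2.mem_nhds g.2)] with k hk hkU
    simp only [extendZero_apply f hkU, hk hkU, extendZero_apply f g.2]
  · intro h
    have : IsManifold 𝓘(𝕜, E) 1 G := IsManifold.of_le (n := ∞) (by simp)
    refine isLocallyConstant_of_mfderiv_eq_zero f fun x hx => ?_
    have h0 : mfderiv 𝓘(𝕜, E) 𝓘(𝕜, 𝕜) (fun k => extendZero f (x * k)) 1 = 0 :=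
      ContinuousLinearMap.ext fun X => congrArg (fun u : NumFun 𝕜 E U => u ⟨x, hx⟩) (h X)
    have e : extendZero f = (fun k => extendZero f (x * k)) ∘ fun k => x⁻¹ * k := by
      funext k; simp
    have h1 : MDifferentiableAt 𝓘(𝕜, E) 𝓘(𝕜, 𝕜) (fun k => extendZero f (x * k)) (x⁻¹ * x) := by
      rw [inv_mul_cancel]; exact mdifferentiableAt_extendZero_mul f hx
    have h2 : MDifferentiableAt 𝓘(𝕜, E) 𝓘(𝕜, E) (fun k : G => x⁻¹ * k) x :=
      (contMDiff_mul_left (n := ∞)).contMDiffAt.mdifferentiableAt (by simp)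
    rw [e, mfderiv_comp x h1 h2]
    have h3 : mfderiv 𝓘(𝕜, E) 𝓘(𝕜, 𝕜) (fun k => extendZero f (x * k)) (x⁻¹ * x) = 0 := by
      have : ∀ y, y = 1 → mfderiv 𝓘(𝕜, E) 𝓘(𝕜, 𝕜) (fun k => extendZero f (x * k)) y = 0 := by
        rintro y rfl; exact h0
      exact this _ (inv_mul_cancel x)
    rw [h3, ContinuousLinearMap.zero_comp]

end InvariantDerivations

section Adjoint

variable {𝕜 : Type*} [RCLike 𝕜] {E : Type*} [NormedAddCommGroup E] [NormedSpace 𝕜 E]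
  {V : Type*} [AddCommGroup V] [Module 𝕜 V]
  {G : Type*} [TopologicalSpace G] [ChartedSpace E G] [Group G] [LieGroup 𝓘(𝕜, E) ∞ G]
  (P : HCSuperpair 𝕜 E V G)

theorem oneDer_Ad (X : Lie[𝕜, E] G) (Y : SuperSpace 𝕜 E V G)
    (φ : Module.Dual 𝕜 (SuperSpace 𝕜 E V G)) :
    oneDer X (fun g => φ (P.Ad g Y)) = φ (P.bracket (X, 0) Y) := P.Ad_deriv X Y φ

theorem Ad_mul_apply (g h : G) (X : SuperSpace 𝕜 E V G) : P.Ad (g * h) X = P.Ad g (P.Ad h X) := by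
  rw [map_mul]; rfl

theorem Ad_one_apply (X : SuperSpace 𝕜 E V G) : P.Ad 1 X = X := by
  rw [map_one]; rfl

theorem Ad_Ad_inv (g : G) (X : SuperSpace 𝕜 E V G) : P.Ad g (P.Ad g⁻¹ X) = X := by
  simp only [← Ad_mul_apply, mul_inv_cancel, Ad_one_apply]

theorem mdifferentiableAt_Ad (X : SuperSpace 𝕜 E V G) (φ : Module.Dual 𝕜 (SuperSpace 𝕜 E V G)) (g : G) :
    MDifferentiableAt 𝓘(𝕜, E) 𝓘(𝕜, 𝕜) (fun g => φ (P.Ad g X)) g :=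
  (P.Ad_smooth X φ).mdifferentiable (by simp) g

theorem contMDiff_Ad_inv (X : SuperSpace 𝕜 E V G) (φ : Module.Dual 𝕜 (SuperSpace 𝕜 E V G)) :
    ContMDiff 𝓘(𝕜, E) 𝓘(𝕜, 𝕜) ∞ (fun g => φ (P.Ad g⁻¹ X)) :=
  (P.Ad_smooth X φ).comp (contMDiff_inv 𝓘(𝕜, E) ∞)

theorem mdifferentiableAt_Ad_inv (X : SuperSpace 𝕜 E V G) (φ : Module.Dual 𝕜 (SuperSpace 𝕜 E V G))
    (g : G) : MDifferentiableAt 𝓘(𝕜, E) 𝓘(𝕜, 𝕜) (fun g => φ (P.Ad g⁻¹ X)) g :=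
  (contMDiff_Ad_inv P X φ).mdifferentiable (by simp) g

/-- The derivative along conjugates of a one-parameter group. -/
theorem oneDer_conj (X : Lie[𝕜, E] G) {u : G → 𝕜}
    (hu : MDifferentiableAt 𝓘(𝕜, E) 𝓘(𝕜, 𝕜) u 1) (g : G) :
    oneDer X (fun h => u (g * h * g⁻¹)) = oneDer (P.Ad g (X, 0)).1 u := by
  have h1 : MDifferentiableAt 𝓘(𝕜, E) 𝓘(𝕜, E) (fun h : G => g * h * g⁻¹) 1 :=
    (((contMDiff_mul_right (a := g⁻¹)).comp (contMDiff_mul_left (a := g) (n := ∞))).contMDiffAt).mdifferentiableAt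
      (by simp)
  have e : g * 1 * g⁻¹ = 1 := by simp
  have hu' : MDifferentiableAt 𝓘(𝕜, E) 𝓘(𝕜, 𝕜) u (g * 1 * g⁻¹) := by rwa [e]
  have h2 : mfderiv 𝓘(𝕜, E) 𝓘(𝕜, 𝕜) (u ∘ fun h : G => g * h * g⁻¹) 1 = _ := mfderiv_comp 1 hu' h1
  rw [P.Ad_even]
  refine (congrArg (fun A : E →L[𝕜] 𝕜 => A X) h2).trans ?_
  have : ∀ (y : G) (w : E), y = 1 → (mfderiv 𝓘(𝕜, E) 𝓘(𝕜, 𝕜) u y : E →L[𝕜] 𝕜) w =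
      (mfderiv 𝓘(𝕜, E) 𝓘(𝕜, 𝕜) u 1 : E →L[𝕜] 𝕜) w := by
    rintro y w rfl; rfl
  exact this _ _ e

/-- The right-invariant derivation is, at each point, a left-invariant one. -/
theorem rightDer_apply_eq {U : Opens G} (X : Lie[𝕜, E] G) (f : NumFun 𝕜 E U) (g : U) :
    rightDer U X f g = -leftDer U (P.Ad (g : G)⁻¹ (X, 0)).1 f g := by
  simp only [rightDer_apply, leftDer_apply,
    ← oneDer_conj P X (mdifferentiableAt_extendZero_mul f g.2)]
  congr 2
  funext h
  simp only [inv_inv, ← mul_assoc, mul_inv_cancel, one_mul]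

variable [FiniteDimensional 𝕜 E]

theorem leftDer_bracket {U : Opens G} (X Y : Lie[𝕜, E] G) (f : NumFun 𝕜 E U) :
    leftDer U (P.bracket (X, 0) (Y, 0)).1 f =
      leftDer U X (leftDer U Y f) - leftDer U Y (leftDer U X f) := by
  have : IsManifold 𝓘(𝕜, E) 1 G := IsManifold.of_le (n := ∞) (by simp)
  have : IsManifold 𝓘(𝕜, E) 2 G := IsManifold.of_le (n := ∞) (by norm_cast)
  refine eq_sub_of_add_eq ?_
  ext g
  change leftDer U _ f g + leftDer U Y (leftDer U X f) g = leftDer U X (leftDer U Y f) g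
  let b := finBasis 𝕜 (Lie[𝕜, E] G)
  let φ : ∀ i, Module.Dual 𝕜 (SuperSpace 𝕜 E V G) := fun i => b.coord i ∘ₗ LinearMap.fst 𝕜 _ V
  have hb : ∀ Z : SuperSpace 𝕜 E V G, Z.1 = ∑ i, φ i Z • b i := fun Z => (b.sum_repr Z.1).symm
  -- `f(gkh) = f(g (khk⁻¹) k)`
  have h1 : ∀ᶠ k : G in nhds 1, (oneDer Y fun h => extendZero f (g * k * h)) =
      ∑ i, φ i (P.Ad k (Y, 0)) * oneDer (b i) fun h => extendZero f (g * h * k) := by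
    have hU : ∀ᶠ k : G in nhds 1, (g : G) * k ∈ U :=
      (contMDiff_mul_left (I := 𝓘(𝕜, E)) (n := ∞) (a := (g : G))).continuous.continuousAt.eventually_mem
        (U.2.mem_nhds (by rw [mul_one]; exact g.2))
    filter_upwards [hU] with k hk
    have hd : MDifferentiableAt 𝓘(𝕜, E) 𝓘(𝕜, 𝕜) (fun h : G => extendZero f (g * h * k)) 1 := by
      refine ContMDiffAt.mdifferentiableAt (n := ∞) ?_ (by simp)
      refine ContMDiffAt.comp (I' := 𝓘(𝕜, E)) 1 (contMDiffAt_extendZero f (by simpa using hk)) ?_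
      exact ((contMDiff_mul_right (a := k)).comp (contMDiff_mul_left (a := (g : G)))).contMDiffAt
    simp only [← oneDer_sum_dir, ← hb, ← oneDer_conj P Y hd k]
    congr 1
    funext h
    group
  have hΦ : ContMDiffAt (𝓘(𝕜, E).prod 𝓘(𝕜, E)) 𝓘(𝕜, 𝕜) ∞
      (fun z : G × G => extendZero f (g * z.2 * z.1)) (1, 1) := by
    refine ContMDiffAt.comp (I' := 𝓘(𝕜, E)) ((1, 1) : G × G)
      (contMDiffAt_extendZero f (by simp)) ?_
    exact ((contMDiff_const.mul contMDiff_snd).mul contMDiff_fst).contMDiffAt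
  have hd : ∀ i, MDifferentiableAt 𝓘(𝕜, E) 𝓘(𝕜, 𝕜)
      (fun k : G => oneDer (b i) fun h => extendZero f (g * h * k)) 1 := by
    intro i
    have h2 := contMDiffAt_deriv f (b i) (fun a h => g * h * (g : G)⁻¹ * a)
      (((contMDiff_const.mul contMDiff_snd).mul contMDiff_const).mul contMDiff_fst) (by simp) (g := g) g.2
    have h3 : ContMDiffAt 𝓘(𝕜, E) 𝓘(𝕜, E) ∞ (fun k : G => (g : G) * k) 1 := contMDiff_mul_left.contMDiffAt
    have h4 : ContMDiffAt 𝓘(𝕜, E) 𝓘(𝕜, 𝕜) ∞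
        (fun a => oneDer (b i) fun h => extendZero f (g * h * (g : G)⁻¹ * a)) ((g : G) * 1) := by
      rw [mul_one]; exact h2
    refine ((ContMDiffAt.comp (1 : G) h4 h3).mdifferentiableAt (by simp)).congr_of_eventuallyEq
      (Filter.Eventually.of_forall fun k => ?_)
    simp [Function.comp, mul_assoc]
  simp only [leftDer_leftDer_apply X Y, oneDer_congr h1,
    oneDer_sum_mul _ _ (fun i => mdifferentiableAt_Ad P (Y, 0) (φ i) 1) hd]
  simp_rw [oneDer_Ad, Ad_one_apply]
  rw [leftDer_apply]
  congr 1
  · rw [hb (P.bracket (X, 0) (Y, 0)), oneDer_sum_dir]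
    simp only [mul_one]
  · rw [leftDer_leftDer_apply Y X]
    have h3 : ∀ i, oneDer X (fun k => oneDer (b i) fun h => extendZero f (g * h * k)) =
        oneDer (b i) fun h => oneDer X fun k => extendZero f (g * h * k) := fun i =>
      oneDer_comm (hΦ.of_le (by norm_cast)) X (b i)
    simp_rw [h3]
    rw [← oneDer_sum_dir, ← hb]

/-- The derivative of `Ad(h⁻¹)` at the identity. -/
theorem oneDer_Ad_inv [FiniteDimensional 𝕜 V] (Y : Lie[𝕜, E] G) (W : SuperSpace 𝕜 E V G)
    (φ : Module.Dual 𝕜 (SuperSpace 𝕜 E V G)) :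
    oneDer Y (fun h => φ (P.Ad h⁻¹ W)) = -φ (P.bracket (Y, 0) W) := by
  let b := finBasis 𝕜 (SuperSpace 𝕜 E V G)
  have hb : ∀ Z : SuperSpace 𝕜 E V G, ∀ ψ : Module.Dual 𝕜 (SuperSpace 𝕜 E V G),
      ψ Z = ∑ i, b.coord i Z * ψ (b i) := fun Z ψ => by
    conv_lhs => rw [← b.sum_repr Z, map_sum]
    exact Finset.sum_congr rfl fun i _ => by rw [map_smul]; rfl
  have h0 : oneDer Y (fun h => ∑ i, b.coord i (P.Ad h⁻¹ W) * φ (P.Ad h (b i))) = 0 := by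
    rw [← oneDer_const (X := Y) (φ W)]
    congr 1
    funext h
    have h1 := hb (P.Ad h⁻¹ W) (φ ∘ₗ (P.Ad h).toLinearMap)
    rw [comp_apply, LinearEquiv.coe_coe, Ad_Ad_inv P h W] at h1
    exact h1.symm
  rw [oneDer_sum_mul _ _ (fun i => mdifferentiableAt_Ad_inv P W (b.coord i) 1)
    (fun i => mdifferentiableAt_Ad P (b i) φ 1)] at h0
  simp_rw [oneDer_Ad, inv_one, Ad_one_apply] at h0
  have h1 : oneDer Y (fun h => φ (P.Ad h⁻¹ W)) =
      ∑ i, oneDer Y (fun h => b.coord i (P.Ad h⁻¹ W)) * φ (b i) := by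
    have : (fun h => φ (P.Ad h⁻¹ W)) = fun h => ∑ i, b.coord i (P.Ad h⁻¹ W) * φ (b i) :=
      funext fun h => hb _ _
    rw [this, oneDer_sum_mul _ _ (fun i => mdifferentiableAt_Ad_inv P W (b.coord i) 1)
      (fun i => mdifferentiableAt_const)]
    simp_rw [oneDer_const, mul_zero]
    rw [Finset.sum_const_zero, add_zero]
  simp only [h1, eq_neg_iff_add_eq_zero, ← h0]
  exact congrArg _ (hb W (φ ∘ₗ P.bracket (Y, 0)))

end Adjoint

/-! ### The frame of functions with values in the Lie superalgebra -/

section Frame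

variable {𝕜 : Type*} [RCLike 𝕜] {E : Type*} [NormedAddCommGroup E] [NormedSpace 𝕜 E]
  {V : Type*} [AddCommGroup V] [Module 𝕜 V]
  {G : Type*} [TopologicalSpace G] [ChartedSpace E G]

theorem evalAt_tmul {A : Type*} [AddCommGroup A] [Module 𝕜 A] {U : Opens G} (x : U) (f : NumFun 𝕜 E U)
    (a : A) : evalAt x (f ⊗ₜ a) = f x • a := rfl

/-- A section of `𝓕 ⊗ A` is determined by its values. -/
theorem eq_zero_of_evalAt {A : Type*} [AddCommGroup A] [Module 𝕜 A] {U : Opens G}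
    {t : NumFun 𝕜 E U ⊗[𝕜] A} (h : ∀ x, evalAt x t = 0) : t = 0 := by
  let b := Module.Free.chooseBasis 𝕜 A
  have hc : ∀ (i) (s : NumFun 𝕜 E U ⊗[𝕜] A) (x : U),
      TensorProduct.equivFinsuppOfBasisRight b s i x = b.coord i (evalAt x s) := by
    intro i s x
    induction s with
    | zero => rw [map_zero, map_zero, map_zero]; rfl
    | tmul f a =>
      rw [TensorProduct.equivFinsuppOfBasisRight_apply_tmul_apply, evalAt_tmul, map_smul]
      exact mul_comm _ _
    | add s t hs ht =>
      rw [map_add, map_add, map_add, ← hs, ← ht]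
      rfl
  refine (TensorProduct.equivFinsuppOfBasisRight b).injective (Finsupp.ext fun i => ?_)
  ext x
  rw [hc, h, map_zero, map_zero]
  rfl

theorem evalAt_lTensor {A B : Type*} [AddCommGroup A] [Module 𝕜 A] [AddCommGroup B] [Module 𝕜 B]
    (φ : A →ₗ[𝕜] B) {U : Opens G} (x : U) (t : NumFun 𝕜 E U ⊗[𝕜] A) :
    evalAt x (lTensor _ φ t) = φ (evalAt x t) := by
  induction t with
  | zero => simp
  | tmul f a => rw [lTensor_tmul, evalAt_tmul, evalAt_tmul, map_smul]
  | add s t hs ht => rw [map_add, map_add, map_add, map_add, hs, ht]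

variable [Group G] [LieGroup 𝓘(𝕜, E) ∞ G] (P : HCSuperpair 𝕜 E V G)

theorem HCSuperpair.isLieSuper : IsLieSuper P.bracket :=
  ⟨P.bracket_mem, P.bracket_skew, P.bracket_jacobi⟩

/-- The numerical functions `g ↦ φ(Ad(g⁻¹) X)`. -/
def adFun (U : Opens G) (φ : Module.Dual 𝕜 (SuperSpace 𝕜 E V G)) :
    SuperSpace 𝕜 E V G →ₗ[𝕜] NumFun 𝕜 E U where
  toFun X := ⟨fun g => φ (P.Ad (g : G)⁻¹ X), (contMDiff_Ad_inv P X φ).comp contMDiff_subtype_val⟩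
  map_add' X Y := by
    ext g
    exact (congrArg φ (map_add (P.Ad (g : G)⁻¹) X Y)).trans (map_add φ _ _)
  map_smul' c X := by
    ext g
    exact (congrArg φ (map_smul (P.Ad (g : G)⁻¹) c X)).trans (map_smul φ _ _)

theorem adFun_apply {U : Opens G} (φ : Module.Dual 𝕜 (SuperSpace 𝕜 E V G)) (X : SuperSpace 𝕜 E V G)
    (g : U) : adFun P U φ X g = φ (P.Ad (g : G)⁻¹ X) := rfl

variable [FiniteDimensional 𝕜 E] [FiniteDimensional 𝕜 V]

theorem leftDer_adFun {U : Opens G} (φ : Module.Dual 𝕜 (SuperSpace 𝕜 E V G)) (X : SuperSpace 𝕜 E V G)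
    (Y : Lie[𝕜, E] G) (g : U) :
    leftDer U Y (adFun P U φ X) g = -φ (P.bracket (Y, 0) (P.Ad (g : G)⁻¹ X)) := by
  rw [← oneDer_Ad_inv, leftDer_apply]
  refine oneDer_congr ?_
  have hU : ∀ᶠ k : G in nhds 1, (g : G) * k ∈ U :=
    (contMDiff_mul_left (I := 𝓘(𝕜, E)) (n := ∞) (a := (g : G))).continuous.continuousAt.eventually_mem
      (U.2.mem_nhds (by rw [mul_one]; exact g.2))
  filter_upwards [hU] with k hk
  rw [extendZero_apply _ hk, adFun_apply, mul_inv_rev, Ad_mul_apply]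

/-- The function `g ↦ Ad(g⁻¹) X` with values in `𝔤`. -/
def adFrame (U : Opens G) : SuperSpace 𝕜 E V G →ₗ[𝕜] NumFun 𝕜 E U ⊗[𝕜] SuperSpace 𝕜 E V G :=
  ∑ i, (TensorProduct.mk 𝕜 _ _).flip (finBasis 𝕜 (SuperSpace 𝕜 E V G) i) ∘ₗ
    adFun P U ((finBasis 𝕜 (SuperSpace 𝕜 E V G)).coord i)

theorem adFrame_apply (U : Opens G) (X : SuperSpace 𝕜 E V G) :
    adFrame P U X = ∑ i, adFun P U ((finBasis 𝕜 (SuperSpace 𝕜 E V G)).coord i) X ⊗ₜ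
      finBasis 𝕜 (SuperSpace 𝕜 E V G) i := by
  rw [adFrame, LinearMap.sum_apply]
  rfl

theorem evalAt_adFrame {U : Opens G} (X : SuperSpace 𝕜 E V G) (g : U) :
    evalAt g (adFrame P U X) = P.Ad (g : G)⁻¹ X := by
  rw [adFrame_apply, map_sum]
  exact (finBasis 𝕜 (SuperSpace 𝕜 E V G)).sum_repr _

omit [LieGroup 𝓘(𝕜, E) ∞ G] [FiniteDimensional 𝕜 E] [FiniteDimensional 𝕜 V] in
theorem mem_coeffParity_of_evalAt {U : Opens G} (j : ZMod 2) {t : NumFun 𝕜 E U ⊗[𝕜] SuperSpace 𝕜 E V G}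
    (h : ∀ x, evalAt x t ∈ homog 𝕜 (Lie[𝕜, E] G) V j) :
    t ∈ coeffParity 𝕜 (Lie[𝕜, E] G) V (NumFun 𝕜 E U) j := by
  have key : ∀ π : SuperSpace 𝕜 E V G →ₗ[𝕜] SuperSpace 𝕜 E V G,
      (∀ X, π X ∈ homog 𝕜 (Lie[𝕜, E] G) V j) →
      (∀ X ∈ homog 𝕜 (Lie[𝕜, E] G) V j, π X = X) →
      t ∈ coeffParity 𝕜 (Lie[𝕜, E] G) V (NumFun 𝕜 E U) j := by
    intro π h1 h2
    have e : lTensor _ π t = t := by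
      refine sub_eq_zero.mp (eq_zero_of_evalAt fun x => ?_)
      rw [map_sub, evalAt_lTensor, h2 _ (h x), sub_self]
    have h3 : ∀ s : NumFun 𝕜 E U ⊗[𝕜] SuperSpace 𝕜 E V G, lTensor _ π s ∈
        coeffParity 𝕜 (Lie[𝕜, E] G) V (NumFun 𝕜 E U) j := by
      intro s
      induction s with
      | zero => rw [map_zero]; exact Submodule.zero_mem _
      | tmul f Z => exact Submodule.apply_mem_map₂ _ Submodule.mem_top (h1 Z)
      | add s t hs ht => rw [map_add]; exact Submodule.add_mem _ hs ht
    exact e ▸ h3 t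
  have h2 : ∀ j : ZMod 2, j = 0 ∨ j = 1 := by decide
  obtain rfl | rfl := h2 j
  · exact key (evenProj 𝕜 E V G) (fun X => inl_mem_homog X.1) fun X hX => evenProj_of_even hX
  · exact key (oddProj 𝕜 E V G) (fun X => inr_mem_homog X.2) fun X hX => oddProj_of_odd hX

theorem evalAt_coeffDer {U : Opens G} (Y : Lie[𝕜, E] G) (X : SuperSpace 𝕜 E V G) (g : U) :
    evalAt g (coeffDer P.bracket (leftDer U) (Y, 0) (adFrame P U X)) = 0 := by
  let b := finBasis 𝕜 (SuperSpace 𝕜 E V G)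
  rw [adFrame_apply, map_sum, map_sum]
  have : ∀ i, evalAt g (coeffDer P.bracket (leftDer U) (Y, 0) (adFun P U (b.coord i) X ⊗ₜ b i)) =
      -(b.coord i (P.bracket (Y, 0) (P.Ad (g : G)⁻¹ X)) • b i) +
        P.bracket (Y, 0) (b.coord i (P.Ad (g : G)⁻¹ X) • b i) := by
    intro i
    rw [coeffDer_tmul, map_add, evalAt_tmul, evalAt_tmul, adFun_apply, leftDer_adFun, neg_smul, map_smul]
  rw [Finset.sum_congr rfl fun i _ => this i, Finset.sum_add_distrib, Finset.sum_neg_distrib, ← map_sum]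
  have e : ∀ Z, ∑ i, b.coord i Z • b i = Z := fun Z => b.sum_repr Z
  rw [e, e, neg_add_cancel]

theorem isRightFrame (U : Opens G) :
    IsRightFrame P.bracket (leftDer U) (fun g : U => NumFun.eval g) (adFrame P U) where
  lie := P.isLieSuper
  der := leftDer_mul
  der_bracket := leftDer_bracket P
  ev_mul _ _ _ := rfl
  ev_ext f h := ContMDiffMap.ext h
  mem i X hX := mem_coeffParity_of_evalAt i fun x => by
    rw [evalAt_adFrame]; exact P.Ad_mem _ i X hX
  flat X Y := eq_zero_of_evalAt (evalAt_coeffDer P Y X)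
  bracket g X Y := by
    have h : ∀ X, evalCoeff (NumFun.eval g) (adFrame P U X) = P.Ad (g : G)⁻¹ X := fun X =>
      evalAt_adFrame P X g
    rw [h, h, h, P.Ad_bracket]
  surj g X := ⟨P.Ad (g : G) X, (evalAt_adFrame P _ g).trans (by
    have := Ad_Ad_inv P (g : G)⁻¹ X
    rwa [inv_inv] at this)⟩

end Frame

/-! ### Flows of even elements of the Grassmann envelope -/

/-- A representation `f` of a Lie algebra by nilpotent endomorphisms turns the
Baker-Campbell-Hausdorff product into the product of exponentials. -/
theorem expNil_map_bch {𝕜 : Type*} [RCLike 𝕜] {M T : Type*} [AddCommGroup M] [Module 𝕜 M]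
    [AddCommGroup T] [Module 𝕜 T] (br : M →ₗ[𝕜] M →ₗ[𝕜] M) (f : M →ₗ[𝕜] T →ₗ[𝕜] T)
    (N : Submodule 𝕜 M) (hN : ∀ x ∈ N, ∀ y ∈ N, br x y ∈ N)
    (hf : ∀ x ∈ N, ∀ y t, f x (f y t) = f (br x y) t + f y (f x t)) {k : ℕ}
    {J : Submodule 𝕜 (Module.End 𝕜 T)} (hJ : J ^ (k + 1) = ⊥) (hfJ : ∀ x ∈ N, f x ∈ J) {x y : M}
    (hx : x ∈ N) (hy : y ∈ N) :
    expNil 𝕜 (f (bch br k x y) : Module.End 𝕜 T) = expNil 𝕜 (f x) * expNil 𝕜 (f y) := by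
  have h := bch_map br (commBr 𝕜 (Module.End 𝕜 T)) f N hN
    (fun x hx y _ => LinearMap.ext fun t => eq_sub_of_add_eq (hf x hx y t).symm) k hx hy
  rw [h, expNil_bch]
  refine le_bot_iff.mp (le_trans (pow_le_pow_left' ?_ _) hJ.le)
  rw [Submodule.span_le]
  rintro z (rfl | rfl)
  · exact hfJ _ hx
  · exact hfJ _ hy

section Flow

variable {𝕜 : Type*} [RCLike 𝕜] {W : Type*} [AddCommGroup W] [Module 𝕜 W]
  {L V : Type*} [AddCommGroup L] [Module 𝕜 L] [AddCommGroup V] [Module 𝕜 V]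
  {br : Bil[𝕜] (L × V)} {S : Type*} [AddCommGroup S] [Module 𝕜 S]
  {ρ : (L × V) →ₗ[𝕜] S →ₗ[𝕜] S}

/-- The exponential of the action of `n ∈ ΛW ⊗ 𝔤` on `ΛW ⊗ S`. -/
def flow (ρ : (L × V) →ₗ[𝕜] S →ₗ[𝕜] S) (n : Λ[𝕜] W ⊗[𝕜] (L × V)) :
    Module.End 𝕜 (Λ[𝕜] W ⊗[𝕜] S) := expNil 𝕜 (superAct W ρ n)

theorem flow_zero : flow (W := W) ρ 0 = 1 := by
  simp only [flow, map_zero, expNil_zero]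

variable [FiniteDimensional 𝕜 W]

theorem isNilpotent_superAct {n : Λ[𝕜] W ⊗[𝕜] (L × V)} (hn : n ∈ extFil 𝕜 W (L × V) 1) :
    IsNilpotent (superAct W ρ n : Module.End 𝕜 (Λ[𝕜] W ⊗[𝕜] S)) := isNilpotent_of_mem_raising (superAct_mem_raising hn)

/-- The flow turns the Baker-Campbell-Hausdorff product into composition. -/
theorem flow_bch (hbr : IsLieSuper br) (hρ : IsSuperRepOn br ρ)
    {N : Submodule 𝕜 (Λ[𝕜] W ⊗[𝕜] (L × V))} (h0 : N ≤ totalParity 𝕜 L V W 0)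
    (h1 : N ≤ extFil 𝕜 W (L × V) 1) (hN : ∀ x ∈ N, ∀ y ∈ N, superAct W br x y ∈ N)
    {x y : Λ[𝕜] W ⊗[𝕜] (L × V)} (hx : x ∈ N) (hy : y ∈ N) :
    flow ρ (bch (superAct W br) (Module.finrank 𝕜 W) x y) = flow ρ x * flow ρ y :=
  expNil_map_bch (superAct W br) (superAct W ρ) N hN (fun _ hx => superAct_superAct hbr hρ (h0 hx))
    raising_pow_eq_bot (fun _ hx => superAct_mem_raising (h1 hx)) hx hy

theorem flow_smul {n : Λ[𝕜] W ⊗[𝕜] (L × V)} (hn : n ∈ totalParity 𝕜 L V W 0)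
    (h1 : n ∈ extFil 𝕜 W (L × V) 1) (a : Λ[𝕜] W) (t : Λ[𝕜] W ⊗[𝕜] S) :
    flow ρ n (a • t) = a • flow ρ n t :=
  expNil_intertwine (g := Algebra.lsmul 𝕜 𝕜 (Λ[𝕜] W ⊗[𝕜] S) a)
    (isNilpotent_superAct (ρ := ρ) h1) (isNilpotent_superAct (ρ := ρ) h1)
    (fun t => superAct_mulLeft hn a t) t

end Flow

section Continuation

variable {𝕜 : Type*} [RCLike 𝕜] {W : Type*} [AddCommGroup W] [Module 𝕜 W] [FiniteDimensional 𝕜 W]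
  {L V : Type*} [AddCommGroup L] [Module 𝕜 L] [AddCommGroup V] [Module 𝕜 V] [FiniteDimensional 𝕜 V]
  {br : Bil[𝕜] (L × V)} {F : Type*} [CommRing F] [Algebra 𝕜 F]
  {D : L →ₗ[𝕜] Module.End 𝕜 F}

omit [FiniteDimensional 𝕜 V] in
theorem bodySection_lTensor {A B : Type*} [AddCommGroup A] [Module 𝕜 A] [AddCommGroup B] [Module 𝕜 B]
    (j : A →ₗ[𝕜] B) (t : A ⊗[𝕜] (F ⊗[𝕜] Λ*[𝕜] V)) :
    bodySection (rTensor _ j t) = lTensor F j (bodySection t) := by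
  induction t with
  | zero => simp only [map_zero]
  | add s t hs ht => simp only [map_add, hs, ht]
  | tmul a s => simp only [rTensor_tmul, bodySection_tmul', lTensor_tmul]

/-- Along the odd directions the flow substitutes for the odd coordinates. -/
theorem bodySection_flow_odd {ρ : (L × V) →ₗ[𝕜] Module.End 𝕜 (F ⊗[𝕜] Λ*[𝕜] V)}
    (hρ : IsRadial ρ) {j : Λ*[𝕜] V →ₐ[𝕜] Λ[𝕜] W}
    (hj : ∀ a, j (extInvol 𝕜 _ a) = extInvol 𝕜 W (j a)) {n : Λ[𝕜] W ⊗[𝕜] (L × V)}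
    (hn : n ∈ extFil 𝕜 W (L × V) 1) (hjn : rTensor _ j.toLinearMap (oddGen 𝕜 L V) = n)
    (s : F ⊗[𝕜] Λ*[𝕜] V) :
    bodySection (flow ρ n (1 ⊗ₜ s)) = lTensor F j.toLinearMap s := by
  have h := expNil_intertwine (g := rTensor (F ⊗[𝕜] Λ*[𝕜] V) j.toLinearMap)
    (isNilpotent_superAct (ρ := ρ) (oddGen_mem_extFil (𝕜 := 𝕜) (L := L) (V := V)))
    (isNilpotent_superAct (ρ := ρ) hn) (fun t => ?_) (1 ⊗ₜ s)
  · rw [rTensor_tmul, AlgHom.toLinearMap_apply, map_one] at h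
    simp only [flow, h, bodySection_lTensor, bodySection_expNil_oddGen hρ]
  · have := superAct_natural (ρ := ρ) (ρ' := ρ) hj (φ₀ := LinearMap.id) (φ₁ := LinearMap.id)
      (ψ := LinearMap.id) (fun _ _ => rfl) (oddGen 𝕜 L V) t
    rw [← hjn]
    exact this.symm

theorem bodyMap_leftOp_even (X : L) (s : F ⊗[𝕜] Λ*[𝕜] V) :
    bodyMap (leftOp br D (X, 0) s) = D X (bodyMap s) := by
  rw [← bodyMap_fieldOp_rightCoeff, rightCoeff_even]
  induction s with
  | zero => simp only [map_zero]
  | add s t hs ht => simp only [map_add, hs, ht]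
  | tmul f b => simp only [fieldOp_even, bodyMap_tmul, one_mul, map_smul]

omit [FiniteDimensional 𝕜 V] in
theorem bodySection_smul_one_tmul {A : Type*} [Ring A] [Algebra 𝕜 A] (a : A)
    (t : A ⊗[𝕜] (F ⊗[𝕜] Λ*[𝕜] V)) :
    bodySection (a • t) = lTensor F (mulLeft 𝕜 a) (bodySection t) := by
  induction t with
  | zero => simp only [smul_zero, map_zero]
  | add s t hs ht => simp only [smul_add, map_add, hs, ht]
  | tmul b s => simp only [smul_tmul', bodySection_tmul', lTensor_tmul]; rfl

end Continuation

/-! ### The Baker-Campbell-Hausdorff product up to higher order terms -/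

section Approximation

variable {𝕜 : Type*} [RCLike 𝕜] {M : Type*} [AddCommGroup M] [Module 𝕜 M]

theorem nestedBracket_zero : ∀ l : List M, 2 ≤ l.length →
    nestedBracket (0 : M →ₗ[𝕜] M →ₗ[𝕜] M) l = 0
  | [], h => by simp at h
  | [_], h => by simp at h
  | _ :: _ :: _, _ => rfl

theorem bch_zero_bracket {N : ℕ} (hN : 1 ≤ N) (x y : M) :
    bch (0 : M →ₗ[𝕜] M →ₗ[𝕜] M) N x y = x + y := by
  simp only [bch_eq_of_le _ hN fun l _ hl => nestedBracket_zero l hl, bch_eq, Finset.Icc_self,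
    Finset.sum_singleton, sum_piFinset_succ, show bchPairs 1 = {(0, 1), (1, 0), (1, 1)} by decide]
  simp [bchWord, bchBlock, nestedBracket, add_comm]

/-- If the letters of a nested bracket are changed by elements of an abelian ideal `B` with
`[A, B] ⊆ C`, then the nested bracket changes by an element of `C` if it has at least two letters. -/
theorem nestedBracket_sub_mem (br : M →ₗ[𝕜] M →ₗ[𝕜] M) {A B C : Submodule 𝕜 M}
    (hA : ∀ x ∈ A, ∀ y ∈ A, br x y ∈ A) (hl : ∀ x ∈ A, ∀ e ∈ B, br x e ∈ C)
    (hr : ∀ e ∈ B, ∀ x ∈ A, br e x ∈ C) (hCB : C ≤ B) : ∀ l : List (M × M),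
    (∀ z ∈ l, z.1 ∈ A ∧ z.2 ∈ A ∧ z.1 - z.2 ∈ B) →
      nestedBracket br (l.map Prod.fst) - nestedBracket br (l.map Prod.snd) ∈ B ∧
        (2 ≤ l.length → nestedBracket br (l.map Prod.fst) - nestedBracket br (l.map Prod.snd) ∈ C)
  | [], _ => by simp [nestedBracket]
  | [z], h => ⟨(h z (by simp)).2.2, fun h => by simp at h⟩
  | z :: w :: l, h => by
    have h' : ∀ u ∈ w :: l, u.1 ∈ A ∧ u.2 ∈ A ∧ u.1 - u.2 ∈ B :=
      fun u hu => h u (List.mem_cons_of_mem _ hu)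
    have ih := (nestedBracket_sub_mem br hA hl hr hCB (w :: l) h').1
    have hm : nestedBracket br ((w :: l).map Prod.fst) ∈ A :=
      nestedBracket_mem br A hA _ fun u hu => by
        obtain ⟨v, hv, rfl⟩ := List.mem_map.mp hu
        exact (h' v hv).1
    obtain ⟨h1, h2, h3⟩ := h z (by simp)
    have key : nestedBracket br ((z :: w :: l).map Prod.fst) -
        nestedBracket br ((z :: w :: l).map Prod.snd) ∈ C := by
      change br z.1 (nestedBracket br ((w :: l).map Prod.fst)) -
        br z.2 (nestedBracket br ((w :: l).map Prod.snd)) ∈ C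
      have e : ∀ a b : M, br z.1 a - br z.2 b = br (z.1 - z.2) a + br z.2 (a - b) := fun a b => by
        simp only [map_sub, LinearMap.sub_apply]; abel
      rw [e]
      exact C.add_mem (hr _ h3 _ hm) (hl _ h2 _ ih)
    exact ⟨hCB key, fun _ => key⟩

theorem bch_sub_mem (br : M →ₗ[𝕜] M →ₗ[𝕜] M) {A B C : Submodule 𝕜 M}
    (hA : ∀ x ∈ A, ∀ y ∈ A, br x y ∈ A) (hl : ∀ x ∈ A, ∀ e ∈ B, br x e ∈ C)
    (hr : ∀ e ∈ B, ∀ x ∈ A, br e x ∈ C) (hCB : C ≤ B) {N : ℕ} (hN : 1 ≤ N) {x x' y y' : M}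
    (hx : x ∈ A) (hx' : x' ∈ A) (hy : y ∈ A) (hy' : y' ∈ A) (hxx : x - x' ∈ B) (hyy : y - y' ∈ B) :
    bch br N x y - bch br N x' y' - ((x - x') + (y - y')) ∈ C := by
  have e : (x - x') + (y - y') = bch (0 : M →ₗ[𝕜] M →ₗ[𝕜] M) N x y -
      bch (0 : M →ₗ[𝕜] M →ₗ[𝕜] M) N x' y' := by
    rw [bch_zero_bracket hN, bch_zero_bracket hN]; abel
  simp only [e, bch_eq]
  simp only [← Finset.sum_sub_distrib, ← smul_sub]
  refine C.sum_mem fun k hk => C.sum_mem fun w hw => C.smul_mem _ ?_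
  have h := nestedBracket_sub_mem br hA hl hr hCB (bchWord (x, x') (y, y') w) fun z hz => by
    rcases mem_bchWord hz with rfl | rfl
    exacts [⟨hx, hx', hxx⟩, ⟨hy, hy', hyy⟩]
  rw [bchWord_map, bchWord_map, bchWord_length] at h
  have hlen := card_le_sum_bchPairs hw
  by_cases h2 : 2 ≤ ∑ i, ((w i).1 + (w i).2)
  · rw [nestedBracket_zero _ (by rwa [bchWord_length]), nestedBracket_zero _ (by rwa [bchWord_length]),
      sub_zero, sub_zero]
    exact h.2 h2
  · have hlen1 : ∀ a b : M, (bchWord a b w).length = 1 := fun a b => by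
      rw [bchWord_length]
      have := (Finset.mem_Icc.mp hk).1
      omega
    have h1 : ∀ l : List M, l.length = 1 → nestedBracket br l = nestedBracket (0 : M →ₗ[𝕜] M →ₗ[𝕜] M) l := by
      intro l hl
      obtain ⟨a, rfl⟩ := List.length_eq_one_iff.mp hl
      rfl
    simp only [h1 _ (hlen1 x y), h1 _ (hlen1 x' y'), sub_self]
    exact C.zero_mem

theorem sub_mem_of_approx {C : Submodule 𝕜 M} {n p p' a b c c' e : M} (h1 : p' - p - (a + c') ∈ C)
    (h0 : a - b ∈ C) (hc : c' = c) (he : b + c = e) (hn : n - p = e) : n - p' ∈ C := by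
  have h := C.neg_mem (C.add_mem h1 h0)
  rw [hc] at h
  have e1 : n - p' = -(p' - p - (a + c) + (a - b)) := by
    rw [eq_add_of_sub_eq hn, ← he]; abel
  rwa [e1]

end Approximation

section Soul

variable {𝕜 : Type*} [RCLike 𝕜] {E : Type*} [NormedAddCommGroup E] [NormedSpace 𝕜 E]
  {V : Type*} [AddCommGroup V] [Module 𝕜 V]
  {G : Type*} [TopologicalSpace G] [ChartedSpace E G] [Group G] {m : ℕ}

theorem soul_le_totalParity : soul 𝕜 E V G m ≤
    totalParity 𝕜 (Lie[𝕜, E] G) V (Fin m → 𝕜) 0 := by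
  refine soul_induction _ fun a X h => ?_
  rcases h with ⟨ha, hX⟩ | ⟨ha, hX⟩
  · obtain ⟨Y, rfl⟩ : X ∈ LinearMap.range (inl 𝕜 (Lie[𝕜, E] G) V) := hX
    exact tmul_even_mem_totalParity (mem_extNilEven.mp ha).1 Y
  · obtain ⟨v, rfl⟩ : X ∈ LinearMap.range (inr 𝕜 (Lie[𝕜, E] G) V) := hX
    exact tmul_odd_mem_totalParity (by rwa [zero_add]) v

theorem soul_le_extFil : soul 𝕜 E V G m ≤ extFil 𝕜 (Fin m → 𝕜) (SuperSpace 𝕜 E V G) 1 := by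
  refine soul_induction _ fun a X h => tmul_mem_extFil ?_ X
  rcases h with ⟨ha, -⟩ | ⟨ha, -⟩
  · exact mem_extPow_one (mem_extNilEven.mp ha).2
  · exact mem_extPow_one (algebraMapInv_odd ha)

/-- The component in `Λ ⊗ 𝔤₀` of an element of `Λ ⊗ 𝔤`. -/
def soulFst : Gr 𝕜 m ⊗[𝕜] SuperSpace 𝕜 E V G →ₗ[𝕜] Gr 𝕜 m ⊗[𝕜] Lie[𝕜, E] G :=
  lTensor _ (LinearMap.fst 𝕜 _ V)

/-- The component in `Λ ⊗ 𝔤₁` of an element of `Λ ⊗ 𝔤`. -/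
def soulSnd : Gr 𝕜 m ⊗[𝕜] SuperSpace 𝕜 E V G →ₗ[𝕜] Gr 𝕜 m ⊗[𝕜] V :=
  lTensor _ (LinearMap.snd 𝕜 (Lie[𝕜, E] G) V)

theorem soulFst_mem : ∀ n ∈ soul 𝕜 E V G m, soulFst n ∈ evenSoul 𝕜 E G m := by
  refine soul_induction ((evenSoul 𝕜 E G m).comap soulFst) fun a X h => ?_
  change a ⊗ₜ[𝕜] X.1 ∈ evenSoul 𝕜 E G m
  rcases h with ⟨ha, hX⟩ | ⟨ha, hX⟩
  · exact Submodule.apply_mem_map₂ _ ha trivial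
  · rw [mem_homog_one.mp hX, tmul_zero]
    exact Submodule.zero_mem _

theorem soulSnd_mem : ∀ n ∈ soul 𝕜 E V G m, soulSnd n ∈ oddSoul 𝕜 V m := by
  refine soul_induction ((oddSoul 𝕜 V m).comap soulSnd) fun a X h => ?_
  change a ⊗ₜ[𝕜] X.2 ∈ oddSoul 𝕜 V m
  rcases h with ⟨ha, hX⟩ | ⟨ha, hX⟩
  · rw [mem_homog_zero.mp hX, tmul_zero]
    exact Submodule.zero_mem _
  · exact Submodule.apply_mem_map₂ _ ha trivial

theorem soulFst_add_soulSnd (n : Gr 𝕜 m ⊗[𝕜] SuperSpace 𝕜 E V G) :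
    lTensor _ (inl 𝕜 _ V) (soulFst n) +
      lTensor _ (inr 𝕜 _ V) (soulSnd n) = n := by
  induction n using TensorProduct.induction_on with
  | zero => simp only [map_zero, add_zero]
  | tmul a X =>
    change a ⊗ₜ[𝕜] ((X.1, 0) : SuperSpace 𝕜 E V G) + a ⊗ₜ[𝕜] ((0, X.2) : SuperSpace 𝕜 E V G) = _
    rw [← tmul_add]
    simp
  | add x y hx hy =>
    conv_rhs => rw [← hx, ← hy]
    simp only [map_add]
    abel

theorem superAct_mem_extFil {W L M S : Type*} [AddCommGroup W] [Module 𝕜 W] [AddCommGroup L]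
    [Module 𝕜 L] [AddCommGroup M] [Module 𝕜 M] [AddCommGroup S] [Module 𝕜 S]
    {ρ : (L × M) →ₗ[𝕜] S →ₗ[𝕜] S} {k l : ℕ} {n : Λ[𝕜] W ⊗[𝕜] (L × M)}
    {t : Λ[𝕜] W ⊗[𝕜] S} (hn : n ∈ extFil 𝕜 W (L × M) k) (ht : t ∈ extFil 𝕜 W S l) :
    superAct W ρ n t ∈ extFil 𝕜 W S (k + l) := by
  have h : extFil 𝕜 W (L × M) k ≤ (extFil 𝕜 W S (k + l)).comap ((superAct W ρ).flip t) := by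
    refine Submodule.map₂_le.2 fun a ha X _ => ?_
    have h2 : extFil 𝕜 W S l ≤ (extFil 𝕜 W S (k + l)).comap (superAct W ρ (a ⊗ₜ X)) := by
      refine Submodule.map₂_le.2 fun b hb s _ => ?_
      change (a * b) ⊗ₜ[𝕜] ρ (X.1, 0) s + (a * extInvol 𝕜 W b) ⊗ₜ[𝕜] ρ (0, X.2) s ∈
        extFil 𝕜 W S (k + l)
      exact Submodule.add_mem _ (tmul_mem_extFil (extPow_mul_mem ha hb) _)
        (tmul_mem_extFil (extPow_mul_mem ha (extInvol_mem_extPow hb)) _)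
    exact h2 ht
  exact h hn

variable [LieGroup 𝓘(𝕜, E) ∞ G] (P : HCSuperpair 𝕜 E V G)

set_option maxHeartbeats 1000000 in
/-- Every point of the soul is of the form `exp(n₀) exp(n₁)`: the factors are found by successive
approximation with respect to the powers of the augmentation ideal. -/
theorem exists_bch_eq {n : Gr 𝕜 m ⊗[𝕜] SuperSpace 𝕜 E V G} (hn : n ∈ soul 𝕜 E V G m) :
    ∃ n₀ ∈ evenSoul 𝕜 E G m, ∃ n₁ ∈ oddSoul 𝕜 V m,
      bch (envBracket P m) m
        (bch (envBracket P m) m 0 (lTensor _ (inl 𝕜 _ V) n₀))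
          (lTensor _ (inr 𝕜 _ V) n₁) = n := by
  let pt (n₀ : Gr 𝕜 m ⊗[𝕜] Lie[𝕜, E] G) (n₁ : Gr 𝕜 m ⊗[𝕜] V) :
      Gr 𝕜 m ⊗[𝕜] SuperSpace 𝕜 E V G := bch (envBracket P m) m
        (bch (envBracket P m) m 0 (lTensor _ (inl 𝕜 _ V) n₀))
          (lTensor _ (inr 𝕜 _ V) n₁)
  have hpt₀ : ∀ n₀ ∈ evenSoul 𝕜 E G m, bch (envBracket P m) m 0
      (lTensor _ (inl 𝕜 _ V) n₀) ∈ soul 𝕜 E V G m := fun n₀ h0 =>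
    bch_mem _ _ (envBracket_mem P m) m (Submodule.zero_mem _) (evenSoul_map_mem h0)
  have hpt : ∀ n₀ ∈ evenSoul 𝕜 E G m, ∀ n₁ ∈ oddSoul 𝕜 V m, pt n₀ n₁ ∈ soul 𝕜 E V G m :=
    fun n₀ h0 n₁ h1 => bch_mem _ _ (envBracket_mem P m) m (hpt₀ n₀ h0) (oddSoul_map_mem h1)
  suffices H : ∀ k ≤ m, ∃ n₀ ∈ evenSoul 𝕜 E G m, ∃ n₁ ∈ oddSoul 𝕜 V m,
      n - pt n₀ n₁ ∈ extFil 𝕜 (Fin m → 𝕜) (SuperSpace 𝕜 E V G) (k + 1) by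
    obtain ⟨n₀, h0, n₁, h1, h⟩ := H m le_rfl
    have hbot := extFil_eq_bot (𝕜 := 𝕜) (W := Fin m → 𝕜) (M := SuperSpace 𝕜 E V G)
    rw [Module.finrank_fin_fun] at hbot
    rw [hbot, Submodule.mem_bot, sub_eq_zero] at h
    exact ⟨n₀, h0, n₁, h1, h.symm⟩
  intro k
  induction k with
  | zero =>
    exact fun _ => ⟨0, Submodule.zero_mem _, 0, Submodule.zero_mem _, soul_le_extFil
      (Submodule.sub_mem _ hn (hpt _ (Submodule.zero_mem _) _ (Submodule.zero_mem _)))⟩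
  | succ k ih =>
    intro hk
    obtain ⟨n₀, h0, n₁, h1, h⟩ := ih (by omega)
    have he := Submodule.sub_mem _ hn (hpt n₀ h0 n₁ h1)
    have he0 := Submodule.add_mem _ h0 (soulFst_mem _ he)
    have he1 := Submodule.add_mem _ h1 (soulSnd_mem _ he)
    refine ⟨_, he0, _, he1, ?_⟩
    generalize hedef : n - pt n₀ n₁ = e at *
    have hl : ∀ x ∈ soul 𝕜 E V G m, ∀ y ∈ extFil 𝕜 (Fin m → 𝕜) (SuperSpace 𝕜 E V G) (k + 1),
        envBracket P m x y ∈ extFil 𝕜 (Fin m → 𝕜) (SuperSpace 𝕜 E V G) (k + 1 + 1) := fun x hx y hy => by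
      rw [add_comm (k + 1)]
      exact superAct_mem_extFil (soul_le_extFil hx) hy
    have hr : ∀ y ∈ extFil 𝕜 (Fin m → 𝕜) (SuperSpace 𝕜 E V G) (k + 1), ∀ x ∈ soul 𝕜 E V G m,
        envBracket P m y x ∈ extFil 𝕜 (Fin m → 𝕜) (SuperSpace 𝕜 E V G) (k + 1 + 1) := fun y hy x hx =>
      superAct_mem_extFil hy (soul_le_extFil hx)
    have hsub := fun {x x' y y'} => bch_sub_mem (envBracket P m) (x := x) (x' := x') (y := y) (y' := y')
      (envBracket_mem P m) hl hr (extFil_succ_le (k + 1)) (N := m) (by omega)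
    have d0 := hsub (Submodule.zero_mem _) (Submodule.zero_mem _) (evenSoul_map_mem (V := V) he0)
      (evenSoul_map_mem h0) (by rw [sub_zero]; exact Submodule.zero_mem _)
      (by rw [map_add, add_sub_cancel_left]; exact lTensor_mem_extFil _ (lTensor_mem_extFil _ h))
    rw [sub_zero, zero_add, map_add, add_sub_cancel_left] at d0
    have d0' := Submodule.add_mem _ (extFil_succ_le _ d0)
      (lTensor_mem_extFil (inl 𝕜 _ V) (lTensor_mem_extFil (LinearMap.fst 𝕜 _ V) h))
    rw [soulFst, sub_add_cancel] at d0'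
    have d1 := hsub (hpt₀ _ he0) (hpt₀ _ h0) (oddSoul_map_mem (E := E) (G := G) he1) (oddSoul_map_mem h1)
      (by rw [map_add]; exact d0')
      (by rw [map_add, add_sub_cancel_left]; exact lTensor_mem_extFil _ (lTensor_mem_extFil _ h))
    rw [← map_add] at d0
    refine sub_mem_of_approx (b := lTensor _ (inl 𝕜 _ V) (soulFst e)) (c := lTensor _ (inr 𝕜 _ V) (soulSnd e)) (p := pt n₀ n₁) (e := e) d1 d0 (by rw [map_add, add_sub_cancel_left]) (soulFst_add_soulSnd e) hedef

end Soul

/-! ### Grassmann-analytic continuation in terms of the flow -/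

section FlowEven

variable {𝕜 : Type*} [RCLike 𝕜] {L V : Type*} [AddCommGroup L] [Module 𝕜 L] [AddCommGroup V]
  [Module 𝕜 V] {F : Type*} [CommRing F] [Algebra 𝕜 F] {W : Type*} [AddCommGroup W] [Module 𝕜 W]
  {ρ : (L × V) →ₗ[𝕜] Module.End 𝕜 (F ⊗[𝕜] Λ*[𝕜] V)}
  {D : L →ₗ[𝕜] Module.End 𝕜 F}
  {T : Λ[𝕜] W ⊗[𝕜] L →ₗ[𝕜] Module.End 𝕜 (F ⊗[𝕜] Λ[𝕜] W)}

theorem bodySection_superAct_even (h : ∀ X s, bodyMap (ρ (X, 0) s) = D X (bodyMap s))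
    (hT : ∀ a X f b, T (a ⊗ₜ X) (f ⊗ₜ b) = D X f ⊗ₜ (a * b))
    (n₀ : Λ[𝕜] W ⊗[𝕜] L)
    (t : Λ[𝕜] W ⊗[𝕜] (F ⊗[𝕜] Λ*[𝕜] V)) :
    bodySection (superAct W ρ (lTensor _ (inl 𝕜 L V) n₀) t) =
      T n₀ (bodySection t) := by
  induction n₀ using TensorProduct.induction_on with
  | zero => simp only [map_zero, LinearMap.zero_apply]
  | add x y hx hy => simp only [map_add, LinearMap.add_apply, hx, hy]
  | tmul a X =>
    induction t with
    | zero => simp only [map_zero]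
    | add x y hx hy => simp only [map_add, hx, hy]
    | tmul b s =>
      simp only [lTensor_tmul, LinearMap.inl_apply, superAct_even, bodySection_tmul', hT,
        h]

/-- Along the even directions the flow is the Taylor expansion. -/
theorem bodySection_flow_even [FiniteDimensional 𝕜 W]
    (h : ∀ X s, bodyMap (ρ (X, 0) s) = D X (bodyMap s))
    (hT : ∀ a X f b, T (a ⊗ₜ X) (f ⊗ₜ b) = D X f ⊗ₜ (a * b))
    {n₀ : Λ[𝕜] W ⊗[𝕜] L}
    (hn : lTensor _ (inl 𝕜 L V) n₀ ∈ extFil 𝕜 W (L × V) 1)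
    (t : Λ[𝕜] W ⊗[𝕜] (F ⊗[𝕜] Λ*[𝕜] V)) :
    bodySection (flow ρ (lTensor _ (inl 𝕜 L V) n₀) t) =
      ∑ k ∈ Finset.range (Module.finrank 𝕜 W + 1),
        ((k.factorial : 𝕜)⁻¹) • ((T n₀) ^ k) (bodySection t) := by
  have hpow := pow_eq_zero_of_mem_raising (superAct_mem_raising (ρ := ρ) hn)
  have hk : ∀ k : ℕ, bodySection (((superAct W ρ
      (lTensor _ (inl 𝕜 L V) n₀) : Module.End 𝕜 (Λ[𝕜] W ⊗[𝕜]
        (F ⊗[𝕜] Λ*[𝕜] V))) ^ k) t) = ((T n₀) ^ k) (bodySection t) := by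
    intro k
    induction k with
    | zero => rfl
    | succ k ih =>
      simp only [pow_succ', Module.End.mul_apply, bodySection_superAct_even h hT, ih]
  simp only [flow,
    expNil_eq_sum (A := Module.End 𝕜 (Λ[𝕜] W ⊗[𝕜] (F ⊗[𝕜] Λ*[𝕜] V))) hpow,
    LinearMap.sum_apply, map_sum]
  exact Finset.sum_congr rfl fun k _ => by simp only [LinearMap.smul_apply, map_smul, hk]

/-- The flow along `exp(n₀) exp(n₁)` is the substitution of odd coordinates followed by the Taylor
expansion. -/
theorem bodySection_flow_flow [FiniteDimensional 𝕜 W] [FiniteDimensional 𝕜 V] (hρ : IsRadial ρ)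
    (h : ∀ X s, bodyMap (ρ (X, 0) s) = D X (bodyMap s))
    (hT : ∀ a X f b, T (a ⊗ₜ X) (f ⊗ₜ b) = D X f ⊗ₜ (a * b))
    {n₀ : Λ[𝕜] W ⊗[𝕜] L}
    (hn : lTensor _ (inl 𝕜 L V) n₀ ∈ extFil 𝕜 W (L × V) 1)
    {j : Λ*[𝕜] V →ₐ[𝕜] Λ[𝕜] W}
    (hj : ∀ a, j (extInvol 𝕜 _ a) = extInvol 𝕜 W (j a)) {n₁ : Λ[𝕜] W ⊗[𝕜] (L × V)}
    (hn₁ : n₁ ∈ extFil 𝕜 W (L × V) 1) (hjn : rTensor _ j.toLinearMap (oddGen 𝕜 L V) = n₁)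
    (s : F ⊗[𝕜] Λ*[𝕜] V) :
    bodySection (flow ρ (lTensor _ (inl 𝕜 L V) n₀) (flow ρ n₁ (1 ⊗ₜ s))) =
      ∑ k ∈ Finset.range (Module.finrank 𝕜 W + 1),
        ((k.factorial : 𝕜)⁻¹) • ((T n₀) ^ k) (lTensor F j.toLinearMap s) := by
  rw [bodySection_flow_even h hT hn, bodySection_flow_odd hρ hj hn₁ hjn]

end FlowEven

section ContinuationFlow

variable {𝕜 : Type*} [RCLike 𝕜] {E : Type*} [NormedAddCommGroup E] [NormedSpace 𝕜 E]
  {V : Type*} [AddCommGroup V] [Module 𝕜 V]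
  {G : Type*} [TopologicalSpace G] [ChartedSpace E G] [Group G] [LieGroup 𝓘(𝕜, E) ∞ G] {m : ℕ}

theorem envDer_tmul {U : Opens G} (a : Gr 𝕜 m) (X : Lie[𝕜, E] G) (f : NumFun 𝕜 E U)
    (b : Gr 𝕜 m) : envDer U (a ⊗ₜ X) (f ⊗ₜ b) = leftDer U X f ⊗ₜ (a * b) := rfl

variable [FiniteDimensional 𝕜 V]

omit [LieGroup 𝓘(𝕜, E) ∞ G] in
theorem rTensor_oddPairing_sum (n : Gr 𝕜 m ⊗[𝕜] V) :
    ∑ i, oddPairing n ((finBasis 𝕜 V).coord i) ⊗ₜ[𝕜]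
      ((0, finBasis 𝕜 V i) : SuperSpace 𝕜 E V G) =
      lTensor _ (inr 𝕜 (Lie[𝕜, E] G) V) n := by
  induction n using TensorProduct.induction_on with
  | zero => simp [oddPairing]
  | add x y hx hy =>
    simp only [map_add, ← hx, ← hy, ← Finset.sum_add_distrib]
    refine Finset.sum_congr rfl fun i _ => ?_
    rw [← add_tmul]
    simp [oddPairing]
  | tmul a v =>
    simp only [oddPairing_tmul, smul_tmul, lTensor_tmul]
    rw [← tmul_sum]
    have e := congrArg (inr 𝕜 (Lie[𝕜, E] G) V) ((finBasis 𝕜 V).sum_repr v)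
    rw [map_sum] at e
    rw [← e]
    simp

omit [LieGroup 𝓘(𝕜, E) ∞ G] in
theorem rTensor_oddSubst_oddGen (n₁ : oddSoul 𝕜 V m) :
    rTensor _ (oddSubst n₁).toLinearMap (oddGen 𝕜 (Lie[𝕜, E] G) V) =
      lTensor _ (inr 𝕜 (Lie[𝕜, E] G) V) n₁.1 := by
  simp only [← rTensor_oddPairing_sum, oddGen, map_sum]
  refine Finset.sum_congr rfl fun i _ => ?_
  simp only [rTensor_tmul, AlgHom.toLinearMap_apply, oddSubst,
    ExteriorAlgebra.lift_ι_apply]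

omit [FiniteDimensional 𝕜 V] in
theorem oddSubst_extInvol (n₁ : oddSoul 𝕜 V m) (a : Λ*[𝕜] V) :
    oddSubst n₁ (extInvol 𝕜 _ a) = extInvol 𝕜 (Fin m → 𝕜) (oddSubst n₁ a) := by
  have h : (oddSubst n₁).comp (extInvol 𝕜 _) = (extInvol 𝕜 (Fin m → 𝕜)).comp (oddSubst n₁) := by
    refine ExteriorAlgebra.hom_ext (LinearMap.ext fun α => ?_)
    change oddSubst n₁ (extInvol 𝕜 _ (ι 𝕜 α)) =
      extInvol 𝕜 _ (oddSubst n₁ (ι 𝕜 α))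
    simp only [extInvol_ι, map_neg, oddSubst, ExteriorAlgebra.lift_ι_apply,
      extInvol_odd (oddPairing_odd n₁.2 α)]
  exact AlgHom.congr_fun h a

variable [FiniteDimensional 𝕜 E] (P : HCSuperpair 𝕜 E V G)

/-- The continuation of a superfunction to the point `g exp(n)`, as a function of `g`: the flow of
the left-invariant action for the time `n`, applied to the superfunction and restricted to the
body. -/
def contSection {U : Opens G} (f : Superfun 𝕜 E V U) (n : Gr 𝕜 m ⊗[𝕜] SuperSpace 𝕜 E V G) :
    NumFun 𝕜 E U ⊗[𝕜] Gr 𝕜 m :=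
  bodySection (flow (W := Fin m → 𝕜) (leftOp P.bracket (leftDer U)) n (1 ⊗ₜ f))

omit [FiniteDimensional 𝕜 E] in
theorem contValue_eq {U : Opens G} (f : Superfun 𝕜 E V U) (g : U) (n₀ : evenSoul 𝕜 E G m)
    (n₁ : oddSoul 𝕜 V m) : contValue f g n₀ n₁ =
      evalAt g (bodySection (flow (W := Fin m → 𝕜) (leftOp P.bracket (leftDer U))
        (lTensor _ (inl 𝕜 _ V) n₀.1)
        (flow (W := Fin m → 𝕜) (leftOp P.bracket (leftDer U))
          (lTensor _ (inr 𝕜 _ V) n₁.1) (1 ⊗ₜ f)))) := by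
  have h := bodySection_flow_flow (𝕜 := 𝕜) (W := Fin m → 𝕜) (F := NumFun 𝕜 E U)
    (D := leftDer U) (T := envDer (m := m) U)
    (leftOp_isRadial (D := leftDer U) P.isLieSuper)
    (fun X s => bodyMap_leftOp_even X s) (fun a X f b => envDer_tmul a X f b)
    (soul_le_extFil (evenSoul_map_mem n₀.2)) (oddSubst_extInvol n₁)
    (soul_le_extFil (oddSoul_map_mem n₁.2)) (rTensor_oddSubst_oddGen n₁) f
  rw [Module.finrank_fin_fun] at h
  exact congrArg (evalAt g) h.symm

theorem leftOp_isSuperRepOn_leftDer (U : Opens G) :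
    IsSuperRepOn P.bracket (leftOp P.bracket (leftDer U)) :=
  leftOp_isSuperRepOn P.isLieSuper (leftDer_bracket P)

theorem flow_leftOp_bch (U : Opens G) {x y : Gr 𝕜 m ⊗[𝕜] SuperSpace 𝕜 E V G}
    (hx : x ∈ soul 𝕜 E V G m) (hy : y ∈ soul 𝕜 E V G m) :
    flow (W := Fin m → 𝕜) (leftOp P.bracket (leftDer U)) (bch (envBracket P m) m x y) =
      flow (W := Fin m → 𝕜) (leftOp P.bracket (leftDer U)) x *
        flow (W := Fin m → 𝕜) (leftOp P.bracket (leftDer U)) y := by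
  have h := flow_bch P.isLieSuper (leftOp_isSuperRepOn_leftDer P U) soul_le_totalParity
    soul_le_extFil (envBracket_mem P m) hx hy
  rw [Module.finrank_fin_fun] at h
  exact h

omit [FiniteDimensional 𝕜 V] [FiniteDimensional 𝕜 E] in
theorem log_ofBody_mul_expEven_mul_expOdd (g : G) (n₀ : evenSoul 𝕜 E G m) (n₁ : oddSoul 𝕜 V m) :
    ((GrPoint.ofBody P m g * GrPoint.expEven P n₀ * GrPoint.expOdd P n₁).log : Gr 𝕜 m ⊗[𝕜] _) =
      bch (envBracket P m) m (bch (envBracket P m) m 0 (lTensor _ (inl 𝕜 _ V) n₀.1))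
        (lTensor _ (inr 𝕜 _ V) n₁.1) := by
  have h : lTensor (Gr 𝕜 m) (P.Ad (1 : G)⁻¹).toLinearMap = LinearMap.id := by
    rw [inv_one, map_one]
    exact LinearMap.lTensor_id _ _
  change bch (envBracket P m) m (lTensor (Gr 𝕜 m) (P.Ad (1 : G)⁻¹).toLinearMap
    (bch (envBracket P m) m (lTensor (Gr 𝕜 m) (P.Ad (1 : G)⁻¹).toLinearMap 0) _)) _ = _
  rw [h]
  rfl

omit [FiniteDimensional 𝕜 V] [FiniteDimensional 𝕜 E] in
theorem body_ofBody_mul_expEven_mul_expOdd (g : G) (n₀ : evenSoul 𝕜 E G m) (n₁ : oddSoul 𝕜 V m) :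
    (GrPoint.ofBody P m g * GrPoint.expEven P n₀ * GrPoint.expOdd P n₁).body = g := by
  change g * 1 * 1 = g
  rw [mul_one, mul_one]

/-- The Grassmann-analytic continuation is given by the flow of the left-invariant action. -/
theorem continuation_eq {U : Opens G} (f : Superfun 𝕜 E V U) (p : GrPoint P m) (hp : p.body ∈ U) :
    continuation P f p = evalAt ⟨p.body, hp⟩ (contSection P f p.log.1) := by
  have hex : ∃ q : U × evenSoul 𝕜 E G m × oddSoul 𝕜 V m,
      p = GrPoint.ofBody P m q.1 * GrPoint.expEven P q.2.1 * GrPoint.expOdd P q.2.2 := by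
    obtain ⟨n₀, h0, n₁, h1, h⟩ := exists_bch_eq P p.log.2
    refine ⟨⟨⟨p.body, hp⟩, ⟨n₀, h0⟩, ⟨n₁, h1⟩⟩, ?_⟩
    have hlog := log_ofBody_mul_expEven_mul_expOdd P p.body ⟨n₀, h0⟩ ⟨n₁, h1⟩
    rw [h] at hlog
    have hbody := body_ofBody_mul_expEven_mul_expOdd P p.body ⟨n₀, h0⟩ ⟨n₁, h1⟩
    rw [GrPoint.mk.injEq]
    exact ⟨hbody.symm, Subtype.ext hlog.symm⟩
  rw [continuation, dif_pos hex]
  have hq := hex.choose_spec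
  generalize hex.choose = q at hq
  obtain ⟨g, n₀, n₁⟩ := q
  have hbody : g = ⟨p.body, hp⟩ := by
    exact Subtype.ext (((congrArg GrPoint.body hq).trans
      (body_ofBody_mul_expEven_mul_expOdd P g n₀ n₁)).symm)
  have hlog := congrArg (fun p : GrPoint P m => p.log.1) hq
  change p.log.1 = _ at hlog
  rw [log_ofBody_mul_expEven_mul_expOdd] at hlog
  change contValue f g n₀ n₁ = _
  simp only [contValue_eq P, hbody, contSection, hlog,
    flow_leftOp_bch P U (bch_mem _ _ (envBracket_mem P m) m (Submodule.zero_mem _) (evenSoul_map_mem n₀.2)) (oddSoul_map_mem n₁.2),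
    flow_leftOp_bch P U (Submodule.zero_mem _) (evenSoul_map_mem n₀.2), flow_zero, one_mul]
  rfl

end ContinuationFlow

/-! ### Derivatives at the identity of families in infinite-dimensional spaces -/

section FinDer

variable {𝕜 : Type*} [RCLike 𝕜] {E : Type*} [NormedAddCommGroup E] [NormedSpace 𝕜 E]
  {G : Type*} [TopologicalSpace G] [ChartedSpace E G] [Group G]
  {M N T : Type*} [AddCommGroup M] [Module 𝕜 M] [AddCommGroup N] [Module 𝕜 N] [AddCommGroup T]
  [Module 𝕜 T]

/-- The family `u : G → M` is a finite sum `∑ cᵢ xᵢ` with vectors `xᵢ` and coefficient functions `cᵢ`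
differentiable at `1`, and `u' = ∑ (X.cᵢ) xᵢ` is its derivative at `1` in the direction `X`. No topology
on `M` is involved; the derivative `u'` is only claimed to be computed from one such presentation. -/
def HasFinDer (X : Lie[𝕜, E] G) (u : G → M) (u' : M) : Prop :=
  ∃ (ι : Type) (_ : Fintype ι) (c : ι → G → 𝕜) (x : ι → M),
    (∀ i, MDifferentiableAt 𝓘(𝕜, E) 𝓘(𝕜, 𝕜) (c i) 1) ∧ (∀ h, u h = ∑ i, c i h • x i) ∧
      u' = ∑ i, oneDer X (c i) • x i

variable {X : Lie[𝕜, E] G} {u : G → M} {u' : M} {v : G → N} {v' : N}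

theorem hasFinDer_const (x : M) : HasFinDer X (fun _ => x) 0 :=
  ⟨Unit, inferInstance, fun _ _ => 1, fun _ => x, fun _ => mdifferentiableAt_const,
    fun _ => by simp, by simp [oneDer_const]⟩

theorem hasFinDer_smul {c : G → 𝕜} (hc : MDifferentiableAt 𝓘(𝕜, E) 𝓘(𝕜, 𝕜) c 1) (x : M) :
    HasFinDer X (fun h => c h • x) (oneDer X c • x) :=
  ⟨Unit, inferInstance, fun _ => c, fun _ => x, fun _ => hc, fun _ => by simp, by simp⟩

theorem HasFinDer.add {w : G → M} {w' : M} (hu : HasFinDer X u u') (hw : HasFinDer X w w') :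
    HasFinDer X (fun h => u h + w h) (u' + w') := by
  obtain ⟨ι, _, c, x, hc, hu, rfl⟩ := hu
  obtain ⟨κ, _, d, y, hd, hw, rfl⟩ := hw
  exact ⟨ι ⊕ κ, inferInstance, Sum.elim c d, Sum.elim x y,
    fun i => i.rec hc hd, fun h => by simp [hu, hw], by simp⟩

theorem HasFinDer.sum {κ : Type*} (s : Finset κ) {w : κ → G → M} {w' : κ → M}
    (hw : ∀ k ∈ s, HasFinDer X (w k) (w' k)) : HasFinDer X (fun h => ∑ k ∈ s, w k h) (∑ k ∈ s, w' k) := by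
  classical
  induction s using Finset.induction_on with
  | empty => simpa using hasFinDer_const (X := X) (0 : M)
  | insert k s hk ih =>
    simp only [Finset.sum_insert hk]
    exact (hw k (Finset.mem_insert_self _ _)).add (ih fun i hi => hw i (Finset.mem_insert_of_mem hi))

theorem HasFinDer.bilinear (B : M →ₗ[𝕜] N →ₗ[𝕜] T) (hu : HasFinDer X u u') (hv : HasFinDer X v v') :
    HasFinDer X (fun h => B (u h) (v h)) (B u' (v 1) + B (u 1) v') := by
  obtain ⟨ι, _, c, x, hc, hu, rfl⟩ := hu
  obtain ⟨κ, _, d, y, hd, hv, rfl⟩ := hv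
  refine ⟨ι × κ, inferInstance, fun i h => c i.1 h * d i.2 h, fun i => B (x i.1) (y i.2),
    fun i => (hc i.1).mul (hd i.2), fun h => ?_, ?_⟩
  · simp only [hu, hv, map_sum, map_smul, LinearMap.sum_apply, LinearMap.smul_apply, smul_smul,
      Fintype.sum_prod_type, Finset.smul_sum]
    rw [Finset.sum_comm]
    simp only [mul_comm]
  · simp only [hu, hv, map_sum, map_smul, LinearMap.sum_apply, LinearMap.smul_apply, smul_smul,
      Fintype.sum_prod_type, Finset.smul_sum, oneDer_mul (hc _) (hd _), add_smul,
      Finset.sum_add_distrib]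
    congr 1 <;> rw [Finset.sum_comm] <;> simp only [mul_comm]

theorem HasFinDer.map (f : M →ₗ[𝕜] T) (hu : HasFinDer X u u') : HasFinDer X (fun h => f (u h)) (f u') := by
  obtain ⟨ι, _, c, x, hc, hu, rfl⟩ := hu
  exact ⟨ι, inferInstance, c, fun i => f (x i), hc, fun h => by simp [hu], by simp⟩

theorem HasFinDer.congr {w : G → M} {w' : M} (hu : HasFinDer X u u') (h : ∀ h, w h = u h) (h' : w' = u') :
    HasFinDer X w w' := by
  rwa [h', show w = u from funext h]

variable {A : Type*} [Ring A] [Algebra 𝕜 A] {a : G → A} {x : A}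

/-- If the derivative of `a` is a commutator `-[x, a]`, then so is the derivative of its powers. -/
theorem HasFinDer.pow (ha : HasFinDer X a (-(x * a 1 - a 1 * x))) (k : ℕ) :
    HasFinDer X (fun h => a h ^ k) (-(x * a 1 ^ k - a 1 ^ k * x)) := by
  induction k with
  | zero => simpa using hasFinDer_const (X := X) (1 : A)
  | succ k ih =>
    refine (HasFinDer.bilinear (LinearMap.mul 𝕜 A) ih ha).congr (fun h => pow_succ _ _) ?_
    simp only [LinearMap.mul_apply', pow_succ]
    noncomm_ring

theorem HasFinDer.expNil (ha : HasFinDer X a (-(x * a 1 - a 1 * x))) {k : ℕ} (hk : ∀ h, a h ^ k = 0) :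
    HasFinDer X (fun h => expNil 𝕜 (a h)) (-(x * expNil 𝕜 (a 1) - expNil 𝕜 (a 1) * x)) := by
  refine (HasFinDer.sum (Finset.range k) fun i _ => (ha.pow i).map
    (((i.factorial : 𝕜)⁻¹) • LinearMap.id)).congr (fun h => expNil_eq_sum (hk h)) ?_
  rw [expNil_eq_sum (hk 1)]
  simp only [LinearMap.smul_apply, LinearMap.id_apply, Finset.mul_sum, Finset.sum_mul,
    ← Finset.sum_sub_distrib, ← Finset.sum_neg_distrib, mul_smul_comm, smul_mul_assoc, ← smul_sub,
    smul_neg]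

end FinDer

section EvalExt

variable {𝕜 : Type*} [RCLike 𝕜] {E : Type*} [NormedAddCommGroup E] [NormedSpace 𝕜 E]
  {G : Type*} [TopologicalSpace G] [ChartedSpace E G] {A : Type*} [AddCommGroup A] [Module 𝕜 A]

open Classical in
/-- Evaluation of sections of `𝓕 ⊗ A` over `U` at a point of `G`, extended by zero outside `U`. -/
def evalExt {U : Opens G} (x : G) : NumFun 𝕜 E U ⊗[𝕜] A →ₗ[𝕜] A :=
  if h : x ∈ U then evalAt ⟨x, h⟩ else 0

theorem evalExt_of_mem {U : Opens G} {x : G} (h : x ∈ U) (t : NumFun 𝕜 E U ⊗[𝕜] A) :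
    evalExt x t = evalAt ⟨x, h⟩ t := by
  rw [evalExt, dif_pos h]

theorem evalExt_tmul {U : Opens G} (x : G) (f : NumFun 𝕜 E U) (a : A) :
    evalExt x (f ⊗ₜ a) = extendZero f x • a := by
  rw [evalExt, extendZero]
  split_ifs with h
  · rfl
  · rw [zero_smul]; rfl

variable [Group G] {X : Lie[𝕜, E] G}

/-- The derivative of the values of a section along a curve of translations, if the derivatives of
numerical functions along this curve are given by the operator `D`. -/
theorem oneDer_evalExt {U : Opens G} {μ : G → G} {D : Module.End 𝕜 (NumFun 𝕜 E U)} {g : U}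
    (hμ : ∀ f : NumFun 𝕜 E U, MDifferentiableAt 𝓘(𝕜, E) 𝓘(𝕜, 𝕜) (fun h => extendZero f (μ h)) 1 ∧
      oneDer X (fun h => extendZero f (μ h)) = D f g)
    (l : Module.Dual 𝕜 A) (t : NumFun 𝕜 E U ⊗[𝕜] A) :
    MDifferentiableAt 𝓘(𝕜, E) 𝓘(𝕜, 𝕜) (fun h => l (evalExt (μ h) t)) 1 ∧
      oneDer X (fun h => l (evalExt (μ h) t)) = l (evalAt g (rTensor A D t)) := by
  induction t with
  | zero => simp only [map_zero, oneDer_const, and_true]; exact mdifferentiableAt_const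
  | add s t hs ht =>
    simp only [map_add]
    exact ⟨hs.1.add ht.1, by simp only [oneDer_add hs.1 ht.1, hs.2, ht.2]⟩
  | tmul f a =>
    have e : (fun h => l (evalExt (μ h) (f ⊗ₜ[𝕜] a))) = fun h => extendZero f (μ h) * l a := by
      funext h
      simp only [evalExt_tmul, map_smul, smul_eq_mul]
    rw [e]
    refine ⟨(hμ f).1.mul mdifferentiableAt_const, ?_⟩
    simp only [oneDer_mul (hμ f).1 mdifferentiableAt_const, oneDer_const, mul_zero, add_zero,
      (hμ f).2, rTensor_tmul, evalAt_tmul, map_smul, smul_eq_mul]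

/-- The product rule for the values along a curve of translations of a varying section. -/
theorem HasFinDer.oneDer_evalExt {U : Opens G} {μ : G → G} {D : Module.End 𝕜 (NumFun 𝕜 E U)} {g : U}
    (hμ : ∀ f : NumFun 𝕜 E U, MDifferentiableAt 𝓘(𝕜, E) 𝓘(𝕜, 𝕜) (fun h => extendZero f (μ h)) 1 ∧
      oneDer X (fun h => extendZero f (μ h)) = D f g) (h1 : μ 1 = g)
    {u : G → NumFun 𝕜 E U ⊗[𝕜] A} {u' : NumFun 𝕜 E U ⊗[𝕜] A} (hu : HasFinDer X u u')
    (l : Module.Dual 𝕜 A) :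
    MDifferentiableAt 𝓘(𝕜, E) 𝓘(𝕜, 𝕜) (fun h => l (evalExt (μ h) (u h))) 1 ∧
      oneDer X (fun h => l (evalExt (μ h) (u h))) =
        l (evalAt g (u' + rTensor A D (u 1))) := by
  obtain ⟨ι, _, c, x, hc, hu, rfl⟩ := hu
  have hx := fun i => BerezinConstruction.oneDer_evalExt hμ l (x i)
  have e : (fun h => l (evalExt (μ h) (u h))) = fun h => ∑ i, c i h * l (evalExt (μ h) (x i)) := by
    funext h
    simp only [hu, map_sum, map_smul, smul_eq_mul]
  rw [e]
  refine ⟨mdifferentiableAt_sum_fun _ fun i _ => (hc i).mul (hx i).1, ?_⟩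
  simp only [oneDer_sum_mul c _ hc fun i => (hx i).1, map_add, hu]
  simp only [map_sum, map_smul, smul_eq_mul, (hx _).2, h1, evalExt_of_mem g.2]

end EvalExt

/-! ### Operators which supercommute with an action -/

section Commute

variable {𝕜 : Type*} [RCLike 𝕜] {W : Type*} [AddCommGroup W] [Module 𝕜 W]
  {L V : Type*} [AddCommGroup L] [Module 𝕜 L] [AddCommGroup V] [Module 𝕜 V]
  {S : Type*} [AddCommGroup S] [Module 𝕜 S] {ρ ρ' : (L × V) →ₗ[𝕜] S →ₗ[𝕜] S}

/-- If two actions supercommute, then so do their extensions to the Grassmann envelope. -/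
theorem superAct_comm
    (h : ∀ (i j : ZMod 2), ∀ X ∈ homog 𝕜 L V i, ∀ Y ∈ homog 𝕜 L V j, ∀ s,
      ρ' X (ρ Y s) = ssign 𝕜 i j • ρ Y (ρ' X s)) {n : Λ[𝕜] W ⊗[𝕜] (L × V)}
    (hn : n ∈ totalParity 𝕜 L V W 0) {k : ZMod 2} {X : L × V} (hX : X ∈ homog 𝕜 L V k)
    (t : Λ[𝕜] W ⊗[𝕜] S) :
    superAct W ρ' (1 ⊗ₜ X) (superAct W ρ n t) = superAct W ρ n (superAct W ρ' (1 ⊗ₜ X) t) := by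
  revert n
  suffices H : ∀ a Y, (a ∈ extParity 𝕜 W 0 ∧ Y ∈ homog 𝕜 L V 0 ∨
      a ∈ extParity 𝕜 W 1 ∧ Y ∈ homog 𝕜 L V 1) →
        superAct W ρ' (1 ⊗ₜ X) (superAct W ρ (a ⊗ₜ Y) t) =
          superAct W ρ (a ⊗ₜ Y) (superAct W ρ' (1 ⊗ₜ X) t) by
    intro n hn
    exact totalParity_ext (f := superAct W ρ' (1 ⊗ₜ X) ∘ₗ (superAct W ρ).flip t)
      (g := (superAct W ρ).flip (superAct W ρ' (1 ⊗ₜ X) t))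
      (fun a ha Y => H a _ (Or.inl ⟨ha, even_mem_homog Y⟩))
      (fun a ha v => H a _ (Or.inr ⟨by simpa using ha, odd_mem_homog v⟩)) hn
  intro a Y haY
  have hk : ∀ l : ZMod 2, l = 0 ∨ l = 1 := by decide
  induction t with
  | zero => simp only [map_zero]
  | add t t' ht ht' => simp only [map_add, ht, ht']
  | tmul c s =>
    rcases hk k with rfl | rfl <;> rcases haY with ⟨ha, hY⟩ | ⟨ha, hY⟩
    · simp only [superAct_of_even ρ hY, superAct_of_even ρ' hX, h 0 0 X hX Y hY,
        ssign_of_left_even, one_smul, one_mul]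
    · simp only [superAct_of_odd ρ hY, superAct_of_even ρ' hX, h 0 1 X hX Y hY, ssign_of_left_even,
        one_smul, one_mul]
    · simp only [superAct_of_even ρ hY, superAct_of_odd ρ' hX, h 1 0 X hX Y hY,
        ssign_of_right_even, one_smul, one_mul, map_mul, extInvol_even ha]
    · simp only [superAct_of_odd ρ hY, superAct_of_odd ρ' hX, h 1 1 X hX Y hY, one_mul, map_mul,
        extInvol_odd ha, neg_mul, neg_tmul, ← tmul_neg]
      congr 1
      simp [ssign]

theorem superAct_flow [FiniteDimensional 𝕜 W]
    (h : ∀ (i j : ZMod 2), ∀ X ∈ homog 𝕜 L V i, ∀ Y ∈ homog 𝕜 L V j, ∀ s,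
      ρ' X (ρ Y s) = ssign 𝕜 i j • ρ Y (ρ' X s)) {n : Λ[𝕜] W ⊗[𝕜] (L × V)}
    (hn : n ∈ totalParity 𝕜 L V W 0) (h1 : n ∈ extFil 𝕜 W (L × V) 1) {k : ZMod 2} {X : L × V}
    (hX : X ∈ homog 𝕜 L V k) (t : Λ[𝕜] W ⊗[𝕜] S) :
    superAct W ρ' (1 ⊗ₜ X) (flow ρ n t) = flow ρ n (superAct W ρ' (1 ⊗ₜ X) t) :=
  (expNil_intertwine (g := superAct W ρ' (1 ⊗ₜ X)) (isNilpotent_superAct (ρ := ρ) h1)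
    (isNilpotent_superAct (ρ := ρ) h1) (fun t => (superAct_comm h hn hX t).symm) t).symm

/-- The flow along a direction of square zero. -/
theorem flow_of_sq {n : Λ[𝕜] W ⊗[𝕜] (L × V)}
    (h : ∀ t, superAct W ρ n (superAct W ρ n t) = 0) (t : Λ[𝕜] W ⊗[𝕜] S) :
    flow ρ n t = t + superAct W ρ n t := by
  have h2 : (superAct W ρ n : Module.End 𝕜 (Λ[𝕜] W ⊗[𝕜] S)) ^ 2 = 0 := by
    rw [pow_two]; exact LinearMap.ext h
  rw [flow, expNil_eq_sum (A := Module.End 𝕜 (Λ[𝕜] W ⊗[𝕜] S)) h2]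
  simp [Finset.sum_range_succ]

theorem superAct_odd_sq {a : Λ[𝕜] W} (ha : a ∈ extParity 𝕜 W 1) (v : V)
    (t : Λ[𝕜] W ⊗[𝕜] S) :
    superAct W ρ (a ⊗ₜ ((0, v) : L × V)) (superAct W ρ (a ⊗ₜ ((0, v) : L × V)) t) = 0 := by
  induction t with
  | zero => simp only [map_zero]
  | add t t' ht ht' => simp only [map_add, ht, ht', add_zero]
  | tmul c s =>
    simp only [superAct_odd, map_mul, extInvol_odd ha, ← mul_assoc, mul_neg, ext_odd_sq ha,
      neg_zero, zero_mul, zero_tmul]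

/-- The flow along an odd parameter. -/
theorem flow_smul_odd [FiniteDimensional 𝕜 W] {a : Λ[𝕜] W} (ha : a ∈ extParity 𝕜 W 1)
    (v : V) (c : 𝕜) (t : Λ[𝕜] W ⊗[𝕜] S) :
    flow ρ (c • a ⊗ₜ ((0, v) : L × V)) t = t + c • superAct W ρ (a ⊗ₜ ((0, v) : L × V)) t := by
  rw [flow_of_sq, map_smul, LinearMap.smul_apply]
  intro t
  simp only [map_smul, LinearMap.smul_apply, superAct_odd_sq ha, smul_zero]

end Commute

/-! ### Derivatives of the continuation -/

section FlowDer

variable {𝕜 : Type*} [RCLike 𝕜] {E : Type*} [NormedAddCommGroup E] [NormedSpace 𝕜 E]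
  {G : Type*} [TopologicalSpace G] [ChartedSpace E G] [Group G]
  {L V : Type*} [AddCommGroup L] [Module 𝕜 L] [AddCommGroup V] [Module 𝕜 V]
  {br : Bil[𝕜] (L × V)} {W : Type*} [AddCommGroup W] [Module 𝕜 W]
  [FiniteDimensional 𝕜 W]

theorem hasFinDer_expNil_map {M T : Type*} [AddCommGroup M] [Module 𝕜 M] [AddCommGroup T] [Module 𝕜 T]
    (br : M →ₗ[𝕜] M →ₗ[𝕜] M) (f : M →ₗ[𝕜] Module.End 𝕜 T) {z : M}
    (hz : ∀ x t, f z (f x t) = f (br z x) t + f x (f z t)) {X : Lie[𝕜, E] G} {n : G → M}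
    (hn : HasFinDer X n (-br z (n 1))) {k : ℕ} (hk : ∀ h, f (n h) ^ k = 0) (t : T) :
    HasFinDer X (fun h => expNil 𝕜 (f (n h)) t)
      (expNil 𝕜 (f (n 1)) (f z t) - f z (expNil 𝕜 (f (n 1)) t)) := by
  have ha : HasFinDer X (fun h => f (n h)) (-(f z * f (n 1) - f (n 1) * f z)) :=
    (hn.map f).congr (fun _ => rfl) (by
      rw [map_neg]
      exact congrArg Neg.neg (LinearMap.ext fun t => sub_eq_of_eq_add (hz (n 1) t)))
  refine ((ha.expNil hk).map (LinearMap.applyₗ (R := 𝕜) t)).congr (fun _ => rfl) ?_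
  change _ = -(f z (expNil 𝕜 (f (n 1)) t) - expNil 𝕜 (f (n 1)) (f z t))
  rw [neg_sub]

/-- The derivative of the flow along a curve of times which is moved by the adjoint action. -/
theorem hasFinDer_flow {S : Type*} [AddCommGroup S] [Module 𝕜 S] {ρ : (L × V) →ₗ[𝕜] S →ₗ[𝕜] S}
    (hbr : IsLieSuper br) (hρ : IsSuperRepOn br ρ) {X : Lie[𝕜, E] G} {Y : L}
    {n : G → Λ[𝕜] W ⊗[𝕜] (L × V)}
    (hn : HasFinDer X n (-superAct W br (1 ⊗ₜ ((Y, 0) : L × V)) (n 1)))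
    (h1 : ∀ h, n h ∈ extFil 𝕜 W (L × V) 1) (s : S) :
    HasFinDer X (fun h => flow ρ (n h) (1 ⊗ₜ s))
      (flow ρ (n 1) (1 ⊗ₜ ρ (Y, 0) s) - superAct W ρ (1 ⊗ₜ ((Y, 0) : L × V)) (flow ρ (n 1) (1 ⊗ₜ s))) := by
  have hY : (1 : Λ[𝕜] W) ⊗ₜ[𝕜] ((Y, 0) : L × V) ∈ totalParity 𝕜 L V W 0 :=
    tmul_even_mem_totalParity one_mem_extParity Y
  refine (hasFinDer_expNil_map (T := Λ[𝕜] W ⊗[𝕜] S) (superAct W br) (superAct W ρ)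
    (superAct_superAct hbr hρ hY) hn
    (fun h => pow_eq_zero_of_mem_raising (superAct_mem_raising (h1 h))) (1 ⊗ₜ s)).congr
    (fun _ => rfl) ?_
  rw [superAct_even ρ 1 1 Y s, one_mul]
  rfl

variable {F : Type*} [CommRing F] [Algebra 𝕜 F]
  {ρ : (L × V) →ₗ[𝕜] Module.End 𝕜 (F ⊗[𝕜] Λ*[𝕜] V)}

omit [FiniteDimensional 𝕜 W] in
theorem bodySection_superAct_one {Y : L} {D : Module.End 𝕜 F}
    (h : ∀ s, bodyMap (ρ (Y, 0) s) = D (bodyMap s))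
    (t : Λ[𝕜] W ⊗[𝕜] (F ⊗[𝕜] Λ*[𝕜] V)) :
    bodySection (superAct W ρ (1 ⊗ₜ ((Y, 0) : L × V)) t) = rTensor _ D (bodySection t) := by
  induction t with
  | zero => simp only [map_zero]
  | add x y hx hy => simp only [map_add, hx, hy]
  | tmul b s =>
    simp only [superAct_even, bodySection_tmul', rTensor_tmul, h, one_mul]

theorem hasFinDer_bodySection_flow (hbr : IsLieSuper br) (hρ : IsSuperRepOn br ρ)
    {X : Lie[𝕜, E] G} {Y : L} {n : G → Λ[𝕜] W ⊗[𝕜] (L × V)}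
    (hn : HasFinDer X n (-superAct W br (1 ⊗ₜ ((Y, 0) : L × V)) (n 1)))
    (h1 : ∀ h, n h ∈ extFil 𝕜 W (L × V) 1) {D : Module.End 𝕜 F}
    (hD : ∀ s, bodyMap (ρ (Y, 0) s) = D (bodyMap s))
    (s : F ⊗[𝕜] Λ*[𝕜] V) :
    HasFinDer X (fun h => bodySection (flow ρ (n h) (1 ⊗ₜ s)))
      (bodySection (flow ρ (n 1) (1 ⊗ₜ ρ (Y, 0) s)) -
        rTensor _ D (bodySection (flow ρ (n 1) (1 ⊗ₜ s)))) :=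
  ((hasFinDer_flow hbr hρ hn h1 s).map bodySection).congr (fun _ => rfl) (by
    rw [map_sub, bodySection_superAct_one hD])

variable [FiniteDimensional 𝕜 V]

omit [FiniteDimensional 𝕜 V] in
/-- The continuation along the one-parameter group of an odd parameter. -/
theorem bodySection_flow_flow_odd {n : Λ[𝕜] W ⊗[𝕜] (L × V)}
    (hn : n ∈ totalParity 𝕜 L V W 0) (h1 : n ∈ extFil 𝕜 W (L × V) 1) {a : Λ[𝕜] W}
    (ha : a ∈ extParity 𝕜 W 1) (v : V) (c : 𝕜) (s : F ⊗[𝕜] Λ*[𝕜] V) :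
    bodySection (flow ρ n (flow ρ (c • a ⊗ₜ ((0, v) : L × V)) (1 ⊗ₜ s))) =
      bodySection (flow ρ n (1 ⊗ₜ s)) + c • lTensor F (mulLeft 𝕜 a)
        (bodySection (flow ρ n (1 ⊗ₜ ρ (0, v) s))) := by
  simp only [flow_smul_odd ha, superAct_odd, map_one, mul_one, map_add, map_smul,
    show a ⊗ₜ[𝕜] ρ (0, v) s = a • ((1 : Λ[𝕜] W) ⊗ₜ[𝕜] ρ (0, v) s) by rw [smul_tmul', smul_eq_mul, mul_one],
    flow_smul hn h1, bodySection_smul_one_tmul]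

end FlowDer

/-! ### The operators given by Berezin's construction -/

section OddRight

variable {𝕜 : Type*} [RCLike 𝕜] {L V : Type*} [AddCommGroup L] [Module 𝕜 L] [AddCommGroup V]
  [Module 𝕜 V] {W : Type*} [AddCommGroup W] [Module 𝕜 W] {F : Type*} [CommRing F] [Algebra 𝕜 F]
  {ρ ρ' : (L × V) →ₗ[𝕜] Module.End 𝕜 (F ⊗[𝕜] Λ*[𝕜] V)}

/-- Two actions whose values at a point agree up to sign have continuations which agree up to sign
there. -/
theorem lid_bodySection_superAct_odd (ev : F →ₗ[𝕜] 𝕜) {v w : V}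
    (h : ∀ s, ev (bodyMap (ρ' (0, v) s)) = -ev (bodyMap (ρ (0, w) s))) (a : Λ[𝕜] W)
    (t : Λ[𝕜] W ⊗[𝕜] (F ⊗[𝕜] Λ*[𝕜] V)) :
    TensorProduct.lid 𝕜 _ (rTensor _ ev
      (bodySection (superAct W ρ (a ⊗ₜ ((0, w) : L × V)) t))) =
      -(a * TensorProduct.lid 𝕜 _ (rTensor _ ev
        (bodySection (superAct W ρ' (1 ⊗ₜ ((0, v) : L × V)) t)))) := by
  induction t with
  | zero => simp only [map_zero, mul_zero, neg_zero]
  | add x y hx hy => simp only [map_add, hx, hy, mul_add, neg_add]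
  | tmul b s =>
    simp only [superAct_odd, bodySection_tmul', rTensor_tmul, TensorProduct.lid_tmul, h,
      one_mul, neg_smul, mul_neg, neg_neg, mul_smul_comm]

theorem map_add_neg_smul {M N : Type*} [AddCommGroup M] [Module 𝕜 M] [AddCommGroup N] [Module 𝕜 N]
    (Φ : M →ₗ[𝕜] N) (c : 𝕜) {x y : M} {z : N} (h : Φ y = -z) : Φ (x + (-c) • y) = Φ x + c • z := by
  rw [map_add, map_smul, h, smul_neg, neg_smul, neg_neg]

/-- The continuation, at the points over a point of the body, along the right translations by the
one-parameter group of an odd parameter. -/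
theorem lid_bodySection_flow_odd_flow [FiniteDimensional 𝕜 W] (ev : F →ₗ[𝕜] 𝕜) {v w : V}
    (h : ∀ s, ev (bodyMap (ρ' (0, v) s)) = -ev (bodyMap (ρ (0, w) s)))
    (hρ : ∀ (i j : ZMod 2), ∀ X ∈ homog 𝕜 L V i, ∀ Y ∈ homog 𝕜 L V j, ∀ s,
      ρ' X (ρ Y s) = ssign 𝕜 i j • ρ Y (ρ' X s)) {n : Λ[𝕜] W ⊗[𝕜] (L × V)}
    (hn : n ∈ totalParity 𝕜 L V W 0) (h1 : n ∈ extFil 𝕜 W (L × V) 1) {a : Λ[𝕜] W}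
    (ha : a ∈ extParity 𝕜 W 1) (c : 𝕜) (s : F ⊗[𝕜] Λ*[𝕜] V) :
    TensorProduct.lid 𝕜 _ (rTensor _ ev
      (bodySection (flow ρ ((-c) • a ⊗ₜ ((0, w) : L × V)) (flow ρ n (1 ⊗ₜ s))))) =
      TensorProduct.lid 𝕜 _ (rTensor _ ev (bodySection (flow ρ n (1 ⊗ₜ s)))) +
        c • (a * TensorProduct.lid 𝕜 _ (rTensor _ ev
          (bodySection (flow ρ n (1 ⊗ₜ ρ' (0, v) s))))) := by
  have hc := superAct_flow hρ hn h1 (odd_mem_homog (𝕜 := 𝕜) (L := L) v) (1 ⊗ₜ s)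
  rw [superAct_odd, map_one, one_mul] at hc
  have key := lid_bodySection_superAct_odd ev h a (flow ρ n (1 ⊗ₜ s))
  rw [hc] at key
  rw [flow_smul_odd ha]
  exact map_add_neg_smul ((TensorProduct.lid 𝕜 (Λ[𝕜] W)).toLinearMap ∘ₗ
    rTensor _ ev ∘ₗ bodySection) c key

end OddRight

section Berezin

variable {𝕜 : Type*} [RCLike 𝕜] {E : Type*} [NormedAddCommGroup E] [NormedSpace 𝕜 E]
  [FiniteDimensional 𝕜 E] {V : Type*} [AddCommGroup V] [Module 𝕜 V] [FiniteDimensional 𝕜 V]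
  {G : Type*} [TopologicalSpace G] [ChartedSpace E G] [Group G] [LieGroup 𝓘(𝕜, E) ∞ G] {m : ℕ}
  (P : HCSuperpair 𝕜 E V G)

theorem contSection_bch {U : Opens G} (f : Superfun 𝕜 E V U) {x y : Gr 𝕜 m ⊗[𝕜] SuperSpace 𝕜 E V G}
    (hx : x ∈ soul 𝕜 E V G m) (hy : y ∈ soul 𝕜 E V G m) :
    contSection P f (bch (envBracket P m) m x y) =
      bodySection (flow (W := Fin m → 𝕜) (leftOp P.bracket (leftDer U)) x
        (flow (W := Fin m → 𝕜) (leftOp P.bracket (leftDer U)) y (1 ⊗ₜ f))) := by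
  rw [contSection, flow_leftOp_bch P U hx hy]
  rfl

theorem contSection_bch_zero {U : Opens G} (f : Superfun 𝕜 E V U) {x : Gr 𝕜 m ⊗[𝕜] SuperSpace 𝕜 E V G}
    (hx : x ∈ soul 𝕜 E V G m) : contSection P f (bch (envBracket P m) m x 0) = contSection P f x := by
  rw [contSection_bch P f hx (Submodule.zero_mem _), flow_zero]
  rfl

theorem contSection_zero_bch {U : Opens G} (f : Superfun 𝕜 E V U) {x : Gr 𝕜 m ⊗[𝕜] SuperSpace 𝕜 E V G}
    (hx : x ∈ soul 𝕜 E V G m) : contSection P f (bch (envBracket P m) m 0 x) = contSection P f x := by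
  rw [contSection_bch P f (Submodule.zero_mem _) hx, flow_zero]
  rfl

theorem continuation_eq_evalExt {U : Opens G} (f : Superfun 𝕜 E V U) (p : GrPoint P m)
    (hp : p.body ∈ U) : continuation P f p = evalExt p.body (contSection P f p.log.1) := by
  rw [continuation_eq P f p hp, evalExt_of_mem hp]

/-- The derivative of `h ↦ Ad(h⁻¹) n` at the identity. -/
theorem hasFinDer_Ad_inv (X : Lie[𝕜, E] G) (n : Gr 𝕜 m ⊗[𝕜] SuperSpace 𝕜 E V G) :
    HasFinDer X (fun h : G => lTensor (Gr 𝕜 m) (P.Ad h⁻¹).toLinearMap n)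
      (-superAct (Fin m → 𝕜) P.bracket (1 ⊗ₜ ((X, 0) : SuperSpace 𝕜 E V G)) n) := by
  induction n using TensorProduct.induction_on with
  | zero => exact (hasFinDer_const 0).congr (fun _ => map_zero _) (by rw [map_zero, neg_zero])
  | add x y hx hy =>
    exact (hx.add hy).congr (fun _ => map_add _ _ _) (by rw [map_add, neg_add])
  | tmul a Z =>
    let b := finBasis 𝕜 (SuperSpace 𝕜 E V G)
    have h := HasFinDer.sum (X := X) Finset.univ fun i _ =>
      hasFinDer_smul (mdifferentiableAt_Ad_inv P Z (b.coord i) 1) (a ⊗ₜ[𝕜] b i)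
    have hs : ∀ Y : SuperSpace 𝕜 E V G, a ⊗ₜ[𝕜] Y = ∑ i, b.coord i Y • a ⊗ₜ[𝕜] b i := fun Y => by
      conv_lhs => rw [← b.sum_repr Y, tmul_sum]
      exact Finset.sum_congr rfl fun i _ => tmul_smul _ _ _
    refine h.congr (fun k => hs (P.Ad k⁻¹ Z)) ?_
    rw [superAct_even, one_mul, hs, ← Finset.sum_neg_distrib]
    exact Finset.sum_congr rfl fun i _ => by rw [oneDer_Ad_inv, neg_smul]

omit [FiniteDimensional 𝕜 E] [FiniteDimensional 𝕜 V] in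
theorem lTensor_Ad_one (n : Gr 𝕜 m ⊗[𝕜] SuperSpace 𝕜 E V G) :
    lTensor (Gr 𝕜 m) (P.Ad (1 : G)⁻¹).toLinearMap n = n := by
  have h : lTensor (Gr 𝕜 m) (P.Ad (1 : G)⁻¹).toLinearMap = LinearMap.id := by
    rw [inv_one, map_one]
    exact LinearMap.lTensor_id _ _
  rw [h, LinearMap.id_apply]

theorem hasFinDer_contSection {U : Opens G} (f : Superfun 𝕜 E V U) {n : Gr 𝕜 m ⊗[𝕜] SuperSpace 𝕜 E V G}
    (hn : n ∈ soul 𝕜 E V G m) (X : Lie[𝕜, E] G) :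
    HasFinDer X (fun h : G => contSection P f (lTensor (Gr 𝕜 m) (P.Ad h⁻¹).toLinearMap n))
      (contSection P (leftOp P.bracket (leftDer U) (X, 0) f) n -
        rTensor _ (leftDer U X) (contSection P f n)) := by
  have h := hasFinDer_Ad_inv P X n
  have e := lTensor_Ad_one P n
  have h2 := hasFinDer_bodySection_flow (n := fun h : G => lTensor (Gr 𝕜 m)
    (P.Ad h⁻¹).toLinearMap n) P.isLieSuper (leftOp_isSuperRepOn_leftDer P U)
    (by rw [e]; exact h) (fun h => lTensor_mem_extFil _ (soul_le_extFil hn))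
    (fun s => bodyMap_leftOp_even X s) f
  rw [e] at h2
  exact h2

/-- The left-invariant operators of the even directions are given by Berezin's construction: the
derivative of the flow along `Ad(h⁻¹) n` is a commutator, and this is what remains of the product rule. -/
theorem leftOp_berezin_even {U : Opens G} (f : Superfun 𝕜 E V U) (p : GrPoint P m) (hp : p.body ∈ U)
    (X : Lie[𝕜, E] G) (l : Module.Dual 𝕜 (Gr 𝕜 m)) :
    MDifferentiableAt 𝓘(𝕜, E) 𝓘(𝕜, 𝕜)
        (fun h : G => l (continuation P f (p * GrPoint.ofBody P m h))) 1 ∧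
      oneDer X (fun h : G => l (continuation P f (p * GrPoint.ofBody P m h))) =
        l (continuation P (leftOp P.bracket (leftDer U) (X, 0) f) p) := by
  have hev : (fun h : G => l (continuation P f (p * GrPoint.ofBody P m h))) =ᶠ[nhds 1]
      fun h => l (evalExt (p.body * h)
        (contSection P f (lTensor (Gr 𝕜 m) (P.Ad h⁻¹).toLinearMap p.log.1))) := by
    filter_upwards [(contMDiff_mul_left (I := 𝓘(𝕜, E)) (n := ∞) (a := p.body)).continuous.continuousAt.eventually_mem
      (U.2.mem_nhds (show p.body * 1 ∈ U by rwa [mul_one]))] with h hh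
    rw [continuation_eq_evalExt P f _ hh]
    exact congrArg (fun t => l (evalExt (p.body * h) t))
      (contSection_bch_zero P f (Ad_mem_soul P m _ _ p.log.2))
  have H := HasFinDer.oneDer_evalExt (D := leftDer U X) (g := ⟨p.body, hp⟩) (μ := fun h => p.body * h)
    (fun f => ⟨mdifferentiableAt_extendZero_mul f hp, rfl⟩) (mul_one _)
    (hasFinDer_contSection P f p.log.2 X) l
  rw [lTensor_Ad_one, sub_add_cancel] at H
  exact ⟨H.1.congr_of_eventuallyEq hev, by simp only [oneDer_congr hev, H.2,
      continuation_eq P _ p hp]⟩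

theorem leftOp_berezin_odd {U : Opens G} (f : Superfun 𝕜 E V U) (p : GrPoint P m) (hp : p.body ∈ U)
    (X : V) (α : extParity 𝕜 (Fin m → 𝕜) 1) (l : Module.Dual 𝕜 (Gr 𝕜 m)) :
    HasDerivAt (fun t : 𝕜 => l (continuation P f (p * oddCurve P α X t)))
      (l (α * continuation P (leftOp P.bracket (leftDer U) (0, X) f) p)) 0 := by
  have e : (fun t : 𝕜 => l (continuation P f (p * oddCurve P α X t))) = fun t =>
      l (continuation P f p) + t * l (α * continuation P (leftOp P.bracket (leftDer U) (0, X) f) p) := by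
    funext t
    have hb : (p * oddCurve P α X t).body = p.body := mul_one _
    have hl : (p * oddCurve P α X t).log.1 = bch (envBracket P m) m
        (lTensor (Gr 𝕜 m) (P.Ad (1 : G)⁻¹).toLinearMap p.log.1)
        (t • α.1 ⊗ₜ[𝕜] ((0, X) : SuperSpace 𝕜 E V G)) :=
      congrArg (bch (envBracket P m) m _) (map_smul _ t _)
    rw [lTensor_Ad_one] at hl
    simp only [continuation_eq_evalExt P f _ (by rwa [hb]), hb, hl,
      contSection_bch P f p.log.2 (Submodule.smul_mem _ t (tmul_mem_soul (Or.inr ⟨α.2, inr_mem_homog X⟩))),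
      bodySection_flow_flow_odd (soul_le_totalParity p.log.2) (soul_le_extFil p.log.2) α.2,
      map_add, map_smul, continuation_eq P _ p hp, evalExt_of_mem hp, evalAt_lTensor]
    rfl
  rw [e]
  simpa using ((hasDerivAt_id (0 : 𝕜)).mul_const
    (l (α * continuation P (leftOp P.bracket (leftDer U) (0, X) f) p))).const_add
      (l (continuation P f p))

end Berezin

section BerezinRight

variable {𝕜 : Type*} [RCLike 𝕜] {E : Type*} [NormedAddCommGroup E] [NormedSpace 𝕜 E]
  [FiniteDimensional 𝕜 E] {V : Type*} [AddCommGroup V] [Module 𝕜 V] [FiniteDimensional 𝕜 V]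
  {G : Type*} [TopologicalSpace G] [ChartedSpace E G] [Group G] [LieGroup 𝓘(𝕜, E) ∞ G] {m : ℕ}
  (P : HCSuperpair 𝕜 E V G)

/-- The right-invariant action on the superfunctions on `U`. -/
abbrev rightAct (U : Opens G) : SuperSpace 𝕜 E V G →ₗ[𝕜] Module.End 𝕜 (Superfun 𝕜 E V U) :=
  rightOp P.bracket (leftDer U) (adFrame P U)

theorem bodyMap_rightAct_apply {U : Opens G} (X : SuperSpace 𝕜 E V G) (s : Superfun 𝕜 E V U) (g : U) :
    bodyMap (rightAct P U X s) g =
      -bodyMap (leftOp P.bracket (leftDer U) (P.Ad (g : G)⁻¹ X) s) g := by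
  have h := (isRightFrame P U).eval_bodyMap_rightOp g X s
  rw [show evalCoeff (NumFun.eval g) (adFrame P U X) = _ from evalAt_adFrame P X g] at h
  exact h

omit [FiniteDimensional 𝕜 E] [FiniteDimensional 𝕜 V] in
theorem Ad_even_apply (g : G) (X : Lie[𝕜, E] G) :
    P.Ad g (X, 0) = ((P.Ad g (X, 0)).1, 0) :=
  Prod.ext rfl (mem_homog_zero.mp (P.Ad_mem g 0 _ (inl_mem_homog X)))

omit [FiniteDimensional 𝕜 E] [FiniteDimensional 𝕜 V] in
theorem Ad_odd_apply (g : G) (v : V) : P.Ad g (0, v) = (0, (P.Ad g (0, v)).2) :=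
  Prod.ext (mem_homog_one.mp (P.Ad_mem g 1 _ (inr_mem_homog v))) rfl

theorem bodyMap_rightAct_even {U : Opens G} (X : Lie[𝕜, E] G) (s : Superfun 𝕜 E V U) :
    bodyMap (rightAct P U (X, 0) s) = rightDer U X (bodyMap s) := by
  refine ContMDiffMap.ext fun g => ?_
  rw [bodyMap_rightAct_apply, Ad_even_apply, bodyMap_leftOp_even, rightDer_apply_eq P]

theorem rightAct_leftOp {U : Opens G} (i j : ZMod 2) (X : SuperSpace 𝕜 E V G)
    (hX : X ∈ homog 𝕜 (Lie[𝕜, E] G) V i) (Y : SuperSpace 𝕜 E V G)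
    (hY : Y ∈ homog 𝕜 (Lie[𝕜, E] G) V j) (s : Superfun 𝕜 E V U) :
    rightAct P U X (leftOp P.bracket (leftDer U) Y s) =
      ssign 𝕜 i j • leftOp P.bracket (leftDer U) Y (rightAct P U X s) :=
  (isRightFrame P U).rightOp_leftOp hX hY s

theorem superAct_rightAct_flow {U : Opens G} {n : Gr 𝕜 m ⊗[𝕜] SuperSpace 𝕜 E V G}
    (hn : n ∈ soul 𝕜 E V G m) {k : ZMod 2} {X : SuperSpace 𝕜 E V G}
    (hX : X ∈ homog 𝕜 (Lie[𝕜, E] G) V k) (t : Gr 𝕜 m ⊗[𝕜] Superfun 𝕜 E V U) :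
    superAct (Fin m → 𝕜) (rightAct P U) (1 ⊗ₜ X)
      (flow (W := Fin m → 𝕜) (leftOp P.bracket (leftDer U)) n t) =
      flow (W := Fin m → 𝕜) (leftOp P.bracket (leftDer U)) n
        (superAct (Fin m → 𝕜) (rightAct P U) (1 ⊗ₜ X) t) :=
  superAct_flow (rightAct_leftOp P) (soul_le_totalParity hn) (soul_le_extFil hn) hX t

theorem rTensor_rightDer_contSection {U : Opens G} (f : Superfun 𝕜 E V U)
    {n : Gr 𝕜 m ⊗[𝕜] SuperSpace 𝕜 E V G} (hn : n ∈ soul 𝕜 E V G m)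
    (X : Lie[𝕜, E] G) :
    rTensor _ (rightDer U X) (contSection P f n) =
      contSection P (rightAct P U (X, 0) f) n := by
  have h := superAct_rightAct_flow P hn (inl_mem_homog X) (1 ⊗ₜ[𝕜] f)
  rw [superAct_even, one_mul] at h
  rw [contSection, ← bodySection_superAct_one (ρ := rightAct P U) (bodyMap_rightAct_even P X), h,
    contSection]

theorem rightAct_berezin_even {U : Opens G} (f : Superfun 𝕜 E V U) (p : GrPoint P m) (hp : p.body ∈ U)
    (X : Lie[𝕜, E] G) (l : Module.Dual 𝕜 (Gr 𝕜 m)) :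
    MDifferentiableAt 𝓘(𝕜, E) 𝓘(𝕜, 𝕜)
        (fun h : G => l (continuation P f (GrPoint.ofBody P m h * p))) 1 ∧
      oneDer (-X) (fun h : G => l (continuation P f (GrPoint.ofBody P m h * p))) =
        l (continuation P (rightAct P U (X, 0) f) p) := by
  have hev : (fun h : G => l (continuation P f (GrPoint.ofBody P m h * p))) =ᶠ[nhds 1]
      fun h => l (evalExt (h * p.body) (contSection P f p.log.1)) := by
    filter_upwards [(contMDiff_mul_right (I := 𝓘(𝕜, E)) (n := ∞) (a := p.body)).continuous.continuousAt.eventually_mem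
      (U.2.mem_nhds (show 1 * p.body ∈ U by rwa [one_mul]))] with h hh
    rw [continuation_eq_evalExt P f _ hh]
    refine congrArg (fun t => l (evalExt (h * p.body) t)) ?_
    change contSection P f (bch (envBracket P m) m (lTensor (Gr 𝕜 m)
      (P.Ad p.body⁻¹).toLinearMap 0) p.log.1) = _
    rw [map_zero, contSection_zero_bch P f p.log.2]
  have hneg : ∀ u : G → 𝕜, oneDer (-X) u = -oneDer X u := fun u =>
    (mfderiv 𝓘(𝕜, E) 𝓘(𝕜, 𝕜) u 1).map_neg X
  have H := oneDer_evalExt (X := -X) (D := rightDer U X) (g := ⟨p.body, hp⟩) (μ := fun h => h * p.body)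
    (fun f => ⟨(ContMDiffAt.comp (I' := 𝓘(𝕜, E)) (1 : G) (contMDiffAt_extendZero f (by rwa [one_mul]))
      contMDiff_mul_right.contMDiffAt).mdifferentiableAt (by simp), hneg _⟩) l
    (contSection P f p.log.1)
  rw [rTensor_rightDer_contSection P f p.log.2] at H
  exact ⟨H.1.congr_of_eventuallyEq hev, by rw [oneDer_congr hev, H.2, continuation_eq P _ p hp]⟩

set_option maxHeartbeats 600000 in
theorem evalAt_flow_odd_flow {U : Opens G} (f : Superfun 𝕜 E V U) {n : Gr 𝕜 m ⊗[𝕜] SuperSpace 𝕜 E V G}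
    (hn : n ∈ soul 𝕜 E V G m) (g : U) (v : V) {a : Gr 𝕜 m} (ha : a ∈ extParity 𝕜 (Fin m → 𝕜) 1) (c : 𝕜) :
    evalAt g (contSection P f (bch (envBracket P m) m ((-c) • a ⊗ₜ[𝕜] P.Ad (g : G)⁻¹ (0, v)) n)) =
      evalAt g (contSection P f n) + c • (a * evalAt g (contSection P (rightAct P U (0, v) f) n)) := by
  rw [contSection_bch P f (Submodule.smul_mem _ (-c) (tmul_mem_soul
    (Or.inr ⟨ha, P.Ad_mem (g : G)⁻¹ 1 _ (inr_mem_homog v)⟩))) hn, Ad_odd_apply]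
  have h : ∀ s : Superfun 𝕜 E V U, NumFun.eval g (bodyMap (rightAct P U (0, v) s)) =
      -NumFun.eval g (bodyMap (leftOp P.bracket (leftDer U) (0, (P.Ad (g : G)⁻¹ (0, v)).2) s)) := fun s => by
    rw [← Ad_odd_apply]
    exact bodyMap_rightAct_apply P (0, v) s g
  have key := lid_bodySection_flow_odd_flow (NumFun.eval g) h (rightAct_leftOp P)
    (soul_le_totalParity hn) (soul_le_extFil hn) ha c f
  rw [contSection, contSection]
  exact key

theorem rightAct_berezin_odd {U : Opens G} (f : Superfun 𝕜 E V U) (p : GrPoint P m) (hp : p.body ∈ U)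
    (X : V) (α : extParity 𝕜 (Fin m → 𝕜) 1) (l : Module.Dual 𝕜 (Gr 𝕜 m)) :
    HasDerivAt (fun t : 𝕜 => l (continuation P f (oddCurve P α X (-t) * p)))
      (l (α * continuation P (rightAct P U (0, X) f) p)) 0 := by
  have e : (fun t : 𝕜 => l (continuation P f (oddCurve P α X (-t) * p))) = fun t =>
      l (continuation P f p) + t * l (α * continuation P (rightAct P U (0, X) f) p) := by
    funext t
    have hb : (oddCurve P α X (-t) * p).body = p.body := one_mul _
    have hl : (oddCurve P α X (-t) * p).log.1 = bch (envBracket P m) m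
        ((-t) • α.1 ⊗ₜ[𝕜] P.Ad p.body⁻¹ (0, X)) p.log.1 :=
      congrArg (fun x => bch (envBracket P m) m x p.log.1)
        ((congrArg _ (map_smul _ (-t) _)).trans (map_smul _ (-t) _))
    rw [continuation_eq_evalExt P f _ (by rwa [hb]), hb, hl, evalExt_of_mem hp,
      evalAt_flow_odd_flow P f p.log.2 ⟨p.body, hp⟩ X α.2, map_add, map_smul,
      continuation_eq P _ p hp, continuation_eq P _ p hp, smul_eq_mul]
  rw [e]
  simpa using ((hasDerivAt_id (0 : 𝕜)).mul_const
    (l (α * continuation P (rightAct P U (0, X) f) p))).const_add (l (continuation P f p))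

end BerezinRight

/-! ### A superfunction is determined by its continuation -/

section Generic

variable {𝕜 : Type*} [RCLike 𝕜]

/-- If `φ` misses the direction `w`, then multiplication by `w` is injective on the image of `Λφ`. -/
theorem ι_mul_map_injective {M W : Type*} [AddCommGroup M] [Module 𝕜 M] [AddCommGroup W] [Module 𝕜 W]
    {φ : M →ₗ[𝕜] W} {ψ : W →ₗ[𝕜] M} (hψ : ψ ∘ₗ φ = LinearMap.id) {d : Module.Dual 𝕜 W} {w : W}
    (hd : d ∘ₗ φ = 0) (hw : d w = 1) {a : ExteriorAlgebra 𝕜 M}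
    (ha : ι 𝕜 w * ExteriorAlgebra.map φ a = 0) : a = 0 := by
  have hc : ∀ b : ExteriorAlgebra 𝕜 M,
      CliffordAlgebra.contractLeft (Q := (0 : QuadraticForm 𝕜 W)) d (ExteriorAlgebra.map φ b) = 0 := by
    intro b
    induction b using ext_left_induction with
    | algebraMap r =>
      rw [AlgHom.commutes]
      exact CliffordAlgebra.contractLeft_algebraMap _ d r
    | add x y hx hy => rw [map_add, map_add, hx, hy, add_zero]
    | ι_mul x v hx =>
      rw [map_mul, ExteriorAlgebra.map_apply_ι]
      refine (CliffordAlgebra.contractLeft_ι_mul d (φ v) _).trans ?_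
      rw [hx, mul_zero, sub_zero, show d (φ v) = 0 from LinearMap.congr_fun hd v, zero_smul]
  have h := congrArg (CliffordAlgebra.contractLeft (Q := (0 : QuadraticForm 𝕜 W)) d) ha
  have h2 := (CliffordAlgebra.contractLeft_ι_mul d w (ExteriorAlgebra.map φ a)).symm.trans h
  rw [hc, mul_zero, sub_zero, hw, one_smul, map_zero] at h2
  have h3 := congrArg (ExteriorAlgebra.map ψ) h2
  rw [map_zero, ← AlgHom.comp_apply, ExteriorAlgebra.map_comp_map, hψ, ExteriorAlgebra.map_id] at h3
  exact h3

end Generic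

section Separation

variable {𝕜 : Type*} [RCLike 𝕜] {E : Type*} [NormedAddCommGroup E] [NormedSpace 𝕜 E]
  [FiniteDimensional 𝕜 E] {V : Type*} [AddCommGroup V] [Module 𝕜 V] [FiniteDimensional 𝕜 V]
  {G : Type*} [TopologicalSpace G] [ChartedSpace E G] [Group G] [LieGroup 𝓘(𝕜, E) ∞ G]
  (P : HCSuperpair 𝕜 E V G)

variable (𝕜 V) in
/-- The embedding of `𝔤₁*` into a space of generators with one generator to spare. -/
def genericGen : Module.Dual 𝕜 V →ₗ[𝕜] (Fin (Module.finrank 𝕜 V + 1) → 𝕜) :=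
  ∑ i, (LinearMap.applyₗ (R := 𝕜) (finBasis 𝕜 V i)).smulRight (Pi.single i.castSucc 1)

theorem genericGen_apply (α : Module.Dual 𝕜 V) : genericGen 𝕜 V α =
    ∑ i, α (finBasis 𝕜 V i) • (Pi.single i.castSucc 1 : Fin (Module.finrank 𝕜 V + 1) → 𝕜) := by
  simp [genericGen]

theorem genericGen_castSucc (α : Module.Dual 𝕜 V) (i : Fin (Module.finrank 𝕜 V)) :
    genericGen 𝕜 V α i.castSucc = α (finBasis 𝕜 V i) := by
  rw [genericGen_apply, Finset.sum_apply, Finset.sum_eq_single i]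
  · simp
  · intro j _ hj
    simp [hj.symm]
  · simp

theorem genericGen_last (α : Module.Dual 𝕜 V) : genericGen 𝕜 V α (Fin.last _) = 0 := by
  rw [genericGen_apply, Finset.sum_apply]
  exact Finset.sum_eq_zero fun i _ => by simp [(Fin.castSucc_lt_last i).ne']

variable (𝕜 V) in
/-- The point of `Λ₁ ⊗ 𝔤₁` whose coefficients are independent generators. -/
def genericOdd : oddSoul 𝕜 V (Module.finrank 𝕜 V + 1) :=
  ⟨∑ i, ι 𝕜 (Pi.single (Fin.castSucc i) 1) ⊗ₜ finBasis 𝕜 V i,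
    Submodule.sum_mem _ fun _ _ => Submodule.apply_mem_map₂ _ (ι_mem_extParity _) trivial⟩

theorem oddSubst_genericOdd :
    oddSubst (genericOdd 𝕜 V) = ExteriorAlgebra.map (genericGen 𝕜 V) := by
  refine ExteriorAlgebra.hom_ext (LinearMap.ext fun α => ?_)
  change oddSubst (genericOdd 𝕜 V) (ι 𝕜 α) =
    ExteriorAlgebra.map (genericGen 𝕜 V) (ι 𝕜 α)
  rw [oddSubst, ExteriorAlgebra.lift_ι_apply, ExteriorAlgebra.map_apply_ι, genericGen_apply, map_sum]
  simp [genericOdd, oddPairing, map_sum]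

variable (𝕜 V) in
/-- The generator to spare, as an odd parameter. -/
def spareGen : extParity 𝕜 (Fin (Module.finrank 𝕜 V + 1) → 𝕜) 1 :=
  ⟨ι 𝕜 (Pi.single (Fin.last _) 1), ι_mem_extParity _⟩

/-- A superfunction vanishes if its continuation, multiplied by an independent odd parameter, vanishes at
the points with generic odd coordinates. -/
theorem eq_zero_of_spareGen_mul_continuation {U : Opens G} {f : Superfun 𝕜 E V U}
    (h : ∀ p : GrPoint P (Module.finrank 𝕜 V + 1), p.body ∈ U →
      (spareGen 𝕜 V : Gr 𝕜 (Module.finrank 𝕜 V + 1)) * continuation P f p = 0) : f = 0 := by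
  have hinj : LinearMap.ker (genericGen 𝕜 V) = ⊥ := LinearMap.ker_eq_bot'.mpr fun α hα =>
    (finBasis 𝕜 V).ext fun i => by
      rw [← genericGen_castSucc, hα]; rfl
  obtain ⟨ψ, hψ⟩ := LinearMap.exists_leftInverse_of_injective _ hinj
  refine eq_zero_of_evalAt fun g => ?_
  have hg := h (GrPoint.mk (g : G) ⟨_, oddSoul_map_mem (E := E) (G := G) (genericOdd 𝕜 V).2⟩) g.2
  rw [continuation_eq P f _ g.2, contSection, bodySection_flow_odd
    (leftOp_isRadial (D := leftDer U) P.isLieSuper) (oddSubst_extInvol (genericOdd 𝕜 V))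
    (soul_le_extFil (oddSoul_map_mem (genericOdd 𝕜 V).2)) (rTensor_oddSubst_oddGen (genericOdd 𝕜 V)),
    evalAt_lTensor, oddSubst_genericOdd] at hg
  exact ι_mul_map_injective hψ (d := LinearMap.proj (Fin.last _))
    (LinearMap.ext genericGen_last) (by simp) hg

theorem continuation_sub {m : ℕ} {U : Opens G} (f f' : Superfun 𝕜 E V U) (p : GrPoint P m)
    (hp : p.body ∈ U) : continuation P (f - f') p = continuation P f p - continuation P f' p := by
  rw [continuation_eq P _ p hp, continuation_eq P _ p hp, continuation_eq P _ p hp, contSection,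
    contSection, contSection, tmul_sub, map_sub, map_sub, map_sub]

theorem eq_of_spareGen_mul_continuation {U : Opens G} {f f' : Superfun 𝕜 E V U}
    (h : ∀ p : GrPoint P (Module.finrank 𝕜 V + 1), p.body ∈ U → ∀ l : Module.Dual 𝕜 (Gr 𝕜 _),
      l ((spareGen 𝕜 V : Gr 𝕜 (Module.finrank 𝕜 V + 1)) * continuation P f p) =
        l ((spareGen 𝕜 V : Gr 𝕜 (Module.finrank 𝕜 V + 1)) * continuation P f' p)) : f = f' := by
  refine sub_eq_zero.mp (eq_zero_of_spareGen_mul_continuation P fun p hp => ?_)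
  rw [continuation_sub P f f' p hp, mul_sub, sub_eq_zero, ← sub_eq_zero,
    ← Module.forall_dual_apply_eq_zero_iff 𝕜]
  intro l
  rw [map_sub, h p hp l, sub_self]

/-- The action is determined by the left-invariant construction. -/
theorem SheafAction.IsBerezinLeft.unique {ρ ρ' : SheafAction P} (h : ρ.IsBerezinLeft)
    (h' : ρ'.IsBerezinLeft) : ρ = ρ' := by
  have key : ρ.op = ρ'.op := by
    funext U
    refine LinearMap.prod_ext (LinearMap.ext fun X => LinearMap.ext fun f => ?_)
      (LinearMap.ext fun v => LinearMap.ext fun f => ?_)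
    · refine eq_of_spareGen_mul_continuation P fun p hp l => ?_
      exact ((h.even _ U f p hp X (l ∘ₗ mulLeft 𝕜 _)).2).symm.trans
        (h'.even _ U f p hp X (l ∘ₗ mulLeft 𝕜 _)).2
    · exact eq_of_spareGen_mul_continuation P fun p hp l =>
        (h.odd _ U f p hp v (spareGen 𝕜 V) l).unique (h'.odd _ U f p hp v (spareGen 𝕜 V) l)
  cases ρ; cases ρ'
  cases key
  rfl

/-- The action is determined by the right-invariant construction. -/
theorem SheafAction.IsBerezinRight.unique {ρ ρ' : SheafAction P} (h : ρ.IsBerezinRight)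
    (h' : ρ'.IsBerezinRight) : ρ = ρ' := by
  have key : ρ.op = ρ'.op := by
    funext U
    refine LinearMap.prod_ext (LinearMap.ext fun X => LinearMap.ext fun f => ?_)
      (LinearMap.ext fun v => LinearMap.ext fun f => ?_)
    · refine eq_of_spareGen_mul_continuation P fun p hp l => ?_
      exact ((h.even _ U f p hp X (l ∘ₗ mulLeft 𝕜 _)).2).symm.trans
        (h'.even _ U f p hp X (l ∘ₗ mulLeft 𝕜 _)).2
    · exact eq_of_spareGen_mul_continuation P fun p hp l =>
        (h.odd _ U f p hp v (spareGen 𝕜 V) l).unique (h'.odd _ U f p hp v (spareGen 𝕜 V) l)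
  cases ρ; cases ρ'
  cases key
  rfl

end Separation

/-! ### Naturality of the invariant vector fields -/

section Naturality

variable {𝕜 : Type*} [RCLike 𝕜] {L V L' V' : Type*} [AddCommGroup L] [Module 𝕜 L] [AddCommGroup V]
  [Module 𝕜 V] [AddCommGroup L'] [Module 𝕜 L'] [AddCommGroup V'] [Module 𝕜 V']

/-- The transport `Λ(φ⁻¹)*` of forms along an isomorphism `φ`. -/
def formMap (φ₁ : V ≃ₗ[𝕜] V') :
    Λ*[𝕜] V →ₐ[𝕜] Λ*[𝕜] V' :=
  ExteriorAlgebra.map (φ₁.symm : V' →ₗ[𝕜] V).dualMap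

theorem formMap_ι (φ₁ : V ≃ₗ[𝕜] V') (α : Module.Dual 𝕜 V) :
    formMap φ₁ (ι 𝕜 α) = ι 𝕜 (α ∘ₗ (φ₁.symm : V' →ₗ[𝕜] V)) :=
  ExteriorAlgebra.map_apply_ι _ _

theorem formMap_extInvol (φ₁ : V ≃ₗ[𝕜] V') (a : Λ*[𝕜] V) :
    formMap φ₁ (extInvol 𝕜 _ a) = extInvol 𝕜 _ (formMap φ₁ a) := by
  have h : (formMap φ₁).comp (extInvol 𝕜 _) = (extInvol 𝕜 _).comp (formMap φ₁) := by
    refine ExteriorAlgebra.hom_ext (LinearMap.ext fun α => ?_)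
    change formMap φ₁ (extInvol 𝕜 _ (ι 𝕜 α)) =
      extInvol 𝕜 _ (formMap φ₁ (ι 𝕜 α))
    simp only [extInvol_ι, map_neg, formMap_ι]
  exact AlgHom.congr_fun h a

theorem formMap_extContract (φ₁ : V ≃ₗ[𝕜] V') (v : V) (a : Λ*[𝕜] V) :
    formMap φ₁ (extContract (Module.Dual.eval 𝕜 V v) a) =
      extContract (Module.Dual.eval 𝕜 V' (φ₁ v)) (formMap φ₁ a) := by
  induction a using ext_left_induction with
  | algebraMap r => simp only [extContract_algebraMap, AlgHom.commutes, map_zero]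
  | add x y hx hy => simp only [map_add, hx, hy]
  | ι_mul x α hx =>
    simp only [extContract_ι_mul, map_sub, map_mul, hx, formMap_ι, map_smul]
    simp

/-- The transport of `ΛV* ⊗ 𝔤` along a morphism which is an isomorphism in the odd directions. -/
abbrev envMap (φ₀ : L →ₗ[𝕜] L') (φ₁ : V ≃ₗ[𝕜] V') :
    Λ*[𝕜] V ⊗[𝕜] (L × V) →ₗ[𝕜]
      Λ*[𝕜] V' ⊗[𝕜] (L' × V') :=
  TensorProduct.map (formMap φ₁).toLinearMap (φ₀.prodMap (φ₁ : V →ₗ[𝕜] V'))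

variable {φ₀ : L →ₗ[𝕜] L'} {φ₁ : V ≃ₗ[𝕜] V'}

theorem envMap_even (a : Λ*[𝕜] V) (X : L) :
    envMap φ₀ φ₁ (a ⊗ₜ (X, 0)) = formMap φ₁ a ⊗ₜ (φ₀ X, 0) := by
  rw [map_tmul]
  simp

theorem envMap_odd (a : Λ*[𝕜] V) (v : V) :
    envMap φ₀ φ₁ (a ⊗ₜ (0, v)) = formMap φ₁ a ⊗ₜ (0, φ₁ v) := by
  rw [map_tmul]
  simp

theorem envMap_evenPart (z : Λ*[𝕜] V ⊗[𝕜] (L × V)) :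
    envMap φ₀ φ₁ (evenPart z) = evenPart (envMap φ₀ φ₁ z) :=
  env_ext (f := envMap φ₀ φ₁ ∘ₗ evenPart) (g := evenPart ∘ₗ envMap φ₀ φ₁)
    (fun a X => by
      simp only [comp_apply, evenPart_even, envMap_even])
    (fun a v => by
      simp only [comp_apply, evenPart_odd, envMap_odd, map_zero]) z

theorem envMap_oddPart (z : Λ*[𝕜] V ⊗[𝕜] (L × V)) :
    envMap φ₀ φ₁ (oddPart z) = oddPart (envMap φ₀ φ₁ z) :=
  env_ext (f := envMap φ₀ φ₁ ∘ₗ oddPart) (g := oddPart ∘ₗ envMap φ₀ φ₁)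
    (fun a X => by
      simp only [comp_apply, oddPart_even, envMap_even, map_zero])
    (fun a v => by
      simp only [comp_apply, oddPart_odd, envMap_odd]) z

variable [FiniteDimensional 𝕜 V] [FiniteDimensional 𝕜 V']

/-- The canonical odd element does not depend on the choice of a basis. -/
theorem envMap_oddGen : envMap φ₀ φ₁ (oddGen 𝕜 L V) = oddGen 𝕜 L' V' := by
  have h1 : ∀ k, formMap φ₁ (ι 𝕜 ((finBasis 𝕜 V').coord k ∘ₗ (φ₁ : V →ₗ[𝕜] V'))) =
      ι 𝕜 ((finBasis 𝕜 V').coord k) := fun k => by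
    simp only [formMap_ι, LinearMap.comp_assoc, LinearEquiv.comp_symm, LinearMap.comp_id]
  have h2 : ∀ i, ((0, φ₁ (finBasis 𝕜 V i)) : L' × V') =
      ∑ k, (finBasis 𝕜 V').coord k (φ₁ (finBasis 𝕜 V i)) •
        ((0, finBasis 𝕜 V' k) : L' × V') := fun i => by
    have h := congrArg (inr 𝕜 L' V') ((finBasis 𝕜 V').sum_repr (φ₁ (finBasis 𝕜 V i)))
    rw [map_sum] at h
    rw [← LinearMap.inr_apply (R := 𝕜), ← h]
    exact Finset.sum_congr rfl fun k _ => map_smul _ _ _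
  rw [oddGen, map_sum]
  simp only [envMap_odd]
  rw [oddGen]
  have h3 : ∀ k, ∑ i, (finBasis 𝕜 V').coord k (φ₁ (finBasis 𝕜 V i)) •
      formMap φ₁ (ι 𝕜 ((finBasis 𝕜 V).coord i)) =
        ι 𝕜 ((finBasis 𝕜 V').coord k) := fun k => by
    rw [← h1, ← sum_apply_smul_ι, map_sum]
    exact Finset.sum_congr rfl fun i _ => (map_smul _ _ _).symm
  simp only [← h3, sum_tmul]
  rw [Finset.sum_comm]
  refine Finset.sum_congr rfl fun i _ => ?_
  rw [h2, tmul_sum]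
  exact Finset.sum_congr rfl fun k _ => by rw [tmul_smul, smul_tmul']

variable {br : Bil[𝕜] (L × V)} {br' : (L' × V') →ₗ[𝕜] (L' × V') →ₗ[𝕜] (L' × V')}
  (hbr : ∀ X Y, φ₀.prodMap (φ₁ : V →ₗ[𝕜] V') (br X Y) =
    br' (φ₀.prodMap (φ₁ : V →ₗ[𝕜] V') X) (φ₀.prodMap (φ₁ : V →ₗ[𝕜] V') Y))

include hbr

theorem envMap_adGen (z : Λ*[𝕜] V ⊗[𝕜] (L × V)) :
    adGen br' (envMap φ₀ φ₁ z) = envMap φ₀ φ₁ (adGen br z) := by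
  simp only [adGen, ← envMap_oddGen (φ₀ := φ₀) (φ₁ := φ₁)]
  exact (superAct_natural (formMap_extInvol φ₁) hbr _ z).symm

theorem envMap_logDiff (z : Λ*[𝕜] V ⊗[𝕜] (L × V)) :
    logDiff br' (envMap φ₀ φ₁ z) = envMap φ₀ φ₁ (logDiff br z) := by
  change evenPart (envMap φ₀ φ₁ z) + phiNil 𝕜 (adGen br') (oddPart (envMap φ₀ φ₁ z)) =
    envMap φ₀ φ₁ (evenPart z + phiNil 𝕜 (adGen br) (oddPart z))
  simp only [map_add, envMap_evenPart, ← envMap_oddPart,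
    phiNil_intertwine (isNilpotent_adGen (br := br)) (isNilpotent_adGen (br := br')) (envMap_adGen hbr)]

theorem envMap_logDiffInv (z : Λ*[𝕜] V ⊗[𝕜] (L × V)) :
    logDiffInv br' (envMap φ₀ φ₁ z) = envMap φ₀ φ₁ (logDiffInv br z) := by
  conv_lhs => rw [← logDiff_logDiffInv (br := br) z, ← envMap_logDiff hbr, logDiffInv_logDiff]

theorem envMap_leftCoeff (X : L × V) : leftCoeff br' (φ₀.prodMap (φ₁ : V →ₗ[𝕜] V') X) =
    envMap φ₀ φ₁ (leftCoeff br X) := by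
  have h : (1 : Λ*[𝕜] V') ⊗ₜ[𝕜] φ₀.prodMap (φ₁ : V →ₗ[𝕜] V') X =
      envMap φ₀ φ₁ (1 ⊗ₜ X) := by
    simp only [map_tmul, AlgHom.toLinearMap_apply, map_one]
  change logDiffInv br' (expNil 𝕜 (adGen br') (1 ⊗ₜ _)) = envMap φ₀ φ₁ (logDiffInv br (expNil 𝕜 (adGen br) (1 ⊗ₜ X)))
  simp only [h,
    expNil_intertwine (isNilpotent_adGen (br := br)) (isNilpotent_adGen (br := br')) (envMap_adGen hbr),
    envMap_logDiffInv hbr]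

theorem envMap_rightCoeff (X : L × V) : rightCoeff br' (φ₀.prodMap (φ₁ : V →ₗ[𝕜] V') X) =
    envMap φ₀ φ₁ (rightCoeff br X) := by
  have h : (1 : Λ*[𝕜] V') ⊗ₜ[𝕜] φ₀.prodMap (φ₁ : V →ₗ[𝕜] V') X =
      envMap φ₀ φ₁ (1 ⊗ₜ X) := by
    simp only [map_tmul, AlgHom.toLinearMap_apply, map_one]
  change logDiffInv br' (1 ⊗ₜ _) = envMap φ₀ φ₁ (logDiffInv br (1 ⊗ₜ X))
  rw [h, envMap_logDiffInv hbr]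

omit hbr

variable {F F' : Type*} [CommRing F] [Algebra 𝕜 F] [CommRing F'] [Algebra 𝕜 F']
  {D : L →ₗ[𝕜] Module.End 𝕜 F} {D' : L' →ₗ[𝕜] Module.End 𝕜 F'} {j : F →ₐ[𝕜] F'}
  (hj : ∀ X f, D' (φ₀ X) (j f) = j (D X f))

/-- The transport of sections of `F ⊗ ΛV*`. -/
abbrev sectionMap (j : F →ₐ[𝕜] F') (φ₁ : V ≃ₗ[𝕜] V') :
    F ⊗[𝕜] Λ*[𝕜] V →ₐ[𝕜] F' ⊗[𝕜] Λ*[𝕜] V' :=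
  Algebra.TensorProduct.map j (formMap φ₁)

include hj

omit [FiniteDimensional 𝕜 V] [FiniteDimensional 𝕜 V'] in
theorem fieldOp_envMap (z : Λ*[𝕜] V ⊗[𝕜] (L × V))
    (s : F ⊗[𝕜] Λ*[𝕜] V) :
    fieldOp V' D' (envMap φ₀ φ₁ z) (sectionMap j φ₁ s) = sectionMap j φ₁ (fieldOp V D z s) := by
  induction s with
  | zero => simp only [map_zero]
  | add s t hs ht => simp only [map_add, hs, ht]
  | tmul f c =>
    rw [Algebra.TensorProduct.map_tmul]
    induction z using env_induction with
    | zero => simp only [map_zero, LinearMap.zero_apply]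
    | add x y hx hy => simp only [map_add, LinearMap.add_apply, hx, hy]
    | even a X =>
      simp only [envMap_even, fieldOp_even, Algebra.TensorProduct.map_tmul, hj, map_mul]
    | odd a v =>
      simp only [envMap_odd, fieldOp_odd, Algebra.TensorProduct.map_tmul, oddField_tmul, map_mul,
        formMap_extContract]

include hbr

theorem leftOp_sectionMap (X : L × V) (s : F ⊗[𝕜] Λ*[𝕜] V) :
    leftOp br' D' (φ₀.prodMap (φ₁ : V →ₗ[𝕜] V') X) (sectionMap j φ₁ s) =
      sectionMap j φ₁ (leftOp br D X s) := by
  simp only [leftOp_apply, envMap_leftCoeff hbr, fieldOp_envMap hj]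

theorem rightField_sectionMap (t : F ⊗[𝕜] (L × V)) (s : F ⊗[𝕜] Λ*[𝕜] V) :
    rightField br' D' (TensorProduct.map j.toLinearMap (φ₀.prodMap (φ₁ : V →ₗ[𝕜] V')) t)
      (sectionMap j φ₁ s) = sectionMap j φ₁ (rightField br D t s) := by
  induction t with
  | zero => simp only [map_zero, LinearMap.zero_apply]
  | add x y hx hy => simp only [map_add, LinearMap.add_apply, hx, hy]
  | tmul f Z =>
    simp only [map_tmul, AlgHom.toLinearMap_apply, rightField_tmul,
      envMap_rightCoeff hbr, fieldOp_envMap hj, map_mul, Algebra.TensorProduct.map_tmul, map_one]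

theorem rightOp_sectionMap {α : (L × V) →ₗ[𝕜] F ⊗[𝕜] (L × V)} {α' : (L' × V') →ₗ[𝕜] F' ⊗[𝕜] (L' × V')}
    {X : L × V} (hα : α' (φ₀.prodMap (φ₁ : V →ₗ[𝕜] V') X) =
      TensorProduct.map j.toLinearMap (φ₀.prodMap (φ₁ : V →ₗ[𝕜] V')) (α X))
    (s : F ⊗[𝕜] Λ*[𝕜] V) :
    rightOp br' D' α' (φ₀.prodMap (φ₁ : V →ₗ[𝕜] V') X) (sectionMap j φ₁ s) =
      sectionMap j φ₁ (rightOp br D α X s) := by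
  simp only [rightOp_apply, hα, rightField_sectionMap hbr hj, map_neg]

end Naturality

/-! ### The Lie supergroup of a superpair -/

section Supergroup

variable {𝕜 : Type*} [RCLike 𝕜] {E : Type*} [NormedAddCommGroup E] [NormedSpace 𝕜 E]
  {V : Type*} [AddCommGroup V] [Module 𝕜 V]
  {G : Type*} [TopologicalSpace G] [ChartedSpace E G]

/-- Restriction of numerical functions, as a homomorphism of algebras. -/
def resHom {U W : Opens G} (h : U ≤ W) : NumFun 𝕜 E W →ₐ[𝕜] NumFun 𝕜 E U :=
  AlgHom.ofLinearMap (NumFun.res h) rfl fun _ _ => rfl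

theorem formMap_refl : formMap (LinearEquiv.refl 𝕜 V) = AlgHom.id 𝕜 _ :=
  ExteriorAlgebra.map_id

theorem sectionMap_resHom {U W : Opens G} (h : U ≤ W) (f : Superfun 𝕜 E V W) :
    sectionMap (resHom h) (LinearEquiv.refl 𝕜 V) f = Superfun.res h f := by
  induction f using TensorProduct.induction_on with
  | zero => simp only [map_zero]
  | add s t hs ht => simp only [map_add, hs, ht]
  | tmul f a => rw [Algebra.TensorProduct.map_tmul, formMap_refl]; rfl

variable [FiniteDimensional 𝕜 V] [Group G] [LieGroup 𝓘(𝕜, E) ∞ G] (P : HCSuperpair 𝕜 E V G)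

theorem leftOp_res {U W : Opens G} (h : U ≤ W) (X : SuperSpace 𝕜 E V G) (f : Superfun 𝕜 E V W) :
    Superfun.res h (leftOp P.bracket (leftDer W) X f) =
      leftOp P.bracket (leftDer U) X (Superfun.res h f) := by
  rw [← sectionMap_resHom, ← sectionMap_resHom]
  exact (leftOp_sectionMap (𝕜 := 𝕜) (F := NumFun 𝕜 E W) (F' := NumFun 𝕜 E U) (φ₀ := LinearMap.id)
    (φ₁ := LinearEquiv.refl 𝕜 V) (D := leftDer W) (D' := leftDer U) (fun _ _ => rfl) (j := resHom h)
    (leftDer_res h) X f).symm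

variable [FiniteDimensional 𝕜 E]

theorem adFrame_res {U W : Opens G} (h : U ≤ W) (X : SuperSpace 𝕜 E V G) :
    adFrame P U X = TensorProduct.map (resHom h).toLinearMap LinearMap.id (adFrame P W X) := by
  rw [adFrame_apply, adFrame_apply, map_sum]
  rfl

theorem rightAct_res {U W : Opens G} (h : U ≤ W) (X : SuperSpace 𝕜 E V G) (f : Superfun 𝕜 E V W) :
    Superfun.res h (rightAct P W X f) = rightAct P U X (Superfun.res h f) := by
  rw [← sectionMap_resHom, ← sectionMap_resHom]
  exact (rightOp_sectionMap (𝕜 := 𝕜) (F := NumFun 𝕜 E W) (F' := NumFun 𝕜 E U) (φ₀ := LinearMap.id)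
    (φ₁ := LinearEquiv.refl 𝕜 V) (D := leftDer W) (D' := leftDer U) (fun _ _ => rfl) (j := resHom h)
    (leftDer_res h) (adFrame_res P h X) f).symm

/-- The left-invariant action of `𝔤` on the sheaf of superfunctions. -/
def leftSheafAction : SheafAction P where
  op U := leftOp P.bracket (leftDer U)
  op_res h X f := leftOp_res P h X f

/-- The right-invariant action of `𝔤` on the sheaf of superfunctions. -/
def rightSheafAction : SheafAction P where
  op U := rightAct P U
  op_res h X f := rightAct_res P h X f

theorem leftSheafAction_isBerezinLeft : (leftSheafAction P).IsBerezinLeft where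
  even _ _ f p hp X l := leftOp_berezin_even P f p hp X l
  odd _ _ f p hp X α l := leftOp_berezin_odd P f p hp X α l

theorem rightSheafAction_isBerezinRight : (rightSheafAction P).IsBerezinRight where
  even _ _ f p hp X l := rightAct_berezin_even P f p hp X l
  odd _ _ f p hp X α l := rightAct_berezin_odd P f p hp X α l

theorem leftSheafAction_isSuperRep : (leftSheafAction P).IsSuperRep where
  map_bracket U i j X hX Y hY := LinearMap.ext fun s =>
    eq_sub_of_add_eq (leftOp_isSuperRepOn_leftDer P U i j X hX Y hY s).symm
  parity _ _ _ _ hX _ hf := leftOp_mem P.isLieSuper hX hf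
  leibniz _ _ _ _ hX _ hf f' := leftOp_mul P.isLieSuper leftDer_mul hX hf f'

theorem rightSheafAction_isSuperRep : (rightSheafAction P).IsSuperRep where
  map_bracket U i j X hX Y hY := LinearMap.ext fun s =>
    eq_sub_of_add_eq ((isRightFrame P U).rightOp_isSuperRepOn i j X hX Y hY s).symm
  parity U _ _ _ hX _ hf := (isRightFrame P U).rightOp_mem hX hf
  leibniz U _ _ _ hX _ hf f' := (isRightFrame P U).rightOp_mul hX hf f'

end Supergroup

section Constants

variable {𝕜 : Type*} [RCLike 𝕜] {L V : Type*} [AddCommGroup L] [Module 𝕜 L] [AddCommGroup V]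
  [Module 𝕜 V] {F : Type*} [CommRing F] [Algebra 𝕜 F] {D : L →ₗ[𝕜] Module.End 𝕜 F} {f : F}

theorem fieldOp_tmul_one_eq_zero (hf : ∀ X, D X f = 0)
    (z : Λ*[𝕜] V ⊗[𝕜] (L × V)) : fieldOp V D z (f ⊗ₜ 1) = 0 := by
  induction z using env_induction with
  | zero => rw [map_zero, LinearMap.zero_apply]
  | add x y hx hy => rw [map_add, LinearMap.add_apply, hx, hy, add_zero]
  | even a X => rw [fieldOp_even, hf, zero_tmul]
  | odd a v => rw [fieldOp_odd, oddField_tmul, extContract_one, mul_zero, tmul_zero]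

variable [FiniteDimensional 𝕜 V] {br : Bil[𝕜] (L × V)}

theorem leftOp_tmul_one_eq_zero (hf : ∀ X, D X f = 0) (X : L × V) :
    leftOp br D X (f ⊗ₜ 1) = 0 :=
  fieldOp_tmul_one_eq_zero hf _

theorem rightField_tmul_one_eq_zero (hf : ∀ X, D X f = 0) (t : F ⊗[𝕜] (L × V)) :
    rightField br D t (f ⊗ₜ 1) = 0 := by
  induction t with
  | zero => rw [map_zero, LinearMap.zero_apply]
  | add x y hx hy => rw [map_add, LinearMap.add_apply, hx, hy, add_zero]
  | tmul c Z => rw [rightField_tmul, fieldOp_tmul_one_eq_zero hf, mul_zero]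

theorem rightField_even_tmul_one_eq {t : F ⊗[𝕜] (L × V)} (ht : t ∈ coeffParity 𝕜 L V F 0) (f : F) :
    rightField br D t (f ⊗ₜ 1) = bodyMap (rightField br D t (f ⊗ₜ 1)) ⊗ₜ 1 := by
  refine coeffParity_induction (motive := fun t =>
    rightField br D t (f ⊗ₜ 1) = bodyMap (rightField br D t (f ⊗ₜ 1)) ⊗ₜ 1) ?_
    (fun x y hx hy => ?_) (fun c x hx => ?_) (fun g Z hZ => ?_) ht
  · rw [map_zero, LinearMap.zero_apply, map_zero, zero_tmul]
  · rw [map_add, LinearMap.add_apply, map_add, add_tmul, ← hx, ← hy]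
  · rw [map_smul, LinearMap.smul_apply, map_smul]
    exact (congrArg (c • ·) hx).trans (smul_tmul' c _ _)
  · obtain ⟨Z, rfl⟩ : Z ∈ LinearMap.range (inl 𝕜 L V) := hZ
    rw [LinearMap.inl_apply, rightField_even_tmul_one, bodyMap_tmul, map_one, one_smul]

end Constants

section Supergroup

variable {𝕜 : Type*} [RCLike 𝕜] {E : Type*} [NormedAddCommGroup E] [NormedSpace 𝕜 E]
  [FiniteDimensional 𝕜 E] {V : Type*} [AddCommGroup V] [Module 𝕜 V] [FiniteDimensional 𝕜 V]
  {G : Type*} [TopologicalSpace G] [ChartedSpace E G] [Group G] [LieGroup 𝓘(𝕜, E) ∞ G]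
  (P : HCSuperpair 𝕜 E V G)

omit [FiniteDimensional 𝕜 E] in
theorem leftSheafAction_isDefinite : (leftSheafAction P).IsDefinite := by
  intro U f
  constructor
  · intro h
    have h' : ∀ X, leftOp P.bracket (leftDer U) X f = 0 := h
    have h3 := eq_tmul_one_of_leftOp_eq_zero (br := P.bracket) (F := NumFun 𝕜 E U) (D := leftDer U) (s := f)
      P.isLieSuper h'
    exact ⟨bodyMap f, (isLocallyConstant_iff_leftDer _).mpr h3.2, h3.1⟩
  · rintro ⟨c, hc, rfl⟩ X
    exact leftOp_tmul_one_eq_zero ((isLocallyConstant_iff_leftDer c).mp hc) X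

theorem rightSheafAction_isDefinite : (rightSheafAction P).IsDefinite := by
  intro U f
  constructor
  · intro h
    obtain ⟨h1, h2⟩ := eq_tmul_one_of_rightOp_eq_zero (isRightFrame P U) h
    exact ⟨bodyMap f, (isLocallyConstant_iff_leftDer _).mpr h2, h1⟩
  · rintro ⟨c, hc, rfl⟩ X
    exact (congrArg Neg.neg (rightField_tmul_one_eq_zero
      ((isLocallyConstant_iff_leftDer c).mp hc) _)).trans neg_zero

theorem rightAct_even_tmul_one {U : Opens G} (X : Lie[𝕜, E] G) (f : NumFun 𝕜 E U) :
    rightAct P U (X, 0) (f ⊗ₜ 1) = rightDer U X f ⊗ₜ 1 := by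
  have h := bodyMap_rightAct_even P X (f ⊗ₜ[𝕜] (1 : Λ*[𝕜] V))
  rw [bodyMap_tmul, map_one, one_smul] at h
  rw [← h, rightOp_apply, map_neg, neg_tmul]
  exact congrArg Neg.neg (rightField_even_tmul_one_eq ((isRightFrame P U).mem 0 _ (inl_mem_homog X)) f)

/-- The RT Lie supergroup which is obtained from a Harish-Chandra superpair. -/
def superpairSupergroup : RTLieSupergroup P where
  left := ⟨leftSheafAction P, leftSheafAction_isSuperRep P,
    fun _ X f => leftOp_even_tmul_one P.isLieSuper X f, leftSheafAction_isDefinite P⟩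
  right := ⟨rightSheafAction P, rightSheafAction_isSuperRep P,
    fun _ X f => rightAct_even_tmul_one P X f, rightSheafAction_isDefinite P⟩
  bilateral _ i j X hX Y hY := LinearMap.ext fun s => rightAct_leftOp P i j X hX Y hY s

theorem superpairSupergroup_isPlaned : (superpairSupergroup P).IsPlaned :=
  fun _ X α => leftOp_even_one_tmul_ι P.isLieSuper leftDer_mul X α

theorem superpairSupergroup_isBerezin : (superpairSupergroup P).IsBerezin :=
  ⟨leftSheafAction_isBerezinLeft P, rightSheafAction_isBerezinRight P⟩

end Supergroup

/-! ### Isomorphic superpairs have isomorphic Lie supergroups -/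

section FormMap

variable {𝕜 : Type*} [RCLike 𝕜] {V V' : Type*} [AddCommGroup V] [Module 𝕜 V] [AddCommGroup V'] [Module 𝕜 V']

theorem formMap_formMap_symm (φ : V ≃ₗ[𝕜] V') (a : Λ*[𝕜] V') :
    formMap φ (formMap φ.symm a) = a := by
  have h : (formMap φ).comp (formMap φ.symm) = AlgHom.id 𝕜 _ := by
    refine ExteriorAlgebra.hom_ext (LinearMap.ext fun α => ?_)
    change formMap φ (formMap φ.symm (ι 𝕜 α)) = ι 𝕜 α
    rw [formMap_ι, formMap_ι]
    exact congrArg _ (LinearMap.ext fun v => congrArg α (φ.apply_symm_apply v))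
  exact AlgHom.congr_fun h a

theorem formMap_bijective (φ : V ≃ₗ[𝕜] V') : Function.Bijective (formMap φ) :=
  Function.bijective_iff_has_inverse.mpr
    ⟨formMap φ.symm, formMap_formMap_symm φ.symm, formMap_formMap_symm φ⟩

end FormMap

section Isomorphism

variable {𝕜 : Type*} [RCLike 𝕜]
  {E : Type*} [NormedAddCommGroup E] [NormedSpace 𝕜 E]
  {V : Type*} [AddCommGroup V] [Module 𝕜 V]
  {G : Type*} [TopologicalSpace G] [ChartedSpace E G] [Group G] [LieGroup 𝓘(𝕜, E) ∞ G]
  {E' : Type*} [NormedAddCommGroup E'] [NormedSpace 𝕜 E']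
  {V' : Type*} [AddCommGroup V'] [Module 𝕜 V']
  {G' : Type*} [TopologicalSpace G'] [ChartedSpace E' G'] [Group G'] [LieGroup 𝓘(𝕜, E') ∞ G']
  {P : HCSuperpair 𝕜 E V G} {P' : HCSuperpair 𝕜 E' V' G'}

namespace HCIso

variable (e : HCIso P P')

/-- The isomorphism of Lie groups, as a continuous map. -/
def cont : C(G, G') := ⟨e.L, e.L_smooth.continuous⟩

/-- The pull-back of numerical functions, as a homomorphism of algebras. -/
def pullHom (W : Opens G') : NumFun 𝕜 E' W →ₐ[𝕜] NumFun 𝕜 E (Opens.comap e.cont W) :=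
  AlgHom.ofLinearMap
    { toFun := NumFun.pull e.cont e.L_smooth W
      map_add' := fun _ _ => rfl
      map_smul' := fun _ _ => rfl } rfl fun _ _ => rfl

theorem pullHom_apply (W : Opens G') (f : NumFun 𝕜 E' W) (x : Opens.comap e.cont W) :
    e.pullHom W f x = f ⟨e.L x, x.2⟩ := rfl

theorem pullHom_bijective (W : Opens G') : Function.Bijective (e.pullHom W) := by
  have hW : ∀ y : W, e.L.symm y ∈ Opens.comap e.cont W := fun y => by
    change e.L (e.L.symm y) ∈ W
    rw [e.L.apply_symm_apply]
    exact y.2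
  constructor
  · intro f f' h
    refine ContMDiffMap.ext fun y => ?_
    have h2 := congrArg (fun u : NumFun 𝕜 E (Opens.comap e.cont W) => u ⟨e.L.symm y, hW y⟩) h
    have hy : (⟨e.L (e.L.symm y), hW y⟩ : W) = y := Subtype.ext (e.L.apply_symm_apply y)
    simp only [pullHom_apply] at h2
    rwa [hy] at h2
  · intro f
    refine ⟨⟨fun y => f ⟨e.L.symm y, hW y⟩, f.contMDiff.comp ?_⟩, ContMDiffMap.ext fun x => ?_⟩
    · rw [← ContMDiff.subtypeVal_comp_iff]
      exact e.L_symm_smooth.comp contMDiff_subtype_val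
    · exact congrArg f (Subtype.ext (e.L.symm_apply_apply x))

/-- The even component of the isomorphism of Lie superalgebras. -/
def evenEquiv : Lie[𝕜, E] G ≃ₗ[𝕜] Lie[𝕜, E'] G' :=
  LinearEquiv.ofBijective e.ell.even e.even_bijective

/-- The odd component of the isomorphism of Lie superalgebras. -/
def oddEquiv : V ≃ₗ[𝕜] V' := LinearEquiv.ofBijective e.ell.odd e.odd_bijective

theorem leftDer_pullHom (W : Opens G') (X : Lie[𝕜, E] G) (f : NumFun 𝕜 E' W) :
    leftDer _ X (e.pullHom W f) = e.pullHom W (leftDer W (e.ell.even X) f) := by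
  refine ContMDiffMap.ext fun g => ?_
  rw [pullHom_apply, leftDer_apply, leftDer_apply, e.even_eq]
  have he : (fun h : G => extendZero (e.pullHom W f) ((g : G) * h)) =
      (fun h' : G' => extendZero f (e.L g * h')) ∘ e.L := by
    funext h
    rw [Function.comp_apply, ← map_mul]
    by_cases hm : e.L ((g : G) * h) ∈ W
    · rw [extendZero_apply _ hm, extendZero_apply _ (show (g : G) * h ∈ Opens.comap e.cont W from hm)]
      rfl
    · rw [extendZero, extendZero, dif_neg hm, dif_neg (show ¬(g : G) * h ∈ Opens.comap e.cont W from hm)]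
  have h1 : e.L 1 = 1 := map_one e.L
  have hu := mdifferentiableAt_extendZero_mul f (g := e.L g) g.2
  have hu' : MDifferentiableAt 𝓘(𝕜, E') 𝓘(𝕜, 𝕜) (fun h' : G' => extendZero f (e.L g * h')) (e.L 1) := by
    rwa [h1]
  have h2 := mfderiv_comp (1 : G) hu' (e.L_smooth.mdifferentiable (by simp) 1)
  rw [he]
  refine (congrArg (fun A : E →L[𝕜] 𝕜 => A X) h2).trans ?_
  have : ∀ (y : G') (w : E'), y = 1 →
      (mfderiv 𝓘(𝕜, E') 𝓘(𝕜, 𝕜) (fun h' : G' => extendZero f (e.L g * h')) y : E' →L[𝕜] 𝕜) w =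
      (mfderiv 𝓘(𝕜, E') 𝓘(𝕜, 𝕜) (fun h' : G' => extendZero f (e.L g * h')) 1 : E' →L[𝕜] 𝕜) w := by
    rintro y w rfl; rfl
  exact this _ _ h1

/-- The inverse of the even component, as a linear map. -/
abbrev evenInv : Lie[𝕜, E'] G' →ₗ[𝕜] Lie[𝕜, E] G := e.evenEquiv.symm

theorem evenInv_even (X : Lie[𝕜, E] G) : e.evenInv (e.ell.even X) = X :=
  e.evenEquiv.symm_apply_apply X

theorem even_evenInv (X : Lie[𝕜, E'] G') : e.ell.even (e.evenInv X) = X :=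
  e.evenEquiv.apply_symm_apply X

theorem oddEquiv_symm_odd (v : V) : e.oddEquiv.symm (e.ell.odd v) = v :=
  e.oddEquiv.symm_apply_apply v

theorem odd_oddEquiv_symm (v : V') : e.ell.odd (e.oddEquiv.symm v) = v :=
  e.oddEquiv.apply_symm_apply v

/-- The inverse of the isomorphism of Lie superalgebras. -/
abbrev ellInv : SuperSpace 𝕜 E' V' G' →ₗ[𝕜] SuperSpace 𝕜 E V G :=
  e.evenInv.prodMap (e.oddEquiv.symm : V' →ₗ[𝕜] V)

theorem ellInv_ell (X : SuperSpace 𝕜 E V G) : e.ellInv (e.ell.even.prodMap e.ell.odd X) = X :=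
  Prod.ext (e.evenInv_even X.1) (e.oddEquiv_symm_odd X.2)

theorem ell_ellInv (X : SuperSpace 𝕜 E' V' G') : e.ell.even.prodMap e.ell.odd (e.ellInv X) = X :=
  Prod.ext (e.even_evenInv X.1) (e.odd_oddEquiv_symm X.2)

theorem ellInv_bracket (X Y : SuperSpace 𝕜 E' V' G') :
    e.ellInv (P'.bracket X Y) = P.bracket (e.ellInv X) (e.ellInv Y) := by
  have h := e.ell.map_bracket (e.ellInv X) (e.ellInv Y)
  rw [ell_ellInv, ell_ellInv] at h
  rw [← h, ellInv_ell]

theorem leftDer_evenInv_pullHom (W : Opens G') (X : Lie[𝕜, E'] G') (f : NumFun 𝕜 E' W) :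
    leftDer _ (e.evenInv X) (e.pullHom W f) = e.pullHom W (leftDer W X f) := by
  rw [leftDer_pullHom, even_evenInv]

theorem evalAt_map_pullHom (W : Opens G') (t : NumFun 𝕜 E' W ⊗[𝕜] SuperSpace 𝕜 E' V' G')
    (g : Opens.comap e.cont W) :
    evalAt g (TensorProduct.map (e.pullHom W).toLinearMap e.ellInv t) =
      e.ellInv (evalAt (⟨e.L g, g.2⟩ : W) t) := by
  induction t with
  | zero => simp only [map_zero]
  | add x y hx hy => simp only [map_add, hx, hy]
  | tmul f Z =>
    rw [map_tmul, evalAt_tmul, evalAt_tmul, map_smul]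
    rfl

theorem adFrame_ellInv [FiniteDimensional 𝕜 E] [FiniteDimensional 𝕜 V] [FiniteDimensional 𝕜 E']
    [FiniteDimensional 𝕜 V'] (W : Opens G') (X : SuperSpace 𝕜 E' V' G') :
    adFrame P (Opens.comap e.cont W) (e.ellInv X) =
      TensorProduct.map (e.pullHom W).toLinearMap e.ellInv (adFrame P' W X) := by
  refine sub_eq_zero.mp (eq_zero_of_evalAt fun g => ?_)
  rw [map_sub, evalAt_adFrame, evalAt_map_pullHom, evalAt_adFrame, sub_eq_zero]
  have h := e.map_Ad (g : G)⁻¹ (e.ellInv X)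
  rw [ell_ellInv, map_inv e.L] at h
  exact (e.ellInv_ell _).symm.trans (congrArg e.ellInv h)

/-- The pull-back of superfunctions. -/
abbrev superPull (W : Opens G') :
    Superfun 𝕜 E' V' W →ₐ[𝕜] Superfun 𝕜 E V (Opens.comap e.cont W) :=
  sectionMap (e.pullHom W) e.oddEquiv.symm

theorem superPull_bijective (W : Opens G') : Function.Bijective (e.superPull W) :=
  Algebra.TensorProduct.map_bijective (e.pullHom_bijective W) (formMap_bijective _)

theorem superPull_leftAct [FiniteDimensional 𝕜 E] [FiniteDimensional 𝕜 V] [FiniteDimensional 𝕜 E']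
    [FiniteDimensional 𝕜 V'] (W : Opens G') (X : SuperSpace 𝕜 E V G) (s : Superfun 𝕜 E' V' W) :
    leftOp P.bracket (leftDer (Opens.comap e.cont W)) X (e.superPull W s) =
      e.superPull W (leftOp P'.bracket (leftDer W) (e.ell.even.prodMap e.ell.odd X) s) := by
  have h := leftOp_sectionMap (φ₀ := e.evenInv) (φ₁ := e.oddEquiv.symm) (br := P'.bracket) (br' := P.bracket)
    (F := NumFun 𝕜 E' W) (F' := NumFun 𝕜 E (Opens.comap e.cont W)) (D := leftDer W)
    (D' := leftDer (Opens.comap e.cont W)) (j := e.pullHom W) e.ellInv_bracket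
    (e.leftDer_evenInv_pullHom W) (e.ell.even.prodMap e.ell.odd X) s
  have hX : e.evenInv.prodMap (e.oddEquiv.symm : V' →ₗ[𝕜] V) (e.ell.even.prodMap e.ell.odd X) = X :=
    e.ellInv_ell X
  rwa [hX] at h

theorem superPull_rightAct [FiniteDimensional 𝕜 E] [FiniteDimensional 𝕜 V] [FiniteDimensional 𝕜 E']
    [FiniteDimensional 𝕜 V'] (W : Opens G') (X : SuperSpace 𝕜 E V G) (s : Superfun 𝕜 E' V' W) :
    rightAct P (Opens.comap e.cont W) X (e.superPull W s) =
      e.superPull W (rightAct P' W (e.ell.even.prodMap e.ell.odd X) s) := by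
  have h := rightOp_sectionMap (φ₀ := e.evenInv) (φ₁ := e.oddEquiv.symm) (br := P'.bracket) (br' := P.bracket)
    (F := NumFun 𝕜 E' W) (F' := NumFun 𝕜 E (Opens.comap e.cont W)) (D := leftDer W)
    (D' := leftDer (Opens.comap e.cont W)) (j := e.pullHom W) e.ellInv_bracket
    (e.leftDer_evenInv_pullHom W) (α := adFrame P' W) (α' := adFrame P (Opens.comap e.cont W))
    (X := e.ell.even.prodMap e.ell.odd X) (e.adFrame_ellInv W _) s
  have hX : e.evenInv.prodMap (e.oddEquiv.symm : V' →ₗ[𝕜] V) (e.ell.even.prodMap e.ell.odd X) = X :=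
    e.ellInv_ell X
  rwa [hX] at h

theorem res_superPull {U W : Opens G'} (h : U ≤ W) (f : Superfun 𝕜 E' V' W) :
    Superfun.res (OrderHomClass.mono (Opens.comap e.cont) h) (e.superPull W f) =
      e.superPull U (Superfun.res h f) := by
  induction f using TensorProduct.induction_on with
  | zero => simp only [map_zero]
  | add x y hx hy => simp only [map_add, hx, hy]
  | tmul f a => rfl

/-- The morphism of supermanifolds and of Lie superalgebras which is defined by an isomorphism of
superpairs. -/
def compatibleMorphism : CompatibleMorphism P P' where
  toHom := e.L.toMonoidHom
  smooth := e.L_smooth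
  diamond := e.ell
  pull := e.superPull
  pull_res h f := e.res_superPull h f
  compatible _ _ _ := rfl

theorem compatibleMorphism_isIso : e.compatibleMorphism.IsIso where
  base := ⟨e.L.symm, e.L_symm_smooth, e.L.symm_apply_apply, e.L.apply_symm_apply⟩
  pull_bijective := e.superPull_bijective

end HCIso

end Isomorphism

end BerezinConstruction
end

open scoped Manifold ContDiff in
open BerezinConstruction in
theorem mainTheorem7 {𝕜 : Type*} [RCLike 𝕜]
    {E : Type*} [NormedAddCommGroup E] [NormedSpace 𝕜 E] [FiniteDimensional 𝕜 E]
    {V : Type*} [AddCommGroup V] [Module 𝕜 V] [FiniteDimensional 𝕜 V]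
    {G : Type*} [TopologicalSpace G] [ChartedSpace E G] [Group G] [LieGroup 𝓘(𝕜, E) ∞ G]
    {E' : Type*} [NormedAddCommGroup E'] [NormedSpace 𝕜 E'] [FiniteDimensional 𝕜 E']
    {V' : Type*} [AddCommGroup V'] [Module 𝕜 V'] [FiniteDimensional 𝕜 V']
    {G' : Type*} [TopologicalSpace G'] [ChartedSpace E' G'] [Group G'] [LieGroup 𝓘(𝕜, E') ∞ G']
    (P : HCSuperpair 𝕜 E V G) (P' : HCSuperpair 𝕜 E' V' G') (e : HCIso P P') :
    ∃ (S : RTLieSupergroup P) (S' : RTLieSupergroup P'),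
      -- Berezin's construction yields `S` and `S'`, and nothing else
      S.IsBerezin ∧ S'.IsBerezin ∧
      (∀ ρ : SheafAction P, ρ.IsBerezinLeft → ρ = S.left.toSheafAction) ∧
      (∀ ρ : SheafAction P, ρ.IsBerezinRight → ρ = S.right.toSheafAction) ∧
      (∀ ρ : SheafAction P', ρ.IsBerezinLeft → ρ = S'.left.toSheafAction) ∧
      (∀ ρ : SheafAction P', ρ.IsBerezinRight → ρ = S'.right.toSheafAction) ∧
      -- the LRT and RT Lie supergroups obtained are planed
      S.left.IsPlaned ∧ S.IsPlaned ∧ S'.left.IsPlaned ∧ S'.IsPlaned ∧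
      -- they are isomorphic as LRT Lie supergroups and as RT Lie supergroups
      (∃ Ψ : LRTHom S.left S'.left, Ψ.toCompatibleMorphism.IsIso ∧
        Ψ.toHom = e.L.toMonoidHom ∧ Ψ.diamond = e.ell) ∧
      (∃ Ψ : RTHom S S', Ψ.toCompatibleMorphism.IsIso ∧
        Ψ.toHom = e.L.toMonoidHom ∧ Ψ.diamond = e.ell) := by
  have hL : e.compatibleMorphism.IsEquivariant (superpairSupergroup P).left.toSheafAction
      (superpairSupergroup P').left.toSheafAction := fun W X f => e.superPull_leftAct W X f
  have hR : e.compatibleMorphism.IsEquivariant (superpairSupergroup P).right.toSheafAction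
      (superpairSupergroup P').right.toSheafAction := fun W X f => e.superPull_rightAct W X f
  exact ⟨superpairSupergroup P, superpairSupergroup P', superpairSupergroup_isBerezin P,
    superpairSupergroup_isBerezin P',
    fun ρ h => SheafAction.IsBerezinLeft.unique P h (leftSheafAction_isBerezinLeft P),
    fun ρ h => SheafAction.IsBerezinRight.unique P h (rightSheafAction_isBerezinRight P),
    fun ρ h => SheafAction.IsBerezinLeft.unique P' h (leftSheafAction_isBerezinLeft P'),
    fun ρ h => SheafAction.IsBerezinRight.unique P' h (rightSheafAction_isBerezinRight P'),
    superpairSupergroup_isPlaned P, superpairSupergroup_isPlaned P,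
    superpairSupergroup_isPlaned P', superpairSupergroup_isPlaned P',
    ⟨⟨e.compatibleMorphism, hL⟩, e.compatibleMorphism_isIso, rfl, rfl⟩,
    ⟨⟨e.compatibleMorphism, hL, hR⟩, e.compatibleMorphism_isIso, rfl, rfl⟩⟩
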